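/- Work in $\widehat{\mathbb R}^3=\mathbb R^3\cup\{\infty\}$; "circle" means circle or straight line (with $\infty$). **Patches.** A *cyclidic patch* is an oriented surface patch obtained by restricting the curvature line parametrization of a Dupin cyclide in $\widehat{\mathbb R}^3$ to a closed rectangle $I_1\times I_2$. (In Lie sphere geometry a Dupin cyclide is a polar decomposition of $\mathbb R^{4,2}$ into two $3$-dimensional subspaces $\widehat P^{(1)},\widehat P^{(2)}$ of signature $(++-)$. Their isotropic lines are the two enveloping families of spheres $s^{(1)}(t_1),s^{(2)}(t_2)$, neither consisting of points only, and the curvature line parametrization sends $(t_1,t_2)$ to the contact element spanned by $s^{(1)}(t_1)$ and $s^{(2)}(t_2)$.) The limiting *spherical patches* are also admitted: closed coordinate rectangles on a sphere or plane for an orthogonal pair of pencils of circles, i.e. Möbius images of rectangles in planar polar or Cartesian coordinates; their parameter lines serve as curvature lines. Curvature lines of a patch run from boundary to boundary; the four extremal ones are its boundary arcs. A patch is *non-singular* if it contains no singular point, i.e. no point through which all its curvature lines of one family pass. Patches are regarded as equal if they agree as point sets together with their curvature lines (irrespective of parametrization and orientation). **Cyclidic cubes.** A *cyclidic cube* consists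 of eight vertices $x,x_i,x_{ij},x_{123}\in\mathbb R^3$ ($i,j\in\{1,2,3\}$, $i\neq j$) with an orthonormal frame $B=(t^{(1)},t^{(2)},t^{(3)})$ at each vertex, such that - the vertices of each of the six quadrilateral faces are four distinct points on a circle, in their cyclic order (embedded circular quadrilaterals); - along each edge from a vertex $y$ to $y_i$, the frame at $y_i$ is obtained from the frame at $y$ by the reflection in the perpendicular bisecting plane of $y$ and $y_i$, followed by $t^{(i)}\mapsto -t^{(i)}$; together with its six faces: for $\{i,j,k\}=\{1,2,3\}$, $f^{(i)}$ is the cyclidic patch with vertices $(x,x_j,x_{jk},x_k)$ whose boundary arcs at $x$ have tangents $t^{(j)},t^{(k)}$ and whose normal at $x$ is $t^{(i)}$; the opposite face $f^{(i)}_i$ is defined in the same way from $(x_i,x_{ij},x_{ijk},x_{ik})$ and the frame at $x_i$. The edge $\widehat{x,x_i}$ is the circular arc leaving $x$ in direction $t^{(i)}$ and ending at $x_i$; the other edges are defined likewise. The cube is *non-singular* if opposite faces are disjoint and adjacent faces intersect only along their common boundary arc. **Theorem.** Let a non-singular cyclidic cube be given whose eight vertices do not all lie on one circle, and let $f^{(i)},f_i^{(i)}$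 be a pair of opposite faces, $\{i,j,k\}=\{1,2,3\}$. For each point $\widetilde x_i\in\widehat{x,x_i}$ there is a unique cyclidic patch $\widetilde f^{(i)}$ such that $\widetilde x_i$ is a vertex of $\widetilde f^{(i)}$ and $\widetilde f^{(i)}$ intersects each of the four faces $f^{(j)},f_j^{(j)},f^{(k)},f_k^{(k)}$ orthogonally along a common curvature line, in the sense that a boundary arc of $\widetilde f^{(i)}$ is a curvature line of that face and the two surfaces are orthogonal at all points of this arc. Moreover, the patch $\widetilde f^{(i)}$ is non-singular. -/

import Mathlib

open scoped unitInterval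

noncomputable section

/-- Euclidean 3-space. -/
abbrev E3 := EuclideanSpace ℝ (Fin 3)

/-! ### The Lie quadric: oriented spheres, points and contact elements -/

/-- Homogeneous coordinates of Lie sphere geometry: `(v, v₀, v_∞, v_r)` stands for
`v + v₀ e₀ + v_∞ e_∞ + v_r e_r`. -/
abbrev LieSpace := E3 × ℝ × ℝ × ℝ

/-- The `e_r`-component; an isotropic vector is a point sphere iff it vanishes. -/
def LieSpace.radial (v : LieSpace) : ℝ := v.2.2.2

/-- The inner product of signature `(4,2)`, with `⟨e₀, e_∞⟩ = -1/2` and `⟨e_r, e_r⟩ = -1`. -/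
def lieForm (v w : LieSpace) : ℝ :=
  inner ℝ (v.1) (w.1) - (v.2.1 * w.2.2.1 + v.2.2.1 * w.2.1) / 2 - v.2.2.2 * w.2.2.2

/-- Lie coordinates of a point of `ℝ³ ∪ {∞}`. -/
def liePoint : OnePoint E3 → LieSpace
  | none => (0, 0, 1, 0)
  | some x => (x, 1, ‖x‖ ^ 2, 0)

/-- Lie coordinates of the oriented plane through `x` with unit normal `n`. -/
def liePlane (n x : E3) : LieSpace := (n, 0, 2 * inner ℝ n x, 1)

/-- Orthogonality of two contact elements (isotropic lines of the Lie quadric, given as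
2-dimensional subspaces) at a common point: the Möbius part of the Lie form, which measures the
angle between unoriented spheres, vanishes between them. For a finite point this says that the two
normals are perpendicular. -/
def OrthogonalContact (L M : Submodule ℝ LieSpace) : Prop :=
  ∀ v ∈ L, ∀ w ∈ M, lieForm v w + v.radial * w.radial = 0

/-! ### Dupin cyclides and their curvature line parametrization -/

/-- `P` is 3-dimensional and the Lie form restricted to `P` has signature `(++-)`. -/
def IsCyclidicPlane (P : Submodule ℝ LieSpace) : Prop :=
  ∃ a b c : LieSpace, lieForm a a = 1 ∧ lieForm b b = 1 ∧ lieForm c c = -1 ∧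
    lieForm a b = 0 ∧ lieForm a c = 0 ∧ lieForm b c = 0 ∧ P = Submodule.span ℝ {a, b, c}

/-- A Dupin cyclide: a polar decomposition of the Lie space into two (projective) planes of
signature `(++-)`; their isotropic vectors are the two enveloping families of spheres.
Circles (one family consisting of point spheres only) are excluded. -/
structure DupinCyclide where
  plane : Fin 2 → Submodule ℝ LieSpace
  signature : ∀ i, IsCyclidicPlane (plane i)
  polar : ∀ w, w ∈ plane 1 ↔ ∀ v ∈ plane 0, lieForm v w = 0
  not_circle : ∀ i, ∃ v ∈ plane i, v.radial ≠ 0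

/-- Parametrization of the conic through three isotropic vectors, taking `0, 1/2, 1` to the
three given spheres. -/
def conicParam (s : Fin 3 → LieSpace) (t : ℝ) : LieSpace :=
  (lieForm (s 1) (s 2) * (2 * t ^ 2 - 3 * t + 1)) • s 0 +
  (lieForm (s 0) (s 2) * (t - t ^ 2)) • s 1 +
  (lieForm (s 0) (s 1) * (2 * t ^ 2 - t)) • s 2

/-- `L` is the restriction to a closed rectangle, rescaled to `[0,1] × [0,1]`, of the curvature
line parametrization of a Dupin cyclide by contact elements `(u, v) ↦ inc[s⁽¹⁾(u), s⁽²⁾(v)]`.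
Here `s⁽ⁱ⁾` runs along an arc of the `i`-th conic, from `s i 0` through `s i 1` to `s i 2`. -/
def IsGenericPatch (L : I → I → Submodule ℝ LieSpace) : Prop :=
  ∃ (C : DupinCyclide) (s : Fin 2 → Fin 3 → LieSpace),
    (∀ i m, s i m ∈ C.plane i ∧ lieForm (s i m) (s i m) = 0) ∧
    (∀ i, LinearIndependent ℝ (s i)) ∧
    ∀ u v : I, L u v = Submodule.span ℝ {conicParam (s 0) u, conicParam (s 1) v}

/-! ### Spherical patches

The limiting case in which the cyclide becomes a sphere `ω`. The curvature lines are then replaced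
by two orthogonal pencils of circles on `ω`. Up to a Möbius transformation from the plane to `ω`
these are either the concentric circles and the lines through their centre, or the two families of
parallels to the coordinate axes. -/

/-- `ω` is an oriented sphere or plane, and `n₀, e₁, e₂, n_∞` describe a Möbius transformation of
the plane onto `ω`: it takes `(p, q)` to the point `n₀ + p e₁ + q e₂ + (p² + q²) n_∞` and `∞` to
the point `n_∞`. -/
structure IsSphereFrame (ω n₀ e₁ e₂ ni : LieSpace) : Prop where
  sphere : lieForm ω ω = 0 ∧ ω.radial ≠ 0
  radial : n₀.radial = 0 ∧ e₁.radial = 0 ∧ e₂.radial = 0 ∧ ni.radial = 0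
  contact : lieForm ω n₀ = 0 ∧ lieForm ω e₁ = 0 ∧ lieForm ω e₂ = 0 ∧ lieForm ω ni = 0
  isotropic : lieForm n₀ n₀ = 0 ∧ lieForm ni ni = 0 ∧ lieForm n₀ ni = -1 / 2
  unit : lieForm e₁ e₁ = 1 ∧ lieForm e₂ e₂ = 1 ∧ lieForm e₁ e₂ = 0
  orthogonal : lieForm n₀ e₁ = 0 ∧ lieForm n₀ e₂ = 0 ∧ lieForm ni e₁ = 0 ∧ lieForm ni e₂ = 0

/-- The point with polar coordinates `r = tan α` (`r = ∞` allowed, `r < 0` allowed) and `θ`. -/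
def polarPoint (n₀ e₁ e₂ ni : LieSpace) (α θ : ℝ) : LieSpace :=
  (Real.cos α ^ 2) • n₀ +
  (Real.cos α * Real.sin α) • (Real.cos θ • e₁ + Real.sin θ • e₂) +
  (Real.sin α ^ 2) • ni

/-- The point with Cartesian coordinates `(tan α, tan β)`; it is the point `n_∞` as soon as one of
the coordinates is `∞`. -/
def cartesianPoint (n₀ e₁ e₂ ni : LieSpace) (α β : ℝ) : LieSpace :=
  open Classical in
  if Real.cos α = 0 ∨ Real.cos β = 0 then ni
  else n₀ + Real.tan α • e₁ + Real.tan β • e₂ + (Real.tan α ^ 2 + Real.tan β ^ 2) • ni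

/-- `L` parametrizes a closed coordinate rectangle of one of the two types of orthogonal pairs of
pencils of circles on a sphere, by the contact elements of that sphere. -/
def IsSphericalPatch (L : I → I → Submodule ℝ LieSpace) : Prop :=
  ∃ (ω n₀ e₁ e₂ ni : LieSpace) (a b c d : ℝ), IsSphereFrame ω n₀ e₁ e₂ ni ∧
    a < b ∧ b < a + Real.pi ∧ c < d ∧
    ((d < c + 2 * Real.pi ∧ ∀ u v : I, L u v = Submodule.span ℝ
        {ω, polarPoint n₀ e₁ e₂ ni (a + u * (b - a)) (c + v * (d - c))}) ∨
     (d < c + 2 * Real.pi ∧ ∀ u v : I, L u v = Submodule.span ℝ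
        {ω, polarPoint n₀ e₁ e₂ ni (a + v * (b - a)) (c + u * (d - c))}) ∨
     (d < c + Real.pi ∧ ∀ u v : I, L u v = Submodule.span ℝ
        {ω, cartesianPoint n₀ e₁ e₂ ni (a + u * (b - a)) (c + v * (d - c))}))

/-! ### Cyclidic patches -/

/-- A cyclidic patch, parametrized over `[0,1] × [0,1]` by its contact elements. Spherical patches
count as (degenerate) cyclidic patches. -/
structure CyclidicPatch where
  contact : I → I → Submodule ℝ LieSpace
  isPatch : IsGenericPatch contact ∨ IsSphericalPatch contact

namespace CyclidicPatch

/-- `p` is the point of the patch at the parameters `(u, v)`: the unique point of the contact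
element there. -/
def IsPointAt (f : CyclidicPatch) (u v : I) (p : OnePoint E3) : Prop :=
  liePoint p ∈ f.contact u v

/-- The patch as a set of points of `ℝ³ ∪ {∞}`. -/
def carrier (f : CyclidicPatch) : Set (OnePoint E3) := {p | ∃ u v, f.IsPointAt u v p}

/-- The curvature line of the first family, on which the first parameter varies. -/
def line₁ (f : CyclidicPatch) (v : I) : Set (OnePoint E3) := {p | ∃ u, f.IsPointAt u v p}

/-- The curvature line of the second family, on which the second parameter varies. -/
def line₂ (f : CyclidicPatch) (u : I) : Set (OnePoint E3) := {p | ∃ v, f.IsPointAt u v p}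

/-- All curvature lines of the patch, each running from boundary to boundary. -/
def curvatureLines (f : CyclidicPatch) : Set (Set (OnePoint E3)) :=
  Set.range f.line₁ ∪ Set.range f.line₂

/-- The four boundary arcs. -/
def boundaryArcs (f : CyclidicPatch) : Set (Set (OnePoint E3)) :=
  {f.line₁ 0, f.line₁ 1, f.line₂ 0, f.line₂ 1}

/-- `p` is one of the four vertices. -/
def HasVertex (f : CyclidicPatch) (p : OnePoint E3) : Prop :=
  f.IsPointAt 0 0 p ∨ f.IsPointAt 1 0 p ∨ f.IsPointAt 1 1 p ∨ f.IsPointAt 0 1 p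

/-- A singular point of the patch: all curvature lines of one family pass through it, i.e. the
point is constant along a parameter line. -/
def IsSingularPoint (f : CyclidicPatch) (p : OnePoint E3) : Prop :=
  (∃ v, ∀ u, f.IsPointAt u v p) ∨ (∃ u, ∀ v, f.IsPointAt u v p)

/-- The patch contains no singular point. -/
def NonSingular (f : CyclidicPatch) : Prop := ∀ p, ¬ f.IsSingularPoint p

/-- Equality of patches as surface patches with their curvature lines, regardless of the
parametrization and of the orientation. -/
def SamePatch (f g : CyclidicPatch) : Prop :=
  f.carrier = g.carrier ∧ f.curvatureLines = g.curvatureLines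

/-- A boundary arc of `g` is a curvature line of `f`, and the two surfaces are orthogonal at each
of its points. -/
def MeetsOrthogonally (g f : CyclidicPatch) : Prop :=
  ∃ c ∈ g.boundaryArcs, c ∈ f.curvatureLines ∧
    ∀ p ∈ c, ∀ u v u' v', g.IsPointAt u v p → f.IsPointAt u' v' p →
      OrthogonalContact (g.contact u v) (f.contact u' v')

end CyclidicPatch

/-! ### Circular arcs and circular quadrilaterals -/

/-- The circular arc (or segment, possibly through `∞`) which leaves `x` in the direction of the
unit vector `t` and ends in `y ≠ x`: the inversion in the unit sphere about `x`, which takes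
`∞` to `x`, maps it onto the ray from the image of `y` in the direction `t`, completed by `∞`. -/
def circularArc (x t y : E3) : Set (OnePoint E3) :=
  {p | p = (x : OnePoint E3) ∨ ∃ r : ℝ, 0 ≤ r ∧
    p.elim x (EuclideanGeometry.inversion x 1) =
      EuclideanGeometry.inversion x 1 y + r • t}

/-- The points of `s` lie on a common circle or straight line. -/
def OnGeneralizedCircle (s : Set E3) : Prop :=
  EuclideanGeometry.Concyclic s ∨ Collinear ℝ s

/-- `(x, x₁, x₁₂, x₂)` is an embedded circular quadrilateral: four distinct points in this cyclic
order on a circle or straight line. The order is read off after the inversion about `x`, which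
takes the circle to a straight line and `x` to `∞`. -/
def EmbeddedCircularQuad (x x₁ x₁₂ x₂ : E3) : Prop :=
  OnGeneralizedCircle {x, x₁, x₁₂, x₂} ∧ x₁ ≠ x ∧ x₁₂ ≠ x ∧ x₂ ≠ x ∧
    Sbtw ℝ (EuclideanGeometry.inversion x 1 x₁) (EuclideanGeometry.inversion x 1 x₁₂)
      (EuclideanGeometry.inversion x 1 x₂)

/-- `f` has the vertices `(x, x₁, x₁₂, x₂)` and the vertex frame `(t₁, t₂, n)` at `x`. -/
structure CyclidicPatch.HasVerticesAndFrame (f : CyclidicPatch)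
    (x x₁ x₁₂ x₂ t₁ t₂ n : E3) : Prop where
  vertex : f.IsPointAt 0 0 x
  vertex₁ : f.IsPointAt 1 0 x₁
  vertex₁₂ : f.IsPointAt 1 1 x₁₂
  vertex₂ : f.IsPointAt 0 1 x₂
  normal : f.contact 0 0 = Submodule.span ℝ {liePoint x, liePlane n x}
  tangent₁ : f.line₁ 0 = circularArc x t₁ x₁
  tangent₂ : f.line₂ 0 = circularArc x t₂ x₂

/-! ### Cyclidic cubes -/

/-- Action on vectors of the reflection in the perpendicular bisecting plane of `x` and `y`. -/
def bisectorReflection (x y v : E3) : E3 :=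
  v - (2 * inner ℝ (y - x) v / inner ℝ (y - x) (y - x)) • (y - x)

/-- `{i}` for a shifted index, `∅` otherwise. -/
def shiftSet (i : Fin 3) (b : Bool) : Finset (Fin 3) := if b then {i} else ∅

/-- A cyclidic cube, i.e. an elementary hexahedron of a 3D cyclidic net in `ℝ³`. The vertex
`x_{ij…}` and the frame `B_{ij…}` are indexed by the set `{i, j, …}`; the `m`-th vector of a frame
is the tangent of the edges in direction `m`. The face `f⁽ⁱ⁾` is `face i false`, the opposite face
`f⁽ⁱ⁾ᵢ` is `face i true`; they are the cyclidic patches spanned by the directions `i + 1`, `i + 2`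
(modulo 3), determined by their vertices and the vertex frame. -/
structure CyclidicCube where
  vertex : Finset (Fin 3) → E3
  frame : Finset (Fin 3) → Fin 3 → E3
  orthonormal : ∀ S, Orthonormal ℝ (frame S)
  circular : ∀ S i j, i ∉ S → j ∉ S → i ≠ j →
    EmbeddedCircularQuad (vertex S) (vertex (insert i S)) (vertex (insert i (insert j S)))
      (vertex (insert j S))
  evolution : ∀ S i, i ∉ S → ∀ m, frame (insert i S) m =
    (if m = i then (-1 : ℝ) else 1) •
      bisectorReflection (vertex S) (vertex (insert i S)) (frame S m)
  face : Fin 3 → Bool → CyclidicPatch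
  face_spec : ∀ i b, (face i b).HasVerticesAndFrame
    (vertex (shiftSet i b))
    (vertex (insert (i + 1) (shiftSet i b)))
    (vertex (insert (i + 1) (insert (i + 2) (shiftSet i b))))
    (vertex (insert (i + 2) (shiftSet i b)))
    (frame (shiftSet i b) (i + 1)) (frame (shiftSet i b) (i + 2)) (frame (shiftSet i b) i)

namespace CyclidicCube

/-- The edge from the vertex `x_S` to `x_{S ∪ {k}}`: the circular arc with tangent `t⁽ᵏ⁾` at
`x_S`. -/
def edgeArc (Q : CyclidicCube) (S : Finset (Fin 3)) (k : Fin 3) : Set (OnePoint E3) :=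
  circularArc (Q.vertex S) (Q.frame S k) (Q.vertex (insert k S))

/-- Opposite faces are disjoint and adjacent faces intersect only along the common boundary
arc. (Every pair of adjacent faces has directions `i` and `i + 1` for some `i` modulo 3.) -/
def NonSingular (Q : CyclidicCube) : Prop :=
  (∀ i, Disjoint (Q.face i false).carrier (Q.face i true).carrier) ∧
  ∀ i b c, (Q.face i b).carrier ∩ (Q.face (i + 1) c).carrier =
    Q.edgeArc (shiftSet i b ∪ shiftSet (i + 1) c) (i + 2)

/-- The patch `g` has `p` as a vertex and intersects the four faces other than the two faces of
direction `i` orthogonally along common curvature lines. -/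
def IsPatchInBetween (Q : CyclidicCube) (i : Fin 3) (p : OnePoint E3) (g : CyclidicPatch) : Prop :=
  g.HasVertex p ∧ ∀ m, m ≠ i → ∀ b, g.MeetsOrthogonally (Q.face m b)

end CyclidicCube

end

/-! ### Bilinearity of the Lie form -/

section LieAlgebra

/-! Points are isotropic vectors with zero radial coordinate, i.e. vectors on the light cone of a
space of signature (4,1), and a circular arc is a quadratic curve on this cone (`Arc`). A patch
without singular points has, up to scaling, a normal form `PatchData.P`: divided by two quadratic
factors that are positive on the unit interval, the point at `(s, t)` is `p` plus a curve in span{W,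
d} plus a curve in span{V, e}, and these two spans are orthogonal. Hence the Lie form of two points
of the patch is a sum of two nonpositive terms (`PatchData.Valid.form_P`), so the point map is
injective. Moreover the reflection `PatchData.R` along `d`, an inversion, interchanges two opposite
boundary arcs. Generic and spherical patches are treated together through `PreForm`, from which
`PreForm.exists_normalForm` derives the normal form; conversely, `PatchData.Valid.exists_patch`
realizes every normal form by a patch.

Faces of the cube. The frames evolve along edges as tangent directions do under the inversions of a
patch (`IsTangent.evolve`). If a face had a degenerate curvature line, two opposite edges would
still be exchanged by an inversion and both would pass through the singular point
(`PreForm.exists_strip`), which is excluded since opposite faces are disjoint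
(`PreForm.quad_ne_zero`). So all faces have normal forms, and the four lateral ones form a `Box`.

Existence. Take `z` on the edge from x to x_i. Comparing bottom and top faces shows that the
difference vectors `d` of all four lateral faces lie in the plane spanned by two of them, for
otherwise x_i would lie on the circle of the bottom face and then all eight vertices would lie on it
(`exists_comb_of_faces`, `mem_span_of_faces`). Hence both ways of carrying `z` by inversions to the
opposite vertical edge agree (`Box.R_comm`), and the four points obtained are concyclic. The
curvature lines of the two adjacent faces through `z` are orthogonal there and span a patch with
these four corners (`Box.exists_cross`). Its two remaining boundary arcs have the right end points
and directions to be curvature lines of the other two faces (`Box.cross_sim`). A zero of one of its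
quadratic factors would be a common point of opposite faces (`Arc.Cross.kappa`), so the patch is
non-singular. Orthogonality to a face is one identity between contact spheres, valid along the whole
arc (`RepData.meets`).

Uniqueness. A competing patch has boundary arcs which are curvature lines of the four faces. Arcs on
disjoint faces are opposite (`ContactMap.opposite_arcs`). Two adjacent faces cannot use the same
arc: it would be their common edge, and no contact sphere is orthogonal to two orthogonal surfaces
while containing their common curve (`RepData.not_orthogonal_both`). Hence the arcs are those of the
patch constructed above, and the arcs determine the data (`PatchData.eq_scale_of_arcs`). -/

theorem lieForm_comm (v w : LieSpace) : lieForm v w = lieForm w v := by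
  simp only [lieForm, real_inner_comm]; ring

theorem lieForm_add_left (u v w : LieSpace) : lieForm (u + v) w = lieForm u w + lieForm v w := by
  simp only [lieForm, Prod.fst_add, Prod.snd_add, inner_add_left]; ring

theorem lieForm_smul_left (c : ℝ) (v w : LieSpace) : lieForm (c • v) w = c * lieForm v w := by
  simp only [lieForm, Prod.smul_fst, Prod.smul_snd, inner_smul_left, smul_eq_mul]
  simp only [conj_trivial]; ring

theorem lieForm_add_right (u v w : LieSpace) : lieForm u (v + w) = lieForm u v + lieForm u w := by
  rw [lieForm_comm, lieForm_add_left, lieForm_comm v, lieForm_comm w]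

theorem lieForm_smul_right (c : ℝ) (v w : LieSpace) : lieForm v (c • w) = c * lieForm v w := by
  rw [lieForm_comm, lieForm_smul_left, lieForm_comm w]

theorem lieForm_neg_left (v w : LieSpace) : lieForm (-v) w = -lieForm v w := by
  rw [← neg_one_smul ℝ v, lieForm_smul_left]; ring

theorem lieForm_neg_right (v w : LieSpace) : lieForm v (-w) = -lieForm v w := by
  rw [lieForm_comm, lieForm_neg_left, lieForm_comm w]

theorem lieForm_sub_left (u v w : LieSpace) : lieForm (u - v) w = lieForm u w - lieForm v w := by
  rw [sub_eq_add_neg, lieForm_add_left, lieForm_neg_left]; ring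

theorem lieForm_sub_right (u v w : LieSpace) : lieForm u (v - w) = lieForm u v - lieForm u w := by
  rw [sub_eq_add_neg, lieForm_add_right, lieForm_neg_right]; ring

@[simp] theorem lieForm_zero_left (w : LieSpace) : lieForm 0 w = 0 := by
  simp [lieForm]

@[simp] theorem lieForm_zero_right (w : LieSpace) : lieForm w 0 = 0 := by
  simp [lieForm]

theorem radial_add (v w : LieSpace) : (v + w).radial = v.radial + w.radial := rfl
theorem radial_sub (v w : LieSpace) : (v - w).radial = v.radial - w.radial := rfl
theorem radial_neg (v : LieSpace) : (-v).radial = -v.radial := rfl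
theorem radial_smul (c : ℝ) (v : LieSpace) : (c • v).radial = c * v.radial := rfl
theorem radial_zero : (0 : LieSpace).radial = 0 := rfl

/-- The unit vector of the radial coordinate axis. -/
def radialUnit : LieSpace := (0, 0, 0, 1)

theorem radial_radialUnit : radialUnit.radial = 1 := rfl

theorem lieForm_radialUnit (v : LieSpace) : lieForm radialUnit v = -v.radial := by
  simp [lieForm, radialUnit, LieSpace.radial]

theorem lieForm_radialUnit_right (v : LieSpace) : lieForm v radialUnit = -v.radial := by
  rw [lieForm_comm, lieForm_radialUnit]

theorem finrank_lieSpace : Module.finrank ℝ LieSpace = 6 := by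
  simp [LieSpace, Module.finrank_prod]

end LieAlgebra

/-! ### The conformal space: vectors with vanishing radial coordinate -/

/-- A nonzero isotropic vector with vanishing radial coordinate, i.e. a point sphere. -/
structure IsPtVec (v : LieSpace) : Prop where
  ne : v ≠ 0
  rad : v.radial = 0
  iso : lieForm v v = 0

theorem IsPtVec.smul {v : LieSpace} (h : IsPtVec v) {c : ℝ} (hc : c ≠ 0) : IsPtVec (c • v) :=
  ⟨smul_ne_zero hc h.ne, by rw [radial_smul, h.rad, mul_zero],
    by rw [lieForm_smul_left, lieForm_smul_right, h.iso, mul_zero, mul_zero]⟩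

theorem norm_sq_of_isotropic {z : LieSpace} (hr : z.radial = 0) (hi : lieForm z z = 0) :
    inner ℝ z.1 z.1 = z.2.1 * z.2.2.1 := by
  simp only [lieForm, LieSpace.radial] at *
  rw [hr] at hi; linarith

/-- The tangent space of the conformal sphere at a point is isometric to Euclidean 3-space. -/
theorem IsPtVec.exists_tangentMap {z : LieSpace} (hz : IsPtVec z) :
    ∃ π : LieSpace →ₗ[ℝ] E3,
      (∀ v w, v.radial = 0 → w.radial = 0 → lieForm z v = 0 → lieForm z w = 0 →
        lieForm v w = inner ℝ (π v) (π w)) ∧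
      (∀ v, v.radial = 0 → lieForm z v = 0 → π v = 0 → ∃ c : ℝ, v = c • z) := by
  have hn := norm_sq_of_isotropic hz.rad hz.iso
  obtain ⟨hne, hrad, -⟩ := hz
  obtain ⟨x, z0, zi, zr⟩ := z
  simp only [LieSpace.radial] at hrad hn
  subst hrad
  -- If the e₀-coordinate vanishes, the point is ∞ and orthogonality to it kills the e₀-coordinate,
  -- so the Euclidean part alone serves as the map.
  by_cases h0 : z0 = 0
  · subst h0
    have hx : x = 0 := by rw [← inner_self_eq_zero (𝕜 := ℝ), hn, zero_mul]
    subst hx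
    have hzi : zi ≠ 0 := by
      rintro rfl; exact hne rfl
    refine ⟨LinearMap.fst ℝ _ _, ?_, ?_⟩
    · rintro ⟨v, v0, vi, vr⟩ ⟨w, w0, wi, wr⟩ hv hw hzv hzw
      simp only [LieSpace.radial, lieForm] at *
      subst hv; subst hw
      have : v0 = 0 := by simpa [hzi] using hzv
      have : w0 = 0 := by simpa [hzi] using hzw
      subst v0; subst w0
      simp
    · rintro ⟨v, v0, vi, vr⟩ hv hzv hp
      simp only [LieSpace.radial, lieForm, LinearMap.fst_apply] at *
      subst hv
      have : v0 = 0 := by simpa [hzi] using hzv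
      subst this; subst hp
      exact ⟨vi / zi, by simp [hzi]⟩
  -- At a finite point, subtract the multiple of `z` that removes the e₀-coordinate, then take the
  -- Euclidean part.
  · refine ⟨LinearMap.fst ℝ _ _ - (z0⁻¹ • LinearMap.toSpanSingleton ℝ E3 x).comp
      ((LinearMap.fst ℝ ℝ (ℝ × ℝ)).comp (LinearMap.snd ℝ E3 (ℝ × ℝ × ℝ))), ?_, ?_⟩
    · rintro ⟨v, v0, vi, vr⟩ ⟨w, w0, wi, wr⟩ hv hw hzv hzw
      simp only [LieSpace.radial, lieForm] at *
      subst hv; subst hw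
      have e1 : inner ℝ x v = (z0 * vi + zi * v0) / 2 := by linarith
      have e2 : inner ℝ x w = (z0 * wi + zi * w0) / 2 := by linarith
      simp only [LinearMap.sub_apply, LinearMap.fst_apply, LinearMap.comp_apply,
        LinearMap.snd_apply, LinearMap.smul_apply, LinearMap.toSpanSingleton_apply,
        inner_sub_left, inner_sub_right, inner_smul_left, inner_smul_right, conj_trivial,
        real_inner_comm x v, e1, e2, hn]
      field_simp
      ring
    · rintro ⟨v, v0, vi, vr⟩ hv hzv hp
      simp only [LieSpace.radial, lieForm, LinearMap.sub_apply, LinearMap.fst_apply,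
        LinearMap.comp_apply, LinearMap.snd_apply, LinearMap.smul_apply,
        LinearMap.toSpanSingleton_apply] at *
      subst hv
      have e : v = z0⁻¹ • v0 • x := by rw [← sub_eq_zero]; exact hp
      subst e
      simp only [inner_smul_right, hn] at hzv
      refine ⟨v0 / z0, ?_⟩
      have : vi = v0 / z0 * zi := by
        field_simp at hzv ⊢
        linarith
      subst this
      simp only [Prod.smul_mk, smul_eq_mul, mul_zero, Prod.mk.injEq, smul_smul, and_true]
      exact ⟨by congr 1; field_simp, by field_simp⟩

/-- A vector orthogonal to a point sphere is spacelike or isotropic. -/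
theorem IsPtVec.form_self_nonneg {z v : LieSpace} (hz : IsPtVec z) (hv : v.radial = 0)
    (hzv : lieForm z v = 0) : 0 ≤ lieForm v v := by
  obtain ⟨π, h1, -⟩ := hz.exists_tangentMap
  rw [h1 v v hv hv hzv hzv]
  exact real_inner_self_nonneg

theorem IsPtVec.eq_smul_of_form_self {z v : LieSpace} (hz : IsPtVec z) (hv : v.radial = 0)
    (hzv : lieForm z v = 0) (h : lieForm v v = 0) : ∃ c : ℝ, v = c • z := by
  obtain ⟨π, h1, h2⟩ := hz.exists_tangentMap
  refine h2 v hv hzv ?_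
  rw [h1 v v hv hv hzv hzv] at h
  exact inner_self_eq_zero.1 h

/-- In Euclidean 3-space a vector orthogonal to three nonzero mutually orthogonal ones vanishes. -/
theorem E3.eq_zero_of_orthogonal {a b c y : E3} (ha : a ≠ 0) (hb : b ≠ 0) (hc : c ≠ 0)
    (hab : inner ℝ a b = 0) (hac : inner ℝ a c = 0) (hbc : inner ℝ b c = 0)
    (hay : inner ℝ a y = 0) (hby : inner ℝ b y = 0) (hcy : inner ℝ c y = 0) : y = 0 := by
  by_contra hy
  have hli : LinearIndependent ℝ ![a, b, c, y] := by
    apply linearIndependent_of_ne_zero_of_inner_eq_zero (𝕜 := ℝ)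
    · intro i; fin_cases i <;> simpa
    · intro i j hij
      fin_cases i <;> fin_cases j <;> first | exact absurd rfl hij | skip
      all_goals simp only [Fin.zero_eta, Fin.mk_one, Fin.reduceFinMk, Matrix.cons_val]
      all_goals first | assumption | (rw [real_inner_comm]; assumption)
  have := hli.fintype_card_le_finrank
  simp at this

/-- The quotient of the orthogonal complement of `z` by `z` is Euclidean 3-space, where three
nonzero mutually orthogonal vectors leave no room for a fourth. -/
theorem IsPtVec.eq_smul_of_orthogonal {z a b c y : LieSpace} (hz : IsPtVec z)
    (ra : a.radial = 0) (rb : b.radial = 0) (rc : c.radial = 0) (ry : y.radial = 0)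
    (za : lieForm z a = 0) (zb : lieForm z b = 0) (zc : lieForm z c = 0) (zy : lieForm z y = 0)
    (aa : lieForm a a ≠ 0) (bb : lieForm b b ≠ 0) (cc : lieForm c c ≠ 0)
    (ab : lieForm a b = 0) (ac : lieForm a c = 0) (bc : lieForm b c = 0)
    (ay : lieForm a y = 0) (by' : lieForm b y = 0) (cy : lieForm c y = 0) :
    ∃ k : ℝ, y = k • z := by
  obtain ⟨π, h1, h2⟩ := hz.exists_tangentMap
  refine h2 y ry zy ?_
  refine E3.eq_zero_of_orthogonal (a := π a) (b := π b) (c := π c) ?_ ?_ ?_ ?_ ?_ ?_ ?_ ?_ ?_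
  · intro h; exact aa (by rw [h1 a a ra ra za za, h, inner_zero_left])
  · intro h; exact bb (by rw [h1 b b rb rb zb zb, h, inner_zero_left])
  · intro h; exact cc (by rw [h1 c c rc rc zc zc, h, inner_zero_left])
  all_goals rw [← h1] <;> assumption

/-- A vector orthogonal to a basis of the conformal space vanishes. -/
theorem IsPtVec.eq_zero_of_orthogonal {z q a b c y : LieSpace} (hz : IsPtVec z)
    (hzq : lieForm z q ≠ 0)
    (ra : a.radial = 0) (rb : b.radial = 0) (rc : c.radial = 0) (ry : y.radial = 0)
    (za : lieForm z a = 0) (zb : lieForm z b = 0) (zc : lieForm z c = 0) (zy : lieForm z y = 0)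
    (aa : lieForm a a ≠ 0) (bb : lieForm b b ≠ 0) (cc : lieForm c c ≠ 0)
    (ab : lieForm a b = 0) (ac : lieForm a c = 0) (bc : lieForm b c = 0)
    (ay : lieForm a y = 0) (by' : lieForm b y = 0) (cy : lieForm c y = 0)
    (qy : lieForm q y = 0) : y = 0 := by
  obtain ⟨k, rfl⟩ := hz.eq_smul_of_orthogonal ra rb rc ry za zb zc zy aa bb cc ab ac bc ay by' cy
  rw [lieForm_smul_right, lieForm_comm] at qy
  rcases mul_eq_zero.1 qy with h | h
  · rw [h, zero_smul]
  · exact absurd h hzq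

/-- Orthogonal point spheres coincide. -/
theorem IsPtVec.eq_smul {z v : LieSpace} (hz : IsPtVec z) (hv : IsPtVec v)
    (h : lieForm z v = 0) : ∃ c : ℝ, c ≠ 0 ∧ v = c • z := by
  obtain ⟨c, rfl⟩ := hz.eq_smul_of_form_self hv.rad h hv.iso
  refine ⟨c, ?_, rfl⟩
  rintro rfl
  exact hv.ne (zero_smul _ _)

/-- Two point spheres on the same half of the light cone as a third one. -/
theorem IsPtVec.form_nonpos {x y z : LieSpace} (hx : IsPtVec x) (hy : IsPtVec y) (hz : IsPtVec z)
    (hxy : lieForm x y < 0) (hxz : lieForm x z < 0) : lieForm y z ≤ 0 := by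
  -- The test vector is orthogonal to `x`, and its square is −2⟨x,y⟩⟨x,z⟩⟨y,z⟩.
  have key := hx.form_self_nonneg (v := (lieForm x z) • y - (lieForm x y) • z)
    (by rw [radial_sub, radial_smul, radial_smul, hy.rad, hz.rad]; ring)
    (by rw [lieForm_sub_right, lieForm_smul_right, lieForm_smul_right]; ring)
  simp only [lieForm_sub_right, lieForm_sub_left, lieForm_smul_left, lieForm_smul_right, hy.iso,
    hz.iso, lieForm_comm z y] at key
  have hp := mul_pos_of_neg_of_neg hxy hxz
  nlinarith

/-! ### Points of `ℝ³ ∪ {∞}` as point spheres -/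

theorem liePoint_coe (x : E3) : liePoint (x : OnePoint E3) = (x, 1, ‖x‖ ^ 2, 0) := rfl
theorem liePoint_infty : liePoint OnePoint.infty = (0, 0, 1, 0) := rfl

theorem isPtVec_liePoint (z : OnePoint E3) : IsPtVec (liePoint z) := by
  induction z using OnePoint.rec with
  | infty => 
    refine ⟨?_, rfl, by simp [liePoint_infty, lieForm]⟩
    intro h
    have := congrArg (fun v : LieSpace => v.2.2.1) h
    simp [liePoint_infty] at this
  | coe x =>
    refine ⟨?_, rfl, by simp [liePoint_coe, lieForm]⟩
    intro h
    have := congrArg (fun v : LieSpace => v.2.1) h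
    simp [liePoint_coe] at this

theorem liePoint_injective {y z : OnePoint E3} {c : ℝ} (h : liePoint y = c • liePoint z) :
    y = z := by
  have hc : c ≠ 0 := by
    rintro rfl
    exact (isPtVec_liePoint y).ne (by rw [h, zero_smul])
  induction y using OnePoint.rec with
  | infty =>
    induction z using OnePoint.rec with
    | infty => rfl
    | coe x =>
      have := congrArg (fun v : LieSpace => v.2.1) h
      simp only [liePoint_coe, liePoint_infty, Prod.smul_mk, smul_eq_mul, mul_one] at this
      exact absurd this.symm hc
  | coe w =>
    induction z using OnePoint.rec with
    | infty =>
      have := congrArg (fun v : LieSpace => v.2.1) h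
      simp [liePoint_coe, liePoint_infty] at this
    | coe x =>
      have h1 := congrArg (fun v : LieSpace => v.2.1) h
      have h2 := congrArg (fun v : LieSpace => v.1) h
      simp only [liePoint_coe, Prod.smul_mk, smul_eq_mul, mul_one] at h1 h2
      rw [← h1, one_smul] at h2
      rw [h2]

theorem liePoint_eq_iff {y z : OnePoint E3} : lieForm (liePoint y) (liePoint z) = 0 ↔ y = z := by
  constructor
  · intro h
    obtain ⟨c, -, hc⟩ := (isPtVec_liePoint y).eq_smul (isPtVec_liePoint z) h
    exact (liePoint_injective hc).symm
  · rintro rfl; exact (isPtVec_liePoint y).iso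

/-- `z` is the point of `ℝ³ ∪ {∞}` represented by the vector `v`. -/
def IsRep (v : LieSpace) (z : OnePoint E3) : Prop := ∃ c : ℝ, liePoint z = c • v

theorem IsRep.exists_ne {v : LieSpace} {z : OnePoint E3} (h : IsRep v z) :
    ∃ c : ℝ, c ≠ 0 ∧ v = c • liePoint z := by
  obtain ⟨c, hc⟩ := h
  have h0 : c ≠ 0 := by
    rintro rfl
    exact (isPtVec_liePoint z).ne (by rw [hc, zero_smul])
  exact ⟨c⁻¹, inv_ne_zero h0, by rw [hc, smul_smul, inv_mul_cancel₀ h0, one_smul]⟩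

theorem IsRep.isPtVec {v : LieSpace} {z : OnePoint E3} (h : IsRep v z) : IsPtVec v := by
  obtain ⟨c, hc, rfl⟩ := h.exists_ne
  exact (isPtVec_liePoint z).smul hc

theorem IsRep.unique {v : LieSpace} {y z : OnePoint E3} (h : IsRep v y) (h' : IsRep v z) : y = z := by
  obtain ⟨c, hc⟩ := h
  obtain ⟨k, hk, rfl⟩ := h'.exists_ne
  exact liePoint_injective (by rw [hc, smul_smul])

theorem repr_liePoint (z : OnePoint E3) : IsRep (liePoint z) z := ⟨1, (one_smul _ _).symm⟩

theorem IsRep.smul {v : LieSpace} {z : OnePoint E3} (h : IsRep v z) {c : ℝ} (hc : c ≠ 0) :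
    IsRep (c • v) z := by
  obtain ⟨k, hk⟩ := h
  exact ⟨k * c⁻¹, by rw [hk, smul_smul, mul_assoc, inv_mul_cancel₀ hc, mul_one]⟩

theorem repr_smul_iff {v : LieSpace} {z : OnePoint E3} {c : ℝ} (hc : c ≠ 0) :
    IsRep (c • v) z ↔ IsRep v z := by
  refine ⟨fun h => ?_, fun h => h.smul hc⟩
  have := h.smul (inv_ne_zero hc)
  rwa [smul_smul, inv_mul_cancel₀ hc, one_smul] at this

theorem IsPtVec.exists_repr {v : LieSpace} (h : IsPtVec v) : ∃ z, IsRep v z := by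
  have hn := norm_sq_of_isotropic h.rad h.iso
  obtain ⟨hne, hrad, -⟩ := h
  obtain ⟨x, v0, vi, vr⟩ := v
  simp only [LieSpace.radial] at hrad hn
  subst hrad
  by_cases h0 : v0 = 0
  · subst h0
    have hx : x = 0 := by rw [← inner_self_eq_zero (𝕜 := ℝ), hn, zero_mul]
    subst hx
    have hvi : vi ≠ 0 := by
      rintro rfl; exact hne rfl
    exact ⟨OnePoint.infty, vi⁻¹, by simp [liePoint_infty, hvi]⟩
  · refine ⟨((v0⁻¹ • x : E3) : OnePoint E3), v0⁻¹, ?_⟩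
    rw [liePoint_coe, ← real_inner_self_eq_norm_sq, inner_smul_left, inner_smul_right, hn]
    simp only [Prod.smul_mk, smul_eq_mul, mul_zero, conj_trivial, Prod.mk.injEq, and_true, true_and]
    exact ⟨by field_simp, by field_simp⟩

/-- Vectors representing points represent the same point iff they are orthogonal. -/
theorem IsRep.form_eq_zero_iff {v w : LieSpace} {y z : OnePoint E3} (hv : IsRep v y) (hw : IsRep w z) :
    lieForm v w = 0 ↔ y = z := by
  obtain ⟨c, hc, rfl⟩ := hv.exists_ne
  obtain ⟨k, hk, rfl⟩ := hw.exists_ne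
  rw [lieForm_smul_left, lieForm_smul_right, ← liePoint_eq_iff]
  simp [hc, hk]

theorem IsRep.trans_smul {v w : LieSpace} {z : OnePoint E3} (hv : IsRep v z) (hw : IsRep w z) :
    ∃ c : ℝ, c ≠ 0 ∧ w = c • v :=
  hv.isPtVec.eq_smul hw.isPtVec ((hv.form_eq_zero_iff hw).2 rfl)

/-- The value is negative for distinct points, so the sign of the form between multiples of standard
representatives tells whether the two scalars have the same sign. Orientations of arcs are
controlled in this way later on. -/
theorem lieForm_liePoint_coe (x y : E3) :
    lieForm (liePoint x) (liePoint y) = -‖y - x‖ ^ 2 / 2 := by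
  rw [liePoint_coe, liePoint_coe, lieForm, norm_sub_sq_real, real_inner_comm]
  ring

noncomputable section

/-! ### Circular arcs in the conformal model -/

/-- Data of a circular arc from the point sphere `p` to the point sphere `q`; `w` represents the
direction in which the arc leaves `p`. -/
structure Arc where
  p : LieSpace
  w : LieSpace
  q : LieSpace

namespace Arc

/-- Homogeneous parametrization of an arc. -/
def hvec (A : Arc) (a b : ℝ) : LieSpace := (a ^ 2) • A.p + (a * b) • A.w + (b ^ 2) • A.q

/-- Parametrization of an arc over the unit interval. -/
def vec (A : Arc) (t : ℝ) : LieSpace := A.hvec (1 - t) t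

/-- The arc as a set of points. -/
def set (A : Arc) : Set (OnePoint E3) := {z | ∃ t ∈ Set.Icc (0 : ℝ) 1, IsRep (A.vec t) z}

/-- These relations make every `A.hvec a b` isotropic with zero radial part (see `form_hvec`). The
sign in `pq` separates the two ends and puts their representatives on the same half of the light
cone. -/
structure Valid (A : Arc) : Prop where
  rp : A.p.radial = 0
  rw : A.w.radial = 0
  rq : A.q.radial = 0
  pp : lieForm A.p A.p = 0
  qq : lieForm A.q A.q = 0
  pw : lieForm A.p A.w = 0
  qw : lieForm A.q A.w = 0
  ww : lieForm A.w A.w = -2 * lieForm A.p A.q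
  pq : lieForm A.p A.q < 0

/-- Two arc data which differ by rescaling and reparametrization. -/
def Sim (A B : Arc) : Prop :=
  ∃ c ρ : ℝ, c ≠ 0 ∧ 0 < ρ ∧ B.p = c • A.p ∧ B.w = (c * ρ) • A.w ∧ B.q = (c * ρ ^ 2) • A.q

/-- The reversed arc. -/
def rev (A : Arc) : Arc := ⟨A.q, A.w, A.p⟩

variable {A B C : Arc}

theorem hvec_smul (c a b : ℝ) : A.hvec (c * a) (c * b) = c ^ 2 • A.hvec a b := by
  simp only [hvec, smul_add, smul_smul]; congr 1; congr 1
  all_goals congr 1; ring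

theorem vec_zero : A.vec 0 = A.p := by simp [vec, hvec]
theorem vec_one : A.vec 1 = A.q := by simp [vec, hvec]

/-- The curve is a conic on the light cone, so the form is a multiple of the squared determinant of
the two homogeneous parameters; different parameters give different points. -/
theorem form_hvec (h : A.Valid) (a b c d : ℝ) :
    lieForm (A.hvec a b) (A.hvec c d) = lieForm A.p A.q * (a * d - b * c) ^ 2 := by
  simp only [hvec, lieForm_add_left, lieForm_add_right, lieForm_smul_left, lieForm_smul_right,
    h.pp, h.qq, h.pw, h.qw, lieForm_comm A.w A.p, lieForm_comm A.w A.q, h.ww, lieForm_comm A.q A.p]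
  ring

theorem form_vec (h : A.Valid) (s t : ℝ) :
    lieForm (A.vec s) (A.vec t) = lieForm A.p A.q * (s - t) ^ 2 := by
  rw [vec, vec, form_hvec h]; ring

theorem p_form_hvec (h : A.Valid) (a b : ℝ) :
    lieForm A.p (A.hvec a b) = lieForm A.p A.q * b ^ 2 := by
  simp only [hvec, lieForm_add_right, lieForm_smul_right, h.pp, h.pw]
  ring

theorem q_form_hvec (h : A.Valid) (a b : ℝ) :
    lieForm A.q (A.hvec a b) = lieForm A.p A.q * a ^ 2 := by
  simp only [hvec, lieForm_add_right, lieForm_smul_right, h.qq, h.qw, lieForm_comm A.q A.p]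
  ring

theorem w_form_hvec (h : A.Valid) (a b : ℝ) :
    lieForm A.w (A.hvec a b) = -2 * lieForm A.p A.q * (a * b) := by
  simp only [hvec, lieForm_add_right, lieForm_smul_right, h.pw, h.qw, lieForm_comm A.w A.p,
    lieForm_comm A.w A.q, h.ww]
  ring

theorem isPtVec_hvec (h : A.Valid) {a b : ℝ} (hab : a ≠ 0 ∨ b ≠ 0) : IsPtVec (A.hvec a b) := by
  refine ⟨?_, ?_, ?_⟩
  · intro h0
    have h1 := p_form_hvec h a b
    have h2 := q_form_hvec h a b
    rw [h0, lieForm_zero_right] at h1 h2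
    have h3 := h.pq.ne
    rcases hab with hab | hab
    · exact mul_ne_zero h3 (pow_ne_zero 2 hab) h2.symm
    · exact mul_ne_zero h3 (pow_ne_zero 2 hab) h1.symm
  · simp only [hvec, radial_add, radial_smul, h.rp, h.rw, h.rq]; ring
  · rw [form_hvec h]; ring

theorem isPtVec_vec (h : A.Valid) (t : ℝ) : IsPtVec (A.vec t) := by
  refine isPtVec_hvec h ?_
  by_cases ht : t = 0
  · left; simp [ht]
  · exact Or.inr ht

theorem isPtVec_q (h : A.Valid) : IsPtVec A.q := vec_one (A := A) ▸ isPtVec_vec h 1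

theorem mem_set_hvec {a b : ℝ} (ha : 0 ≤ a) (hb : 0 ≤ b) (hab : 0 < a + b) {z : OnePoint E3}
    (hz : IsRep (A.hvec a b) z) : z ∈ A.set := by
  refine ⟨b / (a + b), ⟨by positivity, by rw [div_le_one hab]; linarith⟩, ?_⟩
  have : A.vec (b / (a + b)) = ((a + b)⁻¹) ^ 2 • A.hvec a b := by
    rw [← hvec_smul, vec]; congr 1
    · field_simp; ring
    · field_simp
  rw [this]
  exact hz.smul (by positivity)

theorem Sim.hvec (h : A.Sim B) : ∃ c ρ : ℝ, c ≠ 0 ∧ 0 < ρ ∧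
    ∀ a b, B.hvec a b = c • A.hvec a (ρ * b) := by
  obtain ⟨c, ρ, hc, hρ, h1, h2, h3⟩ := h
  refine ⟨c, ρ, hc, hρ, fun a b => ?_⟩
  simp only [Arc.hvec, h1, h2, h3]; module

theorem Sim.symm (h : A.Sim B) : B.Sim A := by
  obtain ⟨c, ρ, hc, hρ, h1, h2, h3⟩ := h
  refine ⟨c⁻¹, ρ⁻¹, inv_ne_zero hc, inv_pos.2 hρ, ?_, ?_, ?_⟩
  · rw [h1, smul_smul, inv_mul_cancel₀ hc, one_smul]
  · rw [h2, smul_smul]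
    rw [show c⁻¹ * ρ⁻¹ * (c * ρ) = 1 by field_simp, one_smul]
  · rw [h3, smul_smul]
    rw [show c⁻¹ * ρ⁻¹ ^ 2 * (c * ρ ^ 2) = 1 by field_simp, one_smul]

theorem Sim.trans (h : A.Sim B) (h' : B.Sim C) : A.Sim C := by
  obtain ⟨c, ρ, hc, hρ, h1, h2, h3⟩ := h
  obtain ⟨k, l, hk, hl, k1, k2, k3⟩ := h'
  refine ⟨k * c, l * ρ, mul_ne_zero hk hc, mul_pos hl hρ, ?_, ?_, ?_⟩
  · rw [k1, h1, smul_smul]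
  · rw [k2, h2, smul_smul]; congr 1; ring
  · rw [k3, h3, smul_smul]; congr 1; ring

theorem Sim.rev (h : A.Sim B) : A.rev.Sim B.rev := by
  obtain ⟨c, ρ, hc, hρ, h1, h2, h3⟩ := h
  refine ⟨c * ρ ^ 2, ρ⁻¹, by positivity, inv_pos.2 hρ, h3, ?_, ?_⟩
  · simp only [Arc.rev]; rw [h2]; congr 1; field_simp
  · simp only [Arc.rev]; rw [h1]; congr 1; field_simp

theorem Sim.valid (h : A.Sim B) (hA : A.Valid) : B.Valid := by
  obtain ⟨c, ρ, hc, hρ, h1, h2, h3⟩ := h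
  refine ⟨?_, ?_, ?_, ?_, ?_, ?_, ?_, ?_, ?_⟩ <;>
    simp only [h1, h2, h3, radial_smul, lieForm_smul_left, lieForm_smul_right, hA.rp, hA.rw,
      hA.rq, hA.pp, hA.qq, hA.pw, hA.qw, hA.ww, mul_zero]
  · ring
  · have := hA.pq
    have h2 : 0 < c * (c * ρ ^ 2) := by rw [← mul_assoc, ← sq]; positivity
    nlinarith

theorem Sim.set_subset (h : A.Sim B) : B.set ⊆ A.set := by
  obtain ⟨c, ρ, hc, hρ, hh⟩ := h.hvec
  rintro z ⟨t, ht, hz⟩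
  rw [vec, hh, repr_smul_iff hc] at hz
  have h0 := ht.1
  have h1 := ht.2
  refine mem_set_hvec (by linarith) (by positivity) ?_ hz
  rcases h0.eq_or_lt with h | h
  · rw [← h]; simp
  · have : 0 < ρ * t := by positivity
    linarith

theorem Sim.set_eq (h : A.Sim B) : A.set = B.set :=
  Set.Subset.antisymm h.symm.set_subset h.set_subset

/-- An arc determines its data up to similarity, once its starting point is distinguished. -/
theorem sim_of_set_eq {c : ℝ} (hA : A.Valid) (hB : B.Valid) (hc : c ≠ 0) (hp : B.p = c • A.p)
    (h : A.set = B.set) : ∃ ρ : ℝ, 0 < ρ ∧ B.w = (c * ρ) • A.w ∧ B.q = (c * ρ ^ 2) • A.q := by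
  -- every point of the second arc lies on the first one
  have key : ∀ a b : ℝ, 0 ≤ a → 0 ≤ b → 0 < a + b → ∃ a' b' : ℝ, 0 ≤ a' ∧ 0 ≤ b' ∧
      0 < a' + b' ∧ c⁻¹ • B.hvec a b = A.hvec a' b' := by
    intro a b ha hb hab
    have hv : IsPtVec (B.hvec a b) := isPtVec_hvec hB (by
      by_contra! hcon; rw [hcon.1, hcon.2] at hab; simp at hab)
    obtain ⟨z, hz⟩ := hv.exists_repr
    have hzB : z ∈ B.set := mem_set_hvec ha hb hab hz
    rw [← h] at hzB
    obtain ⟨t, ht, hzt⟩ := hzB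
    obtain ⟨k, hk, hkv⟩ := hzt.trans_smul (hz.smul (inv_ne_zero hc))
    have h1 := ht.1
    have h2 := ht.2
    -- The sign of the scalar is read off by pairing with `p`, or with `q` at the starting point,
    -- where pairing with `p` gives nothing.
    have hkpos : 0 < k := by
      by_cases hb0 : b = 0
      · have e1 : lieForm A.q (c⁻¹ • B.hvec a b) = k * (lieForm A.p A.q * (1 - t) ^ 2) := by
          rw [hkv, lieForm_smul_right, vec, q_form_hvec hA]
        have e2 : c⁻¹ • B.hvec a b = a ^ 2 • A.p := by
          simp only [hvec, hb0, hp]; simp; rw [smul_comm, inv_smul_smul₀ hc]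
        rw [e2, lieForm_smul_right, lieForm_comm] at e1
        have ha' : 0 < a := by rw [hb0] at hab; linarith
        have e3 : a ^ 2 = k * (1 - t) ^ 2 :=
          mul_right_cancel₀ hA.pq.ne (by linarith)
        by_contra hneg
        have : k * (1 - t) ^ 2 ≤ 0 := mul_nonpos_of_nonpos_of_nonneg (not_lt.1 hneg) (sq_nonneg _)
        have : 0 < a ^ 2 := by positivity
        linarith
      · have e1 : lieForm A.p (c⁻¹ • B.hvec a b) = k * (lieForm A.p A.q * t ^ 2) := by
          rw [hkv, lieForm_smul_right, vec, p_form_hvec hA]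
        have e2 : lieForm A.p (c⁻¹ • B.hvec a b) = (c⁻¹) ^ 2 * (lieForm B.p B.q * b ^ 2) := by
          rw [← p_form_hvec hB, hp, lieForm_smul_left, lieForm_smul_right]
          field_simp
        have e3 : (c⁻¹) ^ 2 * (lieForm B.p B.q * b ^ 2) < 0 := by
          have : 0 < b ^ 2 := by positivity
          have : 0 < (c⁻¹) ^ 2 := by positivity
          have := hB.pq
          exact mul_neg_of_pos_of_neg (by positivity) (mul_neg_of_neg_of_pos this (by positivity))
        rw [← e2, e1] at e3
        by_contra hneg
        have : 0 ≤ k * (lieForm A.p A.q * t ^ 2) :=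
          mul_nonneg_of_nonpos_of_nonpos (not_lt.1 hneg)
            (mul_nonpos_of_nonpos_of_nonneg hA.pq.le (sq_nonneg _))
        linarith
    refine ⟨√k * (1 - t), √k * t, mul_nonneg (Real.sqrt_nonneg _) (by linarith),
      mul_nonneg (Real.sqrt_nonneg _) h1, ?_, ?_⟩
    · have := Real.sqrt_pos.2 hkpos
      nlinarith
    · rw [hkv, hvec_smul, Real.sq_sqrt hkpos.le, vec]
  have hpq := hA.pq
  -- the end point
  obtain ⟨a, b, ha, hb, hab, hq⟩ := key 0 1 le_rfl zero_le_one (by norm_num)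
  have hq' : c⁻¹ • B.q = A.hvec a b := by
    rw [← hq]; simp [hvec]
  have hp' : c⁻¹ • B.p = A.p := by rw [hp, inv_smul_smul₀ hc]
  have hb0 : b ≠ 0 := by
    intro hb0
    have : lieForm (c⁻¹ • B.p) (c⁻¹ • B.q) = 0 := by
      rw [hp', hq', p_form_hvec hA, hb0]; ring
    rw [lieForm_smul_left, lieForm_smul_right] at this
    have h1 := hB.pq.ne
    have h2 := inv_ne_zero hc
    simp_all
  have hbpos : 0 < b := lt_of_le_of_ne hb (Ne.symm hb0)
  -- the direction
  obtain ⟨a1, b1, -, -, -, hm⟩ := key 1 1 zero_le_one zero_le_one (by norm_num)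
  have hw' : c⁻¹ • B.w = A.hvec a1 b1 - A.p - A.hvec a b := by
    rw [← hm, ← hq', ← hp']; simp only [hvec]; module
  obtain ⟨x, y, z, hxyz⟩ : ∃ x y z : ℝ, c⁻¹ • B.w = x • A.p + y • A.w + z • A.q :=
    ⟨a1 ^ 2 - 1 - a ^ 2, a1 * b1 - a * b, b1 ^ 2 - b ^ 2, by rw [hw']; simp only [hvec]; module⟩
  have f1 : lieForm (c⁻¹ • B.p) (c⁻¹ • B.w) = 0 := by
    rw [lieForm_smul_left, lieForm_smul_right, hB.pw]; ring
  rw [hp', hxyz] at f1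
  simp only [lieForm_add_right, lieForm_smul_right, hA.pp, hA.pw, mul_zero, zero_add] at f1
  have hz : z = 0 := by
    rcases mul_eq_zero.1 f1 with h | h
    · exact h
    · exact absurd h hpq.ne
  subst hz
  have f2 : lieForm (c⁻¹ • B.q) (c⁻¹ • B.w) = 0 := by
    rw [lieForm_smul_left, lieForm_smul_right, hB.qw]; ring
  rw [hq', hxyz] at f2
  have f3 : lieForm (c⁻¹ • B.w) (c⁻¹ • B.w) = -2 * lieForm (c⁻¹ • B.p) (c⁻¹ • B.q) := by
    simp only [lieForm_smul_left, lieForm_smul_right, hB.ww]; ring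
  rw [hp', hq', hxyz, p_form_hvec hA] at f3
  simp only [zero_smul, add_zero] at f2 f3 hxyz
  simp only [hvec, lieForm_add_left, lieForm_add_right, lieForm_smul_left, lieForm_smul_right,
    hA.pp, hA.pw, hA.qw, lieForm_comm A.w A.p, lieForm_comm A.q A.p, hA.ww] at f2 f3
  have g2 : x * b = 2 * a * y := by
    apply mul_left_cancel₀ (mul_ne_zero hpq.ne hb0)
    linear_combination f2
  -- The second arc leaves `p` along the line of the first; the sign of `y` decides between the same
  -- and the reversed direction.
  have g3 : (y - b) * (y + b) = 0 := by
    apply mul_left_cancel₀ hpq.ne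
    linear_combination -f3 / 2
  rcases mul_eq_zero.1 g3 with hy | hy
  · have hy : y = b := by linarith
    subst hy
    have hx : x = 2 * a := mul_right_cancel₀ hb0 g2
    subst hx
    -- the end point of the first arc lies on the second one
    obtain ⟨zq, hzq⟩ := (isPtVec_q hA).exists_repr
    have hzq' : zq ∈ A.set := ⟨1, ⟨zero_le_one, le_rfl⟩, by rwa [vec_one]⟩
    rw [h] at hzq'
    obtain ⟨t, ht, hzt⟩ := hzq'
    obtain ⟨k, hk, hkv⟩ := hzt.trans_smul hzq
    have hkv' : A.q = (k * c) • (c⁻¹ • B.vec t) := by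
      rw [hkv, smul_smul, mul_assoc, mul_inv_cancel₀ hc, mul_one]
    have e : c⁻¹ • B.vec t = (1 - t) ^ 2 • A.p + ((1 - t) * t) • ((2 * a) • A.p + y • A.w)
        + t ^ 2 • A.hvec a y := by
      rw [← hxyz, ← hq', ← hp']
      simp only [vec, hvec]; module
    have e2 : lieForm A.w A.q = (k * c) * (((1 - t) * t * y + t ^ 2 * (a * y)) *
        (-2 * lieForm A.p A.q)) := by
      conv_lhs => rw [hkv', e]
      simp only [hvec, lieForm_add_right, lieForm_smul_right, hA.pw, hA.qw,
        lieForm_comm A.w A.p, lieForm_comm A.w A.q, hA.ww]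
      ring
    have e1 : lieForm A.p A.q = (k * c) * (t ^ 2 * y ^ 2 * lieForm A.p A.q) := by
      conv_lhs => rw [hkv', e]
      simp only [hvec, lieForm_add_right, lieForm_smul_right, hA.pw, hA.pp]
      ring
    have ht0 : t ≠ 0 := by
      rintro rfl
      exact hpq.ne (by rw [e1]; ring)
    rw [lieForm_comm, hA.qw] at e2
    -- In the case `y = b`, parameters (λ, μ) on the second arc are parameters (λ + μa, μb) on the
    -- first. Reaching `q` needs the first of them to vanish; both summands being nonnegative, `a =
    -- 0`.
    have e4 : (1 - t) + t * a = 0 := by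
      have := mul_ne_zero (mul_ne_zero (mul_ne_zero hk hc) (mul_ne_zero ht0 hb0))
        (mul_ne_zero (by norm_num : (-2 : ℝ) ≠ 0) hpq.ne)
      apply mul_left_cancel₀ this
      linear_combination -e2
    have ht1 := ht.1
    have ht2 := ht.2
    have : t * a = 0 := le_antisymm (by linarith) (by positivity)
    have ha0 : a = 0 := by simpa [ht0] using this
    subst ha0
    refine ⟨y, hbpos, ?_, ?_⟩
    · have := congrArg (fun v => c • v) hxyz
      simp only [smul_smul, mul_inv_cancel₀ hc, one_smul] at this
      rw [this]; module
    · have := congrArg (fun v => c • v) hq'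
      simp only [smul_smul, mul_inv_cancel₀ hc, one_smul] at this
      rw [this]; simp only [hvec]; module
  · exfalso
    have hy : y = -b := by linarith
    subst hy
    have hx : x = -(2 * a) := mul_right_cancel₀ hb0 (by linarith)
    subst hx
    -- In the case `y = -b`, parameters (λ, 1) on the second arc are parameters (λ − a, −b) on the
    -- first. For λ > a this point lies off the first arc, and λ = 1 + 2a is such a value.
    obtain ⟨a2, b2, ha2, hb2, hab2, h2⟩ := key (1 + 2 * a) 1 (by linarith) zero_le_one (by linarith)
    have e : c⁻¹ • B.hvec (1 + 2 * a) 1 = (1 + 2 * a) ^ 2 • A.p +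
        (1 + 2 * a) • ((-(2 * a)) • A.p + (-b) • A.w) + A.hvec a b := by
      rw [← hxyz, ← hq', ← hp']
      simp only [hvec]; module
    have e2 := w_form_hvec hA a2 b2
    rw [← h2, e] at e2
    simp only [hvec, lieForm_add_right, lieForm_smul_right, hA.pw, hA.qw,
        lieForm_comm A.w A.p, lieForm_comm A.w A.q, hA.ww] at e2
    have e3 : -((1 + a) * b) = a2 * b2 := by
      apply mul_left_cancel₀ (mul_ne_zero (by norm_num : (-2 : ℝ) ≠ 0) hpq.ne)
      linear_combination e2
    have : 0 ≤ a2 * b2 := by positivity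
    have : 0 < (1 + a) * b := by positivity
    linarith

/-- Two arcs with the same end points and the same direction at the starting point agree. -/
theorem sim_of_direction {c c' k l : ℝ} (hA : A.Valid) (hB : B.Valid) (hc : c ≠ 0)
    (hp : B.p = c • A.p) (hq : B.q = c' • A.q) (hk : 0 < c * k) (hw : B.w = k • A.w + l • A.p) :
    A.Sim B := by
  have e1 := hB.qw
  rw [hq, hw] at e1
  simp only [lieForm_add_right, lieForm_smul_right, lieForm_smul_left, hA.qw,
    lieForm_comm A.q A.p] at e1
  have e2 := hB.pq
  rw [hp, hq, lieForm_smul_left, lieForm_smul_right] at e2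
  have hc' : c' ≠ 0 := by
    rintro rfl; simp at e2
  have hl : l = 0 := by
    have h1 := hA.pq.ne
    have : c' * (l * lieForm A.p A.q) = 0 := by linarith
    simpa [hc', h1] using this
  subst hl
  have e3 := hB.ww
  rw [hp, hq, hw] at e3
  simp only [zero_smul, add_zero, lieForm_smul_left, lieForm_smul_right, hA.ww] at e3
  have e4 : k ^ 2 = c * c' := by
    apply mul_left_cancel₀ hA.pq.ne
    linear_combination -e3 / 2
  refine ⟨c, c⁻¹ * k, hc, ?_, hp, ?_, ?_⟩
  · have : c⁻¹ * k = (c⁻¹) ^ 2 * (c * k) := by field_simp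
    rw [this]; positivity
  · rw [hw]; rw [mul_inv_cancel_left₀ hc]; module
  · rw [hq]; congr 1
    rw [mul_pow, e4]; field_simp

end Arc

/-! ### Euclidean circular arcs -/

/-- The vector of the conformal model representing the tangent vector `t` at `x`. -/
def tanVec (x t : E3) : LieSpace := (t, 0, 2 * inner ℝ x t, 0)

theorem lieForm_tanVec (x s t : E3) : lieForm (tanVec x s) (tanVec x t) = inner ℝ s t := by
  simp [lieForm, tanVec]

theorem lieForm_liePoint_tanVec (x t : E3) : lieForm (liePoint x) (tanVec x t) = 0 := by
  simp [lieForm, tanVec, liePoint_coe]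

theorem lieForm_liePoint_tanVec' (x y t : E3) :
    lieForm (liePoint y) (tanVec x t) = inner ℝ (y - x) t := by
  simp [lieForm, tanVec, liePoint_coe, inner_sub_left]

/-- The data of the arc from `x` in direction `t` to `y`. -/
def edgeArcData (x t y : E3) : Arc where
  p := liePoint x
  w := ‖y - x‖ • (tanVec x t + (2 * inner ℝ (y - x) t / ‖y - x‖ ^ 2) • liePoint x)
  q := liePoint y

theorem edgeArcData_valid {x t y : E3} (hxy : y ≠ x) (ht : inner ℝ t t = (1 : ℝ)) :
    (edgeArcData x t y).Valid := by
  have hl : ‖y - x‖ ≠ 0 := norm_ne_zero_iff.2 (sub_ne_zero.2 hxy)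
  refine ⟨rfl, ?_, rfl, (isPtVec_liePoint _).iso, (isPtVec_liePoint _).iso, ?_, ?_, ?_, ?_⟩
  · simp [edgeArcData, LieSpace.radial, tanVec, liePoint_coe]
  · simp only [edgeArcData, lieForm_smul_right, lieForm_add_right, lieForm_liePoint_tanVec,
      (isPtVec_liePoint _).iso]
    ring
  · simp only [edgeArcData, lieForm_smul_right, lieForm_add_right, lieForm_liePoint_tanVec',
      lieForm_comm (liePoint y) (liePoint x), lieForm_liePoint_coe]
    field_simp; ring
  · simp only [edgeArcData, lieForm_smul_right, lieForm_add_right, lieForm_smul_left,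
      lieForm_add_left, lieForm_tanVec, ht, (isPtVec_liePoint _).iso, lieForm_liePoint_coe,
      lieForm_comm (tanVec x t) (liePoint x), lieForm_liePoint_tanVec]
    field_simp; ring
  · simp only [edgeArcData, lieForm_liePoint_coe]
    have : 0 < ‖y - x‖ ^ 2 := by positivity
    linarith

/-- The vector on the right is the image of `x + m` under the inversion about `x`, written without
denominators so that `m = 0` gives ∞. The condition `z ≠ x` is needed because the inversion fixes
its own centre by convention. -/
theorem isRep_inversion {x m : E3} {z : OnePoint E3} :
    (z.elim x (EuclideanGeometry.inversion x 1) = x + m ∧ z ≠ (x : OnePoint E3)) ↔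
      IsRep ((inner ℝ m m : ℝ) • liePoint x + tanVec x m + liePoint OnePoint.infty) z := by
  induction z using OnePoint.rec with
  | infty =>
    constructor
    · rintro ⟨h, -⟩
      have hm : m = 0 := by simpa using h
      subst hm
      exact ⟨1, by simp [tanVec, liePoint_infty]⟩
    · rintro ⟨c, h⟩
      refine ⟨?_, OnePoint.infty_ne_coe _⟩
      have h1 := congrArg (fun v : LieSpace => v.2.1) h
      have h2 := congrArg (fun v : LieSpace => v.2.2.1) h
      simp [liePoint_infty, liePoint_coe, tanVec] at h1 h2
      rcases h1 with h1 | h1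
      · subst h1; simp at h2
      · simp [h1]
  | coe y =>
    have e : (y : OnePoint E3).elim x (EuclideanGeometry.inversion x 1) =
      (1 / ‖y - x‖) ^ 2 • (y - x) + x := by
      simp [EuclideanGeometry.inversion, dist_eq_norm]
    rw [e]
    constructor
    · rintro ⟨h, hne⟩
      have hne : y ≠ x := fun h => hne (by rw [h])
      have hl : ‖y - x‖ ≠ 0 := norm_ne_zero_iff.2 (sub_ne_zero.2 hne)
      have hm : m = (1 / ‖y - x‖) ^ 2 • (y - x) := by
        rw [add_comm] at h; exact (add_left_cancel h).symm
      refine ⟨‖y - x‖ ^ 2, ?_⟩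
      have hmm : ‖y - x‖ ^ 2 * inner ℝ m m = 1 := by
        rw [hm, inner_smul_left, inner_smul_right, real_inner_self_eq_norm_sq]
        simp only [conj_trivial]
        field_simp
      have hym : y = x + ‖y - x‖ ^ 2 • m := by
        rw [hm, smul_smul, ← mul_pow, mul_one_div_cancel hl]; simp
      simp only [liePoint_coe, tanVec, liePoint_infty, smul_add, Prod.smul_mk, Prod.mk_add_mk,
        smul_eq_mul, smul_smul, hmm, mul_zero, add_zero, mul_one, one_smul, Prod.mk.injEq,
        and_true, true_and]
      refine ⟨hym, ?_⟩
      have : ‖y‖ ^ 2 = ‖x‖ ^ 2 + 2 * inner ℝ x (y - x) + ‖y - x‖ ^ 2 := by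
        rw [← norm_add_sq_real]; simp
      have h2 : ‖y - x‖ ^ 2 * inner ℝ x m = inner ℝ x (y - x) := by
        rw [← inner_smul_right]; congr 1; rw [eq_sub_iff_add_eq, add_comm]; exact hym.symm
      linear_combination this - 2 * h2 - ‖x‖ ^ 2 * hmm
    · rintro ⟨c, h⟩
      have h1 := congrArg (fun v : LieSpace => v.2.1) h
      have h2 := congrArg (fun v : LieSpace => v.1) h
      simp only [liePoint_coe, tanVec, liePoint_infty, smul_add, Prod.smul_mk, Prod.mk_add_mk,
        smul_eq_mul, mul_zero, add_zero, mul_one, smul_smul] at h1 h2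
      rw [← h1, one_smul] at h2
      have h3 : y - x = c • m := by rw [h2]; abel
      have hc : c ≠ 0 := by rintro rfl; simp at h1
      have hn : ‖y - x‖ ^ 2 = c := by
        rw [h3, ← real_inner_self_eq_norm_sq, inner_smul_left, inner_smul_right, ← h1]; simp
      refine ⟨?_, ?_⟩
      · rw [div_pow, hn, h3, smul_smul]
        rw [show (1 : ℝ) ^ 2 / c * c = 1 by field_simp, one_smul, add_comm]
      · intro hyx
        rw [OnePoint.coe_eq_coe] at hyx
        rw [hyx] at hn
        simp at hn; exact hc hn.symm

/-- The point of the inverted ray with parameter `r` has homogeneous arc parameters `(r, 1 / ‖y -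
x‖)`. So `r ≥ 0` covers the arc except for `x`, which corresponds to `r = ∞`. -/
theorem circularArc_eq {x t y : E3} (hxy : y ≠ x) (ht : inner ℝ t t = (1 : ℝ)) :
    circularArc x t y = (edgeArcData x t y).set := by
  have hl : ‖y - x‖ ≠ 0 := norm_ne_zero_iff.2 (sub_ne_zero.2 hxy)
  have hlp : 0 < ‖y - x‖ := norm_pos_iff.2 (sub_ne_zero.2 hxy)
  have hv := edgeArcData_valid hxy ht
  have key : ∀ r : ℝ, (inner ℝ ((1 / ‖y - x‖) ^ 2 • (y - x) + r • t)
      ((1 / ‖y - x‖) ^ 2 • (y - x) + r • t) : ℝ) • liePoint x +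
      tanVec x ((1 / ‖y - x‖) ^ 2 • (y - x) + r • t) + liePoint OnePoint.infty =
      (edgeArcData x t y).hvec r (1 / ‖y - x‖) := by
    intro r
    have hy2 : ‖y‖ ^ 2 = ‖x‖ ^ 2 + 2 * inner ℝ x (y - x) + ‖y - x‖ ^ 2 := by
      rw [← norm_add_sq_real]; simp
    simp only [Arc.hvec, edgeArcData, inner_add_left, inner_add_right, inner_smul_left,
      inner_smul_right, real_inner_self_eq_norm_sq (y - x), ht, conj_trivial,
      real_inner_comm (y - x) t, liePoint_coe, tanVec, liePoint_infty, Prod.smul_mk,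
      Prod.mk_add_mk, smul_eq_mul, hy2, Prod.mk.injEq]
    refine ⟨?_, ?_, ?_, ?_⟩
    · have : y = x + (y - x) := by abel
      conv_rhs => rw [this]
      simp only [add_sub_cancel]
      match_scalars <;> field_simp
      ring
    · field_simp; ring
    · field_simp; ring
    · ring
  have einv : EuclideanGeometry.inversion x 1 y = x + (1 / ‖y - x‖) ^ 2 • (y - x) := by
    simp [EuclideanGeometry.inversion, dist_eq_norm, add_comm]
  ext z
  by_cases hz : z = (x : OnePoint E3)
  · subst hz
    refine iff_of_true (Or.inl rfl) ⟨0, ⟨le_rfl, zero_le_one⟩, ?_⟩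
    rw [Arc.vec_zero]; exact repr_liePoint _
  constructor
  · rintro (h | ⟨r, hr, h⟩)
    · exact absurd h hz
    · rw [einv, add_assoc] at h
      have := isRep_inversion.1 ⟨h, hz⟩
      rw [key] at this
      exact Arc.mem_set_hvec hr (by positivity) (by positivity) this
  · rintro ⟨s, hs, h⟩
    have h1 := hs.1
    have h2 := hs.2
    have hs0 : s ≠ 0 := by
      rintro rfl
      rw [Arc.vec_zero] at h
      exact hz (h.unique (repr_liePoint _))
    have hsp : 0 < s := lt_of_le_of_ne h1 (Ne.symm hs0)
    refine Or.inr ⟨(1 - s) / (s * ‖y - x‖), div_nonneg (by linarith) (by positivity), ?_⟩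
    have e : (edgeArcData x t y).vec s = (s * ‖y - x‖) ^ 2 •
        (edgeArcData x t y).hvec ((1 - s) / (s * ‖y - x‖)) (1 / ‖y - x‖) := by
      rw [← Arc.hvec_smul, Arc.vec]; congr 1 <;> field_simp
    rw [e, repr_smul_iff (by positivity), ← key] at h
    rw [einv, add_assoc]
    exact (isRep_inversion.2 h).1

end

noncomputable section

/-! ### Normal form of non-singular patches -/

/-- The normalizing quadratic polynomial. -/
def qd (k s : ℝ) : ℝ := (1 - s) ^ 2 + k * (s * (1 - s)) + s ^ 2

/-- One has `qd k s = (1 - 2 * s) ^ 2 + (k + 2) * (s * (1 - s))`; the midpoint shows that the bound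
−2 cannot be improved. -/
theorem qd_pos {k s : ℝ} (hk : -2 < k) (h0 : 0 ≤ s) (h1 : s ≤ 1) : 0 < qd k s := by
  unfold qd
  rcases h0.eq_or_lt with h | h
  · subst h; norm_num
  rcases h1.eq_or_lt with h' | h'
  · subst h'; norm_num
  · have : 0 < s * (1 - s) := mul_pos h (by linarith)
    nlinarith [sq_nonneg (1 - 2 * s)]

@[simp] theorem qd_zero (k : ℝ) : qd k 0 = 1 := by simp [qd]
@[simp] theorem qd_one (k : ℝ) : qd k 1 = 1 := by simp [qd]

theorem qd_symm (k s : ℝ) : qd k (1 - s) = qd k s := by unfold qd; ring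

/-- Data of a non-singular patch: the corner `p`, the tangent directions `W`, `V` at the corner,
the differences `d`, `e` between the (suitably scaled) neighbouring corners and `p`, and
the parameters of the normalizing polynomials. -/
structure PatchData where
  p : LieSpace
  W : LieSpace
  d : LieSpace
  κ : ℝ
  V : LieSpace
  e : LieSpace
  ν : ℝ

namespace PatchData

variable {D : PatchData}

/-- The relations among `p`, `W`, `d` and among `p`, `V`, `e` make the two boundary arcs conics on
the light cone, the last four products make the planes of the two families orthogonal, and `hκ`,
`hν` keep the quadratic factors positive on the unit interval. -/
structure Valid (D : PatchData) : Prop where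
  rp : D.p.radial = 0
  rW : D.W.radial = 0
  rd : D.d.radial = 0
  rV : D.V.radial = 0
  re : D.e.radial = 0
  pp : lieForm D.p D.p = 0
  pW : lieForm D.p D.W = 0
  WW : lieForm D.W D.W = -2 * lieForm D.p D.d
  dd : lieForm D.d D.d = -2 * lieForm D.p D.d
  Wd : lieForm D.W D.d = -D.κ * lieForm D.p D.d
  pd : lieForm D.p D.d < 0
  pV : lieForm D.p D.V = 0
  VV : lieForm D.V D.V = -2 * lieForm D.p D.e
  ee : lieForm D.e D.e = -2 * lieForm D.p D.e
  Ve : lieForm D.V D.e = -D.ν * lieForm D.p D.e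
  pe : lieForm D.p D.e < 0
  WV : lieForm D.W D.V = 0
  We : lieForm D.W D.e = 0
  dV : lieForm D.d D.V = 0
  de : lieForm D.d D.e = 0
  hκ : -2 < D.κ
  hν : -2 < D.ν

/-- The homogeneous coordinates of the points of the patch. -/
def P (D : PatchData) (s t : ℝ) : LieSpace :=
  (qd D.κ s * qd D.ν t) • D.p + qd D.ν t • ((s * (1 - s)) • D.W + s ^ 2 • D.d) +
    qd D.κ s • ((t * (1 - t)) • D.V + t ^ 2 • D.e)

def swap (D : PatchData) : PatchData := ⟨D.p, D.V, D.e, D.ν, D.W, D.d, D.κ⟩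

/-- The same patch seen from the other end of the first boundary arc. -/
def flip (D : PatchData) : PatchData :=
  ⟨D.p + D.d, D.W - D.κ • D.d, -D.d, D.κ, D.V, D.e, D.ν⟩

def scale (D : PatchData) (c : ℝ) : PatchData :=
  ⟨c • D.p, c • D.W, c • D.d, D.κ, c • D.V, c • D.e, D.ν⟩

theorem swap_P (s t : ℝ) : D.swap.P s t = D.P t s := by
  simp only [P, swap]; module

theorem flip_P (s t : ℝ) : D.flip.P s t = D.P (1 - s) t := by
  simp only [P, flip, qd_symm]
  simp only [qd]; module

theorem scale_P (c s t : ℝ) : (D.scale c).P s t = c • D.P s t := by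
  simp only [P, scale]; module

theorem Valid.swap (h : D.Valid) : D.swap.Valid := by
  obtain ⟨⟩ := h
  constructor <;> simp only [PatchData.swap] <;> first | assumption | skip
  all_goals rw [lieForm_comm]; assumption

theorem Valid.flip (h : D.Valid) : D.flip.Valid := by
  have e1 := lieForm_comm D.d D.p
  have e2 := lieForm_comm D.d D.W
  constructor <;> simp only [PatchData.flip, radial_add, radial_sub, radial_smul, radial_neg,
    lieForm_add_left, lieForm_add_right, lieForm_sub_left, lieForm_sub_right, lieForm_smul_left,
    lieForm_smul_right, lieForm_neg_left, lieForm_neg_right, e1, e2, h.rp, h.rW, h.rd, h.rV, h.re,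
    h.pp, h.pW, h.WW, h.dd, h.Wd, h.pV, h.VV, h.ee, h.Ve, h.WV, h.We, h.dV, h.de, add_zero]
  any_goals ring1
  · have := h.pd; linarith
  · have := h.pe; linarith
  · exact h.hκ
  · exact h.hν

theorem Valid.scale (h : D.Valid) {c : ℝ} (hc : c ≠ 0) : (D.scale c).Valid := by
  have hc2 : 0 < c * c := mul_self_pos.2 hc
  constructor <;> simp only [PatchData.scale, radial_smul, lieForm_smul_left,
    lieForm_smul_right, h.rp, h.rW, h.rd, h.rV, h.re,
    h.pp, h.pW, h.WW, h.dd, h.Wd, h.pV, h.VV, h.ee, h.Ve, h.WV, h.We, h.dV, h.de, mul_zero]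
  any_goals ring1
  · have := h.pd; nlinarith
  · have := h.pe; nlinarith
  · exact h.hκ
  · exact h.hν

/-- After division by the quadratic factors a point is `p` plus two curves in orthogonal planes, so
the form of two points splits into one term for each parameter. Both terms have the same sign, which
is the source of the injectivity of the patch. -/
theorem Valid.form_P (h : D.Valid) (s t s' t' : ℝ) : lieForm (D.P s t) (D.P s' t') =
    lieForm D.p D.d * (s - s') ^ 2 * (qd D.ν t * qd D.ν t') +
    lieForm D.p D.e * (t - t') ^ 2 * (qd D.κ s * qd D.κ s') := by
  simp only [P, lieForm_add_left, lieForm_add_right, lieForm_smul_left, lieForm_smul_right,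
    h.pp, h.pW, h.WW, h.dd, h.Wd, h.pV, h.VV, h.ee, h.Ve, h.WV, h.We, h.dV, h.de,
    lieForm_comm D.d D.p, lieForm_comm D.W D.p, lieForm_comm D.V D.p, lieForm_comm D.e D.p,
    lieForm_comm D.d D.W, lieForm_comm D.e D.V, lieForm_comm D.V D.W, lieForm_comm D.e D.W,
    lieForm_comm D.V D.d, lieForm_comm D.e D.d]
  simp only [qd]
  ring

theorem Valid.isPtVec_p (h : D.Valid) : IsPtVec D.p :=
  ⟨fun h0 => by have := h.pd; rw [h0, lieForm_zero_left] at this; exact lt_irrefl _ this,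
    h.rp, h.pp⟩

theorem Valid.rad_P (h : D.Valid) (s t : ℝ) : (D.P s t).radial = 0 := by
  simp only [P, radial_add, radial_smul, h.rp, h.rW, h.rd, h.rV, h.re]; ring

theorem Valid.isPtVec_P (h : D.Valid) {s t : ℝ} (hs : s ∈ Set.Icc (0 : ℝ) 1)
    (ht : t ∈ Set.Icc (0 : ℝ) 1) : IsPtVec (D.P s t) := by
  refine ⟨fun h0 => ?_, h.rad_P s t, ?_⟩
  · have hq := qd_pos h.hκ hs.1 hs.2
    have hq' := qd_pos h.hν ht.1 ht.2
    have e1 := h.form_P s t 0 t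
    have e2 := h.form_P s t 1 t
    rw [h0, lieForm_zero_left, sub_self] at e1 e2
    have hne := mul_ne_zero h.pd.ne (mul_pos hq' hq').ne'
    have e3 : s ^ 2 = 0 := mul_left_cancel₀ hne (by linarith)
    have e4 : (s - 1) ^ 2 = 0 := mul_left_cancel₀ hne (by linarith)
    nlinarith
  · rw [h.form_P]; ring

/-- The point map of a patch in normal form is injective. -/
theorem Valid.P_inj (h : D.Valid) {s t s' t' : ℝ} (hs : s ∈ Set.Icc (0 : ℝ) 1)
    (ht : t ∈ Set.Icc (0 : ℝ) 1) (hs' : s' ∈ Set.Icc (0 : ℝ) 1) (ht' : t' ∈ Set.Icc (0 : ℝ) 1)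
    (h0 : lieForm (D.P s t) (D.P s' t') = 0) : s = s' ∧ t = t' := by
  rw [h.form_P] at h0
  have q1 := qd_pos h.hκ hs.1 hs.2
  have q2 := qd_pos h.hν ht.1 ht.2
  have q3 := qd_pos h.hκ hs'.1 hs'.2
  have q4 := qd_pos h.hν ht'.1 ht'.2
  have a1 : lieForm D.p D.d * (s - s') ^ 2 * (qd D.ν t * qd D.ν t') ≤ 0 :=
    mul_nonpos_of_nonpos_of_nonneg
      (mul_nonpos_of_nonpos_of_nonneg h.pd.le (sq_nonneg _)) (mul_pos q2 q4).le
  have a2 : lieForm D.p D.e * (t - t') ^ 2 * (qd D.κ s * qd D.κ s') ≤ 0 :=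
    mul_nonpos_of_nonpos_of_nonneg
      (mul_nonpos_of_nonpos_of_nonneg h.pe.le (sq_nonneg _)) (mul_pos q1 q3).le
  have b1 : lieForm D.p D.d * (s - s') ^ 2 * (qd D.ν t * qd D.ν t') = 0 := by linarith
  have b2 : lieForm D.p D.e * (t - t') ^ 2 * (qd D.κ s * qd D.κ s') = 0 := by linarith
  have c1 := h.pd.ne
  have c2 := h.pe.ne
  simp only [mul_eq_zero, c1, c2, q1.ne', q2.ne', q3.ne', q4.ne', or_false, false_or,
    pow_eq_zero_iff, ne_eq, OfNat.ofNat_ne_zero, not_false_eq_true, sub_eq_zero] at b1 b2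
  exact ⟨b1, b2⟩

theorem Valid.rep_inj (h : D.Valid) {s t s' t' : ℝ} (hs : s ∈ Set.Icc (0 : ℝ) 1)
    (ht : t ∈ Set.Icc (0 : ℝ) 1) (hs' : s' ∈ Set.Icc (0 : ℝ) 1) (ht' : t' ∈ Set.Icc (0 : ℝ) 1)
    {z : OnePoint E3} (h1 : IsRep (D.P s t) z) (h2 : IsRep (D.P s' t') z) : s = s' ∧ t = t' :=
  h.P_inj hs ht hs' ht' ((h1.form_eq_zero_iff h2).2 rfl)

/-- The first boundary arc. -/
def arc₁ (D : PatchData) : Arc := ⟨D.p, D.W + D.κ • D.p, D.p + D.d⟩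

/-- The second boundary arc. -/
def arc₂ (D : PatchData) : Arc := ⟨D.p, D.V + D.ν • D.p, D.p + D.e⟩

/-- Scaling factor of the point `z` of the second boundary arc. -/
def mu (D : PatchData) (z : LieSpace) : ℝ := lieForm z D.d / lieForm D.p D.d

/-- The curvature line of the first family through the point `z` of the second boundary arc. -/
def harc (D : PatchData) (z : LieSpace) : Arc :=
  ⟨z, D.mu z • D.W + D.κ • z, z + D.mu z • D.d⟩

theorem swap_arc₁ : D.swap.arc₁ = D.arc₂ := rfl
theorem swap_arc₂ : D.swap.arc₂ = D.arc₁ := rfl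

theorem arc₂_vec (t : ℝ) : D.arc₂.vec t = D.P 0 t := by
  simp only [Arc.vec, Arc.hvec, arc₂, P, qd]; module

theorem arc₁_vec (s : ℝ) : D.arc₁.vec s = D.P s 0 := by
  rw [← swap_arc₂, arc₂_vec, swap_P]

theorem Valid.mu_P (h : D.Valid) (t : ℝ) : D.mu (D.P 0 t) = qd D.ν t := by
  have := h.pd.ne
  simp only [mu, P, lieForm_add_left, lieForm_smul_left, lieForm_comm D.V D.d, lieForm_comm D.e D.d,
    h.dV, h.de, h.Wd, h.dd]
  field_simp
  simp

/-- A curvature line is thus determined by its initial point alone: `mu` recovers the factor `qd D.ν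
t` from that point. This allows transport of lines between faces without mention of parameters. -/
theorem Valid.harc_vec (h : D.Valid) (s t : ℝ) : (D.harc (D.P 0 t)).vec s = D.P s t := by
  rw [harc, h.mu_P]
  simp only [Arc.vec, Arc.hvec, P, qd]
  module

theorem mu_smul (c : ℝ) (z : LieSpace) : D.mu (c • z) = c * D.mu z := by
  rw [mu, lieForm_smul_left, mu]; ring

theorem harc_sim {c : ℝ} (hc : c ≠ 0) (z : LieSpace) : (D.harc z).Sim (D.harc (c • z)) := by
  refine ⟨c, 1, hc, one_pos, rfl, ?_, ?_⟩ <;> simp only [harc, mu_smul] <;> module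

theorem Valid.mu_p (h : D.Valid) : D.mu D.p = 1 := div_self h.pd.ne

theorem Valid.harc_p (h : D.Valid) : D.harc D.p = D.arc₁ := by
  simp [harc, arc₁, h.mu_p]

theorem Valid.harc_valid (h : D.Valid) {z : LieSpace} (hz : IsPtVec z) (hW : lieForm z D.W = 0)
    (hd : lieForm z D.d ≠ 0) : (D.harc z).Valid := by
  have hpd := h.pd.ne
  have hm : lieForm z D.d = D.mu z * lieForm D.p D.d := by rw [mu]; field_simp
  have hm0 : D.mu z ≠ 0 := div_ne_zero hd hpd
  refine ⟨hz.rad, ?_, ?_, hz.iso, ?_, ?_, ?_, ?_, ?_⟩ <;>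
    simp only [harc, radial_add, radial_smul, lieForm_add_left, lieForm_add_right,
      lieForm_smul_left, lieForm_smul_right, h.rW, h.rd, hz.rad, hz.iso, hW, h.WW, h.Wd, h.dd,
      lieForm_comm D.d z, lieForm_comm D.W z, lieForm_comm D.d D.W, hm]
  any_goals ring1
  have h1 := h.pd
  have h2 : 0 < D.mu z * D.mu z := mul_self_pos.2 hm0
  nlinarith

/-- The vectors representing points of the second boundary arc, on the half of the light cone
of `p`. -/
def OnEdge (D : PatchData) (z : LieSpace) : Prop :=
  ∃ t ∈ Set.Icc (0 : ℝ) 1, ∃ c : ℝ, 0 < c ∧ z = c • D.P 0 t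

theorem zero_mem : (0 : ℝ) ∈ Set.Icc (0 : ℝ) 1 := ⟨le_rfl, zero_le_one⟩
theorem one_mem : (1 : ℝ) ∈ Set.Icc (0 : ℝ) 1 := ⟨zero_le_one, le_rfl⟩
theorem half_mem : (1 / 2 : ℝ) ∈ Set.Icc (0 : ℝ) 1 := by norm_num

theorem P_zero_zero : D.P 0 0 = D.p := by simp [P]
theorem P_zero_one : D.P 0 1 = D.p + D.e := by simp [P]
theorem P_one_one : D.P 1 1 = D.p + D.d + D.e := by simp [P]

theorem onEdge_p : D.OnEdge D.p := ⟨0, zero_mem, 1, one_pos, by simp [P_zero_zero]⟩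

theorem Valid.onEdge_isPtVec (h : D.Valid) {z : LieSpace} (hz : D.OnEdge z) : IsPtVec z := by
  obtain ⟨t, ht, c, hc, rfl⟩ := hz
  exact (h.isPtVec_P zero_mem ht).smul hc.ne'

theorem Valid.onEdge_mu_pos (h : D.Valid) {z : LieSpace} (hz : D.OnEdge z) : 0 < D.mu z := by
  obtain ⟨t, ht, c, hc, rfl⟩ := hz
  rw [mu_smul, h.mu_P]
  exact mul_pos hc (qd_pos h.hν ht.1 ht.2)

theorem Valid.form_mu (h : D.Valid) (z : LieSpace) :
    lieForm z D.d = D.mu z * lieForm D.p D.d := by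
  have := h.pd.ne
  rw [mu]; field_simp

theorem Valid.form_W_P (h : D.Valid) (t : ℝ) : lieForm (D.P 0 t) D.W = 0 := by
  simp only [P, lieForm_add_left, lieForm_smul_left, h.pW, lieForm_comm D.V D.W,
    lieForm_comm D.e D.W, h.WV, h.We]
  ring

theorem Valid.onEdge_form_W (h : D.Valid) {z : LieSpace} (hz : D.OnEdge z) :
    lieForm z D.W = 0 := by
  obtain ⟨t, ht, c, hc, rfl⟩ := hz
  rw [lieForm_smul_left, h.form_W_P, mul_zero]

theorem Valid.onEdge_harc (h : D.Valid) {z : LieSpace} (hz : D.OnEdge z) : (D.harc z).Valid := by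
  refine h.harc_valid (h.onEdge_isPtVec hz) (h.onEdge_form_W hz) ?_
  rw [h.form_mu]
  exact mul_ne_zero (h.onEdge_mu_pos hz).ne' h.pd.ne

theorem Valid.arc₁_valid (h : D.Valid) : D.arc₁.Valid := h.harc_p ▸ h.onEdge_harc onEdge_p

theorem Valid.arc₂_valid (h : D.Valid) : D.arc₂.Valid := h.swap.arc₁_valid

theorem Valid.flip_mu (h : D.Valid) {z : LieSpace} : D.flip.mu (z + D.mu z • D.d) = D.mu z := by
  have hpd := h.pd.ne
  rw [mu]
  simp only [PatchData.flip, lieForm_add_left, lieForm_neg_right, lieForm_smul_left, h.form_mu z, h.dd]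
  field_simp

/-- Seen from the opposite boundary arc, the inverted point starts the same curvature line in the
reverse direction. -/
theorem Valid.flip_harc (h : D.Valid) {z : LieSpace} :
    D.flip.harc (z + D.mu z • D.d) = (D.harc z).rev := by
  rw [harc, h.flip_mu]
  simp only [PatchData.flip, harc, Arc.rev, Arc.mk.injEq, true_and]
  constructor <;> module

theorem flip_arc₁ : D.flip.arc₁ = D.arc₁.rev := by
  simp only [flip, arc₁, Arc.rev, Arc.mk.injEq, true_and]
  constructor <;> module

theorem Valid.flip_onEdge (h : D.Valid) {z : LieSpace} (hz : D.OnEdge z) :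
    D.flip.OnEdge (z + D.mu z • D.d) := by
  obtain ⟨t, ht, c, hc, rfl⟩ := hz
  refine ⟨t, ht, c, hc, ?_⟩
  rw [flip_P, sub_zero, mu_smul, h.mu_P]
  simp only [P, qd]; module

end PatchData

/-! ### Contact elements of patches in normal form -/

section Contact

/-- Bare contact maps carry no proof of being a patch, so exchanging or reversing the parameters
needs no new representation as a Dupin cyclide or sphere. -/
abbrev ContactMap := I → I → Submodule ℝ LieSpace

namespace ContactMap

def lineA (L : ContactMap) (v : I) : Set (OnePoint E3) := {p | ∃ u, liePoint p ∈ L u v}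
def lineB (L : ContactMap) (u : I) : Set (OnePoint E3) := {p | ∃ v, liePoint p ∈ L u v}
def curves (L : ContactMap) : Set (Set (OnePoint E3)) := Set.range L.lineA ∪ Set.range L.lineB
def arcs (L : ContactMap) : Set (Set (OnePoint E3)) := {L.lineA 0, L.lineA 1, L.lineB 0, L.lineB 1}
def points (L : ContactMap) : Set (OnePoint E3) := {p | ∃ u v, liePoint p ∈ L u v}
def swap (L : ContactMap) : ContactMap := fun u v => L v u
def flip (L : ContactMap) : ContactMap := fun u v => L (unitInterval.symm u) v

/-- Some boundary arc of `L` is a curvature line of `M`, along which the two are orthogonal. -/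
def Meets (L M : ContactMap) : Prop :=
  ∃ c ∈ L.arcs, c ∈ M.curves ∧ ∀ p ∈ c, ∀ u v u' v', liePoint p ∈ L u v → liePoint p ∈ M u' v' →
      OrthogonalContact (L u v) (M u' v')

variable {L M : ContactMap}

theorem swap_lineA (u : I) : L.swap.lineA u = L.lineB u := rfl
theorem swap_lineB (u : I) : L.swap.lineB u = L.lineA u := rfl

theorem swap_curves : L.swap.curves = L.curves := Set.union_comm _ _

theorem swap_arcs : L.swap.arcs = L.arcs := by
  ext c; simp only [arcs, swap_lineA, swap_lineB, Set.mem_insert_iff, Set.mem_singleton_iff]; tauto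

theorem swap_points : L.swap.points = L.points := by
  ext c; exact exists_comm

theorem flip_lineA (v : I) : L.flip.lineA v = L.lineA v := by
  ext p
  constructor
  · rintro ⟨u, h⟩; exact ⟨_, h⟩
  · rintro ⟨u, h⟩; exact ⟨unitInterval.symm u, by rwa [flip, unitInterval.symm_symm]⟩

theorem flip_lineB (u : I) : L.flip.lineB u = L.lineB (unitInterval.symm u) := rfl

theorem flip_curves : L.flip.curves = L.curves := by
  have h1 : L.flip.lineA = L.lineA := funext flip_lineA
  have h2 : L.flip.lineB = L.lineB ∘ unitInterval.symm := funext flip_lineB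
  rw [curves, h1, h2, Set.range_comp, curves]
  congr 1
  rw [(unitInterval.symm_bijective.surjective).range_eq, Set.image_univ]

theorem flip_arcs : L.flip.arcs = L.arcs := by
  ext c
  simp only [arcs, flip_lineA, flip_lineB, unitInterval.symm_zero, unitInterval.symm_one,
    Set.mem_insert_iff, Set.mem_singleton_iff]
  tauto

theorem flip_points : L.flip.points = L.points := by
  ext c
  constructor
  · rintro ⟨u, v, h⟩; exact ⟨_, _, h⟩
  · rintro ⟨u, v, h⟩; exact ⟨unitInterval.symm u, v, by rwa [flip, unitInterval.symm_symm]⟩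

theorem Meets.swap (h : L.Meets M) : L.swap.Meets M := by
  obtain ⟨c, h1, h2, h3⟩ := h
  exact ⟨c, by rwa [swap_arcs], h2, fun p hp u v u' v' => h3 p hp v u u' v'⟩

theorem Meets.flip (h : L.Meets M) : L.flip.Meets M := by
  obtain ⟨c, h1, h2, h3⟩ := h
  exact ⟨c, by rwa [flip_arcs], h2, fun p hp u v u' v' => h3 p hp _ v u' v'⟩

end ContactMap

/-- The contact elements `L` belong to the patch with data `D`, up to a reparametrization. -/
structure RepData (L : ContactMap) (D : PatchData) where
  f : I → I
  g : I → I
  S : I → LieSpace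
  T : I → LieSpace
  f_surj : Function.Surjective f
  g_surj : Function.Surjective g
  f_zero : f 0 = 0
  f_one : f 1 = 1
  g_zero : g 0 = 0
  g_one : g 1 = 1
  spanS : ∀ u v, L u v = Submodule.span ℝ {D.P (f u) (g v), S v}
  spanT : ∀ u v, L u v = Submodule.span ℝ {D.P (f u) (g v), T u}
  radS : ∀ v, (S v).radial ≠ 0
  radT : ∀ u, (T u).radial ≠ 0
  isoS : ∀ v, lieForm (S v) (S v) = 0
  isoT : ∀ u, lieForm (T u) (T u) = 0
  formS : ∀ u v, lieForm (S v) (D.P (f u) (g v)) = 0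
  formT : ∀ u v, lieForm (T u) (D.P (f u) (g v)) = 0

namespace RepData

variable {L : ContactMap} {D : PatchData}

def swap (R : RepData L D) : RepData L.swap D.swap where
  f := R.g
  g := R.f
  S := R.T
  T := R.S
  f_surj := R.g_surj
  g_surj := R.f_surj
  f_zero := R.g_zero
  f_one := R.g_one
  g_zero := R.f_zero
  g_one := R.f_one
  spanS u v := by rw [PatchData.swap_P]; exact R.spanT v u
  spanT u v := by rw [PatchData.swap_P]; exact R.spanS v u
  radS := R.radT
  radT := R.radS
  isoS := R.isoT
  isoT := R.isoS
  formS u v := by rw [PatchData.swap_P]; exact R.formT v u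
  formT u v := by rw [PatchData.swap_P]; exact R.formS v u

def flip (R : RepData L D) : RepData L.flip D.flip where
  f u := unitInterval.symm (R.f (unitInterval.symm u))
  g := R.g
  S := R.S
  T u := R.T (unitInterval.symm u)
  f_surj := unitInterval.symm_bijective.surjective.comp
    (R.f_surj.comp unitInterval.symm_bijective.surjective)
  g_surj := R.g_surj
  f_zero := by rw [unitInterval.symm_zero, R.f_one, unitInterval.symm_one]
  f_one := by rw [unitInterval.symm_one, R.f_zero, unitInterval.symm_zero]
  g_zero := R.g_zero
  g_one := R.g_one
  spanS u v := by
    rw [PatchData.flip_P, unitInterval.coe_symm_eq, sub_sub_cancel]; exact R.spanS _ v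
  spanT u v := by
    rw [PatchData.flip_P, unitInterval.coe_symm_eq, sub_sub_cancel]; exact R.spanT _ v
  radS := R.radS
  radT u := R.radT _
  isoS := R.isoS
  isoT u := R.isoT _
  formS u v := by
    rw [PatchData.flip_P, unitInterval.coe_symm_eq, sub_sub_cancel]; exact R.formS _ v
  formT u v := by
    rw [PatchData.flip_P, unitInterval.coe_symm_eq, sub_sub_cancel]; exact R.formT _ v

def scale (R : RepData L D) {c : ℝ} (hc : c ≠ 0) : RepData L (D.scale c) where
  f := R.f
  g := R.g
  S := R.S
  T := R.T
  f_surj := R.f_surj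
  g_surj := R.g_surj
  f_zero := R.f_zero
  f_one := R.f_one
  g_zero := R.g_zero
  g_one := R.g_one
  spanS u v := by
    rw [R.spanS, PatchData.scale_P, Submodule.span_insert, Submodule.span_insert,
      Submodule.span_singleton_smul_eq hc.isUnit]
  spanT u v := by
    rw [R.spanT, PatchData.scale_P, Submodule.span_insert, Submodule.span_insert,
      Submodule.span_singleton_smul_eq hc.isUnit]
  radS := R.radS
  radT := R.radT
  isoS := R.isoS
  isoT := R.isoT
  formS u v := by rw [PatchData.scale_P, lieForm_smul_right, R.formS, mul_zero]
  formT u v := by rw [PatchData.scale_P, lieForm_smul_right, R.formT, mul_zero]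


theorem mem_iff (R : RepData L D) (hD : D.Valid) {u v : I} {z : OnePoint E3} :
    liePoint z ∈ L u v ↔ IsRep (D.P (R.f u) (R.g v)) z := by
  rw [R.spanS, Submodule.mem_span_pair]
  constructor
  · rintro ⟨a, b, h⟩
    -- The second generator is the only one with a radial component, so the points of the contact
    -- element are the multiples of `P`.
    have h1 := congrArg LieSpace.radial h
    rw [radial_add, radial_smul, radial_smul, hD.rad_P, (isPtVec_liePoint z).rad] at h1
    have hb : b = 0 := by simpa [R.radS v] using h1
    subst hb
    exact ⟨a, by rw [← h]; simp⟩
  · rintro ⟨c, h⟩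
    exact ⟨c, 0, by rw [h]; simp⟩

theorem mem_lineA (R : RepData L D) (hD : D.Valid) {v : I} {z : OnePoint E3} :
    z ∈ L.lineA v ↔ ∃ s ∈ Set.Icc (0 : ℝ) 1, IsRep (D.P s (R.g v)) z := by
  constructor
  · rintro ⟨u, h⟩
    exact ⟨R.f u, (R.f u).2, (R.mem_iff hD).1 h⟩
  · rintro ⟨s, hs, h⟩
    obtain ⟨u, hu⟩ := R.f_surj ⟨s, hs⟩
    exact ⟨u, (R.mem_iff hD).2 (by rwa [hu])⟩

theorem lineA_eq (R : RepData L D) (hD : D.Valid) (v : I) : L.lineA v = (D.harc (D.P 0 (R.g v))).set := by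
  ext z
  rw [R.mem_lineA hD]
  simp only [Arc.set, hD.harc_vec]
  rfl

theorem lineA_zero (R : RepData L D) (hD : D.Valid) : L.lineA 0 = D.arc₁.set := by
  rw [R.lineA_eq hD, R.g_zero]
  simp [PatchData.P_zero_zero, hD.harc_p]

theorem lineB_zero (R : RepData L D) (hD : D.Valid) : L.lineB 0 = D.arc₂.set := R.swap.lineA_zero hD.swap

theorem lineB_one (R : RepData L D) (hD : D.Valid) : L.lineB 1 = D.flip.arc₂.set := by
  rw [← R.flip.lineB_zero hD.flip, ContactMap.flip_lineB, unitInterval.symm_zero]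

theorem mem_points (R : RepData L D) (hD : D.Valid) {z : OnePoint E3} : z ∈ L.points ↔
    ∃ s ∈ Set.Icc (0 : ℝ) 1, ∃ t ∈ Set.Icc (0 : ℝ) 1, IsRep (D.P s t) z := by
  constructor
  · rintro ⟨u, v, h⟩
    exact ⟨R.f u, (R.f u).2, R.g v, (R.g v).2, (R.mem_iff hD).1 h⟩
  · rintro ⟨s, hs, t, ht, h⟩
    obtain ⟨u, hu⟩ := R.f_surj ⟨s, hs⟩
    obtain ⟨v, hv⟩ := R.g_surj ⟨t, ht⟩
    exact ⟨u, v, (R.mem_iff hD).2 (by rwa [hu, hv])⟩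

theorem range_lineA (R : RepData L D) (hD : D.Valid) : Set.range L.lineA =
    {c | ∃ t ∈ Set.Icc (0 : ℝ) 1, c = (D.harc (D.P 0 t)).set} := by
  ext c
  constructor
  · rintro ⟨v, rfl⟩
    exact ⟨R.g v, (R.g v).2, R.lineA_eq hD v⟩
  · rintro ⟨t, ht, rfl⟩
    obtain ⟨v, hv⟩ := R.g_surj ⟨t, ht⟩
    exact ⟨v, by rw [R.lineA_eq hD, hv]⟩

theorem mem_curves (R : RepData L D) (hD : D.Valid) {c : Set (OnePoint E3)} : c ∈ L.curves ↔
    (∃ t ∈ Set.Icc (0 : ℝ) 1, c = (D.harc (D.P 0 t)).set) ∨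
    (∃ s ∈ Set.Icc (0 : ℝ) 1, c = (D.swap.harc (D.P s 0)).set) := by
  rw [ContactMap.curves, Set.mem_union, R.range_lineA hD]
  refine or_congr Iff.rfl ?_
  have := R.swap.range_lineA hD.swap
  rw [show Set.range L.lineB = Set.range L.swap.lineA from rfl, this]
  simp only [PatchData.swap_P]
  rfl

theorem harc_mem_curves (R : RepData L D) (hD : D.Valid) {z : LieSpace} (hz : D.OnEdge z) : (D.harc z).set ∈ L.curves := by
  obtain ⟨t, ht, c, hc, rfl⟩ := hz
  rw [R.mem_curves hD]
  exact Or.inl ⟨t, ht, (PatchData.harc_sim hc.ne' _).set_eq.symm⟩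

/-- The contact sphere along a curvature line of the first family is orthogonal to the line. -/
theorem formS_line (R : RepData L D) (hD : D.Valid) (v : I) : lieForm (R.S v) (D.P 0 (R.g v)) = 0 ∧ lieForm (R.S v) D.W = 0 ∧
    lieForm (R.S v) D.d = 0 := by
  have key : ∀ s ∈ Set.Icc (0 : ℝ) 1, lieForm (R.S v) (D.P s (R.g v)) = 0 := by
    intro s hs
    obtain ⟨u, hu⟩ := R.f_surj ⟨s, hs⟩
    have := R.formS u v
    rwa [hu] at this
  have hq := (qd_pos hD.hν (R.g v).2.1 (R.g v).2.2).ne'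
  -- A linear form vanishing on a quadratic curve vanishes on its coefficients. The parameters 0, 1
  -- and 1/2 suffice because `qd` equals 1 at both ends and `(2 + κ) / 4` in the middle.
  have k0 := key 0 PatchData.zero_mem
  have k1 := key 1 PatchData.one_mem
  have k2 := key (1 / 2) PatchData.half_mem
  refine ⟨k0, ?_⟩
  simp only [PatchData.P, qd_zero, qd_one, lieForm_add_right, lieForm_smul_right] at k0 k1 k2
  have e1 : lieForm (R.S v) D.d = 0 := by
    apply mul_left_cancel₀ hq
    linear_combination k1 - k0
  refine ⟨?_, e1⟩
  rw [e1] at k2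
  apply mul_left_cancel₀ hq
  have hq2 : qd D.κ (1 / 2) = (2 + D.κ) / 4 := by unfold qd; ring
  rw [hq2] at k2
  linear_combination 4 * k2 - (2 + D.κ) * k0

theorem formT_line (R : RepData L D) (hD : D.Valid) (u : I) : lieForm (R.T u) (D.P (R.f u) 0) = 0 ∧ lieForm (R.T u) D.V = 0 ∧
    lieForm (R.T u) D.e = 0 := by
  have := R.swap.formS_line hD.swap u
  rwa [PatchData.swap_P] at this

/-- Both contact spheres belong to one contact element, whose remaining direction is the point; `b`
is nonzero since `T` is not a point sphere. -/
theorem T_mem (R : RepData L D) (hD : D.Valid) (u v : I) : ∃ a b : ℝ, b ≠ 0 ∧ R.T u = a • D.P (R.f u) (R.g v) + b • R.S v := by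
  have h : R.T u ∈ L u v := by
    rw [R.spanT]; exact Submodule.subset_span (by simp)
  rw [R.spanS, Submodule.mem_span_pair] at h
  obtain ⟨a, b, h⟩ := h
  refine ⟨a, b, ?_, h.symm⟩
  rintro rfl
  apply R.radT u
  rw [← h, radial_add, radial_smul, hD.rad_P, radial_smul]
  ring

/-- The contact sphere along the second boundary arc. -/
theorem formT_zero (R : RepData L D) (hD : D.Valid) {u : I} (hu : (R.f u : ℝ) = 0) : lieForm (R.T u) D.p = 0 ∧
    lieForm (R.T u) D.V = 0 ∧ lieForm (R.T u) D.e = 0 ∧ lieForm (R.T u) D.W = 0 := by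
  obtain ⟨h1, h2, h3⟩ := R.formT_line hD u
  rw [hu, PatchData.P_zero_zero] at h1
  refine ⟨h1, h2, h3, ?_⟩
  obtain ⟨a, b, -, h⟩ := R.T_mem hD u 0
  rw [h, lieForm_add_left, lieForm_smul_left, lieForm_smul_left, hu, hD.form_W_P,
    (R.formS_line hD 0).2.1]
  ring

theorem formS_zero (R : RepData L D) (hD : D.Valid) {v : I} (hv : (R.g v : ℝ) = 0) : lieForm (R.S v) D.p = 0 ∧
    lieForm (R.S v) D.W = 0 ∧ lieForm (R.S v) D.d = 0 ∧ lieForm (R.S v) D.V = 0 :=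
  R.swap.formT_zero hD.swap hv

/-- The conformal part of the contact sphere along the second boundary arc is the direction
normal to the patch. -/
theorem exists_normal (R : RepData L D) (hD : D.Valid) {u : I} (hu : (R.f u : ℝ) = 0) {n : LieSpace} (rn : n.radial = 0)
    (nn : lieForm n n ≠ 0) (pn : lieForm D.p n = 0) (Vn : lieForm D.V n = 0)
    (en : lieForm D.e n = 0) (Wn : lieForm D.W n = 0) :
    ∃ c : ℝ, c ≠ 0 ∧ ∀ w, lieForm w (R.T u) + w.radial * (R.T u).radial = c * lieForm w n := by
  obtain ⟨h1, h2, h3, h4⟩ := R.formT_zero hD hu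
  have hpd := hD.pd.ne
  have hpe := hD.pe.ne
  -- What remains of the contact sphere after removal of its radial part and its component along `n`
  -- is orthogonal to `p`, `e`, `V`, `W`, `n`, which span the conformal space.
  set y := R.T u - (R.T u).radial • radialUnit - (lieForm n (R.T u) / lieForm n n) • n with hy
  have hy0 : y = 0 := by
    refine hD.isPtVec_p.eq_zero_of_orthogonal (q := D.e) (a := D.V) (b := D.W) (c := n)
      hpe hD.rV hD.rW rn ?_ hD.pV hD.pW pn ?_ ?_ ?_ nn ?_ Vn Wn ?_ ?_ ?_ ?_
    · simp only [hy, radial_sub, radial_smul, radial_radialUnit, rn]; ring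
    · simp only [hy, lieForm_sub_right, lieForm_smul_right, lieForm_radialUnit_right, pn, hD.rp,
        lieForm_comm D.p (R.T u), h1]; ring
    · rw [hD.VV]; simpa using hpe
    · rw [hD.WW]; simpa using hpd
    · rw [lieForm_comm]; exact hD.WV
    · simp only [hy, lieForm_sub_right, lieForm_smul_right, lieForm_radialUnit_right, Vn, hD.rV,
        lieForm_comm D.V (R.T u), h2]; ring
    · simp only [hy, lieForm_sub_right, lieForm_smul_right, lieForm_radialUnit_right, Wn, hD.rW,
        lieForm_comm D.W (R.T u), h4]; ring
    · simp only [hy, lieForm_sub_right, lieForm_smul_right, lieForm_radialUnit_right, rn]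
      field_simp; ring
    · simp only [hy, lieForm_sub_right, lieForm_smul_right, lieForm_radialUnit_right, en, hD.re,
        lieForm_comm D.e (R.T u), h3]; ring
  have hT : R.T u = (R.T u).radial • radialUnit + (lieForm n (R.T u) / lieForm n n) • n := by
    rw [hy, sub_sub, sub_eq_zero] at hy0; exact hy0
  refine ⟨lieForm n (R.T u) / lieForm n n, ?_, ?_⟩
  -- Without a component along `n` the sphere would be a multiple of `radialUnit`, which is not
  -- isotropic.
  · intro hc
    have h5 := R.isoT u
    rw [hc, zero_smul, add_zero] at hT
    rw [hT] at h5
    simp only [lieForm_smul_left, lieForm_smul_right, lieForm_radialUnit,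
      radial_radialUnit] at h5
    have h6 := R.radT u
    have h7 : (R.T u).radial * (R.T u).radial = 0 := by linarith
    exact h6 (mul_self_eq_zero.1 h7)
  · intro w
    conv_lhs => rw [hT]
    simp only [lieForm_add_right, lieForm_smul_right, lieForm_radialUnit_right, radial_add,
      radial_smul, radial_radialUnit, rn]
    ring

end RepData

end Contact

end

noncomputable section

/-! ### A uniform description of all patches -/

/-- A homogeneous quadratic polynomial in two variables. -/
def quad (k₀ k₁ k₂ a b : ℝ) : ℝ := k₀ * a ^ 2 + k₁ * (a * b) + k₂ * b ^ 2

/-- Uniform description of the contact elements of a patch. -/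
structure PreForm (L : ContactMap) where
  α : Arc
  β : Arc
  k₀ : ℝ
  k₁ : ℝ
  k₂ : ℝ
  l₀ : ℝ
  l₁ : ℝ
  l₂ : ℝ
  A : I → ℝ
  B : I → ℝ
  C : I → ℝ
  E : I → ℝ
  S : I → LieSpace
  T : I → LieSpace
  contA : Continuous A
  contB : Continuous B
  contC : Continuous C
  contE : Continuous E
  nonnegA : ∀ u, 0 ≤ A u
  nonnegB : ∀ u, 0 ≤ B u
  nonnegC : ∀ u, 0 ≤ C u
  nonnegE : ∀ u, 0 ≤ E u
  posAB : ∀ u, 0 < A u + B u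
  posCE : ∀ u, 0 < C u + E u
  A_zero : A 0 = 1
  B_zero : B 0 = 0
  A_one : A 1 = 0
  B_one : B 1 = 1
  C_zero : C 0 = 1
  E_zero : E 0 = 0
  C_one : C 1 = 0
  E_one : E 1 = 1
  rad : ∀ a b c d : ℝ,
    (quad l₀ l₁ l₂ c d • α.hvec a b + quad k₀ k₁ k₂ a b • β.hvec c d).radial = 0
  iso : ∀ a b c d : ℝ,
    lieForm (quad l₀ l₁ l₂ c d • α.hvec a b + quad k₀ k₁ k₂ a b • β.hvec c d)
      (quad l₀ l₁ l₂ c d • α.hvec a b + quad k₀ k₁ k₂ a b • β.hvec c d) = 0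
  mem : ∀ u v z, (quad k₀ k₁ k₂ (A u) (B u) ≠ 0 ∨ quad l₀ l₁ l₂ (C v) (E v) ≠ 0) →
    (liePoint z ∈ L u v ↔ IsRep (quad l₀ l₁ l₂ (C v) (E v) • α.hvec (A u) (B u) +
      quad k₀ k₁ k₂ (A u) (B u) • β.hvec (C v) (E v)) z)
  ne : ∀ u v, (quad k₀ k₁ k₂ (A u) (B u) ≠ 0 ∨ quad l₀ l₁ l₂ (C v) (E v) ≠ 0) →
    quad l₀ l₁ l₂ (C v) (E v) • α.hvec (A u) (B u) +
      quad k₀ k₁ k₂ (A u) (B u) • β.hvec (C v) (E v) ≠ 0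
  uniq : ∀ u v y z, liePoint y ∈ L u v → liePoint z ∈ L u v → y = z
  spanS : ∀ u v, quad k₀ k₁ k₂ (A u) (B u) ≠ 0 → quad l₀ l₁ l₂ (C v) (E v) ≠ 0 →
    L u v = Submodule.span ℝ {quad l₀ l₁ l₂ (C v) (E v) • α.hvec (A u) (B u) +
      quad k₀ k₁ k₂ (A u) (B u) • β.hvec (C v) (E v), S v}
  spanT : ∀ u v, quad k₀ k₁ k₂ (A u) (B u) ≠ 0 → quad l₀ l₁ l₂ (C v) (E v) ≠ 0 →
    L u v = Submodule.span ℝ {quad l₀ l₁ l₂ (C v) (E v) • α.hvec (A u) (B u) +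
      quad k₀ k₁ k₂ (A u) (B u) • β.hvec (C v) (E v), T u}
  sphereS : ∀ v, quad l₀ l₁ l₂ (C v) (E v) ≠ 0 → (S v).radial ≠ 0 ∧
    ∀ u, S v ∈ L u v ∧ ∀ x ∈ L u v, lieForm (S v) x = 0
  sphereT : ∀ u, quad k₀ k₁ k₂ (A u) (B u) ≠ 0 → (T u).radial ≠ 0 ∧
    ∀ v, T u ∈ L u v ∧ ∀ x ∈ L u v, lieForm (T u) x = 0
  singS : ∀ v, quad l₀ l₁ l₂ (C v) (E v) = 0 → ∃ z, ∀ u, liePoint z ∈ L u v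
  singT : ∀ u, quad k₀ k₁ k₂ (A u) (B u) = 0 → ∃ z, ∀ v, liePoint z ∈ L u v

theorem Arc.rev_hvec (α : Arc) (a b : ℝ) : α.rev.hvec a b = α.hvec b a := by
  simp only [Arc.hvec, Arc.rev]; module

theorem quad_rev (k₀ k₁ k₂ a b : ℝ) : quad k₂ k₁ k₀ a b = quad k₀ k₁ k₂ b a := by
  unfold quad; ring

namespace PreForm

variable {L : ContactMap}

def swap (F : PreForm L) : PreForm L.swap where
  α := F.β
  β := F.α
  k₀ := F.l₀
  k₁ := F.l₁
  k₂ := F.l₂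
  l₀ := F.k₀
  l₁ := F.k₁
  l₂ := F.k₂
  A := F.C
  B := F.E
  C := F.A
  E := F.B
  S := F.T
  T := F.S
  contA := F.contC
  contB := F.contE
  contC := F.contA
  contE := F.contB
  nonnegA := F.nonnegC
  nonnegB := F.nonnegE
  nonnegC := F.nonnegA
  nonnegE := F.nonnegB
  posAB := F.posCE
  posCE := F.posAB
  A_zero := F.C_zero
  B_zero := F.E_zero
  A_one := F.C_one
  B_one := F.E_one
  C_zero := F.A_zero
  E_zero := F.B_zero
  C_one := F.A_one
  E_one := F.B_one
  rad a b c d := by rw [add_comm]; exact F.rad c d a b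
  iso a b c d := by rw [add_comm]; exact F.iso c d a b
  mem u v z h := by rw [add_comm]; exact F.mem v u z h.symm
  ne u v h := by rw [add_comm]; exact F.ne v u h.symm
  uniq u v := F.uniq v u
  spanS u v h h' := by rw [add_comm]; exact F.spanT v u h' h
  spanT u v h h' := by rw [add_comm]; exact F.spanS v u h' h
  sphereS := F.sphereT
  sphereT := F.sphereS
  singS := F.singT
  singT := F.singS

def flip (F : PreForm L) : PreForm L.flip where
  α := F.α.rev
  β := F.β
  k₀ := F.k₂
  k₁ := F.k₁
  k₂ := F.k₀
  l₀ := F.l₀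
  l₁ := F.l₁
  l₂ := F.l₂
  A u := F.B (unitInterval.symm u)
  B u := F.A (unitInterval.symm u)
  C := F.C
  E := F.E
  S := F.S
  T u := F.T (unitInterval.symm u)
  contA := F.contB.comp unitInterval.continuous_symm
  contB := F.contA.comp unitInterval.continuous_symm
  contC := F.contC
  contE := F.contE
  nonnegA _ := F.nonnegB _
  nonnegB _ := F.nonnegA _
  nonnegC := F.nonnegC
  nonnegE := F.nonnegE
  posAB u := by rw [add_comm]; exact F.posAB _
  posCE := F.posCE
  A_zero := by rw [unitInterval.symm_zero, F.B_one]
  B_zero := by rw [unitInterval.symm_zero, F.A_one]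
  A_one := by rw [unitInterval.symm_one, F.B_zero]
  B_one := by rw [unitInterval.symm_one, F.A_zero]
  C_zero := F.C_zero
  E_zero := F.E_zero
  C_one := F.C_one
  E_one := F.E_one
  rad a b c d := by rw [Arc.rev_hvec, quad_rev F.k₀]; exact F.rad b a c d
  iso a b c d := by rw [Arc.rev_hvec, quad_rev F.k₀]; exact F.iso b a c d
  mem u v z h := by
    rw [quad_rev F.k₀] at h; rw [Arc.rev_hvec, quad_rev F.k₀]; exact F.mem _ v z h
  ne u v h := by
    rw [quad_rev F.k₀] at h; rw [Arc.rev_hvec, quad_rev F.k₀]; exact F.ne _ v h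
  uniq u v := F.uniq _ v
  spanS u v h h' := by
    rw [quad_rev F.k₀] at h; rw [Arc.rev_hvec, quad_rev F.k₀]; exact F.spanS _ v h h'
  spanT u v h h' := by
    rw [quad_rev F.k₀] at h; rw [Arc.rev_hvec, quad_rev F.k₀]; exact F.spanT _ v h h'
  sphereS v h := ⟨(F.sphereS v h).1, fun _ => (F.sphereS v h).2 _⟩
  sphereT u h := by rw [quad_rev F.k₀] at h; exact F.sphereT _ h
  singS v h := by
    obtain ⟨z, hz⟩ := F.singS v h
    exact ⟨z, fun _ => hz _⟩
  singT u h := by rw [quad_rev F.k₀] at h; exact F.singT _ h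

end PreForm

/-! ### Generic patches -/

theorem IsCyclidicPlane.eq_zero {P : Submodule ℝ LieSpace} (hP : IsCyclidicPlane P) {v : LieSpace}
    (hv : v ∈ P) (h : ∀ w ∈ P, lieForm v w = 0) : v = 0 := by
  obtain ⟨a, b, c, aa, bb, cc, ab, ac, bc, rfl⟩ := hP
  obtain ⟨x, y, z, rfl⟩ := Submodule.mem_span_triple.1 hv
  have h1 := h a (Submodule.subset_span (by simp))
  have h2 := h b (Submodule.subset_span (by simp))
  have h3 := h c (Submodule.subset_span (by simp))
  simp only [lieForm_add_left, lieForm_smul_left, aa, bb, cc, ab, ac, bc, lieForm_comm b a,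
    lieForm_comm c a, lieForm_comm c b] at h1 h2 h3
  have hx : x = 0 := by linarith
  have hy : y = 0 := by linarith
  have hz : z = 0 := by linarith
  simp [hx, hy, hz]

/-- Signature (++-) admits no isotropic plane: scaling the negative coordinate of `w` to that of `v`
leaves a difference whose square is a sum of two squares and equals zero. -/
theorem IsCyclidicPlane.eq_smul {P : Submodule ℝ LieSpace} (hP : IsCyclidicPlane P)
    {v w : LieSpace} (hv : v ∈ P) (hw : w ∈ P) (vv : lieForm v v = 0) (ww : lieForm w w = 0)
    (vw : lieForm v w = 0) (hv0 : v ≠ 0) : ∃ c : ℝ, w = c • v := by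
  obtain ⟨a, b, c, aa, bb, cc, ab, ac, bc, rfl⟩ := hP
  obtain ⟨x, y, z, rfl⟩ := Submodule.mem_span_triple.1 hv
  obtain ⟨x', y', z', rfl⟩ := Submodule.mem_span_triple.1 hw
  simp only [lieForm_add_left, lieForm_smul_left, lieForm_add_right, lieForm_smul_right,
    aa, bb, cc, ab, ac, bc, lieForm_comm b a, lieForm_comm c a, lieForm_comm c b] at vv ww vw
  have hz : z ≠ 0 := by
    rintro rfl
    have hx : x = 0 := by nlinarith [sq_nonneg x, sq_nonneg y]
    have hy : y = 0 := by nlinarith [sq_nonneg x, sq_nonneg y]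
    exact hv0 (by simp [hx, hy])
  refine ⟨z' / z, ?_⟩
  have e : (x' - z' / z * x) ^ 2 + (y' - z' / z * y) ^ 2 = 0 := by
    field_simp
    linear_combination z ^ 2 * ww - 2 * z * z' * vw + z' ^ 2 * vv
  have e1 : x' - z' / z * x = 0 := by nlinarith [sq_nonneg (x' - z' / z * x), sq_nonneg (y' - z' / z * y)]
  have e2 : y' - z' / z * y = 0 := by nlinarith [sq_nonneg (x' - z' / z * x), sq_nonneg (y' - z' / z * y)]
  have e3 : z' = z' / z * z := by field_simp
  rw [smul_add, smul_add, smul_smul, smul_smul, smul_smul, ← e3, ← sub_eq_zero.1 e1,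
    ← sub_eq_zero.1 e2]

/-- The data of the conic through three isotropic vectors. -/
def conicArc (s : Fin 3 → LieSpace) : Arc where
  p := lieForm (s 1) (s 2) • s 0
  w := lieForm (s 0) (s 2) • s 1 - lieForm (s 1) (s 2) • s 0 - lieForm (s 0) (s 1) • s 2
  q := lieForm (s 0) (s 1) • s 2

theorem conicParam_eq (s : Fin 3 → LieSpace) (t : ℝ) :
    conicParam s t = (conicArc s).hvec (1 - t) t := by
  simp only [conicParam, conicArc, Arc.hvec]; module

theorem conicArc_iso {s : Fin 3 → LieSpace} (h : ∀ m, lieForm (s m) (s m) = 0) (a b : ℝ) :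
    lieForm ((conicArc s).hvec a b) ((conicArc s).hvec a b) = 0 := by
  simp only [conicArc, Arc.hvec, lieForm_add_left, lieForm_add_right, lieForm_smul_left,
    lieForm_smul_right, lieForm_sub_left, lieForm_sub_right, h, lieForm_comm (s 1) (s 0),
    lieForm_comm (s 2) (s 0), lieForm_comm (s 2) (s 1)]
  ring

theorem conicArc_mem {s : Fin 3 → LieSpace} {P : Submodule ℝ LieSpace} (h : ∀ m, s m ∈ P)
    (a b : ℝ) : (conicArc s).hvec a b ∈ P := by
  simp only [conicArc, Arc.hvec]
  exact P.add_mem (P.add_mem (P.smul_mem _ (P.smul_mem _ (h 0))) (P.smul_mem _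
    (P.sub_mem (P.sub_mem (P.smul_mem _ (h 1)) (P.smul_mem _ (h 0))) (P.smul_mem _ (h 2)))))
    (P.smul_mem _ (P.smul_mem _ (h 2)))

theorem form_ne_zero_of_independent {s : Fin 3 → LieSpace} {P : Submodule ℝ LieSpace}
    (hP : IsCyclidicPlane P) (hs : ∀ m, s m ∈ P) (hi : ∀ m, lieForm (s m) (s m) = 0)
    (hl : LinearIndependent ℝ s) {m n : Fin 3} (hmn : m ≠ n) : lieForm (s m) (s n) ≠ 0 := by
  intro h
  obtain ⟨c, hc⟩ := hP.eq_smul (hs m) (hs n) (hi m) (hi n) h (hl.ne_zero m)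
  refine hl.notMem_span_image (s := {m}) (x := n) (by simpa using hmn.symm) ?_
  rw [Set.image_singleton, hc]
  exact Submodule.smul_mem _ _ (Submodule.mem_span_singleton_self _)

theorem conicParam_ne_zero {s : Fin 3 → LieSpace} {P : Submodule ℝ LieSpace}
    (hP : IsCyclidicPlane P) (hs : ∀ m, s m ∈ P) (hi : ∀ m, lieForm (s m) (s m) = 0)
    (hl : LinearIndependent ℝ s) (t : ℝ) : conicParam s t ≠ 0 := by
  intro h
  have h01 := form_ne_zero_of_independent hP hs hi hl (m := 0) (n := 1) (by decide)
  have h02 := form_ne_zero_of_independent hP hs hi hl (m := 0) (n := 2) (by decide)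
  have h12 := form_ne_zero_of_independent hP hs hi hl (m := 1) (n := 2) (by decide)
  have key := Fintype.linearIndependent_iff.1 hl ![lieForm (s 1) (s 2) * (2 * t ^ 2 - 3 * t + 1),
    lieForm (s 0) (s 2) * (t - t ^ 2), lieForm (s 0) (s 1) * (2 * t ^ 2 - t)] (by
      rw [Fin.sum_univ_three]; exact h)
  have k0 := key 0
  have k1 := key 1
  have k2 := key 2
  simp only [Matrix.cons_val, mul_eq_zero, h01, h02, h12, false_or] at k0 k1 k2
  -- The three coefficients are (2t − 1)(t − 1), t(1 − t) and t(2t − 1), which have no common zero.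
  nlinarith

theorem span_pair_comb {x y : LieSpace} {a b : ℝ} (ha : a ≠ 0) :
    Submodule.span ℝ {a • x + b • y, y} = Submodule.span ℝ {x, y} := by
  ext v
  simp only [Submodule.mem_span_pair]
  constructor
  · rintro ⟨r, s, rfl⟩
    exact ⟨r * a, r * b + s, by module⟩
  · rintro ⟨r, s, rfl⟩
    refine ⟨r / a, s - r / a * b, ?_⟩
    rw [smul_add, smul_smul, div_mul_cancel₀ _ ha]; module

theorem rad_hvec (α : Arc) (a b : ℝ) :
    (α.hvec a b).radial = quad α.p.radial α.w.radial α.q.radial a b := by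
  simp only [Arc.hvec, radial_add, radial_smul, quad]; ring

/-- The point of a contact element spanned by two spheres is the combination in which the radial
coordinates cancel: each sphere is weighted by the radius of the other, with opposite signs. So the
forms `k`, `l` are the radial coordinates along the two conics, `β` carries the minus sign, and a
zero of `k` or `l` is a point sphere of a family, hence a singular point. -/
theorem exists_preForm_generic {L : ContactMap} (h : IsGenericPatch L) : Nonempty (PreForm L) := by
  obtain ⟨𝒞, s, hs, hli, hL⟩ := h
  set a₁ := conicArc (s 0) with ha₁
  set a₂ := conicArc (s 1) with ha₂
  have hc1 : ∀ u : ℝ, conicParam (s 0) u = a₁.hvec (1 - u) u := conicParam_eq _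
  have hc2 : ∀ u : ℝ, conicParam (s 1) u = a₂.hvec (1 - u) u := conicParam_eq _
  have m1 : ∀ a b : ℝ, a₁.hvec a b ∈ 𝒞.plane 0 := conicArc_mem fun m => (hs 0 m).1
  have m2 : ∀ a b : ℝ, a₂.hvec a b ∈ 𝒞.plane 1 := conicArc_mem fun m => (hs 1 m).1
  have i1 : ∀ a b : ℝ, lieForm (a₁.hvec a b) (a₁.hvec a b) = 0 :=
    conicArc_iso fun m => (hs 0 m).2
  have i2 : ∀ a b : ℝ, lieForm (a₂.hvec a b) (a₂.hvec a b) = 0 :=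
    conicArc_iso fun m => (hs 1 m).2
  have i12 : ∀ a b c d : ℝ, lieForm (a₁.hvec a b) (a₂.hvec c d) = 0 := fun a b c d =>
    (𝒞.polar _).1 (m2 c d) _ (m1 a b)
  have i21 : ∀ a b c d : ℝ, lieForm (a₂.hvec c d) (a₁.hvec a b) = 0 := fun a b c d => by
    rw [lieForm_comm]; exact i12 a b c d
  have n1 : ∀ u : ℝ, a₁.hvec (1 - u) u ≠ 0 := fun u => by
    rw [← hc1]
    exact conicParam_ne_zero (𝒞.signature 0) (fun m => (hs 0 m).1) (fun m => (hs 0 m).2) (hli 0) u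
  have n2 : ∀ u : ℝ, a₂.hvec (1 - u) u ≠ 0 := fun u => by
    rw [← hc2]
    exact conicParam_ne_zero (𝒞.signature 1) (fun m => (hs 1 m).1) (fun m => (hs 1 m).2) (hli 1) u
  -- Two orthogonal point spheres are proportional, so they would lie in both polar planes, and the
  -- form is nondegenerate on each.
  have hrr : ∀ u v : ℝ, (a₁.hvec (1 - u) u).radial ≠ 0 ∨ (a₂.hvec (1 - v) v).radial ≠ 0 := by
    intro u v
    by_contra! hcon
    obtain ⟨c, -, hc⟩ := (IsPtVec.mk (n1 u) hcon.1 (i1 _ _)).eq_smul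
      (IsPtVec.mk (n2 v) hcon.2 (i2 _ _)) (i12 _ _ _ _)
    apply n2 v
    refine (𝒞.signature 0).eq_zero ?_ (fun w hw => ?_)
    · rw [hc]; exact (𝒞.plane 0).smul_mem _ (m1 _ _)
    · rw [lieForm_comm]; exact (𝒞.polar _).1 (m2 _ _) w hw
  have hnb : ∀ a b : ℝ, (⟨-a₂.p, -a₂.w, -a₂.q⟩ : Arc).hvec a b = -a₂.hvec a b := fun a b => by
    simp only [Arc.hvec]; module
  have hmem : ∀ (u v : I) z, liePoint z ∈ L u v ↔
      IsRep ((a₂.hvec (1 - v) v).radial • a₁.hvec (1 - u) u +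
        (a₁.hvec (1 - u) u).radial • -a₂.hvec (1 - v) v) z := by
    intro u v z
    rw [hL, hc1, hc2, Submodule.mem_span_pair]
    constructor
    · rintro ⟨a, b, hab⟩
      have hr := congrArg LieSpace.radial hab
      rw [(isPtVec_liePoint z).rad, radial_add, radial_smul, radial_smul] at hr
      rcases hrr u v with h0 | h0
      · refine ⟨-b / (a₁.hvec (1 - (u : ℝ)) u).radial, ?_⟩
        rw [← hab]
        have : a = -b / (a₁.hvec (1 - (u : ℝ)) u).radial * (a₂.hvec (1 - (v : ℝ)) v).radial := by
          field_simp; linarith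
        conv_lhs => rw [this]
        rw [smul_add, smul_smul, smul_smul, div_mul_cancel₀ _ h0]; module
      · refine ⟨a / (a₂.hvec (1 - (v : ℝ)) v).radial, ?_⟩
        rw [← hab]
        have : b = -(a / (a₂.hvec (1 - (v : ℝ)) v).radial * (a₁.hvec (1 - (u : ℝ)) u).radial) := by
          field_simp; linarith
        conv_lhs => rw [this]
        rw [smul_add, smul_smul, smul_smul, div_mul_cancel₀ _ h0]; module
    · rintro ⟨c, hc⟩
      exact ⟨c * (a₂.hvec (1 - (v : ℝ)) v).radial, -(c * (a₁.hvec (1 - (u : ℝ)) u).radial), by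
        rw [hc]; module⟩
  refine ⟨{
    α := a₁
    β := ⟨-a₂.p, -a₂.w, -a₂.q⟩
    k₀ := a₁.p.radial
    k₁ := a₁.w.radial
    k₂ := a₁.q.radial
    l₀ := a₂.p.radial
    l₁ := a₂.w.radial
    l₂ := a₂.q.radial
    A := fun u => 1 - u
    B := fun u => u
    C := fun u => 1 - u
    E := fun u => u
    S := fun v => a₂.hvec (1 - v) v
    T := fun u => a₁.hvec (1 - u) u
    contA := by fun_prop
    contB := by fun_prop
    contC := by fun_prop
    contE := by fun_prop
    nonnegA := fun u => unitInterval.one_minus_nonneg u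
    nonnegB := fun u => unitInterval.nonneg u
    nonnegC := fun u => unitInterval.one_minus_nonneg u
    nonnegE := fun u => unitInterval.nonneg u
    posAB := fun u => by simp
    posCE := fun u => by simp
    A_zero := by simp
    B_zero := by simp
    A_one := by simp
    B_one := by simp
    C_zero := by simp
    E_zero := by simp
    C_one := by simp
    E_one := by simp
    rad := ?_, iso := ?_, mem := ?_, ne := ?_, uniq := ?_, spanS := ?_, spanT := ?_
    sphereS := ?_, sphereT := ?_, singS := ?_, singT := ?_ }⟩
  · intro a b c d
    rw [hnb, ← rad_hvec, ← rad_hvec, radial_add, radial_smul, radial_smul, radial_neg]; ring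
  · intro a b c d
    rw [hnb]
    simp only [lieForm_add_left, lieForm_add_right, lieForm_smul_left, lieForm_smul_right,
      lieForm_neg_left, lieForm_neg_right, i1, i2, i12, i21]
    ring
  · intro u v z _
    rw [hnb, ← rad_hvec, ← rad_hvec]
    exact hmem u v z
  · intro u v h h0
    rw [hnb, ← rad_hvec, ← rad_hvec, smul_neg, ← sub_eq_add_neg, sub_eq_zero] at h0
    rw [← rad_hvec, ← rad_hvec] at h
    rcases h with h | h
    · apply n2 v
      refine (𝒞.signature 0).eq_zero ?_ (fun w hw => ?_)
      · rw [← (𝒞.plane 0).smul_mem_iff h, ← h0]; exact (𝒞.plane 0).smul_mem _ (m1 _ _)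
      · rw [lieForm_comm]; exact (𝒞.polar _).1 (m2 _ _) w hw
    · apply n1 u
      refine (𝒞.signature 0).eq_zero (m1 _ _) (fun w hw => ?_)
      rw [lieForm_comm]
      refine (𝒞.polar _).1 ?_ w hw
      rw [← (𝒞.plane 1).smul_mem_iff h, h0]; exact (𝒞.plane 1).smul_mem _ (m2 _ _)
  · intro u v y z hy hz
    exact ((hmem u v y).1 hy).unique ((hmem u v z).1 hz)
  · intro u v h1 h2
    rw [hnb, ← rad_hvec, ← rad_hvec, hL, hc1, hc2, smul_neg, ← neg_smul]
    rw [← rad_hvec] at h2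
    rw [span_pair_comb h2]
  · intro u v h1 h2
    rw [hnb, ← rad_hvec, ← rad_hvec, hL, hc1, hc2, smul_neg, ← neg_smul]
    rw [← rad_hvec] at h1
    rw [add_comm, span_pair_comb (neg_ne_zero.2 h1), Set.pair_comm]
  · intro v h
    rw [← rad_hvec] at h
    refine ⟨h, fun u => ?_⟩
    rw [hL, hc1, hc2]
    refine ⟨Submodule.subset_span (by simp), fun x hx => ?_⟩
    obtain ⟨r, t, rfl⟩ := Submodule.mem_span_pair.1 hx
    rw [lieForm_add_right, lieForm_smul_right, lieForm_smul_right, i21, i2]; ring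
  · intro u h
    rw [← rad_hvec] at h
    refine ⟨h, fun v => ?_⟩
    rw [hL, hc1, hc2]
    refine ⟨Submodule.subset_span (by simp), fun x hx => ?_⟩
    obtain ⟨r, t, rfl⟩ := Submodule.mem_span_pair.1 hx
    rw [lieForm_add_right, lieForm_smul_right, lieForm_smul_right, i12, i1]; ring
  · intro v h
    rw [← rad_hvec] at h
    obtain ⟨z, c, hz⟩ := (IsPtVec.mk (n2 v) h (i2 _ _)).exists_repr
    refine ⟨z, fun u => ?_⟩
    rw [hL, hc2, hz]
    exact Submodule.smul_mem _ _ (Submodule.subset_span (by simp))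
  · intro u h
    rw [← rad_hvec] at h
    obtain ⟨z, c, hz⟩ := (IsPtVec.mk (n1 u) h (i1 _ _)).exists_repr
    refine ⟨z, fun v => ?_⟩
    rw [hL, hc1, hz]
    exact Submodule.smul_mem _ _ (Submodule.subset_span (by simp))

end

noncomputable section

/-! ### Spherical patches -/

/-- Coefficients in the linear interpolation of angles. -/
def sinRatio (δ u : ℝ) : ℝ := Real.sin (u * δ) / Real.sin δ

section SinRatio

variable {δ : ℝ}

theorem sinRatio_nonneg (h0 : 0 < δ) (hπ : δ < Real.pi) {u : ℝ} (hu : 0 ≤ u) (hu' : u ≤ 1) :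
    0 ≤ sinRatio δ u :=
  div_nonneg (Real.sin_nonneg_of_nonneg_of_le_pi (by positivity)
    (by nlinarith)) (Real.sin_pos_of_pos_of_lt_pi h0 hπ).le

theorem sinRatio_pos (h0 : 0 < δ) (hπ : δ < Real.pi) {u : ℝ} (hu : 0 < u) (hu' : u ≤ 1) :
    0 < sinRatio δ u :=
  div_pos (Real.sin_pos_of_pos_of_lt_pi (by positivity) (by nlinarith))
    (Real.sin_pos_of_pos_of_lt_pi h0 hπ)

theorem sinRatio_zero : sinRatio δ 0 = 0 := by simp [sinRatio]

theorem sinRatio_one (h0 : 0 < δ) (hπ : δ < Real.pi) : sinRatio δ 1 = 1 := by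
  rw [sinRatio, one_mul, div_self (Real.sin_pos_of_pos_of_lt_pi h0 hπ).ne']

/-- Interpolating cosine and sine of an angle with the weights `sinRatio` is linear, which turns
trigonometric parametrizations into the homogeneous ones of `Arc`; all weights are nonnegative as
long as δ < π. -/
theorem sinRatio_cos (h0 : 0 < δ) (hπ : δ < Real.pi) (a u : ℝ) :
    sinRatio δ (1 - u) * Real.cos a + sinRatio δ u * Real.cos (a + δ) = Real.cos (a + u * δ) := by
  have h := (Real.sin_pos_of_pos_of_lt_pi h0 hπ).ne'
  rw [sinRatio, sinRatio, sub_mul, one_mul, Real.sin_sub, Real.cos_add, Real.cos_add]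
  field_simp
  ring

theorem sinRatio_sin (h0 : 0 < δ) (hπ : δ < Real.pi) (a u : ℝ) :
    sinRatio δ (1 - u) * Real.sin a + sinRatio δ u * Real.sin (a + δ) = Real.sin (a + u * δ) := by
  have h := (Real.sin_pos_of_pos_of_lt_pi h0 hπ).ne'
  rw [sinRatio, sinRatio, sub_mul, one_mul, Real.sin_sub, Real.sin_add, Real.sin_add]
  field_simp
  ring

end SinRatio

/-- Vector-valued quadratic forms in sine and cosine, between two angles. -/
def trigArc (x y z : LieSpace) (a b : ℝ) : Arc where
  p := (Real.cos a ^ 2) • x + (Real.cos a * Real.sin a) • y + (Real.sin a ^ 2) • z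
  w := (2 * (Real.cos a * Real.cos b)) • x +
    (Real.cos a * Real.sin b + Real.sin a * Real.cos b) • y + (2 * (Real.sin a * Real.sin b)) • z
  q := (Real.cos b ^ 2) • x + (Real.cos b * Real.sin b) • y + (Real.sin b ^ 2) • z

theorem trigArc_hvec (x y z : LieSpace) (a b A B : ℝ) : (trigArc x y z a b).hvec A B =
    ((A * Real.cos a + B * Real.cos b) ^ 2) • x +
    ((A * Real.cos a + B * Real.cos b) * (A * Real.sin a + B * Real.sin b)) • y +
    ((A * Real.sin a + B * Real.sin b) ^ 2) • z := by
  simp only [trigArc, Arc.hvec]; module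

/-- On a sphere all contact elements share `ω`, so both families of contact spheres are constant and
only the points need a description by quadratic forms. The scalar in `hvec` allows these to
represent the points up to a factor. -/
theorem exists_preForm_of_sphere {L : ContactMap} {ω : LieSpace} {Pt : I → I → LieSpace}
    (hω : ω.radial ≠ 0) (ωω : lieForm ω ω = 0)
    (hL : ∀ u v, L u v = Submodule.span ℝ {ω, Pt u v})
    (hPt : ∀ u v, (Pt u v).radial = 0 ∧ lieForm ω (Pt u v) = 0) (hne : ∀ u v, Pt u v ≠ 0)
    (α β : Arc) (k₀ k₁ k₂ l₀ l₁ l₂ : ℝ) {a b : ℝ}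
    (ha0 : 0 < a) (haπ : a < Real.pi) (hb0 : 0 < b) (hbπ : b < Real.pi)
    (rad : ∀ a b c d : ℝ,
      (quad l₀ l₁ l₂ c d • α.hvec a b + quad k₀ k₁ k₂ a b • β.hvec c d).radial = 0)
    (iso : ∀ a b c d : ℝ,
      lieForm (quad l₀ l₁ l₂ c d • α.hvec a b + quad k₀ k₁ k₂ a b • β.hvec c d)
        (quad l₀ l₁ l₂ c d • α.hvec a b + quad k₀ k₁ k₂ a b • β.hvec c d) = 0)
    (hvec : ∀ u v : I, (quad k₀ k₁ k₂ (sinRatio a (1 - u)) (sinRatio a u) ≠ 0 ∨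
      quad l₀ l₁ l₂ (sinRatio b (1 - v)) (sinRatio b v) ≠ 0) → ∃ c : ℝ, c ≠ 0 ∧
      quad l₀ l₁ l₂ (sinRatio b (1 - v)) (sinRatio b v) •
        α.hvec (sinRatio a (1 - u)) (sinRatio a u) +
      quad k₀ k₁ k₂ (sinRatio a (1 - u)) (sinRatio a u) •
        β.hvec (sinRatio b (1 - v)) (sinRatio b v) = c • Pt u v)
    (hS : ∀ v : I, quad l₀ l₁ l₂ (sinRatio b (1 - v)) (sinRatio b v) = 0 →
      ∃ w, IsPtVec w ∧ ∀ u, Pt u v = w)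
    (hT : ∀ u : I, quad k₀ k₁ k₂ (sinRatio a (1 - u)) (sinRatio a u) = 0 →
      ∃ w, IsPtVec w ∧ ∀ v, Pt u v = w) : Nonempty (PreForm L) := by
  have hmem : ∀ u v z, liePoint z ∈ L u v ↔ IsRep (Pt u v) z := by
    intro u v z
    rw [hL, Submodule.mem_span_pair]
    constructor
    · rintro ⟨r, s, h⟩
      have hr := congrArg LieSpace.radial h
      rw [radial_add, radial_smul, radial_smul, (hPt u v).1, (isPtVec_liePoint z).rad] at hr
      have : r = 0 := by simpa [hω] using hr
      subst this
      exact ⟨s, by rw [← h]; simp⟩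
    · rintro ⟨c, h⟩
      exact ⟨0, c, by rw [h]; simp⟩
  have hsub : ∀ u v, ω ∈ L u v ∧ ∀ x ∈ L u v, lieForm ω x = 0 := by
    intro u v
    rw [hL]
    refine ⟨Submodule.subset_span (by simp), fun x hx => ?_⟩
    obtain ⟨r, s, rfl⟩ := Submodule.mem_span_pair.1 hx
    rw [lieForm_add_right, lieForm_smul_right, lieForm_smul_right, ωω, (hPt u v).2]; ring
  have hspan : ∀ u v (c : ℝ), c ≠ 0 → L u v = Submodule.span ℝ {c • Pt u v, ω} := by
    intro u v c hc
    rw [hL, Set.pair_comm]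
    have := span_pair_comb (x := Pt u v) (y := ω) (b := 0) hc
    rw [← this, zero_smul, add_zero]
  have hc1 : ∀ c : ℝ, Continuous fun u : I => sinRatio c u := fun c => by
    unfold sinRatio; fun_prop
  have hc2 : ∀ c : ℝ, Continuous fun u : I => sinRatio c (1 - u) := fun c => by
    unfold sinRatio; fun_prop
  have hpos : ∀ {c : ℝ}, 0 < c → c < Real.pi → ∀ u : I, 0 < sinRatio c (1 - u) + sinRatio c u := by
    intro c h0 h1 u
    rcases (unitInterval.nonneg u).eq_or_lt with h | h
    · rw [← h, sub_zero, sinRatio_one h0 h1, sinRatio_zero]; norm_num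
    · exact add_pos_of_nonneg_of_pos (sinRatio_nonneg h0 h1 (unitInterval.one_minus_nonneg u)
        (unitInterval.one_minus_le_one u)) (sinRatio_pos h0 h1 h (unitInterval.le_one u))
  exact ⟨{
    α := α, β := β, k₀ := k₀, k₁ := k₁, k₂ := k₂, l₀ := l₀, l₁ := l₁, l₂ := l₂
    A := fun u => sinRatio a (1 - u)
    B := fun u => sinRatio a u
    C := fun u => sinRatio b (1 - u)
    E := fun u => sinRatio b u
    S := fun _ => ω
    T := fun _ => ω
    contA := hc2 a
    contB := hc1 a
    contC := hc2 b
    contE := hc1 b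
    nonnegA := fun u => sinRatio_nonneg ha0 haπ (unitInterval.one_minus_nonneg u)
      (unitInterval.one_minus_le_one u)
    nonnegB := fun u => sinRatio_nonneg ha0 haπ (unitInterval.nonneg u) (unitInterval.le_one u)
    nonnegC := fun u => sinRatio_nonneg hb0 hbπ (unitInterval.one_minus_nonneg u)
      (unitInterval.one_minus_le_one u)
    nonnegE := fun u => sinRatio_nonneg hb0 hbπ (unitInterval.nonneg u) (unitInterval.le_one u)
    posAB := hpos ha0 haπ
    posCE := hpos hb0 hbπ
    A_zero := by simp [sinRatio_one ha0 haπ]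
    B_zero := by simp [sinRatio_zero]
    A_one := by simp [sinRatio_zero]
    B_one := by simp [sinRatio_one ha0 haπ]
    C_zero := by simp [sinRatio_one hb0 hbπ]
    E_zero := by simp [sinRatio_zero]
    C_one := by simp [sinRatio_zero]
    E_one := by simp [sinRatio_one hb0 hbπ]
    rad := rad
    iso := iso
    mem := by
      intro u v z h
      obtain ⟨c, hc, e⟩ := hvec u v h
      rw [e, repr_smul_iff hc]; exact hmem u v z
    ne := by
      intro u v h
      obtain ⟨c, hc, e⟩ := hvec u v h
      rw [e]; exact smul_ne_zero hc (hne u v)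
    uniq := fun u v y z hy hz => ((hmem u v y).1 hy).unique ((hmem u v z).1 hz)
    spanS := by
      intro u v h _
      obtain ⟨c, hc, e⟩ := hvec u v (Or.inl h)
      rw [e]; exact hspan u v c hc
    spanT := by
      intro u v h _
      obtain ⟨c, hc, e⟩ := hvec u v (Or.inl h)
      rw [e]; exact hspan u v c hc
    sphereS := fun v _ => ⟨hω, fun u => hsub u v⟩
    sphereT := fun u _ => ⟨hω, fun v => hsub u v⟩
    singS := by
      intro v h
      obtain ⟨w, hw, e⟩ := hS v h
      obtain ⟨z, hz⟩ := hw.exists_repr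
      exact ⟨z, fun u => (hmem u v z).2 (by rw [e]; exact hz)⟩
    singT := by
      intro u h
      obtain ⟨w, hw, e⟩ := hT u h
      obtain ⟨z, hz⟩ := hw.exists_repr
      exact ⟨z, fun v => (hmem u v z).2 (by rw [e]; exact hz)⟩ }⟩

theorem IsSphereFrame.isPtVec {ω n₀ e₁ e₂ ni : LieSpace} (h : IsSphereFrame ω n₀ e₁ e₂ ni) :
    IsPtVec n₀ ∧ IsPtVec ni := by
  refine ⟨⟨?_, h.radial.1, h.isotropic.1⟩, ⟨?_, h.radial.2.2.2, h.isotropic.2.1⟩⟩ <;>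
  · rintro rfl
    have := h.isotropic.2.2
    norm_num at this

/-- The polar point is already bilinear in quadratic expressions: its poles carry the weights cos²
and sin², and its angular part carries cos·sin, which becomes the form `k`. In the angle, `l` is
cos² + sin² and has no zeros. -/
theorem exists_preForm_polar {L : ContactMap} {ω n₀ e₁ e₂ ni : LieSpace}
    (h : IsSphereFrame ω n₀ e₁ e₂ ni) {a b c d : ℝ} (hab : a < b) (hba : b < a + Real.pi)
    (hcd : c < d) (hdc : d < c + 2 * Real.pi)
    (hL : ∀ u v : I, L u v = Submodule.span ℝ
        {ω, polarPoint n₀ e₁ e₂ ni (a + u * (b - a)) (c + v * (d - c))}) :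
    Nonempty (PreForm L) := by
  obtain ⟨p0, pi⟩ := h.isPtVec
  obtain ⟨⟨ωω, hω⟩, ⟨r0, r1, r2, ri⟩, ⟨ω0, ω1, ω2, ωi⟩, ⟨h00, hii, h0i⟩, ⟨h11, h22, h12⟩,
    ⟨h01, h02, hi1, hi2⟩⟩ := h
  have hk : ∀ A B : ℝ, quad (Real.cos a * Real.sin a)
      (Real.cos a * Real.sin b + Real.sin a * Real.cos b) (Real.cos b * Real.sin b) A B =
      (A * Real.cos a + B * Real.cos b) * (A * Real.sin a + B * Real.sin b) := by
    intro A B; unfold quad; ring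
  -- Half angles are used: the angular range is below 2π while the interpolation needs a difference
  -- below π, and squaring restores the full angle.
  have hl : ∀ A B : ℝ, quad 1 (2 * (Real.cos (c / 2) * Real.cos (d / 2) +
      Real.sin (c / 2) * Real.sin (d / 2))) 1 A B =
      (A * Real.cos (c / 2) + B * Real.cos (d / 2)) ^ 2 +
      (A * Real.sin (c / 2) + B * Real.sin (d / 2)) ^ 2 := by
    intro A B; unfold quad
    linear_combination -A ^ 2 * Real.sin_sq_add_cos_sq (c / 2) -
      B ^ 2 * Real.sin_sq_add_cos_sq (d / 2)
  have hb0 : 0 < b - a := by linarith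
  have hbπ : b - a < Real.pi := by linarith
  have hd0 : 0 < (d - c) / 2 := by linarith
  have hdπ : (d - c) / 2 < Real.pi := by linarith
  have c1 : ∀ u : ℝ, sinRatio (b - a) (1 - u) * Real.cos a + sinRatio (b - a) u * Real.cos b =
      Real.cos (a + u * (b - a)) := fun u => by
    have := sinRatio_cos hb0 hbπ a u; rwa [add_sub_cancel] at this
  have s1 : ∀ u : ℝ, sinRatio (b - a) (1 - u) * Real.sin a + sinRatio (b - a) u * Real.sin b =
      Real.sin (a + u * (b - a)) := fun u => by
    have := sinRatio_sin hb0 hbπ a u; rwa [add_sub_cancel] at this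
  have e1 : c / 2 + (d - c) / 2 = d / 2 := by ring
  have c2 : ∀ u : ℝ, sinRatio ((d - c) / 2) (1 - u) * Real.cos (c / 2) +
      sinRatio ((d - c) / 2) u * Real.cos (d / 2) = Real.cos (c / 2 + u * ((d - c) / 2)) :=
    fun u => by
      have := sinRatio_cos hd0 hdπ (c / 2) u; rwa [e1] at this
  have s2 : ∀ u : ℝ, sinRatio ((d - c) / 2) (1 - u) * Real.sin (c / 2) +
      sinRatio ((d - c) / 2) u * Real.sin (d / 2) = Real.sin (c / 2 + u * ((d - c) / 2)) :=
    fun u => by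
      have := sinRatio_sin hd0 hdπ (c / 2) u; rwa [e1] at this
  have ang : ∀ v : ℝ, c + v * (d - c) = 2 * (c / 2 + v * ((d - c) / 2)) := fun v => by ring
  refine exists_preForm_of_sphere hω ωω hL ?_ ?_ (trigArc n₀ 0 ni a b)
    (trigArc e₁ ((2 : ℝ) • e₂) (-e₁) (c / 2) (d / 2))
    (Real.cos a * Real.sin a) (Real.cos a * Real.sin b + Real.sin a * Real.cos b)
    (Real.cos b * Real.sin b)
    1 (2 * (Real.cos (c / 2) * Real.cos (d / 2) + Real.sin (c / 2) * Real.sin (d / 2))) 1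
    hb0 hbπ hd0 hdπ ?_ ?_ ?_ ?_ ?_
  · intro u v
    simp only [polarPoint, radial_add, radial_smul, r0, r1, r2, ri, lieForm_add_right,
      lieForm_smul_right, ω0, ω1, ω2, ωi]
    constructor <;> ring
  · intro u v h0
    have e0 : lieForm n₀ (polarPoint n₀ e₁ e₂ ni (a + u * (b - a)) (c + v * (d - c))) = 0 := by
      rw [h0, lieForm_zero_right]
    have ei : lieForm ni (polarPoint n₀ e₁ e₂ ni (a + u * (b - a)) (c + v * (d - c))) = 0 := by
      rw [h0, lieForm_zero_right]
    simp only [polarPoint, lieForm_add_right, lieForm_smul_right, h00, h01, h02, h0i, hii, hi1,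
      hi2, lieForm_comm ni n₀] at e0 ei
    linarith [Real.sin_sq_add_cos_sq (a + u * (b - a))]
  · intro A B C E
    simp only [trigArc_hvec, radial_add, radial_smul, radial_neg, radial_zero, r0, r1, r2, ri]
    ring
  · intro A B C E
    rw [hk, hl]
    simp only [trigArc_hvec, lieForm_add_left, lieForm_add_right, lieForm_smul_left,
      lieForm_smul_right, lieForm_neg_left, lieForm_neg_right, lieForm_zero_left,
      lieForm_zero_right, h00, hii, h0i, h11, h22, h12, h01, h02, hi1, hi2, lieForm_comm ni n₀,
      lieForm_comm e₂ e₁, lieForm_comm e₁ n₀, lieForm_comm e₂ n₀, lieForm_comm e₁ ni,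
      lieForm_comm e₂ ni]
    ring
  · intro u v _
    refine ⟨1, one_ne_zero, ?_⟩
    rw [hk, hl, trigArc_hvec, trigArc_hvec, c1, s1, c2, s2, polarPoint, ang, Real.cos_two_mul',
      Real.sin_two_mul, Real.cos_sq_add_sin_sq]
    module
  · intro v hv
    rw [hl, c2, s2, Real.cos_sq_add_sin_sq] at hv
    exact absurd hv one_ne_zero
  · intro u hu
    rw [hk, c1, s1] at hu
    -- The factor cos·sin vanishes at the two poles of the polar net, where the angle no longer
    -- matters.
    rcases mul_eq_zero.1 hu with hc | hs
    · refine ⟨ni, pi, fun v => ?_⟩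
      have : Real.sin (a + u * (b - a)) ^ 2 = 1 := by
        rw [Real.sin_sq, hc]; norm_num
      rw [polarPoint, this, hc]; simp
    · refine ⟨n₀, p0, fun v => ?_⟩
      have : Real.cos (a + u * (b - a)) ^ 2 = 1 := by
        rw [Real.cos_sq', hs]; norm_num
      rw [polarPoint, this, hs]; simp

/-- Multiplication by the squares of both cosines clears the tangents and makes `k`, `l` these
squares. If one cosine vanishes, a multiple of `ni` remains; if both vanish, the vector is zero, and
this is why `PreForm.mem` assumes that one of the two forms is nonzero. -/
theorem exists_preForm_cartesian {L : ContactMap} {ω n₀ e₁ e₂ ni : LieSpace}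
    (h : IsSphereFrame ω n₀ e₁ e₂ ni) {a b c d : ℝ} (hab : a < b) (hba : b < a + Real.pi)
    (hcd : c < d) (hdc : d < c + Real.pi)
    (hL : ∀ u v : I, L u v = Submodule.span ℝ
        {ω, cartesianPoint n₀ e₁ e₂ ni (a + u * (b - a)) (c + v * (d - c))}) :
    Nonempty (PreForm L) := by
  obtain ⟨p0, pi⟩ := h.isPtVec
  obtain ⟨⟨ωω, hω⟩, ⟨r0, r1, r2, ri⟩, ⟨ω0, ω1, ω2, ωi⟩, ⟨h00, hii, h0i⟩, ⟨h11, h22, h12⟩,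
    ⟨h01, h02, hi1, hi2⟩⟩ := h
  have hk : ∀ a b A B : ℝ, quad (Real.cos a ^ 2) (2 * (Real.cos a * Real.cos b)) (Real.cos b ^ 2)
      A B = (A * Real.cos a + B * Real.cos b) ^ 2 := by
    intro a b A B; unfold quad; ring
  have hb0 : 0 < b - a := by linarith
  have hbπ : b - a < Real.pi := by linarith
  have hd0 : 0 < d - c := by linarith
  have hdπ : d - c < Real.pi := by linarith
  have c1 : ∀ u : ℝ, sinRatio (b - a) (1 - u) * Real.cos a + sinRatio (b - a) u * Real.cos b =
      Real.cos (a + u * (b - a)) := fun u => by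
    have := sinRatio_cos hb0 hbπ a u; rwa [add_sub_cancel] at this
  have s1 : ∀ u : ℝ, sinRatio (b - a) (1 - u) * Real.sin a + sinRatio (b - a) u * Real.sin b =
      Real.sin (a + u * (b - a)) := fun u => by
    have := sinRatio_sin hb0 hbπ a u; rwa [add_sub_cancel] at this
  have c2 : ∀ u : ℝ, sinRatio (d - c) (1 - u) * Real.cos c + sinRatio (d - c) u * Real.cos d =
      Real.cos (c + u * (d - c)) := fun u => by
    have := sinRatio_cos hd0 hdπ c u; rwa [add_sub_cancel] at this
  have s2 : ∀ u : ℝ, sinRatio (d - c) (1 - u) * Real.sin c + sinRatio (d - c) u * Real.sin d =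
      Real.sin (c + u * (d - c)) := fun u => by
    have := sinRatio_sin hd0 hdπ c u; rwa [add_sub_cancel] at this
  refine exists_preForm_of_sphere hω ωω hL ?_ ?_ (trigArc n₀ e₁ ni a b) (trigArc 0 e₂ ni c d)
    (Real.cos a ^ 2) (2 * (Real.cos a * Real.cos b)) (Real.cos b ^ 2)
    (Real.cos c ^ 2) (2 * (Real.cos c * Real.cos d)) (Real.cos d ^ 2)
    hb0 hbπ hd0 hdπ ?_ ?_ ?_ ?_ ?_
  · intro u v
    unfold cartesianPoint
    split_ifs
    · exact ⟨ri, ωi⟩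
    · simp only [radial_add, radial_smul, r0, r1, r2, ri, lieForm_add_right,
        lieForm_smul_right, ω0, ω1, ω2, ωi]
      constructor <;> ring
  · intro u v
    unfold cartesianPoint
    split_ifs
    · exact pi.ne
    · intro h0
      have ei := lieForm_zero_right ni
      rw [← h0] at ei
      simp only [lieForm_add_right, lieForm_smul_right, hii, hi1, hi2, lieForm_comm ni n₀,
        h0i] at ei
      linarith
  · intro A B C E
    simp only [trigArc_hvec, radial_add, radial_smul, radial_zero, r0, r1, r2, ri]
    ring
  · intro A B C E
    rw [hk, hk]
    simp only [trigArc_hvec, lieForm_add_left, lieForm_add_right, lieForm_smul_left,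
      lieForm_smul_right, lieForm_zero_left,
      lieForm_zero_right, h00, hii, h0i, h11, h22, h12, h01, h02, hi1, hi2, lieForm_comm ni n₀,
      lieForm_comm e₂ e₁, lieForm_comm e₁ n₀, lieForm_comm e₂ n₀, lieForm_comm e₁ ni,
      lieForm_comm e₂ ni]
    ring
  · intro u v huv
    rw [hk, hk, c1, c2] at huv
    rw [hk, hk, trigArc_hvec, trigArc_hvec, c1, s1, c2, s2]
    unfold cartesianPoint
    by_cases hc : Real.cos (a + u * (b - a)) = 0
    · have hc' : Real.cos (c + v * (d - c)) ≠ 0 := by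
        intro h0; simp [hc, h0] at huv
      have hs : Real.sin (a + u * (b - a)) ^ 2 = 1 := by rw [Real.sin_sq, hc]; norm_num
      refine ⟨Real.cos (c + v * (d - c)) ^ 2, pow_ne_zero 2 hc', ?_⟩
      rw [if_pos (Or.inl hc), hs, hc]; module
    · by_cases hc' : Real.cos (c + v * (d - c)) = 0
      · have hs : Real.sin (c + v * (d - c)) ^ 2 = 1 := by rw [Real.sin_sq, hc']; norm_num
        refine ⟨Real.cos (a + u * (b - a)) ^ 2, pow_ne_zero 2 hc, ?_⟩
        rw [if_pos (Or.inr hc'), hs, hc']; module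
      · refine ⟨Real.cos (a + u * (b - a)) ^ 2 * Real.cos (c + v * (d - c)) ^ 2,
          mul_ne_zero (pow_ne_zero 2 hc) (pow_ne_zero 2 hc'), ?_⟩
        rw [if_neg (by tauto), Real.tan_eq_sin_div_cos, Real.tan_eq_sin_div_cos]
        match_scalars <;> field_simp
  · intro v hv
    rw [hk, c2] at hv
    refine ⟨ni, pi, fun u => ?_⟩
    rw [cartesianPoint, if_pos (Or.inr (by simpa using hv))]
  · intro u hu
    rw [hk, c1] at hu
    refine ⟨ni, pi, fun v => ?_⟩
    rw [cartesianPoint, if_pos (Or.inl (by simpa using hu))]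

theorem CyclidicPatch.exists_preForm (f : CyclidicPatch) : Nonempty (PreForm f.contact) := by
  rcases f.isPatch with h | ⟨ω, n₀, e₁, e₂, ni, a, b, c, d, h, hab, hba, hcd, h1 | h1 | h1⟩
  · exact exists_preForm_generic h
  · exact exists_preForm_polar h hab hba hcd h1.1 h1.2
  · obtain ⟨F⟩ := exists_preForm_polar (L := ContactMap.swap f.contact) h hab hba hcd h1.1
      fun u v => h1.2 v u
    exact ⟨F.swap⟩
  · exact exists_preForm_cartesian h hab hba hcd h1.1 h1.2

end

noncomputable section

/-! ### Normal form of non-singular patches: existence -/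

namespace PatchData

variable {D : PatchData}

/-- Homogeneous form of the parametrization of a patch. -/
def hP (D : PatchData) (a b c d : ℝ) : LieSpace :=
  (quad 1 D.κ 1 a b * quad 1 D.ν 1 c d) • D.p +
    quad 1 D.ν 1 c d • ((a * b) • D.W + b ^ 2 • D.d) +
    quad 1 D.κ 1 a b • ((c * d) • D.V + d ^ 2 • D.e)

theorem hP_smul (r r' s t : ℝ) : D.hP (r * (1 - s)) (r * s) (r' * (1 - t)) (r' * t) =
    (r ^ 2 * r' ^ 2) • D.P s t := by
  simp only [hP, P, quad, qd]; module

theorem quad_pos {k b : ℝ} (hk : -2 < k) (hb : 0 < b) : 0 < quad 1 k 1 1 b := by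
  have h : 0 < (k + 2) * b := mul_pos (by linarith) hb
  have e : quad 1 k 1 1 b = (1 - b) ^ 2 + (k + 2) * b := by unfold quad; ring
  rw [e]
  exact add_pos_of_nonneg_of_pos (sq_nonneg _) h

theorem quartic_relations {k w m W X d : ℝ} (h1 : 2 * (2 + k) * (w + m) + W + 2 * X + d = 0)
    (h2 : 2 * (2 - k) * (-w + m) + W - 2 * X + d = 0)
    (h3 : 2 * (5 + 2 * k) * (2 * w + 4 * m) + 4 * W + 16 * X + 16 * d = 0)
    (h4 : 2 * (5 - 2 * k) * (-2 * w + 4 * m) + 4 * W - 16 * X + 16 * d = 0) :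
    w = 0 ∧ W = -2 * m ∧ d = -2 * m ∧ X = -k * m := by
  have hw : w = 0 := by linear_combination (8 * (h1 - h2) - (h3 - h4)) / 24
  subst hw
  have hd : d = -2 * m := by linear_combination ((h3 + h4) / 2 - 2 * (h1 + h2)) / 12
  refine ⟨rfl, ?_, hd, ?_⟩
  · linear_combination (h1 + h2) / 2 - hd
  · linear_combination (h1 - h2) / 4

/-- Isotropy of the parametrization encodes the relations between the data of a patch. -/
theorem valid_of_iso (rad : ∀ a b c d, (D.hP a b c d).radial = 0)
    (iso : ∀ a b c d, lieForm (D.hP a b c d) (D.hP a b c d) = 0) (hκ : -2 < D.κ) (hν : -2 < D.ν)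
    (p0 : D.p ≠ 0) (hd : lieForm D.p D.d ≠ 0) (he : lieForm D.p D.e ≠ 0) : D.Valid := by
  have key : ∀ a b c d, quad 1 D.κ 1 a b ^ 2 * quad 1 D.ν 1 c d ^ 2 * lieForm D.p D.p +
      2 * (quad 1 D.κ 1 a b * quad 1 D.ν 1 c d ^ 2) *
        (a * b * lieForm D.p D.W + b ^ 2 * lieForm D.p D.d) +
      2 * (quad 1 D.κ 1 a b ^ 2 * quad 1 D.ν 1 c d) *
        (c * d * lieForm D.p D.V + d ^ 2 * lieForm D.p D.e) +
      quad 1 D.ν 1 c d ^ 2 * (a ^ 2 * b ^ 2 * lieForm D.W D.W + 2 * (a * b ^ 3) * lieForm D.W D.d +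
        b ^ 4 * lieForm D.d D.d) +
      quad 1 D.κ 1 a b ^ 2 * (c ^ 2 * d ^ 2 * lieForm D.V D.V + 2 * (c * d ^ 3) * lieForm D.V D.e +
        d ^ 4 * lieForm D.e D.e) +
      2 * (quad 1 D.κ 1 a b * quad 1 D.ν 1 c d) * (a * b * c * d * lieForm D.W D.V +
        a * b * d ^ 2 * lieForm D.W D.e + b ^ 2 * (c * d) * lieForm D.d D.V +
        b ^ 2 * d ^ 2 * lieForm D.d D.e) = 0 := by
    intro a b c d
    rw [← iso a b c d]
    simp only [hP, lieForm_add_left, lieForm_add_right, lieForm_smul_left, lieForm_smul_right,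
      lieForm_comm D.d D.p, lieForm_comm D.W D.p, lieForm_comm D.V D.p, lieForm_comm D.e D.p,
      lieForm_comm D.d D.W, lieForm_comm D.e D.V, lieForm_comm D.V D.W, lieForm_comm D.e D.W,
      lieForm_comm D.V D.d, lieForm_comm D.e D.d]
    ring
  have pp : lieForm D.p D.p = 0 := by
    have := key 1 0 1 0
    simp only [quad] at this
    linarith
  have q10 : ∀ k, quad 1 k 1 1 0 = 1 := fun k => by simp [quad]
  have q11 : ∀ k, quad 1 k 1 1 1 = 2 + k := fun k => by unfold quad; ring
  have q1m : ∀ k, quad 1 k 1 1 (-1) = 2 - k := fun k => by unfold quad; ring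
  have q12 : ∀ k, quad 1 k 1 1 2 = 5 + 2 * k := fun k => by unfold quad; ring
  have q1n : ∀ k, quad 1 k 1 1 (-2) = 5 - 2 * k := fun k => by unfold quad; ring
  have a1 := key 1 1 1 0
  have a2 := key 1 (-1) 1 0
  have a3 := key 1 2 1 0
  have a4 := key 1 (-2) 1 0
  have b1 := key 1 0 1 1
  have b2 := key 1 0 1 (-1)
  have b3 := key 1 0 1 2
  have b4 := key 1 0 1 (-2)
  simp only [q10, q11, q1m, q12, q1n, pp] at a1 a2 a3 a4 b1 b2 b3 b4
  obtain ⟨pW, WW, dd, Wd⟩ := quartic_relations (k := D.κ) (w := lieForm D.p D.W)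
    (m := lieForm D.p D.d) (W := lieForm D.W D.W) (X := lieForm D.W D.d) (d := lieForm D.d D.d)
    (by linear_combination a1) (by linear_combination a2) (by linear_combination a3)
    (by linear_combination a4)
  obtain ⟨pV, VV, ee, Ve⟩ := quartic_relations (k := D.ν) (w := lieForm D.p D.V)
    (m := lieForm D.p D.e) (W := lieForm D.V D.V) (X := lieForm D.V D.e) (d := lieForm D.e D.e)
    (by linear_combination b1) (by linear_combination b2) (by linear_combination b3)
    (by linear_combination b4)
  -- Only the mixed products are left, with the two quadratic forms as a common factor. The bounds
  -- on κ and ν make this factor nonzero for positive parameters, and four such pairs separate the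
  -- monomials.
  have key2 : ∀ b d, 0 < b → 0 < d → b * d * lieForm D.W D.V +
        b * d ^ 2 * lieForm D.W D.e + b ^ 2 * d * lieForm D.d D.V +
        b ^ 2 * d ^ 2 * lieForm D.d D.e = 0 := by
    intro b d hb hd
    have h := key 1 b 1 d
    rw [pp, pW, pV, dd, WW, Wd, ee, VV, Ve] at h
    have h1 : 0 < quad 1 D.κ 1 1 b := quad_pos hκ hb
    have h2 : 0 < quad 1 D.ν 1 1 d := quad_pos hν hd
    have h3 : 2 * (quad 1 D.κ 1 1 b * quad 1 D.ν 1 1 d) ≠ 0 := by positivity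
    apply mul_left_cancel₀ h3
    have e1 : quad 1 D.κ 1 1 b = 1 + D.κ * b + b ^ 2 := by unfold quad; ring
    have e2 : quad 1 D.ν 1 1 d = 1 + D.ν * d + d ^ 2 := by unfold quad; ring
    rw [mul_zero, ← h, e1, e2]
    ring
  have c1 := key2 1 1 one_pos one_pos
  have c2 := key2 1 2 one_pos two_pos
  have c3 := key2 2 1 two_pos one_pos
  have c4 := key2 2 2 two_pos two_pos
  have r0 := rad 1 0 1 0
  have r1 := rad 1 1 1 0
  have r2 := rad 1 (-1) 1 0
  have r3 := rad 1 0 1 1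
  have r4 := rad 1 0 1 (-1)
  simp only [hP, q10, q11, q1m, radial_add, radial_smul] at r0 r1 r2 r3 r4
  have rp : D.p.radial = 0 := by linarith
  rw [rp] at r1 r2 r3 r4
  have rW : D.W.radial = 0 := by linarith
  have rV : D.V.radial = 0 := by linarith
  have hp : IsPtVec D.p := ⟨p0, rp, pp⟩
  -- Being orthogonal to the light vector `p`, the vector `W` has nonnegative square −2⟨p, d⟩; this
  -- fixes the sign of ⟨p, d⟩, and likewise for `V` and ⟨p, e⟩.
  have w1 := hp.form_self_nonneg rW pW
  have w2 := hp.form_self_nonneg rV pV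
  exact ⟨rp, rW, by linarith, rV, by linarith, pp, pW, WW, dd, Wd,
    lt_of_le_of_ne (by linarith) hd, pV, VV, ee, Ve, lt_of_le_of_ne (by linarith) he,
    by linarith, by linarith, by linarith, by linarith, hκ, hν⟩

end PatchData

namespace PreForm

variable {L : ContactMap}

/-- A form without zeros on the connected parameter interval has end values of the same sign, and
rescaling `b` by ρ then makes its two square coefficients equal. -/
theorem exists_ratio (F : PreForm L)
    (h : ∀ u, quad F.k₀ F.k₁ F.k₂ (F.A u) (F.B u) ≠ 0) :
    F.k₀ ≠ 0 ∧ ∃ ρ : ℝ, 0 < ρ ∧ F.k₂ = F.k₀ * ρ ^ 2 := by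
  have h0 := h 0
  have h1 := h 1
  have e0 : quad F.k₀ F.k₁ F.k₂ (F.A 0) (F.B 0) = F.k₀ := by simp [quad, F.A_zero, F.B_zero]
  have e1 : quad F.k₀ F.k₁ F.k₂ (F.A 1) (F.B 1) = F.k₂ := by simp [quad, F.A_one, F.B_one]
  have hc : Continuous fun u => quad F.k₀ F.k₁ F.k₂ (F.A u) (F.B u) := by
    have := F.contA
    have := F.contB
    unfold quad; fun_prop
  have hpos : 0 < F.k₂ / F.k₀ := by
    by_contra hcon
    have h0' : F.k₀ ≠ 0 := e0 ▸ h0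
    have hcon' : F.k₂ * F.k₀ ≤ 0 := by
      have : F.k₂ * F.k₀ = F.k₂ / F.k₀ * F.k₀ ^ 2 := by field_simp
      rw [this]
      exact mul_nonpos_of_nonpos_of_nonneg (not_lt.1 hcon) (sq_nonneg _)
    have : ∃ u, quad F.k₀ F.k₁ F.k₂ (F.A u) (F.B u) = 0 := by
      rcases le_total F.k₀ 0 with hk | hk
      · refine mem_range_of_exists_le_of_exists_ge hc ⟨0, e0.trans_le hk⟩ ⟨1, ?_⟩
        rw [e1]
        have : F.k₀ < 0 := lt_of_le_of_ne hk h0'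
        nlinarith
      · refine mem_range_of_exists_le_of_exists_ge hc ⟨1, ?_⟩ ⟨0, hk.trans_eq e0.symm⟩
        rw [e1]
        have : 0 < F.k₀ := lt_of_le_of_ne hk (Ne.symm h0')
        nlinarith
    obtain ⟨u, hu⟩ := this
    exact h u hu
  refine ⟨e0 ▸ h0, √(F.k₂ / F.k₀), Real.sqrt_pos.2 hpos, ?_⟩
  rw [Real.sq_sqrt hpos.le]
  have h0' : F.k₀ ≠ 0 := e0 ▸ h0
  field_simp

/-- The data of the normal form of a patch. -/
def normalForm (F : PreForm L) (ρ τ : ℝ) : PatchData where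
  p := F.k₀⁻¹ • F.α.p + F.l₀⁻¹ • F.β.p
  W := (F.k₀ * ρ)⁻¹ • F.α.w - (F.k₁ / (F.k₀ * ρ) * F.k₀⁻¹) • F.α.p
  d := (F.k₀ * ρ ^ 2)⁻¹ • F.α.q - F.k₀⁻¹ • F.α.p
  κ := F.k₁ / (F.k₀ * ρ)
  V := (F.l₀ * τ)⁻¹ • F.β.w - (F.l₁ / (F.l₀ * τ) * F.l₀⁻¹) • F.β.p
  e := (F.l₀ * τ ^ 2)⁻¹ • F.β.q - F.l₀⁻¹ • F.β.p
  ν := F.l₁ / (F.l₀ * τ)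

theorem normalForm_hP (F : PreForm L) {ρ τ : ℝ} (hk : F.k₀ ≠ 0) (hl : F.l₀ ≠ 0) (hρ : 0 < ρ)
    (hτ : 0 < τ) (hk₂ : F.k₂ = F.k₀ * ρ ^ 2) (hl₂ : F.l₂ = F.l₀ * τ ^ 2) (a b c d : ℝ) :
    quad F.l₀ F.l₁ F.l₂ c d • F.α.hvec a b + quad F.k₀ F.k₁ F.k₂ a b • F.β.hvec c d =
      (F.k₀ * F.l₀) • (F.normalForm ρ τ).hP a (ρ * b) c (τ * d) := by
  simp only [normalForm, PatchData.hP, Arc.hvec, quad, hk₂, hl₂]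
  have := hρ.ne'
  have := hτ.ne'
  match_scalars <;> field_simp <;> ring

/-- Where the parameters balance, `A = ρ B`, the normalized form is (2 + κ)A². With κ ≤ −2 this is
nonpositive, while the form is 1 at the start, so it would vanish somewhere in between. -/
theorem normalForm_κ (F : PreForm L) {ρ : ℝ} (τ : ℝ) (hk : F.k₀ ≠ 0) (hρ : 0 < ρ)
    (hk₂ : F.k₂ = F.k₀ * ρ ^ 2) (h : ∀ u, quad F.k₀ F.k₁ F.k₂ (F.A u) (F.B u) ≠ 0) :
    -2 < (F.normalForm ρ τ).κ := by
  have hA := F.contA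
  have hB := F.contB
  by_contra hcon
  have hc : Continuous fun u => quad 1 (F.normalForm ρ τ).κ 1 (F.A u) (ρ * F.B u) := by
    unfold quad; fun_prop
  have hd : Continuous fun u => ρ * F.B u - F.A u := by fun_prop
  obtain ⟨w, hw⟩ : ∃ w, ρ * F.B w - F.A w = 0 := by
    refine mem_range_of_exists_le_of_exists_ge hd ⟨0, ?_⟩ ⟨1, ?_⟩
    · rw [F.A_zero, F.B_zero]; linarith
    · rw [F.A_one, F.B_one]; linarith
  obtain ⟨u, hu⟩ : ∃ u, quad 1 (F.normalForm ρ τ).κ 1 (F.A u) (ρ * F.B u) = 0 := by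
    refine mem_range_of_exists_le_of_exists_ge hc ⟨w, ?_⟩ ⟨0, ?_⟩
    · rw [sub_eq_zero.1 hw]
      unfold quad
      nlinarith [sq_nonneg (F.A w)]
    · simp [quad, F.A_zero, F.B_zero]
  apply h u
  have e : quad F.k₀ F.k₁ F.k₂ (F.A u) (F.B u) =
      F.k₀ * quad 1 (F.normalForm ρ τ).κ 1 (F.A u) (ρ * F.B u) := by
    simp only [quad, normalForm, hk₂]
    have := hρ.ne'
    field_simp
  rw [e, hu, mul_zero]

/-- The change of parameter leading to the normal form. -/
def reparam (F : PreForm L) {ρ : ℝ} (hρ : 0 < ρ) (u : I) : I :=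
  ⟨ρ * F.B u / (F.A u + ρ * F.B u), by
    have := F.nonnegA u
    have := F.nonnegB u
    positivity, by
    have h1 := F.nonnegA u
    have h2 := F.nonnegB u
    exact div_le_one_of_le₀ (by linarith) (by positivity)⟩

theorem reparam_pos (F : PreForm L) {ρ : ℝ} (hρ : 0 < ρ) (u : I) : 0 < F.A u + ρ * F.B u := by
  have h1 := F.nonnegA u
  have h2 := F.nonnegB u
  have h3 := F.posAB u
  rcases h2.eq_or_lt with h | h
  · rw [← h] at h3 ⊢; linarith
  · have := mul_pos hρ h; linarith

theorem reparam_surj (F : PreForm L) {ρ : ℝ} (hρ : 0 < ρ) : Function.Surjective (F.reparam hρ) := by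
  have hA := F.contA
  have hB := F.contB
  have hc : Continuous fun u => ((F.reparam hρ u : I) : ℝ) := by
    unfold reparam
    exact Continuous.div (by fun_prop) (by fun_prop) fun u => (F.reparam_pos hρ u).ne'
  intro s
  obtain ⟨u, hu⟩ : ∃ u, ((F.reparam hρ u : I) : ℝ) = s := by
    refine mem_range_of_exists_le_of_exists_ge hc ⟨0, ?_⟩ ⟨1, ?_⟩
    · simp [reparam, F.B_zero, s.2.1]
    · simp [reparam, F.A_one, F.B_one, hρ.ne', s.2.2]
  exact ⟨u, Subtype.ext hu⟩

theorem normalForm_P (F : PreForm L) {ρ τ : ℝ} (hk : F.k₀ ≠ 0) (hl : F.l₀ ≠ 0) (hρ : 0 < ρ)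
    (hτ : 0 < τ) (hk₂ : F.k₂ = F.k₀ * ρ ^ 2) (hl₂ : F.l₂ = F.l₀ * τ ^ 2) (u v : I) :
    ∃ c : ℝ, c ≠ 0 ∧ quad F.l₀ F.l₁ F.l₂ (F.C v) (F.E v) • F.α.hvec (F.A u) (F.B u) +
      quad F.k₀ F.k₁ F.k₂ (F.A u) (F.B u) • F.β.hvec (F.C v) (F.E v) =
      c • (F.normalForm ρ τ).P (F.reparam hρ u) (F.swap.reparam hτ v) := by
  have h1 := F.reparam_pos hρ u
  have h2 := F.swap.reparam_pos hτ v
  refine ⟨F.k₀ * F.l₀ * ((F.A u + ρ * F.B u) ^ 2 * (F.C v + τ * F.E v) ^ 2), ?_, ?_⟩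
  · exact mul_ne_zero (mul_ne_zero hk hl) (mul_ne_zero (pow_ne_zero 2 h1.ne') (pow_ne_zero 2 h2.ne'))
  · rw [F.normalForm_hP hk hl hρ hτ hk₂ hl₂, mul_smul (F.k₀ * F.l₀), ← PatchData.hP_smul]
    have e1 : ρ * F.B u = (F.A u + ρ * F.B u) * (F.reparam hρ u : ℝ) := by
      simp only [reparam]; field_simp
    have e2 : τ * F.E v = (F.C v + τ * F.E v) * (F.swap.reparam hτ v : ℝ) := by
      have := h2.ne'
      simp only [reparam, swap] at this ⊢; field_simp
    congr 1
    rw [mul_sub, mul_sub, ← e1, ← e2]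
    congr 1 <;> ring

/-- A patch without singular points has a normal form. -/
theorem exists_normalForm (F : PreForm L)
    (hK : ∀ u, quad F.k₀ F.k₁ F.k₂ (F.A u) (F.B u) ≠ 0)
    (hL : ∀ v, quad F.l₀ F.l₁ F.l₂ (F.C v) (F.E v) ≠ 0)
    (hA : ∀ z, ¬ ∀ u, liePoint z ∈ L u 0) (hB : ∀ z, ¬ ∀ v, liePoint z ∈ L 0 v) :
    ∃ D : PatchData, D.Valid ∧ Nonempty (RepData L D) := by
  obtain ⟨hk, ρ, hρ, hk₂⟩ := F.exists_ratio hK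
  obtain ⟨hl, τ, hτ, hl₂⟩ := F.swap.exists_ratio hL
  change F.l₀ ≠ 0 at hl
  change F.l₂ = F.l₀ * τ ^ 2 at hl₂
  set D := F.normalForm ρ τ with hD
  have hP := F.normalForm_P hk hl hρ hτ hk₂ hl₂
  have hhP := F.normalForm_hP hk hl hρ hτ hk₂ hl₂
  have hf0 : F.reparam hρ 0 = 0 := Subtype.ext (by simp [reparam, F.B_zero])
  have hf1 : F.reparam hρ 1 = 1 := Subtype.ext (by simp [reparam, F.A_one, F.B_one, hρ.ne'])
  have hg0 : F.swap.reparam hτ 0 = 0 := Subtype.ext (by simp [reparam, F.swap.B_zero])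
  have hg1 : F.swap.reparam hτ 1 = 1 :=
    Subtype.ext (by simp [reparam, F.swap.A_one, F.swap.B_one, hτ.ne'])
  have radP : ∀ a b c d, (D.hP a b c d).radial = 0 := by
    intro a b c d
    have h1 := F.rad a (b / ρ) c (d / τ)
    rw [hhP, radial_smul, mul_div_cancel₀ _ hρ.ne', mul_div_cancel₀ _ hτ.ne'] at h1
    exact (mul_eq_zero.1 h1).resolve_left (mul_ne_zero hk hl)
  have isoP : ∀ a b c d, lieForm (D.hP a b c d) (D.hP a b c d) = 0 := by
    intro a b c d
    have h1 := F.iso a (b / ρ) c (d / τ)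
    rw [hhP, lieForm_smul_left, lieForm_smul_right, mul_div_cancel₀ _ hρ.ne',
      mul_div_cancel₀ _ hτ.ne'] at h1
    have h2 := mul_ne_zero hk hl
    exact (mul_eq_zero.1 ((mul_eq_zero.1 h1).resolve_left h2)).resolve_left h2
  have hPt : ∀ u v, IsPtVec (D.P (F.reparam hρ u) (F.swap.reparam hτ v)) := by
    intro u v
    obtain ⟨c, hc, e⟩ := hP u v
    have hne := F.ne u v (Or.inl (hK u))
    rw [e] at hne
    have e2 := D.hP_smul 1 1 (F.reparam hρ u) (F.swap.reparam hτ v)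
    simp only [one_mul, one_pow, one_smul] at e2
    refine ⟨right_ne_zero_of_smul hne, ?_, ?_⟩
    · rw [← e2]; exact radP _ _ _ _
    · rw [← e2]; exact isoP _ _ _ _
  have hmem : ∀ u v z, liePoint z ∈ L u v ↔
      IsRep (D.P (F.reparam hρ u) (F.swap.reparam hτ v)) z := by
    intro u v z
    obtain ⟨c, hc, e⟩ := hP u v
    rw [F.mem u v z (Or.inl (hK u)), e, repr_smul_iff hc]
  have hspan : ∀ (c : ℝ) (x y : LieSpace), c ≠ 0 →
      Submodule.span ℝ {c • x, y} = Submodule.span ℝ {x, y} := by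
    intro c x y hc
    rw [Submodule.span_insert, Submodule.span_insert, Submodule.span_singleton_smul_eq hc.isUnit]
  have p0 : IsPtVec D.p := by
    have := hPt 0 0
    rw [hf0, hg0] at this
    simpa [PatchData.P_zero_zero] using this
  obtain ⟨z₀, hz₀⟩ := p0.exists_repr
  have hκ := F.normalForm_κ τ hk hρ hk₂ hK
  have hν := F.swap.normalForm_κ ρ hl hτ hl₂ hL
  -- the forms along the boundary arcs
  have hpd : lieForm D.p D.d ≠ 0 := by
    intro hpd
    refine hA z₀ fun u => (hmem u 0 z₀).2 ?_
    obtain ⟨y, hy⟩ := (hPt u 0).exists_repr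
    have : lieForm D.p (D.P (F.reparam hρ u) (F.swap.reparam hτ 0)) = 0 := by
      have pp := p0.iso
      have i1 := isoP 1 1 1 0
      have i2 := isoP 1 (-1) 1 0
      have i3 := isoP 1 2 1 0
      have i4 := isoP 1 (-2) 1 0
      simp only [PatchData.hP, quad, lieForm_add_left, lieForm_add_right, lieForm_smul_left,
        lieForm_smul_right, pp, hpd, lieForm_comm D.d D.p, lieForm_comm D.W D.p,
        lieForm_comm D.d D.W, lieForm_comm D.V D.p, lieForm_comm D.e D.p] at i1 i2 i3 i4
      have pW : lieForm D.p D.W = 0 := by linarith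
      rw [hg0]
      simp only [PatchData.P, lieForm_add_right, lieForm_smul_right, pp, hpd, pW]
      simp
    rw [(hz₀.form_eq_zero_iff hy).1 this]
    exact hy
  have hpe : lieForm D.p D.e ≠ 0 := by
    intro hpe
    refine hB z₀ fun v => (hmem 0 v z₀).2 ?_
    obtain ⟨y, hy⟩ := (hPt 0 v).exists_repr
    have : lieForm D.p (D.P (F.reparam hρ 0) (F.swap.reparam hτ v)) = 0 := by
      have pp := p0.iso
      have i1 := isoP 1 0 1 1
      have i2 := isoP 1 0 1 (-1)
      have i3 := isoP 1 0 1 2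
      have i4 := isoP 1 0 1 (-2)
      simp only [PatchData.hP, quad, lieForm_add_left, lieForm_add_right, lieForm_smul_left,
        lieForm_smul_right, pp, hpe, lieForm_comm D.d D.p, lieForm_comm D.W D.p,
        lieForm_comm D.e D.V, lieForm_comm D.V D.p, lieForm_comm D.e D.p] at i1 i2 i3 i4
      have pV : lieForm D.p D.V = 0 := by linarith
      rw [hf0]
      simp only [PatchData.P, lieForm_add_right, lieForm_smul_right, pp, hpe, pV]
      simp
    rw [(hz₀.form_eq_zero_iff hy).1 this]
    exact hy
  have hV : D.Valid := PatchData.valid_of_iso radP isoP hκ hν p0.ne hpd hpe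
  refine ⟨D, hV, ⟨{
    f := F.reparam hρ
    g := F.swap.reparam hτ
    S := F.S
    T := F.T
    f_surj := F.reparam_surj hρ
    g_surj := F.swap.reparam_surj hτ
    f_zero := hf0
    f_one := hf1
    g_zero := hg0
    g_one := hg1
    spanS := fun u v => by
      obtain ⟨c, hc, e⟩ := hP u v
      rw [F.spanS u v (hK u) (hL v), e, hspan _ _ _ hc]
    spanT := fun u v => by
      obtain ⟨c, hc, e⟩ := hP u v
      rw [F.spanT u v (hK u) (hL v), e, hspan _ _ _ hc]
    radS := fun v => (F.sphereS v (hL v)).1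
    radT := fun u => (F.sphereT u (hK u)).1
    isoS := fun v => ((F.sphereS v (hL v)).2 0).2 _ ((F.sphereS v (hL v)).2 0).1
    isoT := fun u => ((F.sphereT u (hK u)).2 0).2 _ ((F.sphereT u (hK u)).2 0).1
    formS := fun u v => ((F.sphereS v (hL v)).2 u).2 _ ?_
    formT := fun u v => ((F.sphereT u (hK u)).2 v).2 _ ?_ }⟩⟩ <;>
  · obtain ⟨c, hc, e⟩ := hP u v
    rw [F.spanS u v (hK u) (hL v), e, hspan _ _ _ hc]
    exact Submodule.subset_span (Set.mem_insert _ _)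

end PreForm

end

noncomputable section

/-! ### Patches with a singular point on a curvature line -/

theorem Arc.valid_of_iso {A : Arc} (rad : ∀ a b, (A.hvec a b).radial = 0)
    (iso : ∀ a b, lieForm (A.hvec a b) (A.hvec a b) = 0) (hpq : lieForm A.p A.q ≠ 0) :
    A.Valid := by
  have key : ∀ a b, a ^ 4 * lieForm A.p A.p + 2 * (a ^ 3 * b) * lieForm A.p A.w +
      a ^ 2 * b ^ 2 * (lieForm A.w A.w + 2 * lieForm A.p A.q) +
      2 * (a * b ^ 3) * lieForm A.q A.w + b ^ 4 * lieForm A.q A.q = 0 := by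
    intro a b
    rw [← iso a b]
    simp only [Arc.hvec, lieForm_add_left, lieForm_add_right, lieForm_smul_left,
      lieForm_smul_right, lieForm_comm A.w A.p, lieForm_comm A.w A.q, lieForm_comm A.q A.p]
    ring
  have k1 := key 1 0
  have k2 := key 0 1
  have pp : lieForm A.p A.p = 0 := by linarith
  have qq : lieForm A.q A.q = 0 := by linarith
  have k3 := key 1 1
  have k4 := key 1 (-1)
  have k5 := key 1 2
  rw [pp, qq] at k3 k4 k5
  have pw : lieForm A.p A.w = 0 := by linarith
  have qw : lieForm A.q A.w = 0 := by linarith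
  have r1 := rad 1 0
  have r2 := rad 0 1
  have r3 := rad 1 1
  simp only [Arc.hvec, radial_add, radial_smul] at r1 r2 r3
  have rp : A.p.radial = 0 := by linarith
  have rw' : A.w.radial = 0 := by linarith
  have hp : IsPtVec A.p := ⟨fun h0 => hpq (by rw [h0, lieForm_zero_left]), rp, pp⟩
  have := hp.form_self_nonneg rw' pw
  exact ⟨rp, rw', by linarith, pp, qq, pw, qw, by linarith, lt_of_le_of_ne (by linarith) hpq⟩

/-- Polynomials have no zero divisors; the values at 0, ±1 and ±2 determine the quartic product. -/
theorem quad_mul_eq_zero {l₀ l₁ l₂ m₀ m₁ m₂ : ℝ}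
    (h : ∀ a b, quad l₀ l₁ l₂ a b * quad m₀ m₁ m₂ a b = 0) (hl : l₀ ≠ 0) (a b : ℝ) :
    quad m₀ m₁ m₂ a b = 0 := by
  have h0 := h 1 0
  have h1 := h 1 1
  have h2 := h 1 (-1)
  have h3 := h 1 2
  have h4 := h 1 (-2)
  simp only [quad] at h0 h1 h2 h3 h4
  have e0 : l₀ * m₀ = 0 := by linarith
  have m0 : m₀ = 0 := (mul_eq_zero.1 e0).resolve_left hl
  subst m0
  have e1 : l₀ * m₁ = 0 := by linarith
  have m1 : m₁ = 0 := (mul_eq_zero.1 e1).resolve_left hl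
  subst m1
  have e2 : l₀ * m₂ = 0 := by linarith
  have m2 : m₂ = 0 := (mul_eq_zero.1 e2).resolve_left hl
  subst m2
  simp [quad]

namespace PreForm

variable {L : ContactMap}

/-- The curvature line of the second family on which the first arc is at `k • y`. -/
def arcB (F : PreForm L) (y : LieSpace) (k : ℝ) : Arc where
  p := (F.l₀ * k⁻¹) • y + F.β.p
  w := (F.l₁ * k⁻¹) • y + F.β.w
  q := (F.l₂ * k⁻¹) • y + F.β.q

theorem arcB_hvec (F : PreForm L) (y : LieSpace) {k : ℝ} (hk : k ≠ 0) (c d : ℝ) :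
    quad F.l₀ F.l₁ F.l₂ c d • y + k • F.β.hvec c d = k • (F.arcB y k).hvec c d := by
  simp only [arcB, Arc.hvec, quad]
  match_scalars <;> field_simp

/-- With the first parameter fixed, division by the constant `k` leaves a single arc. This needs
only `k ≠ 0` at that parameter, so it holds even if the patch is singular elsewhere. -/
theorem lineB_eq (F : PreForm L) (u : I) (h : quad F.k₀ F.k₁ F.k₂ (F.A u) (F.B u) ≠ 0) :
    L.lineB u = (F.arcB (F.α.hvec (F.A u) (F.B u))
      (quad F.k₀ F.k₁ F.k₂ (F.A u) (F.B u))).set := by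
  ext z
  constructor
  · rintro ⟨v, hz⟩
    rw [F.mem u v z (Or.inl h), F.arcB_hvec _ h, repr_smul_iff h] at hz
    exact Arc.mem_set_hvec (F.nonnegC v) (F.nonnegE v) (F.posCE v) hz
  · rintro ⟨t, ht, hz⟩
    obtain ⟨v, hv⟩ := F.swap.reparam_surj one_pos ⟨t, ht⟩
    refine ⟨v, ?_⟩
    have hpos := F.posCE v
    have hne := hpos.ne'
    rw [F.mem u v z (Or.inl h), F.arcB_hvec _ h, repr_smul_iff h]
    have e : t = F.E v / (F.C v + F.E v) := by
      have := congrArg Subtype.val hv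
      simp only [reparam, swap, one_mul] at this
      exact this.symm
    have e1 : F.C v = (F.C v + F.E v) * (1 - t) := by rw [e]; field_simp; ring
    have e2 : F.E v = (F.C v + F.E v) * t := by rw [e]; field_simp
    have := hz.smul (pow_ne_zero 2 hne)
    rw [Arc.vec, ← Arc.hvec_smul, ← e1, ← e2] at this
    exact this

/-- If the curvature lines of one family of a patch degenerate somewhere to a point, then the
boundary arcs which run through that point are interchanged by an inversion. -/
theorem exists_strip (F : PreForm L) {y₀₀ y₀₁ y₁₀ y₁₁ : OnePoint E3} (h₀₀ : liePoint y₀₀ ∈ L 0 0)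
    (h₀₁ : liePoint y₀₁ ∈ L 0 1) (h₁₀ : liePoint y₁₀ ∈ L 1 0) (h₁₁ : liePoint y₁₁ ∈ L 1 1)
    (n₀ : y₀₀ ≠ y₀₁) (n₁ : y₁₀ ≠ y₁₁) (n₂ : y₀₀ ≠ y₁₀) {v : I}
    (hv : quad F.l₀ F.l₁ F.l₂ (F.C v) (F.E v) = 0) :
    ∃ (A B : Arc) (a : LieSpace) (l₀ l₁ l₂ : ℝ), A.Valid ∧ B.Valid ∧ l₀ ≠ 0 ∧
      B.p = A.p + l₀ • a ∧ B.w = A.w + l₁ • a ∧ B.q = A.q + l₂ • a ∧ lieForm A.p B.p < 0 ∧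
      L.lineB 0 = A.set ∧ L.lineB 1 = B.set ∧ IsRep A.p y₀₀ ∧ IsRep B.p y₁₀ ∧ IsRep A.q y₀₁ ∧
      IsRep B.q y₁₁ ∧ ∃ z, z ∈ L.lineB 0 ∧ z ∈ L.lineB 1 := by
  obtain ⟨z, hz⟩ := F.singS v hv
  have e0 : quad F.k₀ F.k₁ F.k₂ (F.A 0) (F.B 0) = F.k₀ := by simp [quad, F.A_zero, F.B_zero]
  have e1 : quad F.k₀ F.k₁ F.k₂ (F.A 1) (F.B 1) = F.k₂ := by simp [quad, F.A_one, F.B_one]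
  have a0 : F.α.hvec (F.A 0) (F.B 0) = F.α.p := by simp [Arc.hvec, F.A_zero, F.B_zero]
  have a1 : F.α.hvec (F.A 1) (F.B 1) = F.α.q := by simp [Arc.hvec, F.A_one, F.B_one]
  -- A zero of a form at an end of its interval would collapse a boundary line and identify two
  -- corners.
  have hk0 : F.k₀ ≠ 0 := fun h => by
    obtain ⟨y, hy⟩ := F.singT 0 (e0.trans h)
    exact n₀ ((F.uniq 0 0 _ _ h₀₀ (hy 0)).trans (F.uniq 0 1 _ _ (hy 1) h₀₁))
  have hk2 : F.k₂ ≠ 0 := fun h => by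
    obtain ⟨y, hy⟩ := F.singT 1 (e1.trans h)
    exact n₁ ((F.uniq 1 0 _ _ h₁₀ (hy 0)).trans (F.uniq 1 1 _ _ (hy 1) h₁₁))
  have hl0 : F.l₀ ≠ 0 := fun h => by
    obtain ⟨y, hy⟩ := F.singS 0 (by simp [quad, F.C_zero, F.E_zero, h])
    exact n₂ ((F.uniq 0 0 _ _ h₀₀ (hy 0)).trans (F.uniq 1 0 _ _ (hy 1) h₁₀))
  have s0 := F.lineB_eq 0 (by rwa [e0])
  have s1 := F.lineB_eq 1 (by rwa [e1])
  rw [e0, a0] at s0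
  rw [e1, a1] at s1
  have key : ∀ (u : I) (y : LieSpace) (k : ℝ), quad F.k₀ F.k₁ F.k₂ (F.A u) (F.B u) = k →
      F.α.hvec (F.A u) (F.B u) = y → k ≠ 0 → ∀ x x', liePoint x ∈ L u 0 → liePoint x' ∈ L u 1 →
      x ≠ x' → (F.arcB y k).Valid ∧ IsRep (F.arcB y k).p x ∧ IsRep (F.arcB y k).q x' := by
    intro u y k hk hy hk0 x x' hx hx' hne
    subst hk hy
    have r1 : IsRep (F.arcB (F.α.hvec (F.A u) (F.B u))
        (quad F.k₀ F.k₁ F.k₂ (F.A u) (F.B u))).p x := by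
      rw [F.mem u 0 _ (Or.inl hk0), F.arcB_hvec _ hk0, repr_smul_iff hk0, F.C_zero, F.E_zero] at hx
      simpa [Arc.hvec] using hx
    have r2 : IsRep (F.arcB (F.α.hvec (F.A u) (F.B u))
        (quad F.k₀ F.k₁ F.k₂ (F.A u) (F.B u))).q x' := by
      rw [F.mem u 1 _ (Or.inl hk0), F.arcB_hvec _ hk0, repr_smul_iff hk0, F.C_one, F.E_one] at hx'
      simpa [Arc.hvec] using hx'
    refine ⟨Arc.valid_of_iso ?_ ?_ ?_, r1, r2⟩
    · intro c d
      have := F.rad (F.A u) (F.B u) c d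
      rw [F.arcB_hvec _ hk0, radial_smul] at this
      exact (mul_eq_zero.1 this).resolve_left hk0
    · intro c d
      have := F.iso (F.A u) (F.B u) c d
      rw [F.arcB_hvec _ hk0, lieForm_smul_left, lieForm_smul_right] at this
      exact (mul_eq_zero.1 ((mul_eq_zero.1 this).resolve_left hk0)).resolve_left hk0
    · intro h
      exact hne ((r1.form_eq_zero_iff r2).1 h)
  obtain ⟨hA, rp, rq⟩ := key 0 _ _ e0 a0 hk0 _ _ h₀₀ h₀₁ n₀
  obtain ⟨hB, rp', rq'⟩ := key 1 _ _ e1 a1 hk2 _ _ h₁₀ h₁₁ n₁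
  set A := F.arcB F.α.p F.k₀ with hAd
  set B := F.arcB F.α.q F.k₂ with hBd
  set a := F.k₂⁻¹ • F.α.q - F.k₀⁻¹ • F.α.p with ha
  have ep : B.p = A.p + F.l₀ • a := by simp only [hAd, hBd, arcB, ha]; module
  have ew : B.w = A.w + F.l₁ • a := by simp only [hAd, hBd, arcB, ha]; module
  have eq : B.q = A.q + F.l₂ • a := by simp only [hAd, hBd, arcB, ha]; module
  have eh : ∀ c d, B.hvec c d = A.hvec c d + quad F.l₀ F.l₁ F.l₂ c d • a := by
    intro c d; simp only [Arc.hvec, ep, ew, eq, quad]; module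
  -- Both arcs are isotropic, so the quadratic form `l` times this expression vanishes identically,
  -- and `l` is not the zero polynomial. This expresses that the reflection along `a` exchanges the
  -- two arcs.
  have hm : ∀ c d, 2 * lieForm (A.hvec c d) a + quad F.l₀ F.l₁ F.l₂ c d * lieForm a a = 0 := by
    intro c d
    have := quad_mul_eq_zero (l₀ := F.l₀) (l₁ := F.l₁) (l₂ := F.l₂)
      (m₀ := 2 * lieForm A.p a + F.l₀ * lieForm a a)
      (m₁ := 2 * lieForm A.w a + F.l₁ * lieForm a a)
      (m₂ := 2 * lieForm A.q a + F.l₂ * lieForm a a) ?_ hl0 c d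
    · rw [← this]
      simp only [Arc.hvec, lieForm_add_left, lieForm_smul_left, quad]; ring
    · intro c d
      have h1 : lieForm (B.hvec c d) (B.hvec c d) = 0 := by rw [Arc.form_hvec hB]; ring
      have h2 : lieForm (A.hvec c d) (A.hvec c d) = 0 := by rw [Arc.form_hvec hA]; ring
      rw [eh] at h1
      simp only [lieForm_add_left, lieForm_add_right, lieForm_smul_left, lieForm_smul_right, h2,
        lieForm_comm a (A.hvec c d)] at h1
      rw [← h1]
      simp only [Arc.hvec, lieForm_add_left, lieForm_smul_left, quad]; ring
  have hpt : IsPtVec (A.hvec (F.C v) (F.E v)) := Arc.isPtVec_hvec hA (by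
    by_contra! hcon
    have := F.posCE v
    rw [hcon.1, hcon.2] at this
    simp at this)
  have hza : lieForm (A.hvec (F.C v) (F.E v)) a = 0 := by
    have := hm (F.C v) (F.E v)
    rw [hv] at this; linarith
  have ra : a.radial = 0 := by
    have := hB.rp
    rw [ep, radial_add, radial_smul, hA.rp, zero_add] at this
    exact (mul_eq_zero.1 this).resolve_left hl0
  -- At the zero of `l` the vector `a` is orthogonal to a point of the arc, so it is spacelike or a
  -- multiple of that point. A nonzero multiple would put both ends of the arc at the same point,
  -- and zero would merge two corners.
  have haa : 0 < lieForm a a := by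
    refine lt_of_le_of_ne (hpt.form_self_nonneg ra hza) fun h0 => ?_
    obtain ⟨c, hc⟩ := hpt.eq_smul_of_form_self ra hza h0.symm
    by_cases hc0 : c = 0
    · rw [hc0, zero_smul] at hc
      rw [hc, smul_zero, add_zero] at ep
      rw [ep] at rp'
      exact n₂ (rp.unique rp')
    · have f1 := hm 1 0
      have f2 := hm 0 1
      rw [← h0, hc] at f1 f2
      have g1 : A.hvec 1 0 = A.p := by simp [Arc.hvec]
      have g2 : A.hvec 0 1 = A.q := by simp [Arc.hvec]
      rw [g1, lieForm_smul_right, Arc.p_form_hvec hA] at f1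
      rw [g2, lieForm_smul_right, Arc.q_form_hvec hA] at f2
      have hpq := hA.pq.ne
      have f1' : F.E v = 0 := by simpa [hc0, hpq] using f1
      have f2' : F.C v = 0 := by simpa [hc0, hpq] using f2
      have := F.posCE v
      rw [f1', f2'] at this
      simp at this
  refine ⟨A, B, a, F.l₀, F.l₁, F.l₂, hA, hB, hl0, ep, ew, eq, ?_, s0, s1, rp, rp', rq, rq', z,
    ⟨v, hz 0⟩, ⟨v, hz 1⟩⟩
  have h1 := hm 1 0
  have g1 : A.hvec 1 0 = A.p := by simp [Arc.hvec]
  have g2 : quad F.l₀ F.l₁ F.l₂ 1 0 = F.l₀ := by simp [quad]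
  rw [g1, g2] at h1
  rw [ep, lieForm_add_right, lieForm_smul_right, hA.pp]
  have h2 : 0 < F.l₀ ^ 2 * lieForm a a := mul_pos (by positivity) haa
  have h3 : F.l₀ * lieForm A.p a = -(F.l₀ ^ 2 * lieForm a a) / 2 := by
    linear_combination F.l₀ / 2 * h1
  linarith

end PreForm

end

noncomputable section

/-! ### Patches spanned by two orthogonal arcs -/

namespace Arc

/-- Similarity of arcs with positive scaling factor. -/
def PSim (A B : Arc) : Prop :=
  ∃ c ρ : ℝ, 0 < c ∧ 0 < ρ ∧ B.p = c • A.p ∧ B.w = (c * ρ) • A.w ∧ B.q = (c * ρ ^ 2) • A.q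

def map (f : LieSpace →ₗ[ℝ] LieSpace) (A : Arc) : Arc := ⟨f A.p, f A.w, f A.q⟩

variable {A B C : Arc}

theorem PSim.sim (h : A.PSim B) : A.Sim B := by
  obtain ⟨c, ρ, hc, h⟩ := h
  exact ⟨c, ρ, hc.ne', h⟩

theorem PSim.symm (h : A.PSim B) : B.PSim A := by
  obtain ⟨c, ρ, hc, hρ, h1, h2, h3⟩ := h
  refine ⟨c⁻¹, ρ⁻¹, inv_pos.2 hc, inv_pos.2 hρ, ?_, ?_, ?_⟩
  · rw [h1, smul_smul, inv_mul_cancel₀ hc.ne', one_smul]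
  · rw [h2, smul_smul, show c⁻¹ * ρ⁻¹ * (c * ρ) = 1 by field_simp, one_smul]
  · rw [h3, smul_smul, show c⁻¹ * ρ⁻¹ ^ 2 * (c * ρ ^ 2) = 1 by field_simp, one_smul]

theorem PSim.trans (h : A.PSim B) (h' : B.PSim C) : A.PSim C := by
  obtain ⟨c, ρ, hc, hρ, h1, h2, h3⟩ := h
  obtain ⟨k, l, hk, hl, k1, k2, k3⟩ := h'
  refine ⟨k * c, l * ρ, mul_pos hk hc, mul_pos hl hρ, ?_, ?_, ?_⟩
  · rw [k1, h1, smul_smul]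
  · rw [k2, h2, smul_smul]; congr 1; ring
  · rw [k3, h3, smul_smul]; congr 1; ring

theorem PSim.map (h : A.PSim B) (f : LieSpace →ₗ[ℝ] LieSpace) : (A.map f).PSim (B.map f) := by
  obtain ⟨c, ρ, hc, hρ, h1, h2, h3⟩ := h
  refine ⟨c, ρ, hc, hρ, ?_, ?_, ?_⟩ <;> simp only [Arc.map]
  · rw [h1, map_smul]
  · rw [h2, map_smul]
  · rw [h3, map_smul]

theorem exists_vec_of_hvec {c ρ : ℝ} (hρ : 0 < ρ) (h : ∀ a b, B.hvec a b = c • A.hvec a (ρ * b))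
    {s : ℝ} (hs : s ∈ Set.Icc (0 : ℝ) 1) :
    ∃ t ∈ Set.Icc (0 : ℝ) 1, ∃ k : ℝ, 0 < k ∧ B.vec s = (c * k) • A.vec t := by
  have h0 := hs.1
  have h1 := hs.2
  obtain ⟨r, hr⟩ : ∃ r, r = (1 - s) + ρ * s := ⟨_, rfl⟩
  have hpos : 0 < r := by
    rw [hr]
    rcases h0.eq_or_lt with h | h
    · rw [← h]; norm_num
    · have := mul_pos hρ h; linarith
  have e2 : ρ * s = r * (ρ * s / r) := (mul_div_cancel₀ _ hpos.ne').symm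
  have e1 : 1 - s = r * (1 - ρ * s / r) := by rw [mul_sub, ← e2, hr]; ring
  refine ⟨ρ * s / r, ⟨by positivity, by rw [div_le_one hpos]; linarith⟩, r ^ 2, by positivity, ?_⟩
  rw [mul_smul, vec, vec, ← hvec_smul, ← e1, ← e2]
  exact h _ _

theorem Sim.exists_vec (h : A.Sim B) {s : ℝ} (hs : s ∈ Set.Icc (0 : ℝ) 1) :
    ∃ t ∈ Set.Icc (0 : ℝ) 1, ∃ c : ℝ, c ≠ 0 ∧ B.vec s = c • A.vec t := by
  obtain ⟨c, ρ, hc, hρ, hh⟩ := h.hvec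
  obtain ⟨t, ht, k, hk, e⟩ := exists_vec_of_hvec hρ hh hs
  exact ⟨t, ht, c * k, mul_ne_zero hc hk.ne', e⟩

theorem PSim.exists_vec (h : A.PSim B) {s : ℝ} (hs : s ∈ Set.Icc (0 : ℝ) 1) :
    ∃ t ∈ Set.Icc (0 : ℝ) 1, ∃ c : ℝ, 0 < c ∧ B.vec s = c • A.vec t := by
  obtain ⟨c, ρ, hc, hρ, e1, e2, e3⟩ := h
  have hh : ∀ a b, B.hvec a b = c • A.hvec a (ρ * b) := fun a b => by
    rw [hvec, hvec, e1, e2, e3]; module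
  obtain ⟨t, ht, k, hk, e⟩ := exists_vec_of_hvec hρ hh hs
  exact ⟨t, ht, c * k, mul_pos hc hk, e⟩

/-- The patch with the given arcs as boundary arcs, up to scaling. -/
def cross (A B : Arc) (x y : ℝ) : PatchData where
  p := A.p
  W := x • A.w - (x * lieForm A.w B.q / lieForm A.p B.q) • A.p
  d := x ^ 2 • A.q - A.p
  κ := x * lieForm A.w B.q / lieForm A.p B.q
  V := y • B.w - (y * lieForm B.w A.q / lieForm B.p A.q) • B.p
  e := y ^ 2 • B.q - B.p
  ν := y * lieForm B.w A.q / lieForm B.p A.q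

theorem cross_swap (hp : A.p = B.p) (x y : ℝ) : (cross A B x y).swap = cross B A y x := by
  simp only [cross, PatchData.swap, PatchData.mk.injEq]
  simp [hp]

theorem cross_arc₁ {x y : ℝ} (hx : 0 < x) : A.PSim (cross A B x y).arc₁ := by
  refine ⟨1, x, one_pos, hx, ?_, ?_, ?_⟩ <;> simp only [cross, PatchData.arc₁] <;> module

theorem cross_arc₂ (hp : A.p = B.p) {x y : ℝ} (hy : 0 < y) : B.PSim (cross A B x y).arc₂ := by
  rw [← PatchData.swap_arc₁, cross_swap hp]
  exact cross_arc₁ hy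

/-- The conditions under which two arcs span a patch. -/
structure Cross (A B : Arc) (x y : ℝ) : Prop where
  hA : A.Valid
  hB : B.Valid
  hp : A.p = B.p
  hw : lieForm A.w B.w = 0
  hx : 0 < x
  hy : 0 < y
  hq : x ^ 2 * y ^ 2 * lieForm A.q B.q = x ^ 2 * lieForm A.p A.q + y ^ 2 * lieForm B.p B.q

variable {x y : ℝ}

theorem Cross.swap (h : Cross A B x y) : Cross B A y x :=
  ⟨h.hB, h.hA, h.hp.symm, by rw [lieForm_comm]; exact h.hw, h.hy, h.hx, by
    rw [lieForm_comm B.q]; linear_combination h.hq⟩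

/-- The numbers κ and ν in `cross` are chosen to give ⟨W, e⟩ = 0 and ⟨d, V⟩ = 0, while `hq`, the
isotropy of the fourth corner x²·A.q + y²·B.q − p, is the relation ⟨d, e⟩ = 0. -/
theorem Cross.valid (h : Cross A B x y) (hκ : -2 < (cross A B x y).κ)
    (hν : -2 < (cross A B x y).ν) : (cross A B x y).Valid := by
  obtain ⟨hA, hB, hp, hw, hx, hy, hq⟩ := h
  have a1 := hA.pq
  have b1 := hB.pq
  have a2 := a1.ne
  have b2 := b1.ne
  have Bpp := hB.pp
  have Bpw := hB.pw
  have Bqw := hB.qw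
  have Bww := hB.ww
  have Brp := hB.rp
  rw [← hp] at b1 b2 Bpp Bpw Bww hq Brp
  have hx2 : 0 < x ^ 2 := by positivity
  have hy2 : 0 < y ^ 2 := by positivity
  constructor
  any_goals first | exact hA.rp | exact hA.pp | exact hκ | exact hν
  any_goals
    simp only [cross, ← hp, radial_sub, radial_smul, hA.rp, hA.rw, hA.rq, hB.rw, hB.rq]
    ring1
  all_goals
    simp only [cross, ← hp, lieForm_sub_left, lieForm_sub_right, lieForm_smul_left,
      lieForm_smul_right, hA.pp, hA.pw, hA.qq, hA.ww, hA.qw, Bpw, Bqw, Bww, hB.qq, hw,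
      lieForm_comm A.w A.p, lieForm_comm A.q A.p, lieForm_comm B.w A.p, lieForm_comm B.q A.p,
      lieForm_comm A.w A.q, lieForm_comm B.w B.q, lieForm_comm B.w A.q]
  any_goals
    field_simp
    ring1
  · have := mul_neg_of_pos_of_neg hx2 a1
    linarith
  · have := mul_neg_of_pos_of_neg hy2 b1
    linarith
  · linear_combination hq

/-- The boundary arc opposite to the first one. -/
def crossTop (A B : Arc) (x y : ℝ) : Arc := (cross A B x y).swap.flip.arc₂

theorem Cross.top_eq (h : Cross A B x y) : crossTop A B x y =
    ⟨y ^ 2 • B.q, x • A.w + (x * lieForm A.w B.q / lieForm A.p B.q) • (y ^ 2 • B.q - A.p),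
      x ^ 2 • A.q + y ^ 2 • B.q - A.p⟩ := by
  simp only [crossTop, cross, PatchData.swap, PatchData.flip, PatchData.arc₂, ← h.hp,
    Arc.mk.injEq]
  refine ⟨?_, ?_, ?_⟩ <;> module

theorem Cross.top_valid (h : Cross A B x y) : (crossTop A B x y).Valid := by
  rw [h.top_eq]
  obtain ⟨hA, hB, hp, hw, hx, hy, hq⟩ := h
  have a1 := hA.pq
  have b1 := hB.pq
  rw [← hp] at b1 hq
  have b2 := b1.ne
  have hx2 : 0 < x ^ 2 := by positivity
  constructor
  any_goals
    simp only [radial_sub, radial_add, radial_smul, hA.rp, hA.rw, hA.rq, hB.rq]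
    ring1
  all_goals
    simp only [lieForm_sub_left, lieForm_sub_right, lieForm_smul_left, lieForm_add_left,
      lieForm_add_right, lieForm_smul_right, hA.pp, hA.pw, hA.qq, hA.ww, hA.qw, hB.qq,
      lieForm_comm A.w A.p, lieForm_comm A.q A.p, lieForm_comm B.q A.p, lieForm_comm B.q A.q,
      lieForm_comm B.q A.w]
  · ring
  · linear_combination 2 * hq
  · field_simp; ring
  · field_simp
    linear_combination x * lieForm A.w B.q * hq
  · field_simp
    linear_combination 2 * lieForm A.p B.q ^ 2 * hq
  · have := mul_neg_of_pos_of_neg hx2 a1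
    linarith

/-- An arc is known from its ends and initial direction. The direction at `B.q` matters only modulo
`B.q`, and its coefficient at `A.p` is forced by orthogonality to `B.q`, so `γ` alone carries
information. -/
theorem Cross.top_sim (h : Cross A B x y) (hC : C.Valid) {α β γ δ₁ δ₂ : ℝ} (hα : α ≠ 0)
    (hβ : β ≠ 0) (hαγ : 0 < α * γ) (hp : C.p = α • B.q)
    (hq : C.q = β • (x ^ 2 • A.q + y ^ 2 • B.q - A.p))
    (hw : C.w = γ • A.w + δ₁ • A.p + δ₂ • B.q) : C.Sim (crossTop A B x y) := by
  have hv := h.top_valid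
  rw [h.top_eq] at hv ⊢
  have hγ : γ ≠ 0 := by rintro rfl; simp at hαγ
  have hx := h.hx
  have hy := h.hy
  have b2 : lieForm A.p B.q ≠ 0 := by rw [h.hp]; exact h.hB.pq.ne
  have e1 : γ * lieForm A.w B.q + δ₁ * lieForm A.p B.q = 0 := by
    have := hC.pw
    rw [hp, hw] at this
    simp only [lieForm_smul_left, lieForm_add_right, lieForm_smul_right, h.hB.qq,
      lieForm_comm B.q A.w, lieForm_comm B.q A.p] at this
    apply mul_left_cancel₀ hα
    linarith
  set κ := x * lieForm A.w B.q / lieForm A.p B.q with hκ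
  have e2 : x * lieForm A.w B.q = κ * lieForm A.p B.q := by rw [hκ]; field_simp
  have e3 : δ₁ = -γ * κ / x := by
    field_simp
    apply mul_right_cancel₀ b2
    linear_combination x * e1 - γ * e2
  refine sim_of_direction hC hv (c := y ^ 2 / α) (c' := β⁻¹) (k := x / γ)
    (l := (κ * y ^ 2 - x / γ * δ₂) / α) (by positivity) ?_ ?_ ?_ ?_
  · simp only [hp, smul_smul]; congr 1; field_simp
  · simp only [hq, smul_smul, inv_mul_cancel₀ hβ, one_smul]
  · rw [div_mul_div_comm]; positivity
  · simp only [hw, hp, e3]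
    match_scalars <;> field_simp
    ring

/-- If κ ≤ −2, the factor `qd κ` has a zero between 0 and 1/2. At this parameter the point does not
depend on the other one, so the bottom arc and the arc opposite to it would meet, contrary to `hne`.
-/
theorem Cross.kappa (h : Cross A B x y) (hC : C.Sim (crossTop A B x y))
    (hne : ∀ s ∈ Set.Icc (0 : ℝ) 1, ∀ t ∈ Set.Icc (0 : ℝ) 1, lieForm (A.vec s) (C.vec t) ≠ 0) :
    -2 < (cross A B x y).κ := by
  by_contra hcon
  set D := cross A B x y with hD
  obtain ⟨s, hs, hs0⟩ : ∃ s ∈ Set.Icc (0 : ℝ) (1 / 2), qd D.κ s = 0 := by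
    have hc : ContinuousOn (fun s => qd D.κ s) (Set.Icc 0 (1 / 2)) := by
      unfold qd; fun_prop
    refine intermediate_value_Icc' (by norm_num) hc ⟨?_, ?_⟩
    · unfold qd; linarith
    · simp
  have hs' : s ∈ Set.Icc (0 : ℝ) 1 := ⟨hs.1, by linarith [hs.2]⟩
  have h1 := cross_arc₁ (A := A) (B := B) (y := y) h.hx
  obtain ⟨s₁, hs₁, c₁, hc₁, e₁⟩ := h1.sim.exists_vec hs'
  obtain ⟨s₂, hs₂, c₂, hc₂, e₂⟩ := hC.exists_vec hs'
  have e3 : (crossTop A B x y).vec s = D.arc₁.vec s := by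
    rw [crossTop, PatchData.arc₂_vec, PatchData.flip_P, PatchData.swap_P, PatchData.arc₁_vec,
      PatchData.P, PatchData.P, ← hD, hs0]
    simp
  have e4 : lieForm (D.arc₁.vec s) (D.arc₁.vec s) = 0 := by
    rw [form_vec (h1.sim.valid h.hA)]; ring
  nth_rewrite 2 [← e3] at e4
  change D.arc₁.vec s = _ at e₁
  rw [e₂, e₁, lieForm_smul_left, lieForm_smul_right] at e4
  have h5 := hne s₁ hs₁ s₂ hs₂
  simp [hc₁, hc₂, h5] at e4

end Arc

end

noncomputable section

/-! ### Boxes: the four vertical faces of a cube -/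

namespace PatchData

variable {D : PatchData}

/-- The inversion which interchanges the second boundary arc with the opposite one. -/
def R (D : PatchData) : LieSpace →ₗ[ℝ] LieSpace where
  toFun z := z + D.mu z • D.d
  map_add' z w := by simp only [mu, lieForm_add_left, add_div]; module
  map_smul' c z := by simp only [mu_smul, RingHom.id_apply]; module

theorem R_apply (z : LieSpace) : D.R z = z + D.mu z • D.d := rfl

/-- Since ⟨d, d⟩ = −2⟨p, d⟩, the factor `mu z` is −2⟨z, d⟩/⟨d, d⟩, so `R` is the orthogonal
reflection along `d`. -/
theorem Valid.form_R (h : D.Valid) (z w : LieSpace) : lieForm (D.R z) (D.R w) = lieForm z w := by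
  simp only [R_apply, lieForm_add_left, lieForm_add_right, lieForm_smul_left, lieForm_smul_right,
    h.form_mu z, h.dd, lieForm_comm D.d w, h.form_mu w]
  ring

/-- The reflection sends `p` to `p + d` and fixes `V` and `e`, both being orthogonal to `d`. -/
theorem Valid.flip_arc₂ (h : D.Valid) : D.flip.arc₂ = D.arc₂.map D.R := by
  have hpd := h.pd.ne
  have hV : D.mu D.V = 0 := by rw [mu, lieForm_comm, h.dV, zero_div]
  have he : D.mu D.e = 0 := by rw [mu, lieForm_comm, h.de, zero_div]
  simp only [arc₂, Arc.map, PatchData.flip, map_add, map_smul, R_apply, h.mu_p, hV, he, Arc.mk.injEq]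
  refine ⟨?_, ?_, ?_⟩ <;> module

theorem harc_smul_vec (c s : ℝ) (z : LieSpace) :
    (D.harc (c • z)).vec s = c • (D.harc z).vec s := by
  simp only [Arc.vec, Arc.hvec, harc, mu_smul]; module

theorem Valid.R_P (h : D.Valid) (t : ℝ) : D.R (D.P 0 t) = D.P 1 t := by
  rw [R_apply, h.mu_P]
  simp only [P, qd]; module

end PatchData

/-- Two patches which meet orthogonally along their second boundary arcs. -/
structure Corner (D D' : PatchData) : Prop where
  arc : D.arc₂.PSim D'.arc₂
  WW : lieForm D.W D'.W = 0

theorem Corner.symm {D D' : PatchData} (h : Corner D D') : Corner D' D :=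
  ⟨h.arc.symm, by rw [lieForm_comm]; exact h.WW⟩

theorem Corner.onEdge {D D' : PatchData} (h : Corner D D') {z : LieSpace} (hz : D.OnEdge z) :
    D'.OnEdge z := by
  obtain ⟨t, ht, c, hc, rfl⟩ := hz
  obtain ⟨s, hs, k, hk, e⟩ := h.symm.arc.exists_vec ht
  rw [PatchData.arc₂_vec, PatchData.arc₂_vec] at e
  exact ⟨s, hs, c * k, mul_pos hc hk, by rw [e, smul_smul]⟩

/-- Four patches which form the lateral faces of a cube: `F` and `G` meet in an edge, `F'` and `G'`
are opposite to `F` and `G`. -/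
structure Box (F G F' G' : PatchData) : Prop where
  hF : F.Valid
  hG : G.Valid
  hF' : F'.Valid
  hG' : G'.Valid
  corner₀ : Corner F G
  corner₁ : Corner F.flip G'
  corner₂ : Corner G.flip F'
  corner₃ : Corner G'.flip F'.flip
  indep : ∀ m n : ℝ, m • F.d + n • G.d = 0 → m = 0 ∧ n = 0
  base : ∀ m n : ℝ, F.p ≠ m • F.d + n • G.d
  hb : ∃ m n : ℝ, 0 < n ∧ G'.d = m • F.d + n • G.d
  hc : ∃ m n : ℝ, 0 < m ∧ F'.d = m • F.d + n • G.d
  hW : ∃ k : ℝ, 0 < k ∧ F'.W = k • G.R F.W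
  hW' : ∃ k : ℝ, 0 < k ∧ G'.W = k • F.R G.W
  disj : ∀ s ∈ Set.Icc (0 : ℝ) 1, ∀ t ∈ Set.Icc (0 : ℝ) 1, ∀ s' ∈ Set.Icc (0 : ℝ) 1,
    ∀ t' ∈ Set.Icc (0 : ℝ) 1, lieForm (F.P s t) (F'.P s' t') ≠ 0
  disj' : ∀ s ∈ Set.Icc (0 : ℝ) 1, ∀ t ∈ Set.Icc (0 : ℝ) 1, ∀ s' ∈ Set.Icc (0 : ℝ) 1,
    ∀ t' ∈ Set.Icc (0 : ℝ) 1, lieForm (G.P s t) (G'.P s' t') ≠ 0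

namespace Box

variable {F G F' G' : PatchData}

theorem swap (h : Box F G F' G') : Box G F G' F' where
  hF := h.hG
  hG := h.hF
  hF' := h.hG'
  hG' := h.hF'
  corner₀ := h.corner₀.symm
  corner₁ := h.corner₂
  corner₂ := h.corner₁
  corner₃ := h.corner₃.symm
  indep m n e := (h.indep n m (by rw [add_comm]; exact e)).symm
  base m n e := by
    obtain ⟨c, ρ, hc, hρ, h1, -⟩ := h.corner₀.arc
    change G.p = c • F.p at h1
    apply h.base (c⁻¹ * n) (c⁻¹ * m)
    rw [mul_smul, mul_smul, ← smul_add, add_comm, ← e, h1, smul_smul, inv_mul_cancel₀ hc.ne',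
      one_smul]
  hb := by
    obtain ⟨m, n, hm, e⟩ := h.hc
    exact ⟨n, m, hm, by rw [e, add_comm]⟩
  hc := by
    obtain ⟨m, n, hm, e⟩ := h.hb
    exact ⟨n, m, hm, by rw [e, add_comm]⟩
  hW := h.hW'
  hW' := h.hW
  disj := h.disj'
  disj' := h.disj

/-- Both ways round the box carry the first vertical edge to the opposite one and agree there up to
a positive scalar `C` and a reparametrization by ρ. Both compositions are isometries, which gives Cρ
= 1; both are the identity on `F.p` modulo the span of `F.d` and `G.d`, which gives C = 1. -/
theorem R_comm (h : Box F G F' G') {z : LieSpace} (hz : F.OnEdge z) :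
    G'.R (F.R z) = F'.R (G.R z) := by
  have h1 : ((F.arc₂.map F.R).map G'.R).PSim ((F.arc₂.map G.R).map F'.R) := by
    have e1 := h.corner₁.arc
    have e2 := h.corner₂.arc
    have e3 := h.corner₃.arc
    rw [h.hF.flip_arc₂] at e1
    rw [h.hG.flip_arc₂] at e2
    rw [h.hF'.flip_arc₂, h.hG'.flip_arc₂] at e3
    exact (e1.map G'.R).trans (e3.trans ((((h.corner₀.arc.map G.R).trans e2).map F'.R).symm))
  obtain ⟨C, ρ, hC, hρ, ep, ew, eq⟩ := h1
  simp only [Arc.map] at ep ew eq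
  have hv := h.hF.arc₂_valid
  have hw : C * ρ = 1 := by
    have e1 : lieForm F.arc₂.w F.arc₂.w = (C * ρ) ^ 2 * lieForm F.arc₂.w F.arc₂.w := by
      conv_lhs => rw [← h.hG.form_R, ← h.hF'.form_R, ew]
      rw [lieForm_smul_left, lieForm_smul_right, h.hG'.form_R, h.hF.form_R]; ring
    have e2 : lieForm F.arc₂.w F.arc₂.w ≠ 0 := by
      rw [hv.ww]; have := hv.pq.ne; simpa using this
    have e3 : (C * ρ) ^ 2 = 1 := mul_right_cancel₀ e2 (by rw [one_mul, ← e1])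
    have e4 : 0 < C * ρ := mul_pos hC hρ
    nlinarith
  obtain ⟨m, n, hn, hb⟩ := h.hb
  obtain ⟨m', n', hm', hc⟩ := h.hc
  have hC1 : C = 1 := by
    by_contra hne
    have hne' : C - 1 ≠ 0 := sub_ne_zero.2 hne
    have e5 : ∃ m n : ℝ, (C - 1) • F.p = m • F.d + n • G.d := by
      change F'.R (G.R F.p) = C • G'.R (F.R F.p) at ep
      rw [PatchData.R_apply (D := F'), PatchData.R_apply (D := G), PatchData.R_apply (D := G'),
        PatchData.R_apply (D := F), hb, hc] at ep
      refine ⟨F'.mu (F.p + G.mu F.p • G.d) * m' -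
          C * (F.mu F.p + G'.mu (F.p + F.mu F.p • F.d) * m),
          G.mu F.p + F'.mu (F.p + G.mu F.p • G.d) * n' -
          C * (G'.mu (F.p + F.mu F.p • F.d) * n), ?_⟩
      linear_combination (norm := module) -ep
    obtain ⟨k, l, e6⟩ := e5
    apply h.base ((C - 1)⁻¹ * k) ((C - 1)⁻¹ * l)
    rw [mul_smul, mul_smul, ← smul_add, ← e6, smul_smul, inv_mul_cancel₀ hne', one_smul]
  subst hC1
  have hρ1 : ρ = 1 := by linarith
  subst hρ1
  simp only [one_mul, one_pow, one_smul] at ep ew eq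
  obtain ⟨t, ht, c, hc, rfl⟩ := hz
  rw [← PatchData.arc₂_vec, Arc.vec, Arc.hvec]
  simp only [map_smul, map_add, ep, ew, eq]

/-- The fourth vertex of the level through a point of a vertical edge. -/
theorem exists_cross (h : Box F G F' G') {z : LieSpace} (hz : F.OnEdge z) :
    ∃ x y β : ℝ, Arc.Cross (F.harc z) (G.harc z) x y ∧ β ≠ 0 ∧
      F'.R (G.R z) = β • (x ^ 2 • F.R z + y ^ 2 • G.R z - z) := by
  have hzG := h.corner₀.onEdge hz
  have hzF' := h.corner₂.onEdge (h.hG.flip_onEdge hzG)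
  have hzG' := h.corner₁.onEdge (h.hF.flip_onEdge hz)
  have μF := h.hF.onEdge_mu_pos hz
  have μG := h.hG.onEdge_mu_pos hzG
  have μF' := h.hF'.onEdge_mu_pos hzF'
  have μG' := h.hG'.onEdge_mu_pos hzG'
  obtain ⟨b₁, b₂, hb₂, hb⟩ := h.hb
  obtain ⟨c₁, c₂, hc₁, hc⟩ := h.hc
  have hs := h.R_comm hz
  have hA := h.hF.onEdge_harc hz
  have hB := h.hG.onEdge_harc hzG
  have hz0 := h.hF.onEdge_isPtVec hz
  obtain ⟨s, hsd⟩ : ∃ s, s = F'.R (G.R z) := ⟨_, rfl⟩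
  have e1 : s = z + (F.mu z + G'.mu (F.R z) * b₁) • F.d + (G'.mu (F.R z) * b₂) • G.d := by
    rw [hsd, ← hs, PatchData.R_apply (D := G'), hb, PatchData.R_apply (D := F)]; module
  have e2 : s = z + (F'.mu (G.R z) * c₁) • F.d + (G.mu z + F'.mu (G.R z) * c₂) • G.d := by
    rw [hsd, PatchData.R_apply (D := F'), hc, PatchData.R_apply (D := G)]; module
  -- The two ways round write the fourth point in terms of `F.d` and `G.d`; equating coefficients
  -- makes the weights `m` and `n` below positive, each being read off from a different way.
  obtain ⟨i1, i2⟩ := h.indep ((F.mu z + G'.mu (F.R z) * b₁) - F'.mu (G.R z) * c₁)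
    (G'.mu (F.R z) * b₂ - (G.mu z + F'.mu (G.R z) * c₂)) (by
      have := e1.symm.trans e2
      linear_combination (norm := module) this)
  obtain ⟨m, hm⟩ : ∃ m, m = F'.mu (G.R z) * c₁ / F.mu z := ⟨_, rfl⟩
  obtain ⟨n, hn⟩ : ∃ n, n = G'.mu (F.R z) * b₂ / G.mu z := ⟨_, rfl⟩
  have hm0 : 0 < m := by rw [hm]; exact div_pos (mul_pos μF' hc₁) μF
  have hn0 : 0 < n := by rw [hn]; exact div_pos (mul_pos μG' hb₂) μG
  have e3 : s = (1 - m - n) • z + m • F.R z + n • G.R z := by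
    have m1 : m * F.mu z = F'.mu (G.R z) * c₁ := by rw [hm]; field_simp
    have n1 : n * G.mu z = G'.mu (F.R z) * b₂ := by rw [hn]; field_simp
    have k2 : G.mu z + F'.mu (G.R z) * c₂ = n * G.mu z := by rw [n1]; linarith
    rw [e2, k2, ← m1, PatchData.R_apply (D := F), PatchData.R_apply (D := G)]; module
  have ss : lieForm s s = 0 := by rw [hsd, h.hF'.form_R, h.hG.form_R, hz0.iso]
  have zq : lieForm z (F.R z) < 0 := hA.pq
  have zr : lieForm z (G.R z) < 0 := hB.pq
  have qq : lieForm (F.R z) (F.R z) = 0 := hA.qq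
  have rr : lieForm (G.R z) (G.R z) = 0 := hB.qq
  -- The form is nonpositive because both points share the half cone of `z`, and nonzero because one
  -- lies on `G'` and the other on `G`.
  have qr : lieForm (F.R z) (G.R z) < 0 := by
    refine lt_of_le_of_ne (hz0.form_nonpos (Arc.isPtVec_q hA) (Arc.isPtVec_q hB) zq zr) ?_
    obtain ⟨t, ht, c, hc, e⟩ := hzG'
    obtain ⟨t', ht', c', hc', e'⟩ := hzG
    change F.R z = _ at e
    rw [e, e', map_smul, h.hG.R_P, lieForm_smul_left, lieForm_smul_right, lieForm_comm]
    have := h.disj' 1 PatchData.one_mem t' ht' 0 PatchData.zero_mem t ht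
    exact mul_ne_zero hc.ne' (mul_ne_zero hc'.ne' this)
  have iso : m * n * lieForm (F.R z) (G.R z) =
      (m + n - 1) * (m * lieForm z (F.R z) + n * lieForm z (G.R z)) := by
    rw [e3] at ss
    simp only [lieForm_add_left, lieForm_add_right, lieForm_smul_left, lieForm_smul_right,
      hz0.iso, qq, rr, lieForm_comm (F.R z) z, lieForm_comm (G.R z) z,
      lieForm_comm (G.R z) (F.R z)] at ss
    linarith
  -- In the isotropy relation the left side and the last factor are negative, so the remaining
  -- factor is positive. Dividing the fourth point by it gives the form x²·F.R z + y²·G.R z − z.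
  have hmn : 0 < m + n - 1 := by
    by_contra hcon
    have k1 := mul_neg_of_pos_of_neg (mul_pos hm0 hn0) qr
    have k2 := mul_neg_of_pos_of_neg hm0 zq
    have k3 := mul_neg_of_pos_of_neg hn0 zr
    nlinarith
  have x2 : √(m / (m + n - 1)) ^ 2 = m / (m + n - 1) := Real.sq_sqrt (by positivity)
  have y2 : √(n / (m + n - 1)) ^ 2 = n / (m + n - 1) := Real.sq_sqrt (by positivity)
  refine ⟨√(m / (m + n - 1)), √(n / (m + n - 1)), m + n - 1, ⟨hA, hB, rfl, ?_,
    Real.sqrt_pos.2 (by positivity), Real.sqrt_pos.2 (by positivity), ?_⟩, hmn.ne', ?_⟩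
  · simp only [PatchData.harc, lieForm_add_left, lieForm_add_right, lieForm_smul_left,
      lieForm_smul_right, h.corner₀.WW, h.hG.onEdge_form_W hzG, lieForm_comm F.W z,
      h.hF.onEdge_form_W hz, hz0.iso]
    ring
  · rw [x2, y2]
    change _ * lieForm (F.R z) (G.R z) = _ * lieForm z (F.R z) + _ * lieForm z (G.R z)
    field_simp
    linarith
  · rw [← hsd, e3, x2, y2]
    match_scalars <;> field_simp
    ring

/-- The curvature line of `F'` starts at `G.R z` and ends at the fourth corner. By `hW` its
direction is a positive multiple of that of `F.W` reflected by `G.R`, as for the boundary arc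
opposite to the first one in the spanned patch. -/
theorem cross_sim (h : Box F G F' G') {z : LieSpace} (hz : F.OnEdge z) {x y β : ℝ}
    (hc : Arc.Cross (F.harc z) (G.harc z) x y) (hβ : β ≠ 0)
    (hs : F'.R (G.R z) = β • (x ^ 2 • F.R z + y ^ 2 • G.R z - z)) :
    (F'.harc (G.R z)).Sim (Arc.crossTop (F.harc z) (G.harc z) x y) := by
  have hzG := h.corner₀.onEdge hz
  have hzF' := h.corner₂.onEdge (h.hG.flip_onEdge hzG)
  have μF := h.hF.onEdge_mu_pos hz
  have μG := h.hG.onEdge_mu_pos hzG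
  have μF' := h.hF'.onEdge_mu_pos hzF'
  obtain ⟨k, hk, hW⟩ := h.hW
  refine hc.top_sim (h.hF'.onEdge_harc hzF') (α := 1) (β := β)
    (γ := F'.mu (G.R z) * k / F.mu z)
    (δ₁ := -(F'.mu (G.R z) * k * F.κ / F.mu z) - F'.mu (G.R z) * k * G.mu F.W / G.mu z)
    (δ₂ := F'.κ + F'.mu (G.R z) * k * G.mu F.W / G.mu z)
    one_ne_zero hβ ?_ ?_ hs ?_
  · rw [one_mul]
    exact div_pos (mul_pos μF' hk) μF
  · exact (one_smul _ _).symm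
  · change F'.mu (G.R z) • F'.W + F'.κ • G.R z = _ • (F.mu z • F.W + F.κ • z) + _ • z + _ • G.R z
    rw [hW, PatchData.R_apply (D := G) F.W]
    have e : G.d = (G.mu z)⁻¹ • (G.R z - z) := by
      rw [PatchData.R_apply, add_sub_cancel_left, smul_smul, inv_mul_cancel₀ μG.ne', one_smul]
    generalize G.R z = r at *
    rw [e]
    have := μF.ne'
    have := μG.ne'
    match_scalars <;> field_simp <;> ring

theorem cross_kappa (h : Box F G F' G') {z : LieSpace} (hz : F.OnEdge z) {x y β : ℝ}
    (hc : Arc.Cross (F.harc z) (G.harc z) x y) (hβ : β ≠ 0)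
    (hs : F'.R (G.R z) = β • (x ^ 2 • F.R z + y ^ 2 • G.R z - z)) :
    -2 < (Arc.cross (F.harc z) (G.harc z) x y).κ := by
  refine hc.kappa (h.cross_sim hz hc hβ hs) fun s hs' t ht => ?_
  obtain ⟨t₁, ht₁, c₁, hc₁, e₁⟩ := h.corner₂.onEdge (h.hG.flip_onEdge (h.corner₀.onEdge hz))
  obtain ⟨t₂, ht₂, c₂, hc₂, rfl⟩ := hz
  change G.R _ = _ at e₁
  rw [e₁, PatchData.harc_smul_vec, PatchData.harc_smul_vec, h.hF.harc_vec, h.hF'.harc_vec,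
    lieForm_smul_left, lieForm_smul_right]
  exact mul_ne_zero hc₂.ne' (mul_ne_zero hc₁.ne' (h.disj s hs' t₂ ht₂ t ht t₁ ht₁))

/-- The patch through a point of a vertical edge whose boundary arcs are curvature lines of the
lateral faces. -/
theorem exists_level (h : Box F G F' G') {z : LieSpace} (hz : F.OnEdge z) :
    ∃ H : PatchData, H.Valid ∧ H.p = z ∧ (F.harc z).Sim H.arc₁ ∧ (G.harc z).Sim H.arc₂ ∧
      (F'.harc (G.R z)).Sim H.swap.flip.arc₂ ∧ (G'.harc (F.R z)).Sim H.flip.arc₂ := by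
  obtain ⟨x, y, β, hc, hβ, hs⟩ := h.exists_cross hz
  have hzG := h.corner₀.onEdge hz
  have hs' : G'.R (F.R z) = β • (y ^ 2 • G.R z + x ^ 2 • F.R z - z) := by
    rw [h.R_comm hz, hs, add_comm (y ^ 2 • G.R z)]
  have h1 := h.cross_kappa hz hc hβ hs
  have h2 := h.swap.cross_kappa hzG hc.swap hβ hs'
  have h3 := h.swap.cross_sim hzG hc.swap hβ hs'
  rw [← Arc.cross_swap hc.hp] at h2
  rw [Arc.crossTop, ← Arc.cross_swap hc.hp] at h3
  exact ⟨_, hc.valid h1 h2, rfl, (Arc.cross_arc₁ hc.hx).sim, (Arc.cross_arc₂ hc.hp hc.hy).sim,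
    h.cross_sim hz hc hβ hs, h3⟩

end Box

end

noncomputable section

/-! ### Realization of patches in normal form: the generic case -/

/-- The relations satisfied by a conic of isotropic vectors. -/
structure Arc.Iso (A : Arc) : Prop where
  pp : lieForm A.p A.p = 0
  qq : lieForm A.q A.q = 0
  pw : lieForm A.p A.w = 0
  qw : lieForm A.q A.w = 0
  ww : lieForm A.w A.w = -2 * lieForm A.p A.q
  pq : lieForm A.p A.q < 0

/-- Three vectors on the conic. -/
def conicTriple (A : Arc) : Fin 3 → LieSpace := ![A.p, A.p + A.w + A.q, A.q]

namespace Arc.Iso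

variable {A B : Arc}

theorem conicParam_eq (h : A.Iso) (t : ℝ) :
    conicParam (conicTriple A) t = lieForm A.p A.q • A.vec t := by
  simp only [conicParam, conicTriple, Matrix.cons_val_zero, Matrix.cons_val_one, Matrix.cons_val,
    lieForm_add_left, lieForm_add_right, h.pp, h.qq, h.pw, lieForm_comm A.w A.q, h.qw, Arc.vec,
    Arc.hvec]
  match_scalars <;> ring

theorem triple_iso (h : A.Iso) (m : Fin 3) :
    lieForm (conicTriple A m) (conicTriple A m) = 0 := by
  fin_cases m
  · exact h.pp
  · simp only [conicTriple, Fin.mk_one, Matrix.cons_val_one, Matrix.cons_val_zero,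
      lieForm_add_left, lieForm_add_right,
      h.pp, h.qq, h.pw, lieForm_comm A.w A.q, lieForm_comm A.w A.p, lieForm_comm A.q A.p, h.qw,
      h.ww]
    ring
  · exact h.qq

theorem triple_mem (A : Arc) (m : Fin 3) :
    conicTriple A m ∈ Submodule.span ℝ {A.p, A.w, A.q} := by
  have h1 : A.p ∈ Submodule.span ℝ {A.p, A.w, A.q} := Submodule.subset_span (by simp)
  have h2 : A.w ∈ Submodule.span ℝ {A.p, A.w, A.q} := Submodule.subset_span (by simp)
  have h3 : A.q ∈ Submodule.span ℝ {A.p, A.w, A.q} := Submodule.subset_span (by simp)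
  fin_cases m
  · exact h1
  · exact add_mem (add_mem h1 h2) h3
  · exact h3

theorem linearIndependent (h : A.Iso) : LinearIndependent ℝ (conicTriple A) := by
  rw [Fintype.linearIndependent_iff]
  intro g hg
  rw [Fin.sum_univ_three] at hg
  simp only [conicTriple, Matrix.cons_val_zero, Matrix.cons_val_one, Matrix.cons_val] at hg
  have k : ∀ v, lieForm v (g 0 • A.p + g 1 • (A.p + A.w + A.q) + g 2 • A.q) = 0 := fun v => by
    rw [hg, lieForm_zero_right]
  have k1 := k A.p
  have k2 := k A.q
  have k3 := k A.w
  simp only [lieForm_add_right, lieForm_smul_right, h.pp, h.qq, h.pw, h.qw, h.ww,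
    lieForm_comm A.w A.p, lieForm_comm A.w A.q, lieForm_comm A.q A.p] at k1 k2 k3
  have hpq := h.pq.ne
  have g1 : g 1 = 0 := by
    apply mul_right_cancel₀ hpq; linarith
  rw [g1] at k1 k2
  have g0 : g 0 = 0 := by
    apply mul_right_cancel₀ hpq; linarith
  have g2 : g 2 = 0 := by
    apply mul_right_cancel₀ hpq; linarith
  intro i
  fin_cases i
  · exact g0
  · exact g1
  · exact g2

theorem isCyclidicPlane (h : A.Iso) : IsCyclidicPlane (Submodule.span ℝ {A.p, A.w, A.q}) := by
  obtain ⟨r, hr⟩ : ∃ r, r = √(-2 * lieForm A.p A.q) := ⟨_, rfl⟩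
  have hpq := h.pq
  have hr0 : 0 < r := by rw [hr]; exact Real.sqrt_pos.2 (by linarith)
  have hr2 : lieForm A.p A.q = -r ^ 2 / 2 := by rw [hr, Real.sq_sqrt (by linarith)]; ring
  refine ⟨r⁻¹ • A.w, r⁻¹ • (A.p - A.q), r⁻¹ • (A.p + A.q), ?_, ?_, ?_, ?_, ?_, ?_, ?_⟩
  any_goals
    simp only [lieForm_smul_left, lieForm_smul_right, lieForm_add_left, lieForm_add_right,
      lieForm_sub_left, lieForm_sub_right, h.pp, h.qq, h.pw, h.qw, h.ww, hr2,
      lieForm_comm A.w A.p, lieForm_comm A.w A.q, lieForm_comm A.q A.p]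
    field_simp
    try ring1
  apply le_antisymm <;> rw [Submodule.span_le] <;> rintro x (rfl | rfl | rfl)
  · exact Submodule.mem_span_triple.2 ⟨0, r / 2, r / 2, by
      match_scalars <;> field_simp <;> ring⟩
  · exact Submodule.mem_span_triple.2 ⟨r, 0, 0, by match_scalars <;> field_simp <;> simp⟩
  · exact Submodule.mem_span_triple.2 ⟨0, -r / 2, r / 2, by
      match_scalars <;> field_simp <;> ring⟩
  · exact Submodule.mem_span_triple.2 ⟨0, r⁻¹, 0, by module⟩
  · exact Submodule.mem_span_triple.2 ⟨r⁻¹, 0, -r⁻¹, by module⟩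
  · exact Submodule.mem_span_triple.2 ⟨r⁻¹, 0, r⁻¹, by module⟩

theorem _root_.IsCyclidicPlane.finrank_eq {P : Submodule ℝ LieSpace} (hP : IsCyclidicPlane P) :
    Module.finrank ℝ P = 3 := by
  obtain ⟨a, b, c, aa, bb, cc, ab, ac, bc, rfl⟩ := hP
  have hli : LinearIndependent ℝ ![a, b, c] := by
    rw [Fintype.linearIndependent_iff]
    intro g hg
    rw [Fin.sum_univ_three] at hg
    simp only [Matrix.cons_val_zero, Matrix.cons_val_one, Matrix.cons_val] at hg
    have k : ∀ v, lieForm v (g 0 • a + g 1 • b + g 2 • c) = 0 := fun v => by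
      rw [hg, lieForm_zero_right]
    have k1 := k a
    have k2 := k b
    have k3 := k c
    simp only [lieForm_add_right, lieForm_smul_right, aa, bb, cc, ab, ac, bc,
      lieForm_comm b a, lieForm_comm c a, lieForm_comm c b] at k1 k2 k3
    intro i
    fin_cases i
    · change g 0 = 0; linarith
    · change g 1 = 0; linarith
    · change g 2 = 0; linarith
  have := finrank_span_eq_card hli
  rwa [Matrix.range_cons, Matrix.range_cons, Matrix.range_cons, Matrix.range_empty,
    Set.union_empty, Set.singleton_union, Set.singleton_union] at this

/-- Two orthogonal nondegenerate spaces of dimension 3 are complementary in dimension 6, so the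
orthogonal complement of one is not larger than the other. -/
theorem _root_.IsCyclidicPlane.mem_of_orthogonal {P Q : Submodule ℝ LieSpace}
    (hP : IsCyclidicPlane P) (hQ : IsCyclidicPlane Q)
    (h : ∀ v ∈ P, ∀ w ∈ Q, lieForm v w = 0) {w : LieSpace} (hw : ∀ v ∈ P, lieForm v w = 0) :
    w ∈ Q := by
  have hinf : P ⊓ Q = ⊥ := by
    rw [eq_bot_iff]
    rintro v ⟨h1, h2⟩
    exact hP.eq_zero h1 fun w hw => by rw [lieForm_comm]; exact h w hw v h2
  have hsup : P ⊔ Q = ⊤ := by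
    apply Submodule.eq_top_of_finrank_eq
    have := Submodule.finrank_sup_add_finrank_inf_eq P Q
    rw [hinf, finrank_bot, hP.finrank_eq, hQ.finrank_eq] at this
    rw [finrank_lieSpace]; omega
  obtain ⟨x, hx, y, hy, rfl⟩ := Submodule.mem_sup.1 (hsup ▸ Submodule.mem_top : w ∈ P ⊔ Q)
  have : x = 0 := hP.eq_zero hx fun v hv => by
    have h1 := hw v hv
    rw [lieForm_add_right, h v hv y hy, add_zero] at h1
    rw [lieForm_comm]; exact h1
  rw [this, zero_add]; exact hy

/-- Two conics in polar planes define a Dupin cyclide. -/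
def cyclide (hA : A.Iso) (hB : B.Iso)
    (h : ∀ s t, lieForm (A.vec s) (B.vec t) = 0) (rA : A.p.radial ≠ 0) (rB : B.p.radial ≠ 0) :
    DupinCyclide where
  plane := ![Submodule.span ℝ {A.p, A.w, A.q}, Submodule.span ℝ {B.p, B.w, B.q}]
  signature i := by
    fin_cases i
    · exact hA.isCyclidicPlane
    · exact hB.isCyclidicPlane
  polar w := by
    have hw : ∀ A : Arc, A.w = 4 • A.vec (1 / 2) - A.vec 0 - A.vec 1 := fun A => by
      simp only [Arc.vec, Arc.hvec]; module
    have key : ∀ v ∈ Submodule.span ℝ {A.p, A.w, A.q}, ∀ w ∈ Submodule.span ℝ {B.p, B.w, B.q},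
        lieForm v w = 0 := by
      intro v hv w hw'
      obtain ⟨a, b, c, rfl⟩ := Submodule.mem_span_triple.1 hv
      obtain ⟨a', b', c', rfl⟩ := Submodule.mem_span_triple.1 hw'
      rw [hw A, hw B, ← A.vec_zero, ← A.vec_one, ← B.vec_zero, ← B.vec_one]
      simp only [lieForm_add_left, lieForm_add_right, lieForm_smul_left, lieForm_smul_right,
        lieForm_sub_left, lieForm_sub_right, h, ← Nat.cast_smul_eq_nsmul ℝ]
      ring
    constructor
    · exact fun hw v hv => key v hv w hw
    · exact hA.isCyclidicPlane.mem_of_orthogonal hB.isCyclidicPlane key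
  not_circle i := by
    fin_cases i
    · exact ⟨A.p, Submodule.subset_span (by simp), rA⟩
    · exact ⟨B.p, Submodule.subset_span (by simp), rB⟩

theorem isGenericPatch (hA : A.Iso) (hB : B.Iso)
    (h : ∀ s t, lieForm (A.vec s) (B.vec t) = 0) (rA : A.p.radial ≠ 0) (rB : B.p.radial ≠ 0) :
    IsGenericPatch fun u v => Submodule.span ℝ {A.vec u, B.vec v} := by
  refine ⟨cyclide hA hB h rA rB, ![conicTriple A, conicTriple B], ?_, ?_, ?_⟩
  · intro i m
    fin_cases i
    · exact ⟨triple_mem A m, hA.triple_iso m⟩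
    · exact ⟨triple_mem B m, hB.triple_iso m⟩
  · intro i
    fin_cases i
    · exact hA.linearIndependent
    · exact hB.linearIndependent
  · intro u v
    change _ = Submodule.span ℝ {conicParam (conicTriple A) u, conicParam (conicTriple B) v}
    rw [hA.conicParam_eq, hB.conicParam_eq, Submodule.span_insert,
      Submodule.span_singleton_smul_eq hA.pq.ne.isUnit,
      Submodule.span_singleton_smul_eq hB.pq.ne.isUnit, ← Submodule.span_insert]

end Arc.Iso

namespace PatchData

variable {D : PatchData}

/-- Five linear conditions on six coordinates have a nonzero solution. It is orthogonal to `p`,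
hence spacelike or a multiple of `p`, and ⟨d, n⟩ = 0 rules out the latter. It represents the sphere
through the first boundary arc that is tangent to `V`. -/
theorem Valid.exists_normal (h : D.Valid) : ∃ n : LieSpace, n.radial = 0 ∧ lieForm n n = 1 ∧
    lieForm D.p n = 0 ∧ lieForm D.W n = 0 ∧ lieForm D.d n = 0 ∧ lieForm D.V n = 0 := by
  let φ : LieSpace →ₗ[ℝ] (Fin 5 → ℝ) :=
    { toFun := fun v => ![v.radial, lieForm D.p v, lieForm D.W v, lieForm D.d v, lieForm D.V v]
      map_add' := fun v w => by
        ext i; fin_cases i <;> simp [radial_add, lieForm_add_right]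
      map_smul' := fun c v => by
        ext i; fin_cases i <;> simp [radial_smul, lieForm_smul_right] }
  have hker : LinearMap.ker φ ≠ ⊥ := LinearMap.ker_ne_bot_of_finrank_lt (by
    rw [finrank_lieSpace]; simp)
  obtain ⟨v, hv, hv0⟩ := Submodule.exists_mem_ne_zero_of_ne_bot hker
  have hφ : φ v = 0 := hv
  have e0 : v.radial = 0 := congrFun hφ 0
  have e1 : lieForm D.p v = 0 := congrFun hφ 1
  have e2 : lieForm D.W v = 0 := congrFun hφ 2
  have e3 : lieForm D.d v = 0 := congrFun hφ 3
  have e4 : lieForm D.V v = 0 := congrFun hφ 4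
  have hpos : 0 < lieForm v v := by
    refine lt_of_le_of_ne (h.isPtVec_p.form_self_nonneg e0 e1) fun h0 => hv0 ?_
    obtain ⟨c, rfl⟩ := h.isPtVec_p.eq_smul_of_form_self e0 e1 h0.symm
    rw [lieForm_smul_right, lieForm_comm] at e3
    have : c = 0 := (mul_eq_zero.1 e3).resolve_right h.pd.ne
    rw [this, zero_smul]
  have hs := Real.sqrt_pos.2 hpos
  refine ⟨(√(lieForm v v))⁻¹ • v, ?_, ?_, ?_, ?_, ?_, ?_⟩
  · rw [radial_smul, e0, mul_zero]
  · rw [lieForm_smul_left, lieForm_smul_right]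
    nth_rewrite 3 [← Real.mul_self_sqrt hpos.le]
    field_simp
  all_goals rw [lieForm_smul_right]; simp only [e1, e2, e3, e4, mul_zero]

/-- `N` is the contact sphere along the first boundary arc. The spheres of one family are
combinations of `N` and points of that arc, those of the other start at `N`. The scalar `l` makes
the two conics orthogonal, and cancelling radii returns `P` (see `hP`). It is nonzero because the
patch does not lie on the sphere `n`. -/
theorem Valid.exists_patch_generic (h : D.Valid) {n : LieSpace} (rn : n.radial = 0)
    (nn : lieForm n n = 1) (pn : lieForm D.p n = 0) (Wn : lieForm D.W n = 0)
    (dn : lieForm D.d n = 0) (Vn : lieForm D.V n = 0) (en : lieForm D.e n ≠ 0) :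
    ∃ g : CyclidicPatch, Nonempty (RepData g.contact D) := by
  obtain ⟨l, hl⟩ : ∃ l, l = -lieForm D.e n / lieForm D.p D.e := ⟨_, rfl⟩
  have hpe := h.pe
  have hpd := h.pd
  have hpe' := hpe.ne
  have hl0 : l ≠ 0 := by rw [hl]; exact div_ne_zero (neg_ne_zero.2 en) hpe'
  have hl2 : 0 < l ^ 2 := by positivity
  obtain ⟨N, hN⟩ : ∃ N, N = n + radialUnit := ⟨_, rfl⟩
  have rN : N.radial = 1 := by rw [hN, radial_add, rn, radial_radialUnit, zero_add]
  have NN : lieForm N N = 0 := by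
    rw [hN]
    simp only [lieForm_add_left, lieForm_add_right, nn, lieForm_radialUnit,
      lieForm_radialUnit_right, rn, radial_radialUnit, radial_add]
    ring
  have hxN : ∀ x : LieSpace, x.radial = 0 → lieForm N x = lieForm x n := fun x hx => by
    rw [hN, lieForm_add_left, lieForm_radialUnit, hx, lieForm_comm]; ring
  have Np : lieForm N D.p = 0 := by rw [hxN _ h.rp, pn]
  have NW : lieForm N D.W = 0 := by rw [hxN _ h.rW, Wn]
  have Nd : lieForm N D.d = 0 := by rw [hxN _ h.rd, dn]
  have NV : lieForm N D.V = 0 := by rw [hxN _ h.rV, Vn]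
  have Ne : lieForm N D.e = -l * lieForm D.p D.e := by rw [hxN _ h.re, hl]; field_simp
  let A : Arc := ⟨N + l • D.p, D.κ • N + l • (D.W + D.κ • D.p), N + l • (D.p + D.d)⟩
  let B : Arc := ⟨N, D.ν • N - l • D.V, N - l • D.e⟩
  have hAv : ∀ s, A.vec s = qd D.κ s • N + l • D.arc₁.vec s := fun s => by
    simp only [A, Arc.vec, Arc.hvec, arc₁, qd]; module
  have hBv : ∀ t, B.vec t = qd D.ν t • (N + l • D.p) - l • D.arc₂.vec t := fun t => by
    simp only [B, Arc.vec, Arc.hvec, arc₂, qd]; module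
  have hP : ∀ s t, qd D.ν t • A.vec s - qd D.κ s • B.vec t = l • D.P s t := fun s t => by
    rw [hAv, hBv, arc₁_vec, arc₂_vec]
    simp only [P, qd_zero]; module
  have hA : A.Iso := by
    constructor <;> simp only [A, lieForm_add_left, lieForm_add_right, lieForm_smul_left,
      lieForm_smul_right, NN, Np, NW, Nd, lieForm_comm D.p N, lieForm_comm D.W N,
      lieForm_comm D.d N, h.pp, h.pW, h.WW, h.dd, h.Wd, lieForm_comm D.W D.p,
      lieForm_comm D.d D.p, lieForm_comm D.d D.W]
    any_goals ring1
    nlinarith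
  have hB : B.Iso := by
    constructor <;> simp only [B, lieForm_smul_left,
      lieForm_smul_right, lieForm_sub_left, lieForm_sub_right, NN, NV, Ne, lieForm_comm D.V N,
      lieForm_comm D.e N, h.VV, h.ee, h.Ve, lieForm_comm D.e D.V]
    any_goals ring1
    nlinarith
  have hAB : ∀ s t, lieForm (A.vec s) (B.vec t) = 0 := by
    intro s t
    simp only [A, B, Arc.vec, Arc.hvec, lieForm_add_left, lieForm_add_right, lieForm_smul_left,
      lieForm_smul_right, lieForm_sub_right, NN, Np, NW, Nd, NV, Ne,
      lieForm_comm D.p N, lieForm_comm D.W N, lieForm_comm D.d N, h.pV, h.WV, h.We, h.dV, h.de]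
    ring
  have rA : ∀ s, (A.vec s).radial = qd D.κ s := fun s => by
    rw [hAv, radial_add, radial_smul, radial_smul, rN, arc₁_vec, h.rad_P]; ring
  have rB : ∀ s, (B.vec s).radial = qd D.ν s := fun s => by
    rw [hBv, radial_sub, radial_smul, radial_smul, radial_add, rN, radial_smul, h.rp, arc₂_vec,
      h.rad_P]; ring
  have qκ : ∀ u : I, qd D.κ u ≠ 0 := fun u => (qd_pos h.hκ u.2.1 u.2.2).ne'
  have qν : ∀ u : I, qd D.ν u ≠ 0 := fun u => (qd_pos h.hν u.2.1 u.2.2).ne'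
  have hAA : ∀ s, lieForm (A.vec s) (A.vec s) = 0 := fun s => by
    simp only [Arc.vec, Arc.hvec, lieForm_add_left, lieForm_add_right, lieForm_smul_left,
      lieForm_smul_right, hA.pp, hA.qq, hA.pw, hA.qw, hA.ww, lieForm_comm A.w A.p,
      lieForm_comm A.w A.q, lieForm_comm A.q A.p]
    ring
  have hBB : ∀ s, lieForm (B.vec s) (B.vec s) = 0 := fun s => by
    simp only [Arc.vec, Arc.hvec, lieForm_add_left, lieForm_add_right, lieForm_smul_left,
      lieForm_smul_right, hB.pp, hB.qq, hB.pw, hB.qw, hB.ww, lieForm_comm B.w B.p,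
      lieForm_comm B.w B.q, lieForm_comm B.q B.p]
    ring
  have hPform : ∀ x s t, lieForm x (A.vec s) = 0 → lieForm x (B.vec t) = 0 →
      lieForm x (D.P s t) = 0 := fun x s t h1 h2 => by
    have := congrArg (lieForm x) (hP s t)
    rw [lieForm_sub_right, lieForm_smul_right, lieForm_smul_right, lieForm_smul_right, h1, h2]
      at this
    have : l * lieForm x (D.P s t) = 0 := by linarith
    exact (mul_eq_zero.1 this).resolve_left hl0
  have hPs : ∀ s t, D.P s t = (l⁻¹ * qd D.ν t) • A.vec s + (-(l⁻¹ * qd D.κ s)) • B.vec t :=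
    fun s t => by
      rw [neg_smul, ← sub_eq_add_neg, mul_smul, mul_smul, ← smul_sub, hP, smul_smul,
        inv_mul_cancel₀ hl0, one_smul]
  have rA0 : A.p.radial ≠ 0 := by rw [← A.vec_zero, rA, qd_zero]; exact one_ne_zero
  have rB0 : B.p.radial ≠ 0 := by rw [← B.vec_zero, rB, qd_zero]; exact one_ne_zero
  refine ⟨⟨fun u v => Submodule.span ℝ {A.vec u, B.vec v},
    Or.inl (hA.isGenericPatch hB hAB rA0 rB0)⟩, ⟨{
      f := id, g := id, S := fun v => B.vec v, T := fun u => A.vec u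
      f_surj := Function.surjective_id, g_surj := Function.surjective_id
      f_zero := rfl, f_one := rfl, g_zero := rfl, g_one := rfl
      spanS := fun u v => ?_
      spanT := fun u v => ?_
      radS := fun v => by rw [rB]; exact qν v
      radT := fun u => by rw [rA]; exact qκ u
      isoS := fun v => hBB v
      isoT := fun u => hAA u
      formS := fun u v => hPform _ _ _ (by rw [lieForm_comm]; exact hAB u v) (hBB v)
      formT := fun u v => hPform _ _ _ (hAA u) (hAB u v) }⟩⟩
  · simp only [id]
    rw [hPs, span_pair_comb (mul_ne_zero (inv_ne_zero hl0) (qν v))]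
  · simp only [id]
    rw [hPs, add_comm, span_pair_comb (neg_ne_zero.2 (mul_ne_zero (inv_ne_zero hl0) (qκ u))),
      Set.pair_comm]

end PatchData

end

noncomputable section

/-! ### Realization of patches in normal form: the spherical case -/

theorem unitInterval_surjective {f : I → I} (hf : Continuous f) (h0 : f 0 = 0) (h1 : f 1 = 1) :
    Function.Surjective f := fun s =>
  mem_range_of_exists_le_of_exists_ge hf ⟨0, by rw [h0]; exact unitInterval.nonneg'⟩
    ⟨1, by rw [h1]; exact unitInterval.le_one'⟩

theorem sinRatio_add_pos {δ k : ℝ} (h0 : 0 < δ) (hπ : δ < Real.pi) (hk : 0 < k) (u : I) :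
    0 < sinRatio δ (1 - u) + k * sinRatio δ u := by
  rcases (unitInterval.nonneg u).eq_or_lt with h | h
  · rw [← h, sub_zero, sinRatio_one h0 hπ, sinRatio_zero]; norm_num
  · exact add_pos_of_nonneg_of_pos (sinRatio_nonneg h0 hπ (unitInterval.one_minus_nonneg u)
      (unitInterval.one_minus_le_one u))
      (mul_pos hk (sinRatio_pos h0 hπ h (unitInterval.le_one u)))

theorem exists_sinParam {δ k : ℝ} (h0 : 0 < δ) (hπ : δ < Real.pi) (hk : 0 < k) :
    ∃ f : I → I, Continuous f ∧ f 0 = 0 ∧ f 1 = 1 ∧ ∀ u : I, ∃ r : ℝ, 0 < r ∧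
      (1 - f u : ℝ) = sinRatio δ (1 - u) / r ∧ (f u : ℝ) = k * sinRatio δ u / r := by
  have hpos := fun u : I => sinRatio_add_pos h0 hπ hk u
  have hn : ∀ u : I, 0 ≤ k * sinRatio δ u := fun u =>
    mul_nonneg hk.le (sinRatio_nonneg h0 hπ (unitInterval.nonneg u) (unitInterval.le_one u))
  have hn' : ∀ u : I, 0 ≤ sinRatio δ (1 - u) := fun u =>
    sinRatio_nonneg h0 hπ (unitInterval.one_minus_nonneg u) (unitInterval.one_minus_le_one u)
  refine ⟨fun u => ⟨k * sinRatio δ u / (sinRatio δ (1 - u) + k * sinRatio δ u),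
    div_nonneg (hn u) (hpos u).le, div_le_one_of_le₀ (by linarith [hn' u]) (hpos u).le⟩,
    ?_, ?_, ?_, fun u => ⟨_, hpos u, ?_, rfl⟩⟩
  · refine Continuous.subtype_mk (Continuous.div ?_ ?_ fun u => (hpos u).ne') _ <;>
    · unfold sinRatio; fun_prop
  · ext; simp [sinRatio_zero]
  · ext; simp [sinRatio_zero, sinRatio_one h0 hπ, hk.ne']
  · have := (hpos u).ne'
    field_simp
    ring

namespace PatchData

variable {D : PatchData}

theorem repData_of_sphere {L : ContactMap} {ω : LieSpace}
    {Pt : I → I → LieSpace} (hω : ω.radial ≠ 0) (ωω : lieForm ω ω = 0)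
    (hL : ∀ u v, L u v = Submodule.span ℝ {ω, Pt u v})
    (ωP : ∀ s t, lieForm ω (D.P s t) = 0) {f g : I → I} (hf : Continuous f) (hg : Continuous g)
    (f0 : f 0 = 0) (f1 : f 1 = 1) (g0 : g 0 = 0) (g1 : g 1 = 1)
    (hP : ∀ u v, ∃ c : ℝ, c ≠ 0 ∧ D.P (f u) (g v) = c • Pt u v) : Nonempty (RepData L D) := by
  have hs : ∀ u v, L u v = Submodule.span ℝ {D.P (f u) (g v), ω} := fun u v => by
    obtain ⟨c, hc, e⟩ := hP u v
    rw [hL, e, Set.pair_comm, Submodule.span_insert, ← Submodule.span_singleton_smul_eq hc.isUnit,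
      ← Submodule.span_insert]
  exact ⟨{
    f := f, g := g, S := fun _ => ω, T := fun _ => ω
    f_surj := unitInterval_surjective hf f0 f1
    g_surj := unitInterval_surjective hg g0 g1
    f_zero := f0, f_one := f1, g_zero := g0, g_one := g1
    spanS := hs, spanT := hs
    radS := fun _ => hω, radT := fun _ => hω, isoS := fun _ => ωω, isoT := fun _ => ωω
    formS := fun _ _ => ωP _ _, formT := fun _ _ => ωP _ _ }⟩

/-- Relations in the case that the patch lies on a sphere. -/
theorem Valid.exists_pole (h : D.Valid) {n : LieSpace} (rn : n.radial = 0)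
    (nn : lieForm n n = 1) (pn : lieForm D.p n = 0) (Wn : lieForm D.W n = 0)
    (dn : lieForm D.d n = 0) (Vn : lieForm D.V n = 0) (en : lieForm D.e n = 0) :
    ∃ f : LieSpace, f.radial = 0 ∧ lieForm f f = 0 ∧ lieForm D.p f = -1 / 2 ∧ lieForm D.W f = 0 ∧
      lieForm D.V f = 0 ∧ lieForm f n = 0 ∧
      D.d = (D.κ / 2) • D.W + ((D.κ ^ 2 - 4) / 4) • D.p + (-2 * lieForm D.p D.d) • f ∧
      D.e = (D.ν / 2) • D.V + ((D.ν ^ 2 - 4) / 4) • D.p + (-2 * lieForm D.p D.e) • f ∧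
      lieForm D.p D.e * (D.κ ^ 2 - 4) + lieForm D.p D.d * (D.ν ^ 2 - 4) = 0 := by
  obtain ⟨a, ha⟩ : ∃ a, a = -2 * lieForm D.p D.d := ⟨_, rfl⟩
  obtain ⟨b, hb⟩ : ∃ b, b = -2 * lieForm D.p D.e := ⟨_, rfl⟩
  have pd : lieForm D.p D.d = -a / 2 := by rw [ha]; ring
  have pe : lieForm D.p D.e = -b / 2 := by rw [hb]; ring
  have ha0 : 0 < a := by have := h.pd; linarith
  have hb0 : 0 < b := by have := h.pe; linarith
  have WW := h.WW
  have dd := h.dd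
  have Wd := h.Wd
  have VV := h.VV
  have ee := h.ee
  have Ve := h.Ve
  rw [pd] at WW dd Wd
  rw [pe] at VV ee Ve
  -- The vector `f` is a second point of the sphere; in the stereographic chart with `f` at infinity
  -- and `p` at the origin, `W` and `V` are the coordinate directions.
  obtain ⟨f, hf⟩ : ∃ f, f = a⁻¹ • (D.d - (D.κ / 2) • D.W - ((D.κ ^ 2 - 4) / 4) • D.p) := ⟨_, rfl⟩
  have hd : D.d = (D.κ / 2) • D.W + ((D.κ ^ 2 - 4) / 4) • D.p + a • f := by
    rw [hf, smul_smul, mul_inv_cancel₀ ha0.ne']; module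
  have rf : f.radial = 0 := by
    rw [hf]; simp only [radial_smul, radial_sub, h.rd, h.rW, h.rp]; ring
  have ff : lieForm f f = 0 := by
    rw [hf]
    simp only [lieForm_smul_left, lieForm_smul_right, lieForm_sub_left, lieForm_sub_right, dd,
      WW, Wd, pd, h.pp, h.pW, lieForm_comm D.d D.W, lieForm_comm D.d D.p, lieForm_comm D.W D.p]
    ring
  have pf : lieForm D.p f = -1 / 2 := by
    rw [hf]
    simp only [lieForm_smul_right, lieForm_sub_right, pd, h.pp, h.pW]
    field_simp; ring
  have Wf : lieForm D.W f = 0 := by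
    rw [hf]
    simp only [lieForm_smul_right, lieForm_sub_right, WW, Wd, h.pW, lieForm_comm D.W D.p]
    ring
  have Vf : lieForm D.V f = 0 := by
    rw [lieForm_comm, hf]
    simp only [lieForm_smul_left, lieForm_sub_left, h.dV, h.WV, h.pV]
    ring
  have nf : lieForm f n = 0 := by
    rw [hf]
    simp only [lieForm_smul_left, lieForm_sub_left, dn, Wn, pn]
    ring
  have ef : lieForm D.e f = (D.κ ^ 2 - 4) / 4 * (b / (2 * a)) := by
    rw [lieForm_comm, hf]
    simp only [lieForm_smul_left, lieForm_sub_left, h.de, h.We, pe]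
    field_simp; ring
  obtain ⟨γ, hγ⟩ : ∃ γ, γ = (D.κ ^ 2 - 4) / 4 * (b / a) := ⟨_, rfl⟩
  have hγa : γ * a = (D.κ ^ 2 - 4) / 4 * b := by rw [hγ]; field_simp
  -- The vector is orthogonal to `p`, `f`, `V`, `W` and `n`, which span the conformal space.
  have hy : D.e - (D.ν / 2) • D.V - b • f + γ • D.p = 0 := by
    refine h.isPtVec_p.eq_zero_of_orthogonal (q := f) (a := D.V) (b := D.W) (c := n)
      (by rw [pf]; norm_num) h.rV h.rW rn ?_ h.pV h.pW pn ?_ ?_ ?_ ?_ ?_ Vn Wn ?_ ?_ ?_ ?_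
    · simp only [radial_add, radial_sub, radial_smul, h.re, h.rV, rf, h.rp]; ring
    · simp only [lieForm_add_right, lieForm_sub_right, lieForm_smul_right, pe, h.pV, pf, h.pp]; ring
    · rw [VV]; linarith
    · rw [WW]; linarith
    · rw [nn]; norm_num
    · rw [lieForm_comm]; exact h.WV
    · simp only [lieForm_add_right, lieForm_sub_right, lieForm_smul_right, Ve, VV, Vf,
        lieForm_comm D.V D.p, h.pV]; ring
    · simp only [lieForm_add_right, lieForm_sub_right, lieForm_smul_right, h.We, h.WV, Wf,
        lieForm_comm D.W D.p, h.pW]; ring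
    · rw [lieForm_comm]
      simp only [lieForm_add_left, lieForm_sub_left, lieForm_smul_left, en, Vn, nf, pn]; ring
    · simp only [lieForm_add_right, lieForm_sub_right, lieForm_smul_right, lieForm_comm f D.e, ef,
        lieForm_comm f D.V, Vf, ff, lieForm_comm f D.p, pf, hγ]
      field_simp; ring
  have he : D.e = (D.ν / 2) • D.V - γ • D.p + b • f := by
    linear_combination (norm := module) hy
  have rel : b * (D.κ ^ 2 - 4) + a * (D.ν ^ 2 - 4) = 0 := by
    rw [he] at ee
    simp only [lieForm_add_left, lieForm_add_right, lieForm_sub_left, lieForm_sub_right,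
      lieForm_smul_left, lieForm_smul_right, VV, Vf, h.pV, h.pp, pf, ff, lieForm_comm f D.V,
      lieForm_comm f D.p, lieForm_comm D.V D.p] at ee
    apply mul_left_cancel₀ hb0.ne'
    linear_combination 4 * a * ee - 4 * b * hγa
  have hγ' : γ = -((D.ν ^ 2 - 4) / 4) := by
    apply mul_right_cancel₀ ha0.ne'; linarith
  refine ⟨f, rf, ff, pf, Wf, Vf, nf, ?_, ?_, ?_⟩
  · rw [← ha]; exact hd
  · rw [← hb]
    conv_lhs => rw [he, hγ']
    module
  · rw [pd, pe]; linarith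

end PatchData

end

/-! ### Trigonometric reparametrizations and the realization of normal forms on a sphere -/

noncomputable section

theorem exists_tanParam {r : ℝ} (hr : 0 < r) : ∃ f : I → I, Continuous f ∧ f 0 = 0 ∧ f 1 = 1 ∧
    ∀ u : I, Real.cos (u * Real.arctan r) ≠ 0 ∧ f u * r = Real.tan (u * Real.arctan r) := by
  have h0 : 0 < Real.arctan r := Real.arctan_pos.2 hr
  have hπ : Real.arctan r < Real.pi := by
    have := Real.arctan_lt_pi_div_two r
    have := Real.pi_pos
    linarith
  have hc := Real.cos_arctan_pos r
  have hs : Real.sin (Real.arctan r) = r * Real.cos (Real.arctan r) := by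
    conv_rhs => rw [← Real.tan_arctan r]
    rw [Real.arctan_tan (Real.neg_pi_div_two_lt_arctan r) (Real.arctan_lt_pi_div_two r),
      Real.tan_mul_cos hc.ne']
  obtain ⟨f, hf, f0, f1, hfu⟩ := exists_sinParam h0 hπ hc
  refine ⟨f, hf, f0, f1, fun u => ?_⟩
  obtain ⟨x, hx, e1, e2⟩ := hfu u
  have ec := sinRatio_cos h0 hπ 0 u
  rw [Real.cos_zero, zero_add, zero_add] at ec
  have hxc : x = Real.cos (u * Real.arctan r) := by
    rw [← ec]
    field_simp at e1 e2
    linear_combination e1 + e2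
  refine ⟨hxc ▸ hx.ne', ?_⟩
  rw [e2, Real.tan_eq_sin_div_cos, ← hxc, sinRatio, hs]
  field_simp

/-- The quotient of the two linear functions of `f` grows from 1 to η². This is the tangent of an
angle running from π/4 to arctan η², while the common factor `r` is irrelevant for points. -/
theorem exists_polarParam {η : ℝ} (hη : 1 < η) : ∃ a b : ℝ, a < b ∧ b < a + Real.pi ∧
    ∃ f : I → I, Continuous f ∧ f 0 = 0 ∧ f 1 = 1 ∧ ∀ u : I, ∃ r : ℝ, r ≠ 0 ∧
      1 - f u + f u / η = Real.cos (a + u * (b - a)) / r ∧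
      1 - f u + f u * η = Real.sin (a + u * (b - a)) / r := by
  have hη0 : 0 < η := by linarith
  obtain ⟨b, hb⟩ : ∃ b, b = Real.arctan (η ^ 2) := ⟨_, rfl⟩
  have hab : Real.pi / 4 < b := by
    rw [hb, ← Real.arctan_one]
    exact Real.arctan_strictMono (by nlinarith)
  have hb2 : b < Real.pi / 2 := hb ▸ Real.arctan_lt_pi_div_two _
  have hπ := Real.pi_pos
  have hc : 0 < Real.cos b := hb ▸ Real.cos_arctan_pos _
  have hs : Real.sin b = η ^ 2 * Real.cos b := by
    rw [← Real.tan_mul_cos hc.ne', hb, Real.tan_arctan]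
  have h2 : 0 < √2 / 2 := by positivity
  obtain ⟨f, hf, f0, f1, hfu⟩ := exists_sinParam (δ := b - Real.pi / 4)
    (k := η * Real.cos b / (√2 / 2)) (by linarith) (by linarith) (by positivity)
  refine ⟨Real.pi / 4, b, hab, by linarith, f, hf, f0, f1, fun u => ?_⟩
  obtain ⟨x, hx, e1, e2⟩ := hfu u
  have ec := sinRatio_cos (δ := b - Real.pi / 4) (by linarith) (by linarith) (Real.pi / 4) u
  have es := sinRatio_sin (δ := b - Real.pi / 4) (by linarith) (by linarith) (Real.pi / 4) u
  rw [add_sub_cancel, Real.cos_pi_div_four] at ec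
  rw [add_sub_cancel, Real.sin_pi_div_four, hs] at es
  refine ⟨√2 / 2 * x, by positivity, ?_, ?_⟩
  · rw [e1, e2, ← ec]; field_simp
  · rw [e1, e2, ← es]; field_simp

/-- In complex notation (1 − g) + g·exp(iφ) = exp(ivφ)/r, so the chord is traversed at a linear
angle. The three identities are the squared modulus and the real and imaginary parts of the square.
-/
theorem exists_angleParam {φ : ℝ} (h0 : 0 < φ) (hπ : φ < Real.pi) :
    ∃ g : I → I, Continuous g ∧ g 0 = 0 ∧ g 1 = 1 ∧ ∀ v : I, ∃ r : ℝ, r ≠ 0 ∧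
      qd (2 * Real.cos φ) (g v) = 1 / r ^ 2 ∧
      qd (2 * Real.cos φ) (g v) - 2 * Real.sin φ ^ 2 * (g v : ℝ) ^ 2 =
        Real.cos (v * (2 * φ)) / r ^ 2 ∧
      2 * Real.sin φ * (g v * (1 - g v) + Real.cos φ * (g v : ℝ) ^ 2) =
        Real.sin (v * (2 * φ)) / r ^ 2 := by
  obtain ⟨g, hg, g0, g1, hgv⟩ := exists_sinParam h0 hπ one_pos
  refine ⟨g, hg, g0, g1, fun v => ?_⟩
  obtain ⟨r, hr, e1, e2⟩ := hgv v
  have hs := (Real.sin_pos_of_pos_of_lt_pi h0 hπ).ne'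
  have ec := sinRatio_cos h0 hπ 0 v
  rw [Real.cos_zero, zero_add, zero_add, mul_one] at ec
  have es : sinRatio φ v * Real.sin φ = Real.sin (v * φ) := by
    rw [sinRatio]; field_simp
  have e3 : (1 - g v : ℝ) = (Real.cos (v * φ) - sinRatio φ v * Real.cos φ) / r := by
    rw [e1, ← ec]; ring
  rw [one_mul] at e2
  have h2 : (v : ℝ) * (2 * φ) = 2 * (v * φ) := by ring
  have k1 := Real.sin_sq_add_cos_sq (v * φ)
  have k2 := Real.sin_sq_add_cos_sq φ
  have hq : qd (2 * Real.cos φ) (g v) = 1 / r ^ 2 := by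
    rw [qd, e3, e2]
    field_simp
    rw [← es] at k1
    linear_combination k1 - (sinRatio φ v) ^ 2 * k2
  refine ⟨r, hr.ne', hq, ?_, ?_⟩
  · rw [hq, e2, h2, Real.cos_two_mul]
    field_simp
    rw [← es] at k1
    linear_combination -2 * k1
  · rw [e3, e2, h2, Real.sin_two_mul, ← es]
    field_simp
    ring

namespace PatchData

variable {D : PatchData}

theorem isSphereFrame_of {n n₀ e₁ e₂ ni : LieSpace} (rn : n.radial = 0)
    (nn : lieForm n n = 1) (r : n₀.radial = 0 ∧ e₁.radial = 0 ∧ e₂.radial = 0 ∧ ni.radial = 0)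
    (hn : lieForm n₀ n = 0 ∧ lieForm e₁ n = 0 ∧ lieForm e₂ n = 0 ∧ lieForm ni n = 0)
    (i : lieForm n₀ n₀ = 0 ∧ lieForm ni ni = 0 ∧ lieForm n₀ ni = -1 / 2)
    (u : lieForm e₁ e₁ = 1 ∧ lieForm e₂ e₂ = 1 ∧ lieForm e₁ e₂ = 0)
    (o : lieForm n₀ e₁ = 0 ∧ lieForm n₀ e₂ = 0 ∧ lieForm ni e₁ = 0 ∧ lieForm ni e₂ = 0) :
    IsSphereFrame (n + radialUnit) n₀ e₁ e₂ ni := by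
  have hx : ∀ x : LieSpace, x.radial = 0 → lieForm x n = 0 → lieForm (n + radialUnit) x = 0 :=
    fun x hx hn => by rw [lieForm_add_left, lieForm_radialUnit, hx, lieForm_comm, hn]; ring
  refine ⟨⟨?_, ?_⟩, r, ⟨hx _ r.1 hn.1, hx _ r.2.1 hn.2.1, hx _ r.2.2.1 hn.2.2.1,
    hx _ r.2.2.2 hn.2.2.2⟩, i, u, o⟩
  · simp only [lieForm_add_left, lieForm_add_right, nn, lieForm_radialUnit,
      lieForm_radialUnit_right, rn, radial_radialUnit, radial_add]
    ring
  · rw [radial_add, rn, radial_radialUnit]; norm_num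

theorem Valid.form_add_radialUnit_P (h : D.Valid) {n : LieSpace} (pn : lieForm D.p n = 0)
    (Wn : lieForm D.W n = 0) (dn : lieForm D.d n = 0) (Vn : lieForm D.V n = 0)
    (en : lieForm D.e n = 0) (s t : ℝ) : lieForm (n + radialUnit) (D.P s t) = 0 := by
  rw [lieForm_add_left, lieForm_radialUnit, h.rad_P, lieForm_comm]
  simp only [P, lieForm_add_left, lieForm_smul_left, pn, Wn, dn, Vn, en]
  ring

theorem Valid.exists_patch_cartesian (h : D.Valid) {n : LieSpace} (rn : n.radial = 0)
    (nn : lieForm n n = 1) (pn : lieForm D.p n = 0) (Wn : lieForm D.W n = 0)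
    (dn : lieForm D.d n = 0) (Vn : lieForm D.V n = 0) (en : lieForm D.e n = 0)
    (hκ : D.κ = 2) (hν : D.ν = 2) :
    ∃ g : CyclidicPatch, Nonempty (RepData g.contact D) := by
  obtain ⟨f, rf, ff, pf, Wf, Vf, nf, hd, he, -⟩ := h.exists_pole rn nn pn Wn dn Vn en
  obtain ⟨a, ha⟩ : ∃ a, a = √(-2 * lieForm D.p D.d) := ⟨_, rfl⟩
  obtain ⟨b, hb⟩ : ∃ b, b = √(-2 * lieForm D.p D.e) := ⟨_, rfl⟩
  have hpd := h.pd
  have hpe := h.pe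
  have ha0 : 0 < a := by rw [ha]; exact Real.sqrt_pos.2 (by linarith)
  have hb0 : 0 < b := by rw [hb]; exact Real.sqrt_pos.2 (by linarith)
  have ha2 : -2 * lieForm D.p D.d = a ^ 2 := by rw [ha, Real.sq_sqrt (by linarith)]
  have hb2 : -2 * lieForm D.p D.e = b ^ 2 := by rw [hb, Real.sq_sqrt (by linarith)]
  have WW := h.WW
  have VV := h.VV
  rw [ha2] at WW hd
  rw [hb2] at VV he
  rw [hκ] at hd
  rw [hν] at he
  have hfr : IsSphereFrame (n + radialUnit) D.p (a⁻¹ • D.W) (b⁻¹ • D.V) f := by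
    refine isSphereFrame_of rn nn ⟨h.rp, ?_, ?_, rf⟩ ⟨pn, ?_, ?_, nf⟩ ⟨h.pp, ff, pf⟩ ⟨?_, ?_, ?_⟩
      ⟨?_, ?_, ?_, ?_⟩ <;>
    simp only [radial_smul, lieForm_smul_left, lieForm_smul_right, h.rW, h.rV, Wn, Vn, WW, VV, h.WV,
      h.pW, h.pV, lieForm_comm f, Wf, Vf, mul_zero]
    all_goals field_simp
  obtain ⟨F, hF, F0, F1, hFu⟩ := exists_tanParam ha0
  obtain ⟨G, hG, G0, G1, hGu⟩ := exists_tanParam hb0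
  have hπ := Real.pi_pos
  have hA := Real.arctan_lt_pi_div_two a
  have hB := Real.arctan_lt_pi_div_two b
  refine ⟨⟨fun u v => Submodule.span ℝ {n + radialUnit, cartesianPoint D.p (a⁻¹ • D.W) (b⁻¹ • D.V) f
    (0 + u * (Real.arctan a - 0)) (0 + v * (Real.arctan b - 0))}, Or.inr ⟨_, _, _, _, _, _, _, _, _,
    hfr, Real.arctan_pos.2 ha0, by linarith, Real.arctan_pos.2 hb0, Or.inr (Or.inr ⟨by linarith,
    fun u v => rfl⟩)⟩⟩, repData_of_sphere hfr.sphere.2 hfr.sphere.1 (fun u v => rfl)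
    (h.form_add_radialUnit_P pn Wn dn Vn en) hF hG F0 F1 G0 G1 fun u v => ⟨1, one_ne_zero, ?_⟩⟩
  obtain ⟨c1, e1⟩ := hFu u
  obtain ⟨c2, e2⟩ := hGu v
  rw [zero_add, zero_add, sub_zero, sub_zero, cartesianPoint, if_neg (by tauto), ← e1, ← e2, P, hκ,
    hν, hd, he]
  simp only [qd]
  match_scalars <;> field_simp <;> ring

/-- For κ > 2 the span of `W` and `d` is Lorentzian and its isotropic lines are spanned by d − ηW
and d − η⁻¹W, where κ = η + η⁻¹. These two points are the poles of the polar net. -/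
theorem Valid.isSphereFrame_polar (h : D.Valid) {n : LieSpace} (rn : n.radial = 0)
    (nn : lieForm n n = 1) (pn : lieForm D.p n = 0) (Wn : lieForm D.W n = 0)
    (dn : lieForm D.d n = 0) (Vn : lieForm D.V n = 0) {η δ m a b : ℝ} (hη0 : η ≠ 0)
    (hκη : D.κ = η + η⁻¹) (hδη : δ = η - η⁻¹) (hδ0 : 0 < δ) (hm0 : 0 < m) (hb0 : 0 < b)
    (ha2 : lieForm D.p D.d = -a ^ 2 / 2) (hb2 : lieForm D.p D.e = -b ^ 2 / 2) (ham : a = m * δ) :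
    IsSphereFrame (n + radialUnit) ((m * δ ^ 2)⁻¹ • (D.d - η • D.W))
      (m⁻¹ • D.p - (m * δ ^ 2)⁻¹ • (D.d - η • D.W) - (m * δ ^ 2)⁻¹ • (D.d - η⁻¹ • D.W))
      (b⁻¹ • D.V) ((m * δ ^ 2)⁻¹ • (D.d - η⁻¹ • D.W)) := by
  obtain ⟨n₀, hn₀⟩ : ∃ n₀, n₀ = (m * δ ^ 2)⁻¹ • (D.d - η • D.W) := ⟨_, rfl⟩
  obtain ⟨ni, hni⟩ : ∃ ni, ni = (m * δ ^ 2)⁻¹ • (D.d - η⁻¹ • D.W) := ⟨_, rfl⟩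
  obtain ⟨e₁, he₁⟩ : ∃ e₁, e₁ = m⁻¹ • D.p - n₀ - ni := ⟨_, rfl⟩
  obtain ⟨e₂, he₂⟩ : ∃ e₂, e₂ = b⁻¹ • D.V := ⟨_, rfl⟩
  have WW := h.WW
  have dd := h.dd
  have Wd := h.Wd
  have VV := h.VV
  rw [ha2] at WW dd Wd
  rw [hb2] at VV
  rw [← hn₀, ← hni, ← he₁, ← he₂]
  have i1 : lieForm n₀ n₀ = 0 := by
    simp only [hn₀, lieForm_smul_left, lieForm_smul_right, lieForm_sub_left, lieForm_sub_right,
      dd, WW, Wd, lieForm_comm D.d D.W, hκη]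
    field_simp; ring
  have i2 : lieForm ni ni = 0 := by
    simp only [hni, lieForm_smul_left, lieForm_smul_right, lieForm_sub_left, lieForm_sub_right,
      dd, WW, Wd, lieForm_comm D.d D.W, hκη]
    field_simp; ring
  have i3 : lieForm n₀ ni = -1 / 2 := by
    have hδ2' : η ^ 2 - 1 = δ * η := by rw [hδη]; field_simp
    simp only [hn₀, hni, lieForm_smul_left, lieForm_smul_right, lieForm_sub_left,
      lieForm_sub_right, dd, WW, Wd, lieForm_comm D.d D.W, hκη, ham]
    field_simp
    linear_combination (-(η ^ 2 - 1) - δ * η) * hδ2'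
  have i4 : lieForm D.p n₀ = -m / 2 := by
    simp only [hn₀, lieForm_smul_right, lieForm_sub_right, ha2, h.pW, ham]
    field_simp; ring
  have i5 : lieForm D.p ni = -m / 2 := by
    simp only [hni, lieForm_smul_right, lieForm_sub_right, ha2, h.pW, ham]
    field_simp; ring
  refine isSphereFrame_of rn nn ⟨?_, ?_, ?_, ?_⟩ ⟨?_, ?_, ?_, ?_⟩ ⟨i1, i2, i3⟩ ⟨?_, ?_, ?_⟩
    ⟨?_, ?_, ?_, ?_⟩
  · simp only [hn₀, radial_smul, radial_sub, h.rd, h.rW]; ring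
  · simp only [he₁, hn₀, hni, radial_smul, radial_sub, h.rd, h.rW, h.rp]; ring
  · simp only [he₂, radial_smul, h.rV]; ring
  · simp only [hni, radial_smul, radial_sub, h.rd, h.rW]; ring
  · simp only [hn₀, lieForm_smul_left, lieForm_sub_left, dn, Wn]; ring
  · simp only [he₁, hn₀, hni, lieForm_smul_left, lieForm_sub_left, dn, Wn, pn]; ring
  · simp only [he₂, lieForm_smul_left, Vn]; ring
  · simp only [hni, lieForm_smul_left, lieForm_sub_left, dn, Wn]; ring
  · simp only [he₁, lieForm_smul_left, lieForm_smul_right, lieForm_sub_left, lieForm_sub_right,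
      h.pp, i1, i2, i3, i4, i5, lieForm_comm n₀ D.p, lieForm_comm ni D.p, lieForm_comm ni n₀]
    field_simp; ring
  · simp only [he₂, lieForm_smul_left, lieForm_smul_right, VV]
    field_simp
  · simp only [he₁, he₂, hn₀, hni, lieForm_smul_left, lieForm_smul_right, lieForm_sub_left, h.pV,
      h.dV, h.WV]
    ring
  · simp only [he₁, lieForm_smul_right, lieForm_sub_right, i1, i3, i4, lieForm_comm n₀ D.p]
    field_simp; ring
  · simp only [he₂, hn₀, lieForm_smul_left, lieForm_smul_right, lieForm_sub_left, h.dV, h.WV]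
    ring
  · simp only [he₁, lieForm_smul_right, lieForm_sub_right, i2, i3, i5, lieForm_comm ni D.p,
      lieForm_comm ni n₀]
    field_simp; ring
  · simp only [he₂, hni, lieForm_smul_left, lieForm_smul_right, lieForm_sub_left, h.dV, h.WV]
    ring

/-- The factor `qd D.κ s` splits as (1 − s + s/η)(1 − s + sη); the squares of these linear factors
are the weights of the poles, their product that of the angular part. -/
theorem P_eq_polar {η φ m : ℝ} {n₀ ni e₁ e₂ : LieSpace} (hη : η ≠ 0) (hκ : D.κ = η + η⁻¹)
    (hp : D.p = m • (n₀ + ni + e₁)) (hW : D.W = (m * (η - η⁻¹)) • (ni - n₀))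
    (hd : D.d = (m * (η - η⁻¹)) • (η • ni - η⁻¹ • n₀)) (hV : D.V = (2 * m * Real.sin φ) • e₂)
    (he : D.e = (-2 * Real.sin φ ^ 2 * m) • e₁ + (Real.cos φ * (2 * m * Real.sin φ)) • e₂)
    (s t : ℝ) : D.P s t = (m * qd D.ν t * (1 - s + s / η) ^ 2) • n₀ +
      (m * qd D.ν t * (1 - s + s * η) ^ 2) • ni +
      ((1 - s + s / η) * (1 - s + s * η) * m) •
      ((qd D.ν t - 2 * Real.sin φ ^ 2 * t ^ 2) • e₁ +
        (2 * Real.sin φ * (t * (1 - t) + Real.cos φ * t ^ 2)) • e₂) := by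
  have h1 : qd D.κ s = (1 - s + s / η) * (1 - s + s * η) := by
    rw [qd, hκ]; field_simp; ring
  rw [P, he, hV, hd, hW, hp, h1]
  generalize qd D.ν t = q
  match_scalars <;> field_simp <;> ring

theorem Valid.exists_patch_polar (h : D.Valid) {n : LieSpace} (rn : n.radial = 0)
    (nn : lieForm n n = 1) (pn : lieForm D.p n = 0) (Wn : lieForm D.W n = 0)
    (dn : lieForm D.d n = 0) (Vn : lieForm D.V n = 0) (en : lieForm D.e n = 0)
    (hκ : 2 < D.κ) :
    ∃ L : ContactMap, IsSphericalPatch L ∧ IsSphericalPatch L.swap ∧ Nonempty (RepData L D) := by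
  obtain ⟨f, rf, ff, pf, Wf, Vf, nf, hd, he, hrel⟩ := h.exists_pole rn nn pn Wn dn Vn en
  have hκ4 : 0 < D.κ ^ 2 - 4 := by nlinarith
  obtain ⟨δ, hδ⟩ : ∃ δ, δ = √(D.κ ^ 2 - 4) := ⟨_, rfl⟩
  have hδ0 : 0 < δ := by rw [hδ]; exact Real.sqrt_pos.2 hκ4
  have hδ2 : δ ^ 2 = D.κ ^ 2 - 4 := by rw [hδ, Real.sq_sqrt hκ4.le]
  obtain ⟨η, hη⟩ : ∃ η, η = (D.κ + δ) / 2 := ⟨_, rfl⟩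
  have hη1 : 1 < η := by linarith
  have hη0 : η ≠ 0 := by linarith
  have hηi : η⁻¹ = (D.κ - δ) / 2 := by
    rw [inv_eq_iff_eq_inv]
    apply eq_inv_of_mul_eq_one_left
    rw [hη]; linarith
  have hκη : D.κ = η + η⁻¹ := by rw [hηi, hη]; ring
  have hδη : δ = η - η⁻¹ := by rw [hηi, hη]; ring
  obtain ⟨a, ha⟩ : ∃ a, a = √(-2 * lieForm D.p D.d) := ⟨_, rfl⟩
  obtain ⟨b, hb⟩ : ∃ b, b = √(-2 * lieForm D.p D.e) := ⟨_, rfl⟩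
  have hpd := h.pd
  have hpe := h.pe
  have ha0 : 0 < a := by rw [ha]; exact Real.sqrt_pos.2 (by linarith)
  have hb0 : 0 < b := by rw [hb]; exact Real.sqrt_pos.2 (by linarith)
  have ha2 : lieForm D.p D.d = -a ^ 2 / 2 := by rw [ha, Real.sq_sqrt (by linarith)]; ring
  have hb2 : lieForm D.p D.e = -b ^ 2 / 2 := by rw [hb, Real.sq_sqrt (by linarith)]; ring
  rw [ha2, hb2, ← hδ2] at hrel
  have hν : D.ν ^ 2 < 4 := by
    have : 0 < b ^ 2 * δ ^ 2 := by positivity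
    have : 0 < a ^ 2 := by positivity
    nlinarith
  have hν1 : D.ν / 2 < 1 := by nlinarith
  have hν2 : -1 < D.ν / 2 := by have := h.hν; linarith
  obtain ⟨φ, hφ⟩ : ∃ φ, φ = Real.arccos (D.ν / 2) := ⟨_, rfl⟩
  have hφ0 : 0 < φ := by rw [hφ]; exact Real.arccos_pos.2 hν1
  have hφπ : φ < Real.pi := by
    rw [hφ]
    refine lt_of_le_of_ne (Real.arccos_le_pi _) fun h => ?_
    rw [Real.arccos_eq_pi] at h
    linarith
  have hc : D.ν = 2 * Real.cos φ := by
    rw [hφ, Real.cos_arccos hν2.le hν1.le]; ring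
  have hsin := Real.sin_pos_of_pos_of_lt_pi hφ0 hφπ
  obtain ⟨m, hm⟩ : ∃ m, m = a / δ := ⟨_, rfl⟩
  have hm0 : 0 < m := by rw [hm]; positivity
  have ham : a = m * δ := by rw [hm]; field_simp
  have hbm : b = 2 * m * Real.sin φ := by
    have h1 := Real.sin_sq_add_cos_sq φ
    have : b ^ 2 = (2 * m * Real.sin φ) ^ 2 := by
      rw [hc, ham] at hrel
      apply mul_left_cancel₀ (pow_pos hδ0 2).ne'
      linear_combination -2 * hrel - 4 * m ^ 2 * δ ^ 2 * h1
    exact (sq_eq_sq₀ hb0.le (by positivity)).1 this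
  obtain ⟨n₀, hn₀⟩ : ∃ n₀, n₀ = (m * δ ^ 2)⁻¹ • (D.d - η • D.W) := ⟨_, rfl⟩
  obtain ⟨ni, hni⟩ : ∃ ni, ni = (m * δ ^ 2)⁻¹ • (D.d - η⁻¹ • D.W) := ⟨_, rfl⟩
  obtain ⟨e₁, he₁⟩ : ∃ e₁, e₁ = m⁻¹ • D.p - n₀ - ni := ⟨_, rfl⟩
  obtain ⟨e₂, he₂⟩ : ∃ e₂, e₂ = b⁻¹ • D.V := ⟨_, rfl⟩
  have hfr : IsSphereFrame (n + radialUnit) n₀ e₁ e₂ ni := by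
    rw [he₁, he₂, hn₀, hni]
    exact h.isSphereFrame_polar rn nn pn Wn dn Vn hη0 hκη hδη hδ0 hm0 hb0 ha2 hb2 ham
  have hθ : η⁻¹ = η - δ := by linarith
  have hW : D.W = (m * δ) • (ni - n₀) := by
    rw [hn₀, hni, hθ]
    match_scalars <;> field_simp <;> ring
  have hd' : D.d = (m * δ) • (η • ni - η⁻¹ • n₀) := by
    rw [hn₀, hni, hθ]
    match_scalars <;> field_simp <;> ring
  have hp : D.p = m • (n₀ + ni + e₁) := by
    rw [he₁]; match_scalars <;> field_simp <;> ring
  have hV : D.V = b • e₂ := by rw [he₂, smul_smul, mul_inv_cancel₀ hb0.ne', one_smul]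
  have he' : D.e = (-2 * Real.sin φ ^ 2 * m) • e₁ + (Real.cos φ * b) • e₂ := by
    have hf' : f = (a ^ 2)⁻¹ • (D.d - (D.κ / 2) • D.W - (δ ^ 2 / 4) • D.p) := by
      rw [eq_inv_smul_iff₀ (pow_pos ha0 2).ne']
      rw [ha2, ← hδ2] at hd
      linear_combination (norm := module) -hd
    have h1 := Real.sin_sq_add_cos_sq φ
    have hκ' : D.κ = 2 * η - δ := by linarith
    conv_lhs => rw [he, hf']
    rw [he₁, hn₀, hni, he₂, hb2, hbm, ham, hc, hθ, hκ']
    match_scalars <;> field_simp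
    any_goals ring1
    linear_combination 4 * h1
  obtain ⟨x₀, x₁, hx, hx', F, hF, F0, F1, hFu⟩ := exists_polarParam hη1
  obtain ⟨G, hG, G0, G1, hGv⟩ := exists_angleParam hφ0 hφπ
  refine ⟨fun u v => Submodule.span ℝ {n + radialUnit, polarPoint n₀ e₁ e₂ ni
    (x₀ + u * (x₁ - x₀)) (0 + v * (2 * φ - 0))},
    ⟨_, _, _, _, _, _, _, _, _, hfr, hx, hx', by linarith, Or.inl ⟨by linarith, fun _ _ => rfl⟩⟩,
    ⟨_, _, _, _, _, _, _, _, _, hfr, hx, hx', by linarith,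
      Or.inr (Or.inl ⟨by linarith, fun _ _ => rfl⟩)⟩,
    repData_of_sphere hfr.sphere.2 hfr.sphere.1 (fun u v => rfl)
    (h.form_add_radialUnit_P pn Wn dn Vn en) hF hG F0 F1 G0 G1 fun u v => ?_⟩
  obtain ⟨r, hr, c1, c2⟩ := hFu u
  obtain ⟨ρ, hρ, c3, c4, c5⟩ := hGv v
  refine ⟨m / (r * ρ) ^ 2, by positivity, ?_⟩
  rw [P_eq_polar hη0 (hκη ▸ rfl) hp (hδη ▸ hW) (hδη ▸ hd') (hbm ▸ hV) (hbm ▸ he'), hc, c1, c2, c4, c5, c3, zero_add, sub_zero, polarPoint]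
  match_scalars <;> field_simp

/-- Every normal form is the normal form of a patch. -/
theorem Valid.exists_patch (h : D.Valid) : ∃ g : CyclidicPatch, Nonempty (RepData g.contact D) := by
  obtain ⟨n, rn, nn, pn, Wn, dn, Vn⟩ := h.exists_normal
  by_cases en : lieForm D.e n = 0
  · obtain ⟨f, -, -, -, -, -, -, -, -, hrel⟩ := h.exists_pole rn nn pn Wn dn Vn en
    have hpd := h.pd
    have hpe := h.pe
    have hκ := h.hκ
    have hν := h.hν
    -- By `hrel`, κ² − 4 and ν² − 4 have opposite signs or both vanish. The family whose constant
    -- exceeds 2 runs between two poles and is the radial one; two constants equal to 2 give the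
    -- Cartesian net.
    rcases lt_trichotomy D.κ 2 with h2 | h2 | h2
    · have h3 : 2 < D.ν := by
        have : D.κ ^ 2 - 4 < 0 := by nlinarith
        have := mul_pos_of_neg_of_neg hpe this
        by_contra! hν2
        have : D.ν ^ 2 - 4 ≤ 0 := by nlinarith
        have := mul_nonneg_of_nonpos_of_nonpos hpd.le this
        linarith
      obtain ⟨L, -, hL, ⟨R⟩⟩ := h.swap.exists_patch_polar rn nn pn Vn en Wn dn h3
      exact ⟨⟨L.swap, Or.inr hL⟩, ⟨R.swap⟩⟩
    · have h3 : D.ν = 2 := by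
        rw [h2] at hrel
        have : D.ν ^ 2 - 4 = 0 := by
          apply mul_left_cancel₀ hpd.ne; linarith
        nlinarith
      exact h.exists_patch_cartesian rn nn pn Wn dn Vn en h2 h3
    · obtain ⟨L, hL, -, ⟨R⟩⟩ := h.exists_patch_polar rn nn pn Wn dn Vn en h2
      exact ⟨⟨L, Or.inr hL⟩, ⟨R⟩⟩
  · exact h.exists_patch_generic rn nn pn Wn dn Vn en

theorem _root_.RepData.nonSingular {g : CyclidicPatch} (R : RepData g.contact D) (h : D.Valid) :
    g.NonSingular := by
  rintro z (⟨v, hv⟩ | ⟨u, hu⟩)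
  · have h0 := (R.mem_iff h).1 (hv 0)
    have h1 := (R.mem_iff h).1 (hv 1)
    have := (h.rep_inj (R.f 0).2 (R.g v).2 (R.f 1).2 (R.g v).2 h0 h1).1
    simp [R.f_zero, R.f_one] at this
  · have h0 := (R.mem_iff h).1 (hu 0)
    have h1 := (R.mem_iff h).1 (hu 1)
    have := (h.rep_inj (R.f u).2 (R.g 0).2 (R.f u).2 (R.g 1).2 h0 h1).2
    simp [R.g_zero, R.g_one] at this

end PatchData

end

noncomputable section

/-! ### Evolution of frames along edges -/

/-- Reflection in the bisecting plane changes a tangent vector, in the conformal model, by a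
multiple of the difference of its two foot points only. -/
theorem tanVec_reflection {x y : E3} (hxy : y ≠ x) (t : E3) :
    tanVec y (bisectorReflection x y t) = tanVec x t -
      (2 * inner ℝ (y - x) t / inner ℝ (y - x) (y - x)) • (liePoint y - liePoint x) := by
  have h0 : inner ℝ (y - x) (y - x) ≠ (0 : ℝ) := by
    rw [inner_self_ne_zero]; exact sub_ne_zero.2 hxy
  obtain ⟨k, hk⟩ : ∃ k : ℝ, k = 2 * inner ℝ (y - x) t / inner ℝ (y - x) (y - x) := ⟨_, rfl⟩
  have hk2 : k * inner ℝ (y - x) (y - x) = 2 * inner ℝ (y - x) t := by rw [hk]; field_simp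
  rw [bisectorReflection, ← hk]
  simp only [tanVec, liePoint_coe, Prod.mk_sub_mk, Prod.smul_mk, smul_eq_mul, Prod.mk.injEq,
    inner_sub_right, inner_smul_right, true_and, sub_self, mul_zero, and_true,
    ← real_inner_self_eq_norm_sq]
  simp only [inner_sub_left, inner_sub_right, real_inner_comm x y] at hk2 ⊢
  linear_combination -hk2

theorem inner_bisectorReflection {x y : E3} (hxy : y ≠ x) (s t : E3) :
    inner ℝ (bisectorReflection x y s) (bisectorReflection x y t) = (inner ℝ s t : ℝ) := by
  rw [← lieForm_tanVec y, tanVec_reflection hxy, tanVec_reflection hxy, ← lieForm_tanVec x]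
  have h0 : ‖y - x‖ ≠ 0 := norm_ne_zero_iff.2 (sub_ne_zero.2 hxy)
  simp only [lieForm_sub_left, lieForm_sub_right, lieForm_smul_left, lieForm_smul_right,
    lieForm_comm (tanVec x s) (liePoint _), lieForm_liePoint_tanVec', lieForm_liePoint_coe,
    (isPtVec_liePoint _).iso, real_inner_self_eq_norm_sq, lieForm_comm (liePoint (y : OnePoint E3)) (liePoint x)]
  simp only [sub_self, inner_zero_left, lieForm_tanVec]
  field_simp
  ring

/-- The vector `v` represents a positive multiple of the tangent vector `t` at `x`. -/
def IsTangent (v : LieSpace) (x t : E3) : Prop :=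
  ∃ c l : ℝ, 0 < c ∧ v = c • tanVec x t + l • liePoint x

/-- The vector `v` is a positive multiple of the standard representative of `x`. -/
def PosRep (v : LieSpace) (x : E3) : Prop := ∃ c : ℝ, 0 < c ∧ v = c • liePoint x

theorem PosRep.isRep {v : LieSpace} {x : E3} (h : PosRep v x) : IsRep v x := by
  obtain ⟨c, hc, rfl⟩ := h
  exact (repr_liePoint _).smul hc.ne'

theorem IsTangent.form_left {v w : LieSpace} {x t : E3} (h : IsTangent v x t) (hw : PosRep w x) :
    lieForm w v = 0 := by
  obtain ⟨c, l, -, rfl⟩ := h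
  obtain ⟨k, -, rfl⟩ := hw
  simp only [lieForm_smul_left, lieForm_add_right, lieForm_smul_right, lieForm_liePoint_tanVec,
    (isPtVec_liePoint _).iso]
  ring

theorem IsTangent.form {v w : LieSpace} {x s t : E3} (hv : IsTangent v x s) (hw : IsTangent w x t)
    (h : inner ℝ s t = (0 : ℝ)) : lieForm v w = 0 := by
  obtain ⟨c, l, -, rfl⟩ := hv
  obtain ⟨c', l', -, rfl⟩ := hw
  simp only [lieForm_smul_left, lieForm_add_right, lieForm_smul_right, lieForm_add_left,
    lieForm_comm (tanVec x s) (liePoint _), lieForm_liePoint_tanVec, lieForm_tanVec, h,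
    (isPtVec_liePoint _).iso]
  ring

/-- Modulo the two end points a tangent vector and its reflected image agree, and orthogonality to
`y` removes the part along `x`. So the inversion of a patch moves directions as the frames of the
cube do. -/
theorem IsTangent.evolve {v w : LieSpace} {x y t : E3} (h : IsTangent v x t) (hxy : y ≠ x)
    {m n : ℝ} (e : w = v + m • liePoint x + n • liePoint y) (hw : lieForm (liePoint y) w = 0) :
    IsTangent w y (bisectorReflection x y t) := by
  obtain ⟨c, l, hc, rfl⟩ := h
  obtain ⟨k, hk⟩ : ∃ k : ℝ, k = 2 * inner ℝ (y - x) t / inner ℝ (y - x) (y - x) := ⟨_, rfl⟩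
  have hr := tanVec_reflection hxy t
  rw [← hk] at hr
  have e' : w = c • tanVec y (bisectorReflection x y t) + (l + m - c * k) • liePoint x +
      (n + c * k) • liePoint y := by
    rw [e, hr]; module
  rw [e'] at hw
  simp only [lieForm_add_right, lieForm_smul_right, lieForm_liePoint_tanVec,
    (isPtVec_liePoint _).iso] at hw
  have hne : lieForm (liePoint (y : OnePoint E3)) (liePoint x) ≠ 0 := fun h0 =>
    hxy (OnePoint.coe_injective (liePoint_eq_iff.1 h0))
  have h0 : l + m - c * k = 0 := by
    apply mul_right_cancel₀ hne; linarith
  exact ⟨c, n + c * k, hc, by rw [e', h0]; module⟩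

/-! ### Patches with prescribed vertices and tangent directions -/

/-- The vertices of the patch `D` are `x`, `x₁`, `x₁₂`, `x₂`, and the tangent directions at `x` are
`t₁`, `t₂`. -/
structure Framed (D : PatchData) (x x₁ x₁₂ x₂ t₁ t₂ : E3) : Prop where
  p : PosRep D.p x
  q : PosRep (D.p + D.d) x₁
  s : PosRep (D.p + D.d + D.e) x₁₂
  r : PosRep (D.p + D.e) x₂
  W : IsTangent D.W x t₁
  V : IsTangent D.V x t₂

namespace Framed

variable {D : PatchData} {x x₁ x₁₂ x₂ t₁ t₂ : E3}

theorem swap (h : Framed D x x₁ x₁₂ x₂ t₁ t₂) : Framed D.swap x x₂ x₁₂ x₁ t₂ t₁ :=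
  ⟨h.p, h.r, by
    change PosRep (D.p + D.e + D.d) _
    rw [add_right_comm]; exact h.s, h.q, h.V, h.W⟩

theorem ne₁ (h : Framed D x x₁ x₁₂ x₂ t₁ t₂) (hD : D.Valid) : x₁ ≠ x := by
  rintro rfl
  have := (h.p.isRep.form_eq_zero_iff h.q.isRep).2 rfl
  rw [lieForm_add_right, hD.pp, zero_add] at this
  exact hD.pd.ne this

theorem flip (h : Framed D x x₁ x₁₂ x₂ t₁ t₂) (hD : D.Valid) : Framed D.flip x₁ x x₂ x₁₂
    (bisectorReflection x x₁ t₁) (bisectorReflection x x₁ t₂) := by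
  have hne := h.ne₁ hD
  obtain ⟨c, hc, ep⟩ := h.p
  obtain ⟨k, hk, eq⟩ := h.q
  have ed : D.d = k • liePoint x₁ - c • liePoint x := by rw [← ep, ← eq]; abel
  have hv := hD.flip
  have hk' : liePoint (x₁ : OnePoint E3) = k⁻¹ • D.flip.p := by
    change _ = _ • (D.p + D.d)
    rw [eq, smul_smul, inv_mul_cancel₀ hk.ne', one_smul]
  refine ⟨h.q, ?_, ?_, h.s, ?_, ?_⟩
  · change PosRep (D.p + D.d + -D.d) x
    rw [add_neg_cancel_right]; exact h.p
  · change PosRep (D.p + D.d + -D.d + D.e) x₂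
    rw [add_neg_cancel_right]; exact h.r
  · refine h.W.evolve hne (m := D.κ * c) (n := -(D.κ * k)) ?_ ?_
    · change D.W - D.κ • D.d = _
      rw [ed]; module
    · rw [hk', lieForm_smul_left, hv.pW, mul_zero]
  · refine h.V.evolve hne (m := 0) (n := 0) ?_ ?_
    · change D.V = _
      module
    · rw [hk', lieForm_smul_left, hv.pV, mul_zero]

/-- Common end points and common initial direction make the two arcs equal; the scale factor is
positive because both data use positive multiples of the standard representatives. -/
theorem psim (h : Framed D x x₁ x₁₂ x₂ t₁ t₂) {D' : PatchData} {y₁ y₁₂ s₁ : E3}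
    (h' : Framed D' x y₁ y₁₂ x₂ s₁ t₂) (hD : D.Valid) (hD' : D'.Valid) : D.arc₂.PSim D'.arc₂ := by
  obtain ⟨c, hc, ep⟩ := h.p
  obtain ⟨c', hc', ep'⟩ := h'.p
  obtain ⟨k, hk, er⟩ := h.r
  obtain ⟨k', hk', er'⟩ := h'.r
  obtain ⟨l, m, hl, eV⟩ := h.V
  obtain ⟨l', m', hl', eV'⟩ := h'.V
  have e1 : D'.arc₂.p = (c' / c) • D.arc₂.p := by
    change D'.p = _ • D.p
    rw [ep, ep', smul_smul, div_mul_cancel₀ _ hc.ne']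
  obtain ⟨b, ρ, hb, hρ, h1, h2⟩ := Arc.sim_of_direction (k := l' / l)
    (l := (m' + D'.ν * c' - l' / l * (m + D.ν * c)) / c) hD.arc₂_valid hD'.arc₂_valid
    (div_pos hc' hc).ne' e1 (c' := k' / k) (by
      change D'.p + D'.e = _ • (D.p + D.e)
      rw [er, er', smul_smul, div_mul_cancel₀ _ hk.ne']) (by positivity) (by
      change D'.V + D'.ν • D'.p = _ • (D.V + D.ν • D.p) + _ • D.p
      rw [ep, ep', eV, eV']
      match_scalars <;> field_simp
      ring)
  have hbc : b = c' / c := by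
    rw [e1] at h1
    have h3 := smul_left_injective ℝ hD.isPtVec_p.ne h1
    exact h3.symm
  exact ⟨b, ρ, hbc ▸ div_pos hc' hc, hρ, h1, h2⟩

theorem corner (h : Framed D x x₁ x₁₂ x₂ t₁ t₂) {D' : PatchData} {y₁ y₁₂ s₁ : E3}
    (h' : Framed D' x y₁ y₁₂ x₂ s₁ t₂) (hD : D.Valid) (hD' : D'.Valid)
    (ho : inner ℝ t₁ s₁ = (0 : ℝ)) : Corner D D' :=
  ⟨h.psim h' hD hD', h.W.form h'.W ho⟩

/-- The frame at a neighbouring vertex of a patch, seen from the neighbouring patch. -/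
theorem W_eq {G F' : PatchData} {x₃ x₂₃ x₁₃ y t₃ : E3} (h : Framed D x x₁ x₁₂ x₂ t₁ t₂)
    (hG : Framed G x x₃ x₂₃ x₂ t₃ t₂) (hF' : Framed F' x₃ x₁₃ y x₂₃ (bisectorReflection x x₃ t₁)
      (bisectorReflection x x₃ t₂)) (hD : D.Valid) (hGv : G.Valid) (hFv' : F'.Valid) :
    ∃ k : ℝ, 0 < k ∧ F'.W = k • G.R D.W := by
  have hne := hG.ne₁ hGv
  obtain ⟨c, hc, ep⟩ := hG.p
  obtain ⟨k, hk, eq⟩ := hG.q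
  have ed : G.d = k • liePoint x₃ - c • liePoint x := by rw [← ep, ← eq]; abel
  have hq : liePoint (x₃ : OnePoint E3) = k⁻¹ • G.R G.p := by
    rw [PatchData.R_apply, hGv.mu_p, one_smul, eq, smul_smul, inv_mul_cancel₀ hk.ne', one_smul]
  have h1 : IsTangent (G.R D.W) x₃ (bisectorReflection x x₃ t₁) := by
    refine h.W.evolve hne (m := -(G.mu D.W * c)) (n := G.mu D.W * k) ?_ ?_
    · rw [PatchData.R_apply, ed]; module
    · rw [hq, lieForm_smul_left, hGv.form_R, h.W.form_left hG.p, mul_zero]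
  have he : lieForm (G.p + G.e) D.W = 0 := by
    obtain ⟨l, hl, er⟩ := hG.r
    obtain ⟨l', hl', er'⟩ := h.r
    have : lieForm (D.p + D.e) D.W = 0 := by
      rw [lieForm_add_left, hD.pW, lieForm_comm, hD.We, zero_add]
    rw [er', lieForm_smul_left] at this
    rw [er, lieForm_smul_left, (mul_eq_zero.1 this).resolve_left hl'.ne', mul_zero]
  have hs : lieForm (liePoint (x₂₃ : OnePoint E3)) (G.R D.W) = 0 := by
    obtain ⟨l, hl, es⟩ := hG.s
    have : G.R (G.p + G.e) = G.p + G.d + G.e := by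
      rw [← PatchData.P_zero_one, hGv.R_P, PatchData.P_one_one]
    rw [es] at this
    have h2 := hGv.form_R (G.p + G.e) D.W
    rw [this, lieForm_smul_left, he] at h2
    exact (mul_eq_zero.1 h2).resolve_left hl.ne'
  have hs' : lieForm (liePoint (x₂₃ : OnePoint E3)) F'.W = 0 := by
    obtain ⟨l, hl, es⟩ := hF'.r
    have : lieForm (F'.p + F'.e) F'.W = 0 := by
      rw [lieForm_add_left, hFv'.pW, lieForm_comm, hFv'.We, zero_add]
    rw [es, lieForm_smul_left] at this
    exact (mul_eq_zero.1 this).resolve_left hl.ne'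
  have hne' : lieForm (liePoint (x₂₃ : OnePoint E3)) (liePoint x₃) ≠ 0 := fun h0 =>
    hF'.swap.ne₁ hFv'.swap (OnePoint.coe_injective (liePoint_eq_iff.1 h0))
  obtain ⟨a, l, ha, e1⟩ := h1
  obtain ⟨a', l', ha', e2⟩ := hF'.W
  refine ⟨a' / a, div_pos ha' ha, ?_⟩
  rw [e1, lieForm_add_right, lieForm_smul_right, lieForm_smul_right] at hs
  rw [e2, lieForm_add_right, lieForm_smul_right, lieForm_smul_right] at hs'
  have hll : l' = a' / a * l := by
    rw [div_mul_eq_mul_div, eq_div_iff ha.ne']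
    apply mul_right_cancel₀ hne'
    linear_combination a * hs' - a' * hs
  rw [e1, e2, hll]
  match_scalars <;> field_simp

end Framed

/-- The normal form of a patch with prescribed vertices and tangents. -/
theorem PatchData.Valid.exists_framed {L : ContactMap} {D : PatchData} (hD : D.Valid)
    (R : RepData L D) {x x₁ x₁₂ x₂ t₁ t₂ : E3} (h₀₀ : liePoint x ∈ L 0 0)
    (h₁₁ : liePoint x₁₂ ∈ L 1 1) (n₁ : x₁ ≠ x) (n₂ : x₂ ≠ x) (u₁ : inner ℝ t₁ t₁ = (1 : ℝ))
    (u₂ : inner ℝ t₂ t₂ = (1 : ℝ)) (hA : L.lineA 0 = circularArc x t₁ x₁)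
    (hB : L.lineB 0 = circularArc x t₂ x₂) :
    ∃ D' : PatchData, D'.Valid ∧ Nonempty (RepData L D') ∧ Framed D' x x₁ x₁₂ x₂ t₁ t₂ := by
  rw [R.mem_iff hD, R.f_zero, R.g_zero] at h₀₀
  change IsRep (D.P 0 0) x at h₀₀
  rw [PatchData.P_zero_zero] at h₀₀
  obtain ⟨c, hc, ec⟩ := h₀₀.exists_ne
  have hc' := inv_ne_zero hc
  have hD' := hD.scale hc'
  have R' := R.scale hc'
  have ep : (D.scale c⁻¹).p = liePoint x := by
    change c⁻¹ • D.p = _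
    rw [ec, smul_smul, inv_mul_cancel₀ hc, one_smul]
  generalize D.scale c⁻¹ = E at *
  have key : ∀ {E : PatchData}, E.Valid → E.p = liePoint x → ∀ {x₁ t₁ : E3}, x₁ ≠ x →
      inner ℝ t₁ t₁ = (1 : ℝ) → E.arc₁.set = circularArc x t₁ x₁ →
      PosRep (E.p + E.d) x₁ ∧ IsTangent E.W x t₁ := by
    intro E hE ep x₁ t₁ n₁ u₁ hs
    rw [circularArc_eq n₁ u₁] at hs
    have hl : 0 < ‖x₁ - x‖ := norm_pos_iff.2 (sub_ne_zero.2 n₁)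
    obtain ⟨ρ, hρ, h1, h2⟩ := Arc.sim_of_set_eq (edgeArcData_valid n₁ u₁) hE.arc₁_valid one_ne_zero
      (by rw [one_smul]; exact ep) hs.symm
    refine ⟨⟨1 * ρ ^ 2, by positivity, h2⟩, ⟨ρ * ‖x₁ - x‖,
      ρ * ‖x₁ - x‖ * (2 * inner ℝ (x₁ - x) t₁ / ‖x₁ - x‖ ^ 2) - E.κ, by positivity, ?_⟩⟩
    change E.W + E.κ • E.p = (1 * ρ) • (‖x₁ - x‖ • (_ + _)) at h1
    rw [ep] at h1
    linear_combination (norm := module) h1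
  obtain ⟨q, W⟩ := key hD' ep n₁ u₁ (by rw [← R'.lineA_zero hD', hA])
  obtain ⟨r, V⟩ := key hD'.swap ep n₂ u₂ (by rw [PatchData.swap_arc₁, ← R'.lineB_zero hD', hB])
  refine ⟨E, hD', ⟨R'⟩, ⟨1, one_pos, by rw [ep, one_smul]⟩, q, ?_, r, W, V⟩
  rw [R'.mem_iff hD', R'.f_one, R'.g_one] at h₁₁
  change IsRep (E.P 1 1) x₁₂ at h₁₁
  rw [PatchData.P_one_one] at h₁₁
  obtain ⟨k, hk, ek⟩ := h₁₁.exists_ne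
  refine ⟨k, ?_, ek⟩
  -- The fourth corner lies on the half cone of `p`, so its scalar is positive.
  have h1 : lieForm E.p (E.p + E.d + E.e) < 0 := by
    rw [lieForm_add_right, lieForm_add_right, hD'.pp]
    linarith [hD'.pd, hD'.pe]
  rw [ek, ep, lieForm_smul_right, lieForm_liePoint_coe] at h1
  by_contra hneg
  have : 0 ≤ k * (-‖x₁₂ - x‖ ^ 2 / 2) :=
    mul_nonneg_of_nonpos_of_nonpos (not_lt.1 hneg) (by have := sq_nonneg ‖x₁₂ - x‖; linarith)
  linarith

end

noncomputable section

/-! ### The faces of a cube -/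

/-- A zero of `l` would be a singular point lying on both boundary arcs of the second family. By
`exists_strip` these arcs are still related by an inversion, so the opposite one leaves `x₁` in the
reflected direction and is the arc that is assumed disjoint from the first. -/
theorem PreForm.quad_ne_zero {L : ContactMap} (F : PreForm L) {x x₁ x₁₂ x₂ t₂ : E3}
    (h₀₀ : liePoint x ∈ L 0 0) (h₁₀ : liePoint x₁ ∈ L 1 0) (h₁₁ : liePoint x₁₂ ∈ L 1 1)
    (h₀₁ : liePoint x₂ ∈ L 0 1) (n₁ : x₁ ≠ x) (n₂ : x₂ ≠ x) (n₁₂ : x₁₂ ≠ x₁)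
    (u₂ : inner ℝ t₂ t₂ = (1 : ℝ)) (hB : L.lineB 0 = circularArc x t₂ x₂)
    (hd : Disjoint (circularArc x t₂ x₂) (circularArc x₁ (bisectorReflection x x₁ t₂) x₁₂))
    (v : I) : quad F.l₀ F.l₁ F.l₂ (F.C v) (F.E v) ≠ 0 := by
  intro hv
  have coe_ne : ∀ {y z : E3}, y ≠ z → (z : OnePoint E3) ≠ y := fun h h' =>
    h (OnePoint.coe_injective h').symm
  obtain ⟨A, B, a, l₀, l₁, l₂, hA, hB', hl₀, ep, ew, -, hneg, s0, s1, rp, rp', -, rq', z, hz0,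
    hz1⟩ := F.exists_strip h₀₀ h₀₁ h₁₀ h₁₁ (coe_ne n₂) (coe_ne n₁₂) (coe_ne n₁) hv
  have u₂' : inner ℝ (bisectorReflection x x₁ t₂) (bisectorReflection x x₁ t₂) = (1 : ℝ) := by
    rw [inner_bisectorReflection n₁, u₂]
  rw [hB] at s0 hz0
  refine Set.disjoint_left.1 hd hz0 ?_
  rw [s1] at hz1
  obtain ⟨c, hc, ec⟩ := rp.exists_ne
  obtain ⟨b, hb, eb⟩ := rp'.exists_ne
  obtain ⟨b', hb', eb'⟩ := rq'.exists_ne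
  rw [circularArc_eq n₂ u₂] at s0
  obtain ⟨ρ, hρ, h1, h2⟩ := Arc.sim_of_set_eq (edgeArcData_valid n₂ u₂) hA hc ec s0
  have hlen : 0 < ‖x₂ - x‖ := norm_pos_iff.2 (sub_ne_zero.2 n₂)
  have hlen' : 0 < ‖x₁₂ - x₁‖ := norm_pos_iff.2 (sub_ne_zero.2 n₁₂)
  have ht : IsTangent (c • A.w) x t₂ := by
    refine ⟨c ^ 2 * ρ * ‖x₂ - x‖,
      c ^ 2 * ρ * ‖x₂ - x‖ * (2 * inner ℝ (x₂ - x) t₂ / ‖x₂ - x‖ ^ 2), by positivity, ?_⟩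
    rw [h1, edgeArcData]
    module
  have ea : a = l₀⁻¹ • (B.p - A.p) := by
    rw [ep, add_sub_cancel_left, smul_smul, inv_mul_cancel₀ hl₀, one_smul]
  have ht' : IsTangent (c • B.w) x₁ (bisectorReflection x x₁ t₂) := by
    refine ht.evolve n₁ (m := -(c * l₁ * l₀⁻¹ * c)) (n := c * l₁ * l₀⁻¹ * b) ?_ ?_
    · rw [ew, ea, ec, eb]; module
    · have := hB'.pw
      rw [eb, lieForm_smul_left] at this
      rw [lieForm_smul_right, (mul_eq_zero.1 this).resolve_left hb, mul_zero]
  obtain ⟨C, m, hC, e⟩ := ht'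
  -- Equal signs of the two scalars ensure that the reflected direction is not reversed.
  have hbc : 0 < b * c := by
    rw [ec, eb, lieForm_smul_left, lieForm_smul_right, lieForm_liePoint_coe] at hneg
    by_contra hcon
    have : 0 ≤ b * c * (-‖x₁ - x‖ ^ 2 / 2) :=
      mul_nonneg_of_nonpos_of_nonpos (not_lt.1 hcon) (by have := sq_nonneg ‖x₁ - x‖; linarith)
    linarith
  have hw : B.w = c⁻¹ • (C • tanVec x₁ (bisectorReflection x x₁ t₂) + m • liePoint x₁) := by
    rw [← e, smul_smul, inv_mul_cancel₀ hc, one_smul]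
  rw [circularArc_eq n₁₂ u₂']
  have hsim : (edgeArcData x₁ (bisectorReflection x x₁ t₂) x₁₂).Sim B := by
    refine Arc.sim_of_direction (edgeArcData_valid n₁₂ u₂') hB' (c := b) (c' := b')
      (k := C / (c * ‖x₁₂ - x₁‖)) (l := (m - C * (2 * inner ℝ (x₁₂ - x₁)
        (bisectorReflection x x₁ t₂) / ‖x₁₂ - x₁‖ ^ 2)) / c) hb eb eb' ?_ ?_
    · rw [show b * (C / (c * ‖x₁₂ - x₁‖)) = b * c * (C / (c ^ 2 * ‖x₁₂ - x₁‖)) by field_simp]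
      positivity
    · rw [hw, edgeArcData]
      match_scalars <;> field_simp
      ring
  rwa [hsim.set_eq]

theorem CyclidicPatch.HasVerticesAndFrame.exists_framed {f : CyclidicPatch}
    {x x₁ x₁₂ x₂ t₁ t₂ n : E3} (h : f.HasVerticesAndFrame x x₁ x₁₂ x₂ t₁ t₂ n)
    (hq : EmbeddedCircularQuad x x₁ x₁₂ x₂) (u₁ : inner ℝ t₁ t₁ = (1 : ℝ))
    (u₂ : inner ℝ t₂ t₂ = (1 : ℝ))
    (d₁ : Disjoint (circularArc x t₁ x₁) (circularArc x₂ (bisectorReflection x x₂ t₁) x₁₂))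
    (d₂ : Disjoint (circularArc x t₂ x₂) (circularArc x₁ (bisectorReflection x x₁ t₂) x₁₂)) :
    ∃ D : PatchData, D.Valid ∧ Nonempty (RepData f.contact D) ∧ Framed D x x₁ x₁₂ x₂ t₁ t₂ := by
  obtain ⟨-, n₁, -, n₂, hb⟩ := hq
  have n₁₂ : x₁₂ ≠ x₁ := by
    rintro rfl; exact hb.ne_left rfl
  have n₂₁ : x₁₂ ≠ x₂ := by
    rintro rfl; exact hb.ne_right rfl
  obtain ⟨F⟩ := f.exists_preForm
  have coe_ne : ∀ {y z : E3}, y ≠ z → (y : OnePoint E3) ≠ z := fun h h' =>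
    h (OnePoint.coe_injective h')
  obtain ⟨D, hD, ⟨R⟩⟩ := F.exists_normalForm
    (F.swap.quad_ne_zero h.vertex h.vertex₂ h.vertex₁₂ h.vertex₁ n₂ n₁ n₂₁ u₁ h.tangent₁ d₁)
    (F.quad_ne_zero h.vertex h.vertex₁ h.vertex₁₂ h.vertex₂ n₁ n₂ n₁₂ u₂ h.tangent₂ d₂)
    (fun z hz => coe_ne n₁ ((F.uniq 1 0 _ _ h.vertex₁ (hz 1)).trans
      (F.uniq 0 0 _ _ (hz 0) h.vertex)))
    (fun z hz => coe_ne n₂ ((F.uniq 0 1 _ _ h.vertex₂ (hz 1)).trans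
      (F.uniq 0 0 _ _ (hz 0) h.vertex)))
  exact hD.exists_framed R h.vertex h.vertex₁₂ n₁ n₂ u₁ u₂ h.tangent₁ h.tangent₂

/-! ### Points on a common circle -/

/-- The e₀-coordinate turns a linear relation into an affine one, which gives collinearity or
coplanarity. In the non-collinear case the vector of a sphere through the three points is orthogonal
to them, hence to every point of the span. -/
theorem onGeneralizedCircle_of_mem_span {a b c : E3} {S : Set E3}
    (h : ∀ y ∈ S, liePoint y ∈ Submodule.span ℝ {liePoint a, liePoint b, liePoint c}) :
    OnGeneralizedCircle S := by
  have hspan : S ⊆ affineSpan ℝ {a, b, c} := by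
    intro y hy
    obtain ⟨α, β, γ, e⟩ := Submodule.mem_span_triple.1 (h y hy)
    have e1 := congrArg (fun v : LieSpace => v.1) e
    have e2 := congrArg (fun v : LieSpace => v.2.1) e
    simp [liePoint_coe] at e1 e2
    have hv : y = (β • (b -ᵥ a) + γ • (c -ᵥ a)) +ᵥ a := by
      have : α = 1 - β - γ := by linarith
      rw [← e1, this, vsub_eq_sub, vsub_eq_sub, vadd_eq_add]; module
    rw [hv]
    exact vadd_mem_affineSpan_of_mem_affineSpan_of_mem_vectorSpan
      (subset_affineSpan ℝ _ (by simp)) (add_mem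
        (Submodule.smul_mem _ _ (vsub_mem_vectorSpan ℝ (by simp) (by simp)))
        (Submodule.smul_mem _ _ (vsub_mem_vectorSpan ℝ (by simp) (by simp))))
  have hle : vectorSpan ℝ S ≤ vectorSpan ℝ {a, b, c} := by
    rw [← direction_affineSpan ℝ {a, b, c}]
    exact vectorSpan_mono ℝ hspan
  by_cases hcol : Collinear ℝ {a, b, c}
  · exact Or.inr ((Submodule.rank_mono hle).trans hcol)
  · refine Or.inl ⟨?_, (Submodule.rank_mono hle).trans (coplanar_triple ℝ a b c)⟩
    obtain ⟨cs, -, hcs⟩ :=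
      (affineIndependent_iff_not_collinear_set.2 hcol).existsUnique_dist_eq.exists
    refine ⟨cs.center, cs.radius, fun y hy => ?_⟩
    have hr : ∀ z : E3, dist z cs.center ^ 2 = lieForm (liePoint z)
        ((-2 : ℝ) • liePoint cs.center) := fun z => by
      rw [lieForm_smul_right, lieForm_liePoint_coe, dist_eq_norm, norm_sub_rev]; ring
    have h0 : lieForm (liePoint y) ((-2 : ℝ) • liePoint cs.center +
        (2 * cs.radius ^ 2) • liePoint OnePoint.infty) = 0 := by
      have hi : ∀ z : E3, lieForm (liePoint z) (liePoint OnePoint.infty) = -1 / 2 := fun z => by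
        simp [lieForm, liePoint_coe, liePoint_infty]; norm_num
      have key : ∀ z ∈ Set.range ![a, b, c], lieForm (liePoint z) ((-2 : ℝ) • liePoint cs.center +
          (2 * cs.radius ^ 2) • liePoint OnePoint.infty) = 0 := fun z hz => by
        have : dist z cs.center = cs.radius := hcs hz
        rw [lieForm_add_right, ← hr, lieForm_smul_right, hi, this]; ring
      obtain ⟨α, β, γ, e⟩ := Submodule.mem_span_triple.1 (h y hy)
      rw [← e, lieForm_add_left, lieForm_add_left, lieForm_smul_left, lieForm_smul_left,
        lieForm_smul_left, key a ⟨0, rfl⟩, key b ⟨1, rfl⟩, key c ⟨2, rfl⟩]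
      ring
    have hi : lieForm (liePoint y) (liePoint OnePoint.infty) = -1 / 2 := by
      simp [lieForm, liePoint_coe, liePoint_infty]; norm_num
    rw [lieForm_add_right, ← hr, lieForm_smul_right, hi] at h0
    have hr0 : 0 ≤ cs.radius := by
      have : dist a cs.center = cs.radius := hcs ⟨0, rfl⟩
      rw [← this]; exact dist_nonneg
    exact (sq_eq_sq₀ dist_nonneg hr0).1 (by linarith)

end

noncomputable section

/-! ### The lateral faces of a cube -/

theorem PosRep.mem_iff {v : LieSpace} {y : E3} (h : PosRep v y) {U : Submodule ℝ LieSpace} :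
    v ∈ U ↔ liePoint y ∈ U := by
  obtain ⟨c, hc, rfl⟩ := h
  exact U.smul_mem_iff hc.ne'

theorem liePoint_independent {x y z : E3} (hxy : y ≠ x) (hxz : z ≠ x) (hyz : y ≠ z) {a b c : ℝ}
    (h : a • liePoint x + b • liePoint y + c • liePoint z = 0) : a = 0 ∧ b = 0 ∧ c = 0 := by
  have ne : ∀ {y z : E3}, y ≠ z → lieForm (liePoint y) (liePoint z) ≠ 0 := fun h h' =>
    h (OnePoint.coe_injective (liePoint_eq_iff.1 h'))
  have n1 := ne hxy
  have n2 := ne hxz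
  have n3 := ne hyz
  have k : ∀ v, lieForm v (a • liePoint x + b • liePoint y + c • liePoint z) = 0 := fun v => by
    rw [h, lieForm_zero_right]
  have k1 := k (liePoint x)
  have k2 := k (liePoint y)
  have k3 := k (liePoint z)
  simp only [lieForm_add_right, lieForm_smul_right, (isPtVec_liePoint _).iso,
    lieForm_comm (liePoint (x : OnePoint E3)) (liePoint y),
    lieForm_comm (liePoint (x : OnePoint E3)) (liePoint z),
    lieForm_comm (liePoint (z : OnePoint E3)) (liePoint y)] at k1 k2 k3
  generalize lieForm (liePoint (y : OnePoint E3)) (liePoint x) = A at *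
  generalize lieForm (liePoint (z : OnePoint E3)) (liePoint x) = B at *
  generalize lieForm (liePoint (y : OnePoint E3)) (liePoint z) = C at *
  have hb : b = 0 := by
    apply mul_left_cancel₀ (mul_ne_zero n1 n3)
    linear_combination C / 2 * k1 + -B / 2 * k2 + A / 2 * k3
  subst hb
  have hc : c = 0 := by
    apply mul_right_cancel₀ n2; linarith
  subst hc
  refine ⟨?_, rfl, rfl⟩
  apply mul_right_cancel₀ n1; linarith

/-- Along a circular face the fourth vertex is a combination of the others with positive weight at
`Xk`. Modulo `X`, the difference `b` therefore has a positive coefficient at `d`. -/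
theorem exists_comb {X Xj Xk Xjk a b d : LieSpace} {α β γ δ ρ₀ ρ₁ ρ₂ ρ₁₂ τ τ' : ℝ} (hα : 0 < α)
    (hγ : 0 < γ) (h₂ : 0 < ρ₂) (h₁₂ : 0 < ρ₁₂) (hτ : 0 < τ) (ha : a = α • Xj - β • X)
    (hd : d = γ • Xk - δ • X) (hs : ρ₁₂ • Xjk = ρ₁ • Xj + ρ₂ • Xk - ρ₀ • X)
    (hb : b = τ • Xjk - τ' • Xj) : ∃ m n k : ℝ, 0 < n ∧ b = m • a + n • d + k • X := by
  have hs' : Xjk = ρ₁₂⁻¹ • (ρ₁ • Xj + ρ₂ • Xk - ρ₀ • X) := by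
    rw [← hs, smul_smul, inv_mul_cancel₀ h₁₂.ne', one_smul]
  refine ⟨(τ * ρ₁ / ρ₁₂ - τ') / α, τ * ρ₂ / (ρ₁₂ * γ), (τ * ρ₁ / ρ₁₂ - τ') / α * β +
    τ * ρ₂ / (ρ₁₂ * γ) * δ - τ * ρ₀ / ρ₁₂, by positivity, ?_⟩
  rw [hb, ha, hd, hs']
  match_scalars <;> field_simp <;> ring

/-- The difference vector of a lateral face in terms of those of the adjacent ones. -/
theorem exists_comb_of_faces {F G G' Bt Tp : PatchData} {x xi xj xk xij xik xjk xijk t₁ t₂ t₃ t₄ t₅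
    t₆ t₇ t₈ t₉ t₁₀ : E3} (hF : Framed F x xj xij xi t₁ t₂) (hG : Framed G x xk xik xi t₃ t₄)
    (hG' : Framed G' xj xjk xijk xij t₅ t₆) (hB : Framed Bt x xj xjk xk t₇ t₈)
    (hT : Framed Tp xi xij xijk xik t₉ t₁₀)
    (hxi : liePoint xi ∉ Submodule.span ℝ {liePoint x, liePoint xj, liePoint xk}) :
    ∃ m n : ℝ, 0 < n ∧ G'.d = m • F.d + n • G.d := by
  obtain ⟨f₀, hf₀, ef₀⟩ := hF.p
  obtain ⟨f₁, hf₁, ef₁⟩ := hF.q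
  obtain ⟨f₂, hf₂, ef₂⟩ := hF.s
  obtain ⟨f₃, hf₃, ef₃⟩ := hF.r
  obtain ⟨g₀, hg₀, eg₀⟩ := hG.p
  obtain ⟨g₁, hg₁, eg₁⟩ := hG.q
  obtain ⟨g₂, hg₂, eg₂⟩ := hG.s
  obtain ⟨g₃, hg₃, eg₃⟩ := hG.r
  obtain ⟨k₀, hk₀, ek₀⟩ := hG'.p
  obtain ⟨k₁, hk₁, ek₁⟩ := hG'.q
  obtain ⟨k₂, hk₂, ek₂⟩ := hG'.s
  obtain ⟨k₃, hk₃, ek₃⟩ := hG'.r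
  obtain ⟨b₀, hb₀, eb₀⟩ := hB.p
  obtain ⟨b₁, hb₁, eb₁⟩ := hB.q
  obtain ⟨b₂, hb₂, eb₂⟩ := hB.s
  obtain ⟨b₃, hb₃, eb₃⟩ := hB.r
  obtain ⟨s₀, hs₀, es₀⟩ := hT.p
  obtain ⟨s₁, hs₁, es₁⟩ := hT.q
  obtain ⟨s₂, hs₂, es₂⟩ := hT.s
  obtain ⟨s₃, hs₃, es₃⟩ := hT.r
  have eF : F.d = f₁ • liePoint xj - f₀ • liePoint x := by rw [← ef₁, ← ef₀]; abel
  have eF' : F.d = f₂ • liePoint xij - f₃ • liePoint xi := by rw [← ef₂, ← ef₃]; abel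
  have eG : G.d = g₁ • liePoint xk - g₀ • liePoint x := by rw [← eg₁, ← eg₀]; abel
  have eG' : G.d = g₂ • liePoint xik - g₃ • liePoint xi := by rw [← eg₂, ← eg₃]; abel
  have eB : b₂ • liePoint xjk = b₁ • liePoint xj + b₃ • liePoint xk - b₀ • liePoint x := by
    rw [← eb₀, ← eb₁, ← eb₂, ← eb₃]; abel
  have eT : s₂ • liePoint xijk = s₁ • liePoint xij + s₃ • liePoint xik - s₀ • liePoint xi := by
    rw [← es₀, ← es₁, ← es₂, ← es₃]; abel
  obtain ⟨m, n, k, -, e⟩ := exists_comb hf₁ hg₁ hb₃ hb₂ hk₁ eF eG eB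
    (show G'.d = k₁ • _ - k₀ • _ by rw [← ek₁, ← ek₀]; abel)
  obtain ⟨m', n', k', hn', e'⟩ := exists_comb hf₂ hg₂ hs₃ hs₂ hk₂ eF' eG' eT
    (show G'.d = k₂ • _ - k₃ • _ by rw [← ek₂, ← ek₃]; abel)
  -- The bottom face expresses the difference vector modulo x, the top face modulo x_i. If the
  -- latter correction is nonzero, x_i lies in the span of x, x_j and x_k.
  by_cases hk' : k' = 0
  · exact ⟨m', n', hn', by rw [e', hk', zero_smul, add_zero]⟩
  · exfalso
    apply hxi
    rw [← (Submodule.span ℝ {liePoint x, liePoint xj, liePoint xk}).smul_mem_iff hk']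
    have h1 : k' • liePoint xi = (m - m') • F.d + (n - n') • G.d + k • liePoint x := by
      have := e.symm.trans e'
      linear_combination (norm := module) -this
    rw [h1, eF, eG]
    exact Submodule.mem_span_triple.2
      ⟨k - (m - m') * f₀ - (n - n') * g₀, (m - m') * f₁, (n - n') * g₁, by module⟩

/-- If one vertical edge ends on the circle of the bottom face, then all vertices are on it. -/
theorem mem_span_of_faces {F G G' Bt : PatchData} {x xi xj xk xij xik xjk xijk t₁ t₂ t₃ t₄ t₅
    t₆ t₇ t₈ : E3} (hF : Framed F x xj xij xi t₁ t₂) (hG : Framed G x xk xik xi t₃ t₄)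
    (hG' : Framed G' xj xjk xijk xij t₅ t₆) (hB : Framed Bt x xj xjk xk t₇ t₈)
    {U : Submodule ℝ LieSpace} (hx : liePoint x ∈ U) (hxj : liePoint xj ∈ U)
    (hxk : liePoint xk ∈ U) (hxi : liePoint xi ∈ U) : liePoint xij ∈ U ∧ liePoint xik ∈ U ∧
      liePoint xjk ∈ U ∧ liePoint xijk ∈ U := by
  have h1 : liePoint xij ∈ U := by
    rw [← hF.s.mem_iff, show F.p + F.d + F.e = (F.p + F.d) + (F.p + F.e) - F.p by abel]
    exact U.sub_mem (U.add_mem (hF.q.mem_iff.2 hxj) (hF.r.mem_iff.2 hxi)) (hF.p.mem_iff.2 hx)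
  have h2 : liePoint xik ∈ U := by
    rw [← hG.s.mem_iff, show G.p + G.d + G.e = (G.p + G.d) + (G.p + G.e) - G.p by abel]
    exact U.sub_mem (U.add_mem (hG.q.mem_iff.2 hxk) (hG.r.mem_iff.2 hxi)) (hG.p.mem_iff.2 hx)
  have h3 : liePoint xjk ∈ U := by
    rw [← hB.s.mem_iff, show Bt.p + Bt.d + Bt.e = (Bt.p + Bt.d) + (Bt.p + Bt.e) - Bt.p by abel]
    exact U.sub_mem (U.add_mem (hB.q.mem_iff.2 hxj) (hB.r.mem_iff.2 hxk)) (hB.p.mem_iff.2 hx)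
  refine ⟨h1, h2, h3, ?_⟩
  rw [← hG'.s.mem_iff, show G'.p + G'.d + G'.e = (G'.p + G'.d) + (G'.p + G'.e) - G'.p by abel]
  exact U.sub_mem (U.add_mem (hG'.q.mem_iff.2 h3) (hG'.r.mem_iff.2 h1)) (hG'.p.mem_iff.2 hxj)

theorem Framed.ne₁₂ {D : PatchData} {x x₁ x₁₂ x₂ t₁ t₂ : E3} (h : Framed D x x₁ x₁₂ x₂ t₁ t₂)
    (hD : D.Valid) : x₁ ≠ x₂ := by
  rintro rfl
  have := (h.q.isRep.form_eq_zero_iff h.r.isRep).2 rfl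
  rw [lieForm_add_right, lieForm_add_left, lieForm_add_left, hD.pp, hD.de, lieForm_comm D.d] at this
  have h1 := hD.pd
  have h2 := hD.pe
  linarith

theorem RepData.form_ne_zero {L M : ContactMap} {D E : PatchData} (R : RepData L D)
    (T : RepData M E) (hD : D.Valid) (hE : E.Valid) (hd : Disjoint L.points M.points) :
    ∀ s ∈ Set.Icc (0 : ℝ) 1, ∀ t ∈ Set.Icc (0 : ℝ) 1, ∀ s' ∈ Set.Icc (0 : ℝ) 1,
    ∀ t' ∈ Set.Icc (0 : ℝ) 1, lieForm (D.P s t) (E.P s' t') ≠ 0 := by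
  intro s hs t ht s' hs' t' ht' h0
  obtain ⟨y, hy⟩ := (hD.isPtVec_P hs ht).exists_repr
  obtain ⟨z, hz⟩ := (hE.isPtVec_P hs' ht').exists_repr
  rw [hy.form_eq_zero_iff hz] at h0
  subst h0
  exact Set.disjoint_left.1 hd ((R.mem_points hD).2 ⟨s, hs, t, ht, hy⟩)
    ((T.mem_points hE).2 ⟨s', hs', t', ht', hz⟩)

theorem box_of_framed {F G F' G' Bt Tp : PatchData} {x xi xj xk xij xik xjk xijk ti tj tk t₁ t₂ t₃
    t₄ : E3} (vF : F.Valid) (vG : G.Valid) (vF' : F'.Valid) (vG' : G'.Valid) (vB : Bt.Valid)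
    (hF : Framed F x xj xij xi tj ti) (hG : Framed G x xk xik xi tk ti)
    (hF' : Framed F' xk xjk xijk xik (bisectorReflection x xk tj) (bisectorReflection x xk ti))
    (hG' : Framed G' xj xjk xijk xij (bisectorReflection x xj tk) (bisectorReflection x xj ti))
    (hB : Framed Bt x xj xjk xk t₁ t₂) (hT : Framed Tp xi xij xijk xik t₃ t₄)
    (o₀ : inner ℝ tj tk = (0 : ℝ))
    (o₃ : inner ℝ (bisectorReflection xj xjk (bisectorReflection x xj tk))
      (bisectorReflection xk xjk (bisectorReflection x xk tj)) = (0 : ℝ))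
    (ht : bisectorReflection xj xjk (bisectorReflection x xj ti) =
      bisectorReflection xk xjk (bisectorReflection x xk ti))
    (hxi : liePoint xi ∉ Submodule.span ℝ {liePoint x, liePoint xj, liePoint xk})
    (disj : ∀ s ∈ Set.Icc (0 : ℝ) 1, ∀ t ∈ Set.Icc (0 : ℝ) 1, ∀ s' ∈ Set.Icc (0 : ℝ) 1,
      ∀ t' ∈ Set.Icc (0 : ℝ) 1, lieForm (F.P s t) (F'.P s' t') ≠ 0)
    (disj' : ∀ s ∈ Set.Icc (0 : ℝ) 1, ∀ t ∈ Set.Icc (0 : ℝ) 1, ∀ s' ∈ Set.Icc (0 : ℝ) 1,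
      ∀ t' ∈ Set.Icc (0 : ℝ) 1, lieForm (G.P s t) (G'.P s' t') ≠ 0) : Box F G F' G' := by
  have nj := hF.ne₁ vF
  have nk := hG.ne₁ vG
  have njk := hB.ne₁₂ vB
  have o₀' : inner ℝ tk tj = (0 : ℝ) := by rw [real_inner_comm, o₀]
  have hxi' : liePoint xi ∉ Submodule.span ℝ {liePoint x, liePoint xk, liePoint xj} := by
    rwa [Set.pair_comm (liePoint (xk : OnePoint E3))]
  obtain ⟨f₀, hf₀, ef₀⟩ := hF.p
  obtain ⟨f₁, hf₁, ef₁⟩ := hF.q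
  obtain ⟨g₀, hg₀, eg₀⟩ := hG.p
  obtain ⟨g₁, hg₁, eg₁⟩ := hG.q
  have eF : F.d = f₁ • liePoint xj - f₀ • liePoint x := by rw [← ef₁, ← ef₀]; abel
  have eG : G.d = g₁ • liePoint xk - g₀ • liePoint x := by rw [← eg₁, ← eg₀]; abel
  -- Three distinct points are linearly independent vectors; this yields the fields `indep` and
  -- `base` of the box.
  have key : ∀ m n l : ℝ, l • liePoint x + m • F.d + n • G.d = 0 → l = 0 ∧ m = 0 ∧ n = 0 := by
    intro m n l h
    rw [eF, eG] at h
    obtain ⟨h1, h2, h3⟩ := liePoint_independent nj nk njk (a := l - m * f₀ - n * g₀)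
      (b := m * f₁) (c := n * g₁) (by rw [← h]; module)
    have hm := (mul_eq_zero.1 h2).resolve_right hf₁.ne'
    have hn := (mul_eq_zero.1 h3).resolve_right hg₁.ne'
    subst hm hn
    exact ⟨by linarith, rfl, rfl⟩
  exact {
    hF := vF, hG := vG, hF' := vF', hG' := vG'
    corner₀ := hF.corner hG vF vG o₀
    corner₁ := (hF.flip vF).corner hG' vF.flip vG' (by rw [inner_bisectorReflection nj, o₀])
    corner₂ := (hG.flip vG).corner hF' vG.flip vF' (by rw [inner_bisectorReflection nk, o₀'])
    corner₃ := (hG'.flip vG').corner (ht ▸ hF'.flip vF') vG'.flip vF'.flip o₃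
    indep := fun m n h => (key m n 0 (by rw [← h]; module)).2
    base := fun m n h => by
      obtain ⟨h1, -⟩ := key (-m) (-n) f₀ (by rw [← ef₀, h]; module)
      exact hf₀.ne' h1
    hb := exists_comb_of_faces hF hG hG' hB hT hxi
    hc := by
      obtain ⟨m, n, hn, e⟩ := exists_comb_of_faces hG hF hF' hB.swap hT.swap hxi'
      exact ⟨n, m, hn, by rw [e, add_comm]⟩
    hW := hF.W_eq hG hF' vF vG vF'
    hW' := hG.W_eq hF hG' vG vF vG'
    disj := disj
    disj' := disj' }

end

/-! ### The box formed by the lateral faces of a cube -/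

noncomputable section

namespace CyclidicCube

variable {Q : CyclidicCube}

theorem inner_frame_self (Q : CyclidicCube) (S : Finset (Fin 3)) (m : Fin 3) :
    inner ℝ (Q.frame S m) (Q.frame S m) = (1 : ℝ) := by
  rw [real_inner_self_eq_norm_sq, (Q.orthonormal S).1 m, one_pow]

theorem frame_insert (Q : CyclidicCube) {S : Finset (Fin 3)} {a m : Fin 3} (ha : a ∉ S)
    (hm : m ≠ a) : bisectorReflection (Q.vertex S) (Q.vertex (insert a S)) (Q.frame S m) =
      Q.frame (insert a S) m := by
  rw [Q.evolution S a ha m, if_neg hm, one_smul]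

theorem frame_insert_self (Q : CyclidicCube) {S : Finset (Fin 3)} {a : Fin 3} (ha : a ∉ S) :
    bisectorReflection (Q.vertex S) (Q.vertex (insert a S)) (Q.frame S a) =
      -Q.frame (insert a S) a := by
  rw [Q.evolution S a ha a, if_pos rfl, neg_one_smul, neg_neg]

/-- Each edge is the intersection of two adjacent faces. Two opposite edges of a face thus lie on
two opposite faces of another direction, which are disjoint. -/
theorem NonSingular.edge_disjoint (hQ : Q.NonSingular) (i : Fin 3) (b : Bool) :
    Disjoint (Q.edgeArc (shiftSet i b) (i + 2)) (Q.edgeArc (insert (i + 1) (shiftSet i b)) (i + 2)) := by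
  refine Set.disjoint_of_subset ?_ ?_ (hQ.1 (i + 1))
  · have := hQ.2 i b false
    rw [show shiftSet i b ∪ shiftSet (i + 1) false = shiftSet i b by simp [shiftSet]] at this
    rw [← this]; exact Set.inter_subset_right
  · have := hQ.2 i b true
    rw [show shiftSet i b ∪ shiftSet (i + 1) true = insert (i + 1) (shiftSet i b) by
      rw [Finset.union_comm]; rfl] at this
    rw [← this]; exact Set.inter_subset_right

theorem NonSingular.edge_disjoint' (hQ : Q.NonSingular) (i : Fin 3) (b : Bool) :
    Disjoint (Q.edgeArc (shiftSet i b) (i + 1)) (Q.edgeArc (insert (i + 2) (shiftSet i b)) (i + 1)) := by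
  have e1 : i + 2 + 1 = i := by revert i; decide
  have e2 : i + 2 + 2 = i + 1 := by revert i; decide
  refine Set.disjoint_of_subset ?_ ?_ (hQ.1 (i + 2))
  · have := hQ.2 (i + 2) false b
    rw [e1, e2, show shiftSet (i + 2) false ∪ shiftSet i b = shiftSet i b by simp [shiftSet]] at this
    rw [← this]; exact Set.inter_subset_left
  · have := hQ.2 (i + 2) true b
    rw [e1, e2, show shiftSet (i + 2) true ∪ shiftSet i b = insert (i + 2) (shiftSet i b) from rfl]
      at this
    rw [← this]; exact Set.inter_subset_left

theorem NonSingular.exists_framed (hQ : Q.NonSingular) (i : Fin 3) (b : Bool) :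
    ∃ D : PatchData, D.Valid ∧ Nonempty (RepData (Q.face i b).contact D) ∧
      Framed D (Q.vertex (shiftSet i b)) (Q.vertex (insert (i + 1) (shiftSet i b)))
        (Q.vertex (insert (i + 1) (insert (i + 2) (shiftSet i b))))
        (Q.vertex (insert (i + 2) (shiftSet i b)))
        (Q.frame (shiftSet i b) (i + 1)) (Q.frame (shiftSet i b) (i + 2)) := by
  have h3 : i + 1 ≠ i + 2 := by revert i; decide
  have h1 : i + 1 ∉ shiftSet i b := by clear h3; revert i b; decide
  have h2 : i + 2 ∉ shiftSet i b := by clear h1 h3; revert i b; decide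
  refine (Q.face_spec i b).exists_framed (Q.circular _ _ _ h1 h2 h3) (Q.inner_frame_self _ _)
    (Q.inner_frame_self _ _) ?_ ?_
  · rw [Q.frame_insert h2 h3]
    exact hQ.edge_disjoint' i b
  · rw [Q.frame_insert h1 h3.symm, Finset.insert_comm]
    exact hQ.edge_disjoint i b

/-- The lateral faces of a cube. -/
theorem NonSingular.exists_box (hQ : Q.NonSingular)
    (hcirc : ¬ OnGeneralizedCircle (Set.range Q.vertex)) (i : Fin 3) :
    ∃ F G F' G' : PatchData, Box F G F' G' ∧
      Nonempty (RepData (ContactMap.swap (Q.face (i + 2) false).contact) F) ∧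
      Nonempty (RepData (Q.face (i + 1) false).contact G) ∧
      Nonempty (RepData (ContactMap.swap (Q.face (i + 2) true).contact) F') ∧
      Nonempty (RepData (Q.face (i + 1) true).contact G') ∧ F.arc₂.set = Q.edgeArc ∅ i := by
  obtain ⟨j, k, hj, hk, j1, j2, k1, k2, nij, nik, njk, huniv⟩ : ∃ j k : Fin 3, j = i + 1 ∧
      k = i + 2 ∧ j + 1 = k ∧ j + 2 = i ∧ k + 1 = i ∧ k + 2 = j ∧ i ≠ j ∧ i ≠ k ∧ j ≠ k ∧
      ∀ S : Finset (Fin 3), S = ∅ ∨ S = {i} ∨ S = {j} ∨ S = {k} ∨ S = insert i {j} ∨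
        S = insert i {k} ∨ S = insert j {k} ∨ S = insert i (insert j {k}) := by
    revert i; decide
  obtain ⟨F, vF, ⟨RF⟩, hF⟩ := hQ.exists_framed k false
  obtain ⟨G, vG, ⟨RG⟩, hG⟩ := hQ.exists_framed j false
  obtain ⟨F', vF', ⟨RF'⟩, hF'⟩ := hQ.exists_framed k true
  obtain ⟨G', vG', ⟨RG'⟩, hG'⟩ := hQ.exists_framed j true
  obtain ⟨Bt, vB, -, hB⟩ := hQ.exists_framed i false
  obtain ⟨Tp, vT, -, hT⟩ := hQ.exists_framed i true
  -- The face of direction `i + 2` has `i` as its first edge direction; after the swap the vertical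
  -- direction `i` is second on all lateral faces.
  have hF := hF.swap
  have hF' := hF'.swap
  rw [← hj, ← hk] at hB hT
  rw [j1, j2] at hG hG'
  rw [k1, k2] at hF hF'
  have st : ∀ m : Fin 3, shiftSet m true = insert m ∅ := fun m => rfl
  have sf : ∀ m : Fin 3, shiftSet m false = ∅ := fun m => rfl
  simp only [st, sf] at hF hG hF' hG' hB hT
  have nn : ∀ m : Fin 3, m ∉ (∅ : Finset (Fin 3)) := fun m => Finset.notMem_empty m
  rw [← Q.frame_insert (nn k) njk, ← Q.frame_insert (nn k) nik] at hF'
  rw [← Q.frame_insert (nn j) njk.symm, ← Q.frame_insert (nn j) nij] at hG'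
  have c1 : insert k (insert j (∅ : Finset (Fin 3))) = insert j (insert k ∅) :=
    Finset.insert_comm _ _ _
  have c2 : insert k (insert i (∅ : Finset (Fin 3))) = insert i (insert k ∅) :=
    Finset.insert_comm _ _ _
  have c3 : insert j (insert i (∅ : Finset (Fin 3))) = insert i (insert j ∅) :=
    Finset.insert_comm _ _ _
  have mk : k ∉ insert j (∅ : Finset (Fin 3)) := by simp [njk.symm]
  have mj : j ∉ insert k (∅ : Finset (Fin 3)) := by simp [njk]
  have e1 : insert k (insert i (insert j (∅ : Finset (Fin 3)))) = insert i (insert j (insert k ∅)) := by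
    rw [Finset.insert_comm, c1]
  have e2 : insert j (insert i (insert k (∅ : Finset (Fin 3)))) = insert i (insert j (insert k ∅)) :=
    Finset.insert_comm _ _ _
  rw [c1, e1] at hG'
  rw [c2] at hG
  rw [c3, c2, e2] at hT
  have hxi : liePoint (Q.vertex (insert i ∅)) ∉ Submodule.span ℝ {liePoint (Q.vertex ∅),
      liePoint (Q.vertex (insert j ∅)), liePoint (Q.vertex (insert k ∅))} := by
    intro hxi
    have hx : ∀ v : LieSpace, v ∈ ({liePoint (Q.vertex ∅), liePoint (Q.vertex (insert j ∅)),
      liePoint (Q.vertex (insert k ∅))} : Set LieSpace) → v ∈ Submodule.span ℝ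
      {liePoint (Q.vertex ∅), liePoint (Q.vertex (insert j ∅)),
      liePoint (Q.vertex (insert k ∅))} := fun v hv => Submodule.subset_span hv
    have h0 := hx _ (Or.inl rfl)
    have hj' := hx _ (Or.inr (Or.inl rfl))
    have hk' := hx _ (Or.inr (Or.inr rfl))
    obtain ⟨m1, m2, m3, m4⟩ := mem_span_of_faces hF hG hG' hB h0 hj' hk' hxi
    refine hcirc (onGeneralizedCircle_of_mem_span (a := Q.vertex ∅) (b := Q.vertex (insert j ∅))
      (c := Q.vertex (insert k ∅)) ?_)
    rintro _ ⟨S, rfl⟩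
    rcases huniv S with h | h | h | h | h | h | h | h <;> rw [h] <;> assumption
  have RFs := RF.swap
  have RFs' := RF'.swap
  refine ⟨F.swap, G, F'.swap, G', box_of_framed vF.swap vG vF'.swap vG' vB hF hG hF' hG' hB hT
    ((Q.orthonormal ∅).2 njk) ?_ ?_ hxi ?_ ?_, ⟨hk ▸ RFs⟩, ⟨hj ▸ RG⟩, ⟨hk ▸ RFs'⟩, ⟨hj ▸ RG'⟩,
    ?_⟩
  -- At the fourth bottom vertex both tangents have been reversed by their own edge, so the signs
  -- cancel in the inner product.
  · rw [Q.frame_insert (nn j) njk.symm, Q.frame_insert (nn k) njk, ← c1, Q.frame_insert_self mk,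
      c1, Q.frame_insert_self mj, inner_neg_neg]
    exact (Q.orthonormal _).2 njk.symm
  · rw [Q.frame_insert (nn j) nij, Q.frame_insert (nn k) nik, ← c1, Q.frame_insert mk nik, c1,
      Q.frame_insert mj nij]
  · refine RFs.form_ne_zero RFs' vF.swap vF'.swap ?_
    rw [ContactMap.swap_points, ContactMap.swap_points]
    exact hQ.1 k
  · exact RG.form_ne_zero RG' vG vG' (hQ.1 j)
  · rw [PatchData.swap_arc₂, ← RF.lineA_zero vF]
    have := (Q.face_spec k false).tangent₁
    rw [k1] at this
    exact this

end CyclidicCube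

end

/-! ### Orthogonality along a common curvature line -/

noncomputable section

/-- Two spheres touching orthogonal surfaces are orthogonal if one of them contains the common
curve and the other one is orthogonal to it. -/
theorem IsPtVec.form_add_radial_eq_zero {z q a b n S S' : LieSpace} (hz : IsPtVec z)
    (hzq : lieForm z q ≠ 0) (ra : a.radial = 0) (rb : b.radial = 0) (rn : n.radial = 0)
    (rq : q.radial = 0) (za : lieForm z a = 0) (zb : lieForm z b = 0) (zn : lieForm z n = 0)
    (aa : lieForm a a ≠ 0) (bb : lieForm b b ≠ 0) (nn : lieForm n n ≠ 0) (ab : lieForm a b = 0)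
    (an : lieForm a n = 0) (bn : lieForm b n = 0) (qn : lieForm q n = 0)
    (zS : lieForm z S' = 0) (aS : lieForm a S' = 0) (bS : lieForm b S' = 0)
    (qS : lieForm q S' = 0) (Sn : lieForm S n = 0) :
    lieForm S S' + S.radial * S'.radial = 0 := by
  have h0 : S' - S'.radial • radialUnit - (lieForm n S' / lieForm n n) • n = 0 := by
    refine hz.eq_zero_of_orthogonal hzq ra rb rn ?_ za zb zn ?_ aa bb nn ab an bn ?_ ?_ ?_ ?_
    · simp only [radial_sub, radial_smul, radial_radialUnit, rn]; ring
    all_goals simp only [lieForm_sub_right, lieForm_smul_right, lieForm_radialUnit_right, zS, aS,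
      bS, qS, ra, rb, rn, rq, hz.rad, zn, an, bn, qn]
    any_goals ring1
    field_simp; ring
  rw [sub_sub, sub_eq_zero] at h0
  have h1 := congrArg (lieForm S) h0
  rw [lieForm_add_right, lieForm_smul_right, lieForm_smul_right, lieForm_radialUnit_right, Sn] at h1
  linear_combination h1

namespace Arc

variable {A : Arc}

/-- A tangent vector of an arc at the point with parameter `t`. -/
def tangent (A : Arc) (t : ℝ) : LieSpace :=
  (-2 * (1 - t)) • A.p + (1 - 2 * t) • A.w + (2 * t) • A.q

theorem Valid.rad_tangent (h : A.Valid) (t : ℝ) : (A.tangent t).radial = 0 := by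
  simp only [tangent, radial_add, radial_smul, h.rp, h.rw, h.rq]; ring

theorem Valid.form_vec_tangent (h : A.Valid) (t : ℝ) : lieForm (A.vec t) (A.tangent t) = 0 := by
  simp only [tangent, vec, hvec, lieForm_add_left, lieForm_add_right, lieForm_smul_left,
    lieForm_smul_right, h.pp, h.qq, h.pw, h.qw, h.ww, lieForm_comm A.q A.p, lieForm_comm A.w A.p,
    lieForm_comm A.w A.q]
  ring

theorem Valid.form_tangent (h : A.Valid) (t : ℝ) :
    lieForm (A.tangent t) (A.tangent t) = -2 * lieForm A.p A.q := by
  simp only [tangent, lieForm_add_left, lieForm_add_right, lieForm_smul_left,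
    lieForm_smul_right, h.pp, h.qq, h.pw, h.qw, h.ww, lieForm_comm A.q A.p, lieForm_comm A.w A.p,
    lieForm_comm A.w A.q]
  ring

theorem form_tangent_eq_zero {v : LieSpace} (hp : lieForm v A.p = 0) (hw : lieForm v A.w = 0)
    (hq : lieForm v A.q = 0) (t : ℝ) : lieForm v (A.tangent t) = 0 := by
  simp only [tangent, lieForm_add_right, lieForm_smul_right, hp, hw, hq]; ring

end Arc

namespace PatchData

variable {D D' : PatchData}

theorem Valid.form_W_arc₂ (h : D.Valid) : lieForm D.W D.arc₂.p = 0 ∧ lieForm D.W D.arc₂.w = 0 ∧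
    lieForm D.W D.arc₂.q = 0 := by
  simp only [arc₂, lieForm_add_right, lieForm_smul_right, lieForm_comm D.W D.p, h.pW, h.WV, h.We]
  norm_num

theorem Valid.form_W_tangent (h : D.Valid) (t : ℝ) : lieForm D.W (D.arc₂.tangent t) = 0 :=
  Arc.form_tangent_eq_zero h.form_W_arc₂.1 h.form_W_arc₂.2.1 h.form_W_arc₂.2.2 t

theorem Valid.form_W_of_corner (h : D'.Valid) (hc : Corner D D') : lieForm D'.W D.arc₂.p = 0 ∧
    lieForm D'.W D.arc₂.w = 0 ∧ lieForm D'.W D.arc₂.q = 0 := by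
  obtain ⟨c, ρ, hc, hρ, h1, h2, h3⟩ := hc.symm.arc
  obtain ⟨k1, k2, k3⟩ := h.form_W_arc₂
  refine ⟨?_, ?_, ?_⟩
  · rw [h1, lieForm_smul_right, k1, mul_zero]
  · rw [h2, lieForm_smul_right, k2, mul_zero]
  · rw [h3, lieForm_smul_right, k3, mul_zero]

theorem Valid.form_W_tangent_of_corner (h : D'.Valid) (hc : Corner D D') (t : ℝ) :
    lieForm D'.W (D.arc₂.tangent t) = 0 := by
  obtain ⟨k1, k2, k3⟩ := h.form_W_of_corner hc
  exact Arc.form_tangent_eq_zero k1 k2 k3 t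

theorem exists_W_of_sim {H : PatchData} (h : (D.harc H.p).Sim H.arc₁) :
    ∃ k l : ℝ, H.W = k • D.W + l • H.p := by
  obtain ⟨c, ρ, -, -, -, h2, -⟩ := h
  refine ⟨c * ρ * D.mu H.p, c * ρ * D.κ - H.κ, ?_⟩
  simp only [arc₁, harc] at h2
  linear_combination (norm := module) h2

theorem exists_d_of_sim {H : PatchData} (h : (D.harc H.p).Sim H.arc₁) :
    ∃ k l : ℝ, H.d = k • D.d + l • H.p := by
  obtain ⟨c, ρ, -, -, -, -, h3⟩ := h
  refine ⟨c * ρ ^ 2 * D.mu H.p, c * ρ ^ 2 - 1, ?_⟩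
  simp only [arc₁, harc] at h3
  linear_combination (norm := module) h3

end PatchData

namespace RepData

variable {L M : ContactMap} {H D D' : PatchData}

/-- The contact sphere along a curvature line of the first family is tangent to the second
boundary arc. -/
theorem formS_tangent (R : RepData L D) (hD : D.Valid) (v : I) :
    lieForm (R.S v) (D.arc₂.tangent (R.g v)) = 0 := by
  obtain ⟨a, b, hb, h⟩ := R.T_mem hD 0 v
  have h0 : (R.f 0 : ℝ) = 0 := by rw [R.f_zero]; rfl
  obtain ⟨h1, h2, h3, -⟩ := R.formT_zero hD h0
  have h4 : lieForm (R.T 0) (D.arc₂.tangent (R.g v)) = 0 := by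
    refine Arc.form_tangent_eq_zero h1 ?_ ?_ _
    · simp only [PatchData.arc₂, lieForm_add_right, lieForm_smul_right, h1, h2]; ring
    · simp only [PatchData.arc₂, lieForm_add_right, h1, h3]; ring
  rw [h, h0, ← PatchData.arc₂_vec, lieForm_add_left, lieForm_smul_left, lieForm_smul_left,
    hD.arc₂_valid.form_vec_tangent, mul_zero, zero_add] at h4
  exact (mul_eq_zero.1 h4).resolve_left hb

/-- Each patch has a single contact sphere along the common line, so one identity `key` between two
spheres settles orthogonality at all its points. -/
theorem meets (R : RepData L H) (T : RepData M D) (hH : H.Valid) (hD : D.Valid) (hD' : D'.Valid)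
    (hc : Corner D D') (hz : D.OnEdge H.p) (h1 : (D.harc H.p).Sim H.arc₁)
    (h2 : (D'.harc H.p).Sim H.arc₂) : L.Meets M := by
  refine ⟨H.arc₁.set, ?_, ?_, ?_⟩
  · exact Or.inl (R.lineA_zero hH).symm
  · rw [← h1.set_eq]; exact T.harc_mem_curves hD hz
  intro y hy u v u' v' hu hv
  obtain ⟨t, ht, c, hc0, hzt⟩ := hz
  rw [R.mem_iff hH] at hu
  rw [T.mem_iff hD] at hv
  -- the parameters of the common point
  have hgv : (R.g v : ℝ) = 0 := by
    obtain ⟨s, hs, hs'⟩ := hy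
    rw [PatchData.arc₁_vec] at hs'
    exact ((hH.rep_inj (R.f u).2 (R.g v).2 hs PatchData.zero_mem hu hs').2)
  have hgv' : (T.g v' : ℝ) = t := by
    rw [← h1.set_eq, hzt, ← (PatchData.harc_sim hc0.ne' _).set_eq] at hy
    obtain ⟨s, hs, hs'⟩ := hy
    rw [hD.harc_vec] at hs'
    exact ((hD.rep_inj (T.f u').2 (T.g v').2 hs ht hv hs').2)
  obtain ⟨s1, s2, s3⟩ := T.formS_line hD v'
  have s4 := T.formS_tangent hD v'
  obtain ⟨-, -, -, r4⟩ := R.formS_zero hH hgv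
  rw [hgv'] at s1 s4
  have zS : lieForm H.p (T.S v') = 0 := by
    rw [hzt, lieForm_smul_left, lieForm_comm, s1, mul_zero]
  have zb : lieForm H.p (D.arc₂.tangent t) = 0 := by
    rw [hzt, ← PatchData.arc₂_vec, lieForm_smul_left, hD.arc₂_valid.form_vec_tangent, mul_zero]
  obtain ⟨k, l, hW⟩ := PatchData.exists_W_of_sim h1
  obtain ⟨k', l', hV⟩ := PatchData.exists_W_of_sim (H := H.swap) h2
  obtain ⟨k₂, l₂, hd⟩ := PatchData.exists_d_of_sim h1
  -- The face sphere contains the common line and the vertical tangent, so its conformal part is a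
  -- multiple of `H.V`; the contact sphere of the level patch is orthogonal to `H.V` because it is
  -- tangent to its second arc.
  have key : lieForm (R.S v) (T.S v') + (R.S v).radial * (T.S v').radial = 0 := by
    refine hH.isPtVec_p.form_add_radial_eq_zero (q := H.d) (a := H.W) (b := D.arc₂.tangent t)
      (n := H.V) hH.pd.ne hH.rW (hD.arc₂_valid.rad_tangent t) hH.rV hH.rd hH.pW zb hH.pV ?_ ?_ ?_ ?_
      hH.WV ?_ hH.dV zS ?_ ?_ ?_ r4
    · rw [hH.WW]; linarith [hH.pd]
    · rw [hD.arc₂_valid.form_tangent]; linarith [hD.arc₂_valid.pq]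
    · rw [hH.VV]; linarith [hH.pe]
    · rw [hW, lieForm_add_left, lieForm_smul_left, lieForm_smul_left, hD.form_W_tangent, zb]; ring
    · rw [lieForm_comm, show H.V = _ from hV, lieForm_add_left, lieForm_smul_left, lieForm_smul_left,
        hD'.form_W_tangent_of_corner hc, show lieForm H.swap.p (D.arc₂.tangent t) = 0 from zb]; ring
    · rw [hW, lieForm_add_left, lieForm_smul_left, lieForm_smul_left, zS, lieForm_comm D.W, s2]; ring
    · rw [lieForm_comm, s4]
    · rw [hd, lieForm_add_left, lieForm_smul_left, lieForm_smul_left, zS, lieForm_comm D.d, s3]; ring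
  obtain ⟨a, ha, hk⟩ := hu.trans_smul hv
  have m1 := R.formS u v
  have m2 := T.formS u' v'
  rw [hk, lieForm_smul_right] at m2
  replace m2 := (mul_eq_zero.1 m2).resolve_left ha
  have m3 := hu.isPtVec
  intro x hx x' hx'
  rw [R.spanS, Submodule.mem_span_pair] at hx
  rw [T.spanS, hk, Submodule.mem_span_pair] at hx'
  obtain ⟨α, β, rfl⟩ := hx
  obtain ⟨γ, δ, rfl⟩ := hx'
  simp only [lieForm_add_left, lieForm_add_right, lieForm_smul_left, lieForm_smul_right, radial_add,
    radial_smul, m1, m3.iso, m3.rad, lieForm_comm (H.P _ _) (T.S v'), m2]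
  linear_combination β * δ * key

end RepData

end

/-! ### Patches determined by their boundary arcs -/

noncomputable section

theorem PreForm.exists_point {L : ContactMap} (F : PreForm L) (u v : I) :
    ∃ y, liePoint y ∈ L u v := by
  by_cases h : quad F.k₀ F.k₁ F.k₂ (F.A u) (F.B u) = 0
  · obtain ⟨y, hy⟩ := F.singT u h
    exact ⟨y, hy v⟩
  · have h' : quad F.k₀ F.k₁ F.k₂ (F.A u) (F.B u) ≠ 0 ∨ quad F.l₀ F.l₁ F.l₂ (F.C v) (F.E v) ≠ 0 :=
      Or.inl h
    obtain ⟨y, hy⟩ := IsPtVec.exists_repr (v := quad F.l₀ F.l₁ F.l₂ (F.C v) (F.E v) •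
      F.α.hvec (F.A u) (F.B u) + quad F.k₀ F.k₁ F.k₂ (F.A u) (F.B u) • F.β.hvec (F.C v) (F.E v))
      ⟨F.ne u v h', F.rad _ _ _ _, F.iso _ _ _ _⟩
    exact ⟨y, (F.mem u v y h').2 hy⟩

namespace ContactMap

variable {L : ContactMap}

/-- Two disjoint boundary arcs are opposite to each other. -/
theorem opposite_arcs (hpt : ∀ u v, ∃ y, liePoint y ∈ L u v) {p : OnePoint E3}
    (hp : liePoint p ∈ L 0 0) {c c' : Set (OnePoint E3)} (hc : c ∈ L.arcs) (hc' : c' ∈ L.arcs)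
    (hd : Disjoint c c') (hpc : p ∉ c') :
    (c = L.lineA 0 ∧ c' = L.lineA 1) ∨ (c = L.lineB 0 ∧ c' = L.lineB 1) := by
  obtain ⟨y, hy⟩ := hpt 0 1
  obtain ⟨z, hz⟩ := hpt 1 0
  obtain ⟨x, hx⟩ := hpt 1 1
  have hd' := Set.disjoint_left.1 hd
  rcases hc' with rfl | rfl | rfl | rfl
  · exact absurd ⟨0, hp⟩ hpc
  · rcases hc with rfl | rfl | rfl | rfl
    · exact Or.inl ⟨rfl, rfl⟩
    · exact absurd ⟨0, hy⟩ (hd' (a := y) ⟨0, hy⟩)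
    · exact absurd ⟨0, hy⟩ (hd' (a := y) ⟨1, hy⟩)
    · exact absurd ⟨1, hx⟩ (hd' (a := x) ⟨1, hx⟩)
  · exact absurd ⟨0, hp⟩ hpc
  · rcases hc with rfl | rfl | rfl | rfl
    · exact absurd ⟨0, hz⟩ (hd' (a := z) ⟨1, hz⟩)
    · exact absurd ⟨1, hx⟩ (hd' (a := x) ⟨1, hx⟩)
    · exact Or.inr ⟨rfl, rfl⟩
    · exact absurd ⟨0, hz⟩ (hd' (a := z) ⟨0, hz⟩)

end ContactMap

namespace PatchData

/-- Patch data are determined by three of the boundary arcs. -/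
theorem eq_scale_of_arcs {H H' : PatchData} (h : H.Valid) (h' : H'.Valid) {c : ℝ} (hc : c ≠ 0)
    (hp : H'.p = c • H.p) (s₁ : H.arc₁.set = H'.arc₁.set) (s₂ : H.arc₂.set = H'.arc₂.set)
    (s₃ : H.swap.flip.arc₂.set = H'.swap.flip.arc₂.set) : H' = H.scale c := by
  obtain ⟨ρ, hρ, w1, q1⟩ := Arc.sim_of_set_eq h.arc₁_valid h'.arc₁_valid hc hp s₁
  obtain ⟨τ, hτ, w2, q2⟩ := Arc.sim_of_set_eq h.arc₂_valid h'.arc₂_valid hc hp s₂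
  have hc₂ : c * τ ^ 2 ≠ 0 := mul_ne_zero hc (pow_ne_zero 2 hτ.ne')
  obtain ⟨r, hr, -, q3⟩ := Arc.sim_of_set_eq h.swap.flip.arc₂_valid h'.swap.flip.arc₂_valid hc₂
    q2 s₃
  generalize c * τ ^ 2 * r ^ 2 = k at q3
  simp only [arc₁, arc₂, PatchData.swap, PatchData.flip] at w1 q1 w2 q2 q3
  have hd : H'.d = (c * ρ ^ 2 - c) • H.p + (c * ρ ^ 2) • H.d := by
    rw [hp] at q1; linear_combination (norm := module) q1
  have he : H'.e = (c * τ ^ 2 - c) • H.p + (c * τ ^ 2) • H.e := by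
    rw [hp] at q2; linear_combination (norm := module) q2
  rw [hd, he, hp] at q3
  have hpd := h.pd
  have hpe := h.pe
  have fp := congrArg (lieForm H.p) q3
  have fd := congrArg (lieForm H.d) q3
  have fe := congrArg (lieForm H.e) q3
  simp only [lieForm_add_right, lieForm_smul_right, h.pp, h.dd, h.ee, h.de, lieForm_comm H.d H.p,
    lieForm_comm H.e H.p, lieForm_comm H.e H.d] at fp fd fe
  have fd' : c * τ ^ 2 - c * ρ ^ 2 - c = -k := by
    apply mul_right_cancel₀ hpd.ne; linear_combination fd
  have fe' : c * ρ ^ 2 - c * τ ^ 2 - c = -k := by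
    apply mul_right_cancel₀ hpe.ne; linear_combination fe
  -- Pairing the fourth corner with `d`, `e` and `p` leaves no freedom in the scales of the three
  -- arcs; κ and ν are then fixed by ⟨W, e⟩ = 0 and ⟨d, V⟩ = 0.
  have hk : k = c := by linarith
  have hρτ : c * ρ ^ 2 = c * τ ^ 2 := by linarith
  have hρ1 : c * ρ ^ 2 = c := by
    have : lieForm H.p H.d + lieForm H.p H.e ≠ 0 := by linarith
    apply mul_right_cancel₀ this
    rw [hk] at fp
    linear_combination fp + lieForm H.p H.e * hρτ
  have one : ∀ {x : ℝ}, 0 < x → c * x ^ 2 = c → x = 1 := fun hx hx' => by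
    have : _ = (1 : ℝ) := mul_left_cancel₀ hc (hx'.trans (mul_one c).symm)
    exact (pow_eq_one_iff_of_nonneg hx.le two_ne_zero).1 this
  have eρ := one hρ hρ1
  have eτ := one hτ (hρτ ▸ hρ1)
  subst eρ eτ
  have hd' : H'.d = c • H.d := by rw [hd]; module
  have he' : H'.e = c • H.e := by rw [he]; module
  rw [hp] at w1 w2
  have hW : H'.W = c • H.W + (c * H.κ - c * H'.κ) • H.p := by
    linear_combination (norm := module) w1
  have hV : H'.V = c • H.V + (c * H.ν - c * H'.ν) • H.p := by
    linear_combination (norm := module) w2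
  have g1 := h'.We
  have g2 := h'.dV
  rw [hW, he'] at g1
  rw [hV, hd'] at g2
  simp only [lieForm_add_left, lieForm_add_right, lieForm_smul_left, lieForm_smul_right, h.We, h.dV,
    lieForm_comm H.d H.p, ← mul_sub, mul_zero, zero_add, mul_eq_zero, hc, hpd.ne, hpe.ne, false_or,
    or_false, sub_eq_zero] at g1 g2
  rw [g1, sub_self, zero_smul, add_zero] at hW
  rw [g2, sub_self, zero_smul, add_zero] at hV
  obtain ⟨p', W', d', κ', V', e', ν'⟩ := H'
  simp only [scale, mk.injEq]
  exact ⟨hp, hW, hd', g1.symm, hV, he', g2.symm⟩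

end PatchData

namespace RepData

variable {L M : ContactMap} {D : PatchData}

theorem points_eq (R : RepData L D) (T : RepData M D) (hD : D.Valid) : L.points = M.points := by
  ext z; rw [R.mem_points hD, T.mem_points hD]

theorem curves_eq (R : RepData L D) (T : RepData M D) (hD : D.Valid) : L.curves = M.curves := by
  ext z; rw [R.mem_curves hD, T.mem_curves hD]

/-- By injectivity of the point map just one curvature line of each family passes through a point;
at a point of the second boundary arc, the one of the second family is that arc itself. -/
theorem curve_eq (R : RepData M D) (hD : D.Valid) {c : Set (OnePoint E3)} (hc : c ∈ M.curves)
    {y : OnePoint E3} {z : LieSpace} (hz : D.OnEdge z) (hzy : IsRep z y) (hy : y ∈ c) :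
    c = D.arc₂.set ∨ c = (D.harc z).set := by
  obtain ⟨t₀, ht₀, k, hk, rfl⟩ := hz
  rw [repr_smul_iff hk.ne'] at hzy
  rw [← (PatchData.harc_sim hk.ne' _).set_eq]
  rcases (R.mem_curves hD).1 hc with ⟨t, ht, rfl⟩ | ⟨s, hs, rfl⟩
  · obtain ⟨s, hs, h⟩ := hy
    rw [hD.harc_vec] at h
    rw [(hD.rep_inj hs ht PatchData.zero_mem ht₀ h hzy).2]
    exact Or.inr rfl
  · obtain ⟨t, ht, h⟩ := hy
    rw [← PatchData.swap_P, hD.swap.harc_vec, PatchData.swap_P] at h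
    rw [(hD.rep_inj hs ht PatchData.zero_mem ht₀ h hzy).1, PatchData.P_zero_zero]
    left
    exact congrArg Arc.set hD.swap.harc_p

end RepData

end

/-! ### No patch is orthogonal to two orthogonal faces along their edge -/

noncomputable section

namespace PatchData

variable {L MF : ContactMap} {D D' : PatchData}

theorem Valid.corner_forms (h : D'.Valid) (hc : Corner D D') : lieForm D.p D'.W = 0 ∧
    lieForm D.V D'.W = 0 ∧ lieForm D.e D'.W = 0 := by
  obtain ⟨e1, e2, e3⟩ := h.form_W_of_corner hc
  simp only [arc₂, lieForm_add_right, lieForm_smul_right] at e1 e2 e3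
  rw [e1] at e2 e3
  rw [lieForm_comm D.p, lieForm_comm D.V, lieForm_comm D.e]
  exact ⟨e1, by linarith, by linarith⟩

/-- Along the common arc `D'.W` is normal to the first patch, so it carries the conformal part of
that patch's contact sphere; orthogonality to the patch is orthogonality to this vector. -/
theorem Valid.form_normal_eq_zero (h : D.Valid) (h' : D'.Valid) (hc : Corner D D')
    (R : RepData MF D) {K : Submodule ℝ LieSpace} {v : I} (ho : OrthogonalContact K (MF 0 v))
    {S : LieSpace} (hS : S ∈ K) : lieForm S D'.W = 0 := by
  obtain ⟨m1, m2, m3⟩ := h'.corner_forms hc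
  have h0 : (R.f 0 : ℝ) = 0 := by rw [R.f_zero]; rfl
  obtain ⟨c, hc0, e⟩ := R.exists_normal h h0 h'.rW (by rw [h'.WW]; linarith [h'.pd]) m1 m2 m3 hc.WW
  have := ho S hS (R.T 0) (by rw [R.spanT]; exact Submodule.subset_span (by simp))
  rw [e] at this
  exact (mul_eq_zero.1 this).resolve_left hc0

end PatchData

namespace RepData

variable {L MF MG : ContactMap} {F G : PatchData}

/-- No patch is orthogonal to both of two orthogonal patches along their common boundary arc. -/
theorem not_orthogonal_both (X : PreForm L) (RF : RepData MF F) (RG : RepData MG G) (hF : F.Valid)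
    (hG : G.Valid) (hc : Corner F G) (hL : L.lineA 0 = F.arc₂.set) {v v' : I}
    (oF : OrthogonalContact (L 0 0) (MF 0 v)) (oG : OrthogonalContact (L 0 0) (MG 0 v')) :
    False := by
  have mem : ∀ {t : ℝ} {y : OnePoint E3}, t ∈ Set.Icc (0 : ℝ) 1 → IsRep (F.P 0 t) y →
      y ∈ L.lineA 0 := by
    intro t y ht hy
    rw [hL]
    exact ⟨t, ht, by rwa [PatchData.arc₂_vec]⟩
  -- A zero here would collapse the boundary line to a point, while the edge has two distinct ends.
  have hl : quad X.l₀ X.l₁ X.l₂ (X.C 0) (X.E 0) ≠ 0 := by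
    intro h0
    obtain ⟨z, hz⟩ := X.singS 0 h0
    have key : ∀ {t : ℝ}, t ∈ Set.Icc (0 : ℝ) 1 → IsRep (F.P 0 t) z := by
      intro t ht
      obtain ⟨y, hy⟩ := (hF.isPtVec_P PatchData.zero_mem ht).exists_repr
      obtain ⟨u, hu⟩ := mem ht hy
      rwa [X.uniq u 0 _ _ (hz u) hu]
    exact zero_ne_one (hF.rep_inj PatchData.zero_mem PatchData.zero_mem PatchData.zero_mem
      PatchData.one_mem (key PatchData.zero_mem) (key PatchData.one_mem)).2
  obtain ⟨hr, hS⟩ := X.sphereS 0 hl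
  generalize X.S 0 = S at hr hS
  have iso := (hS 0).2 _ (hS 0).1
  have line : ∀ {t : ℝ}, t ∈ Set.Icc (0 : ℝ) 1 → lieForm S (F.P 0 t) = 0 := by
    intro t ht
    obtain ⟨y, hy⟩ := (hF.isPtVec_P PatchData.zero_mem ht).exists_repr
    obtain ⟨u, hu⟩ := mem ht hy
    obtain ⟨c, -, e⟩ := hy.exists_ne
    rw [e, lieForm_smul_right, (hS u).2 _ hu, mul_zero]
  have k0 := line PatchData.zero_mem
  have k1 := line PatchData.one_mem
  have k2 := line PatchData.half_mem
  rw [PatchData.P_zero_zero] at k0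
  rw [PatchData.P_zero_one, lieForm_add_right, k0, zero_add] at k1
  simp only [PatchData.P, lieForm_add_right, lieForm_smul_right, k0, k1, qd_zero] at k2
  have k3 : lieForm S F.V = 0 := by linarith
  have n1 : lieForm S G.W = 0 := hF.form_normal_eq_zero hG hc RF oF (hS 0).1
  have n2 : lieForm S F.W = 0 := by
    exact hG.form_normal_eq_zero hF hc.symm RG oG (hS 0).1
  obtain ⟨m1, m2, m3⟩ := hG.corner_forms hc
  -- The contact sphere contains the edge and is orthogonal to both normals, so it has no conformal
  -- part. Applied to the sphere paired with itself, the lemma leaves only the square of its radial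
  -- coordinate.
  have := hF.isPtVec_p.form_add_radial_eq_zero (q := F.e) (a := F.V) (b := F.W) (n := G.W)
    (S := S) (S' := S) hF.pe.ne hF.rV hF.rW hG.rW hF.re hF.pV hF.pW m1 (by rw [hF.VV]; linarith [hF.pe])
    (by rw [hF.WW]; linarith [hF.pd]) (by rw [hG.WW]; linarith [hG.pd])
    (by rw [lieForm_comm, hF.WV]) m2 hc.WW m3 (by rw [lieForm_comm, k0]) (by rw [lieForm_comm, k3])
    (by rw [lieForm_comm, n2]) (by rw [lieForm_comm, k1]) n1
  rw [iso, zero_add] at this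
  exact hr (mul_self_eq_zero.1 this)

end RepData

end

/-! ### Level patches of a box: orthogonality and uniqueness -/

noncomputable section

namespace ContactMap

variable {L M : ContactMap}

theorem Meets.swap_right (h : L.Meets M) : L.Meets M.swap := by
  obtain ⟨c, h1, h2, h3⟩ := h
  exact ⟨c, h1, by rwa [swap_curves], fun p hp u v u' v' => h3 p hp u v v' u'⟩

theorem flip_flip : L.flip.flip = L := by
  funext u v; simp only [flip, unitInterval.symm_symm]

theorem subset_points {c : Set (OnePoint E3)} (h : c ∈ L.curves) : c ⊆ L.points := by
  rcases h with ⟨v, rfl⟩ | ⟨u, rfl⟩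
  · rintro y ⟨u, hu⟩; exact ⟨u, v, hu⟩
  · rintro y ⟨v, hv⟩; exact ⟨u, v, hv⟩

end ContactMap

namespace Box

variable {F G F' G' H : PatchData} {L MF MG MF' MG' : ContactMap}

/-- The end points of the boundary arcs of a level. -/
theorem exists_end {D : PatchData} (hH : H.Valid) (h : (D.harc H.p).Sim H.arc₁) :
    ∃ k : ℝ, 0 < k ∧ H.p + H.d = k • D.R H.p := by
  obtain ⟨c, ρ, hc, hρ, h1, -, h3⟩ := h
  have h1' : (1 - c) • H.p = 0 := by
    simp only [PatchData.arc₁, PatchData.harc] at h1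
    linear_combination (norm := module) h1
  have hc1 : c = 1 := by
    linarith [(smul_eq_zero.1 h1').resolve_right hH.isPtVec_p.ne]
  exact ⟨ρ ^ 2, pow_pos hρ 2, by rw [hc1, one_mul] at h3; exact h3⟩

/-- Meeting `G'` is the same statement as meeting `F`, for the level patch seen from the other end
of its first arc, where `G'` and `F.flip` play the roles of `F` and `G`. -/
theorem meets (h : Box F G F' G') (hH : H.Valid) (hz : F.OnEdge H.p)
    (s₁ : (F.harc H.p).Sim H.arc₁) (s₂ : (G.harc H.p).Sim H.arc₂)
    (s₄ : (G'.harc (F.R H.p)).Sim H.flip.arc₂) (R : RepData L H) (RF : RepData MF F)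
    (RG' : RepData MG' G') : L.Meets MF ∧ L.Meets MG' := by
  refine ⟨R.meets RF hH h.hF h.hG h.corner₀ hz s₁ s₂, ?_⟩
  obtain ⟨k, hk, e⟩ := exists_end hH s₁
  have hp : H.flip.swap.p = k • F.R H.p := e
  obtain ⟨t, ht, c, hc, et⟩ := h.corner₁.onEdge (h.hF.flip_onEdge hz)
  have e₁ : (G'.harc H.flip.swap.p).Sim H.flip.swap.arc₁ := by
    rw [hp]; exact (PatchData.harc_sim hk.ne' _).symm.trans s₄
  have e₂ : (F.flip.harc H.flip.swap.p).Sim H.flip.swap.arc₂ := by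
    rw [hp, PatchData.swap_arc₂, PatchData.flip_arc₁]
    refine (PatchData.harc_sim hk.ne' _).symm.trans ?_
    rw [PatchData.R_apply, h.hF.flip_harc]
    exact s₁.rev
  have hzG : G'.OnEdge H.flip.swap.p := by
    refine ⟨t, ht, k * c, mul_pos hk hc, ?_⟩
    rw [hp, PatchData.R_apply, et, smul_smul]
  have := (R.flip.swap.meets RG' hH.flip.swap h.hG' h.hF.flip h.corner₁.symm hzG e₁ e₂).swap.flip
  rwa [show L.flip.swap.swap = L.flip from rfl, ContactMap.flip_flip] at this

/-- A patch whose boundary arcs are curvature lines of the four faces of a box. -/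
theorem exists_scale (h : Box F G F' G') (X : PreForm L) (RF : RepData MF F) (RG : RepData MG G)
    (RF' : RepData MF' F') (dF : Disjoint MF.points MF'.points)
    (dG : Disjoint MG.points MG'.points) (hH : H.Valid) (hz : F.OnEdge H.p)
    (s₁ : (F.harc H.p).Sim H.arc₁) (s₂ : (G.harc H.p).Sim H.arc₂)
    (s₃ : (F'.harc (G.R H.p)).Sim H.swap.flip.arc₂) {y : OnePoint E3} (hy : IsRep H.p y)
    (hL : liePoint y ∈ L 0 0) (a₀ : L.lineA 0 ∈ MF.curves) (a₁ : L.lineA 1 ∈ MF'.curves)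
    (b₀ : L.lineB 0 ∈ MG.curves) (b₁ : L.lineB 1 ∈ MG'.curves) :
    ∃ c : ℝ, c ≠ 0 ∧ Nonempty (RepData L (H.scale c)) := by
  have A₀ := ContactMap.subset_points a₀
  have A₁ := ContactMap.subset_points a₁
  have B₀ := ContactMap.subset_points b₀
  have B₁ := ContactMap.subset_points b₁
  replace dF := Set.disjoint_left.1 dF
  replace dG := Set.disjoint_left.1 dG
  -- A degenerate parameter line would join two opposite boundary arcs, which lie on disjoint faces.
  have hT : ∀ z u, ¬ ∀ v, liePoint z ∈ L u v := fun z u hz =>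
    dF (A₀ ⟨u, hz 0⟩) (A₁ ⟨u, hz 1⟩)
  have hS : ∀ z v, ¬ ∀ u, liePoint z ∈ L u v := fun z v hz =>
    dG (B₀ ⟨v, hz 0⟩) (B₁ ⟨v, hz 1⟩)
  obtain ⟨H', hH', ⟨R⟩⟩ := X.exists_normalForm
    (fun u hu => by obtain ⟨z, hz⟩ := X.singT u hu; exact hT z u hz)
    (fun v hv => by obtain ⟨z, hz⟩ := X.singS v hv; exact hS z v hz)
    (fun z => hS z 0) (fun z => hT z 0)
  have hy' : IsRep H'.p y := by
    have := (R.mem_iff hH').1 hL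
    rwa [R.f_zero, R.g_zero, Set.Icc.coe_zero, PatchData.P_zero_zero] at this
  obtain ⟨c, hc, hp⟩ := hy.trans_smul hy'
  obtain ⟨y₁₀, h₁₀⟩ := X.exists_point 1 0
  obtain ⟨y₀₁, h₀₁⟩ := X.exists_point 0 1
  obtain ⟨y₁₁, h₁₁⟩ := X.exists_point 1 1
  have hzG := h.corner₀.onEdge hz
  have eFG : F.arc₂.set = G.arc₂.set := h.corner₀.arc.sim.set_eq
  have t₁ : L.lineA 0 = H.arc₁.set := by
    rw [← s₁.set_eq]
    -- The only alternative is that the boundary arc is the edge itself; its far corner would then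
    -- lie on both `G` and `G'`.
    refine (RF.curve_eq h.hF a₀ hz hy ⟨0, hL⟩).resolve_left fun e => ?_
    have : y₁₀ ∈ MG.lineB 0 := by
      rw [RG.lineB_zero h.hG, ← eFG, ← e]; exact ⟨1, h₁₀⟩
    exact dG (ContactMap.subset_points (Or.inr ⟨0, rfl⟩) this) (B₁ ⟨0, h₁₀⟩)
  have t₂ : L.lineB 0 = H.arc₂.set := by
    rw [← s₂.set_eq]
    refine (RG.curve_eq h.hG b₀ hzG hy ⟨0, hL⟩).resolve_left fun e => ?_
    have : y₀₁ ∈ MF.lineB 0 := by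
      rw [RF.lineB_zero h.hF, eFG, ← e]; exact ⟨1, h₀₁⟩
    exact dF (ContactMap.subset_points (Or.inr ⟨0, rfl⟩) this) (A₁ ⟨0, h₀₁⟩)
  have u₁ : H.arc₁.set = H'.arc₁.set := by rw [← t₁, R.lineA_zero hH']
  have u₂ : H.arc₂.set = H'.arc₂.set := by rw [← t₂, R.lineB_zero hH']
  obtain ⟨k, hk, e⟩ := exists_end (H := H.swap) hH.swap s₂
  have hr : IsRep (G.R H.p) y₀₁ := by
    obtain ⟨ρ, hρ, -, q⟩ := Arc.sim_of_set_eq hH.arc₂_valid hH'.arc₂_valid hc hp u₂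
    have h' := (R.mem_iff hH').1 h₀₁
    rw [R.f_zero, R.g_one, Set.Icc.coe_zero, Set.Icc.coe_one, PatchData.P_zero_one,
      show H'.p + H'.e = _ from q, repr_smul_iff (mul_ne_zero hc (pow_ne_zero 2 hρ.ne')),
      show H.arc₂.q = _ from e, repr_smul_iff hk.ne'] at h'
    exact h'
  have t₃ : L.lineA 1 = H.swap.flip.arc₂.set := by
    rw [← s₃.set_eq]
    refine (RF'.curve_eq h.hF' a₁ (h.corner₂.onEdge (h.hG.flip_onEdge hzG)) hr
      ⟨0, h₀₁⟩).resolve_left fun e => ?_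
    have : y₁₁ ∈ MG.lineB 1 := by
      rw [RG.lineB_one h.hG, h.corner₂.arc.sim.set_eq, ← e]; exact ⟨1, h₁₁⟩
    exact dG (ContactMap.subset_points (Or.inr ⟨1, rfl⟩) this) (B₁ ⟨1, h₁₁⟩)
  have u₃ : H.swap.flip.arc₂.set = H'.swap.flip.arc₂.set := by
    rw [← t₃, ← R.swap.lineB_one hH'.swap, ContactMap.swap_lineB]
  exact ⟨c, hc, PatchData.eq_scale_of_arcs hH hH' hc hp u₁ u₂ u₃ ▸ ⟨R⟩⟩

/-- A patch orthogonal to the four faces of a box is determined by a vertex. -/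
theorem unique (h : Box F G F' G') (X : PreForm L) (RF : RepData MF F) (RG : RepData MG G)
    (RF' : RepData MF' F') (RG' : RepData MG' G') (dF : Disjoint MF.points MF'.points)
    (dG : Disjoint MG.points MG'.points) (hH : H.Valid) (hz : F.OnEdge H.p)
    (s₁ : (F.harc H.p).Sim H.arc₁) (s₂ : (G.harc H.p).Sim H.arc₂)
    (s₃ : (F'.harc (G.R H.p)).Sim H.swap.flip.arc₂) {M : ContactMap} (R : RepData M H)
    {y : OnePoint E3} (hy : IsRep H.p y) (hL : liePoint y ∈ L 0 0) (mF : L.Meets MF)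
    (mG : L.Meets MG) (mF' : L.Meets MF') (mG' : L.Meets MG') :
    L.points = M.points ∧ L.curves = M.curves := by
  obtain ⟨cF, aF, bF, oF⟩ := mF
  obtain ⟨cG, aG, bG, oG⟩ := mG
  obtain ⟨cF', aF', bF', -⟩ := mF'
  obtain ⟨cG', aG', bG', -⟩ := mG'
  have hzG := h.corner₀.onEdge hz
  have eFG : F.arc₂.set = G.arc₂.set := h.corner₀.arc.sim.set_eq
  have yF : y ∈ F.arc₂.set := by
    obtain ⟨t, ht, c, hc, e⟩ := hz
    rw [e, repr_smul_iff hc.ne'] at hy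
    exact ⟨t, ht, by rwa [PatchData.arc₂_vec]⟩
  have yG : y ∈ G.arc₂.set := eFG ▸ yF
  rw [← RF.lineB_zero h.hF] at yF
  rw [← RG.lineB_zero h.hG] at yG
  have nF : y ∉ cF' := fun hy => Set.disjoint_left.1 dF
    (ContactMap.subset_points (Or.inr ⟨0, rfl⟩) yF) (ContactMap.subset_points bF' hy)
  have nG : y ∉ cG' := fun hy => Set.disjoint_left.1 dG
    (ContactMap.subset_points (Or.inr ⟨0, rfl⟩) yG) (ContactMap.subset_points bG' hy)
  -- A common arc would be a curvature line of `F` through `y`. If it is the edge, it contradicts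
  -- `not_orthogonal_both`; if it is the other line, it ends on `G'` while lying on `G`.
  have ne : ∀ {L' : ContactMap}, PreForm L' → L' 0 0 = L 0 0 → L'.lineA 0 = cF → cF ≠ cG := by
    rintro L' X' e₀ rfl rfl
    have hyL : y ∈ L'.lineA 0 := ⟨0, by rwa [e₀]⟩
    rcases RF.curve_eq h.hF bF hz hy hyL with e | e
    · obtain ⟨v, hv⟩ := yF
      obtain ⟨v', hv'⟩ := yG
      refine RF.not_orthogonal_both X' RG h.hF h.hG h.corner₀ e (v := v) (v' := v') ?_ ?_ <;> rw [e₀]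
      exacts [oF y hyL 0 0 0 v hL hv, oG y hyL 0 0 0 v' hL hv']
    · obtain ⟨t, ht, c, hc, et⟩ := h.corner₁.onEdge (h.hF.flip_onEdge hz)
      obtain ⟨w, hw⟩ := (h.hG'.isPtVec_P PatchData.zero_mem ht).exists_repr
      have hw' : w ∈ L'.lineA 0 := by
        rw [e]
        refine ⟨1, PatchData.one_mem, ?_⟩
        rw [Arc.vec_one, show (F.harc H.p).q = _ from et, repr_smul_iff hc.ne']
        exact hw
      exact Set.disjoint_left.1 dG (ContactMap.subset_points bG hw')
        ((RG'.mem_points h.hG').2 ⟨0, PatchData.zero_mem, t, ht, hw⟩)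
  have fin : ∀ {L : ContactMap}, (∃ c : ℝ, c ≠ 0 ∧ Nonempty (RepData L (H.scale c))) →
      L.points = M.points ∧ L.curves = M.curves := by
    rintro L ⟨c, hc, ⟨T⟩⟩
    exact ⟨T.points_eq (R.scale hc) (hH.scale hc), T.curves_eq (R.scale hc) (hH.scale hc)⟩
  have dF' := Set.disjoint_of_subset (ContactMap.subset_points bF) (ContactMap.subset_points bF') dF
  have dG' := Set.disjoint_of_subset (ContactMap.subset_points bG) (ContactMap.subset_points bG') dG
  -- The arcs on `F`, `F'` form one opposite pair and those on `G`, `G'` the other; the two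
  -- consistent cases differ by exchanging the parameters.
  rcases ContactMap.opposite_arcs X.exists_point hL aF aF' dF' nF with ⟨rfl, rfl⟩ | ⟨rfl, rfl⟩ <;>
  rcases ContactMap.opposite_arcs X.exists_point hL aG aG' dG' nG with ⟨rfl, rfl⟩ | ⟨rfl, rfl⟩
  · exact absurd rfl (ne X rfl rfl)
  · exact fin (h.exists_scale X RF RG RF' dF dG hH hz s₁ s₂ s₃ hy hL bF bF' bG bG')
  · rw [← ContactMap.swap_points, ← ContactMap.swap_curves]
    exact fin (h.exists_scale X.swap RF RG RF' dF dG hH hz s₁ s₂ s₃ hy hL bF bF' bG bG')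
  · exact absurd rfl (ne X.swap rfl rfl)

end Box

end

/-! ### Existence and uniqueness for the cube -/

noncomputable section

theorem mainTheorem2 (Q : CyclidicCube) (hQ : Q.NonSingular)
    (hcirc : ¬ OnGeneralizedCircle (Set.range Q.vertex))
    (i : Fin 3) (p : OnePoint E3) (hp : p ∈ Q.edgeArc ∅ i) :
    ∃ g : CyclidicPatch, Q.IsPatchInBetween i p g ∧ g.NonSingular ∧
      ∀ g' : CyclidicPatch, Q.IsPatchInBetween i p g' → g'.SamePatch g := by
  obtain ⟨F, G, F', G', hB, ⟨RF⟩, ⟨RG⟩, ⟨RF'⟩, ⟨RG'⟩, he⟩ := hQ.exists_box hcirc i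
  rw [← he] at hp
  obtain ⟨t, ht, hpt⟩ := hp
  rw [PatchData.arc₂_vec] at hpt
  have hz₀ : F.OnEdge (F.P 0 t) := ⟨t, ht, 1, one_pos, (one_smul _ _).symm⟩
  obtain ⟨H, hH, hHp, s₁, s₂, s₃, s₄⟩ := hB.exists_level hz₀
  rw [← hHp] at hz₀ hpt s₁ s₂ s₃ s₄
  obtain ⟨g, ⟨R⟩⟩ := hH.exists_patch
  obtain ⟨mF, mG'⟩ := hB.meets hH hz₀ s₁ s₂ s₄ R RF RG'
  obtain ⟨mG, mF'⟩ := hB.swap.meets hH.swap (hB.corner₀.onEdge hz₀) s₂ s₁ s₃ R.swap RG RF'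
  have dF : Disjoint (ContactMap.swap (Q.face (i + 2) false).contact).points
      (ContactMap.swap (Q.face (i + 2) true).contact).points := by
    rw [ContactMap.swap_points, ContactMap.swap_points]
    exact hQ.1 (i + 2)
  have hm : ∀ m : Fin 3, m ≠ i ↔ m = i + 1 ∨ m = i + 2 := by
    clear * -
    revert i; decide
  have h₁ : i + 1 ≠ i := (hm _).2 (Or.inl rfl)
  have h₂ : i + 2 ≠ i := (hm _).2 (Or.inr rfl)
  refine ⟨g, ⟨?_, ?_⟩, R.nonSingular hH, ?_⟩
  · left
    refine (R.mem_iff hH).2 ?_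
    rwa [R.f_zero, R.g_zero, Set.Icc.coe_zero, PatchData.P_zero_zero]
  · intro m hmi b
    rcases (hm m).1 hmi with rfl | rfl <;> cases b
    exacts [mG.swap, mG', mF.swap_right, mF'.swap.swap_right]
  · rintro g' ⟨hv, hg⟩
    obtain ⟨X⟩ := g'.exists_preForm
    -- The given point may be any of the four vertices of the competing patch; exchanging and
    -- reversing parameters moves it to `(0, 0)` without changing points, curves or meetings.
    have key : ∀ {L : ContactMap}, PreForm L → liePoint p ∈ L 0 0 →
        (∀ M, ContactMap.Meets g'.contact M → L.Meets M) →
        L.points = ContactMap.points g.contact ∧ L.curves = ContactMap.curves g.contact := by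
      intro L Y h0 hL
      exact hB.unique Y RF RG RF' RG' dF (hQ.1 (i + 1)) hH hz₀ s₁ s₂ s₃ R hpt h0
        (hL _ (ContactMap.Meets.swap_right (hg _ h₂ false))) (hL _ (hg _ h₁ false))
        (hL _ (ContactMap.Meets.swap_right (hg _ h₂ true))) (hL _ (hg _ h₁ true))
    have zero : unitInterval.symm 0 = 1 := unitInterval.symm_zero
    rcases hv with hv | hv | hv | hv
    · exact key X hv fun M hM => hM
    · have := key X.flip (by rwa [ContactMap.flip, zero]) fun M hM => hM.flip
      rwa [ContactMap.flip_points, ContactMap.flip_curves] at this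
    · have := key X.flip.swap.flip (by simp only [ContactMap.flip, ContactMap.swap, zero]; exact hv)
        fun M hM => hM.flip.swap.flip
      rwa [ContactMap.flip_points, ContactMap.flip_curves, ContactMap.swap_points,
        ContactMap.swap_curves, ContactMap.flip_points, ContactMap.flip_curves] at this
    · have := key X.swap.flip (by simp only [ContactMap.flip, ContactMap.swap, zero]; exact hv)
        fun M hM => hM.swap.flip
      rwa [ContactMap.flip_points, ContactMap.flip_curves, ContactMap.swap_points,
        ContactMap.swap_curves] at this

end
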